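/- **Setting.** Let $0<s<1$. For functions of $v\in\mathbb R$ let $\mu(v)=(2\pi)^{-1/2}e^{-v^2/2}$, $\beta(\theta)=|\cos\frac\theta2|\,|\sin\frac\theta2|^{-1-2s}$, $$K(f,g)(v)=\int_{|\theta|\le\pi/4}\beta(\theta)\Big(\int_{\mathbb R}\big(\breve f(v_*')g(v')-\breve f(v_*)g(v)\big)dv_*\Big)d\theta,\qquad \Gamma(f,g)=\mu^{-1/2}K(\mu^{1/2}f,\mu^{1/2}g),$$ where $v'=v\cos\theta-v_*\sin\theta$, $v_*'=v\sin\theta+v_*\cos\theta$ and $\breve f(v)=\frac12(f(v)+f(-v))$ (this is the finite-part definition of the non-cutoff Kac operator). For functions of $(x,v)\in\mathbb R^2$, $\Gamma$ acts in $v$ for each fixed $x$. Let $(e_n)_{n\ge0}$ be the orthonormal basis of Hermite functions of $L^2(\mathbb R_v)$ with $\mathcal He_n=(n+\frac12)e_n$, $\mathcal H=-\partial_v^2+\frac{v^2}4$, and write $u_n(x)=(u(x,\cdot),e_n)_{L^2(\mathbb R_v)}$. With $\langle\xi\rangle=(1+\xi^2)^{1/2}$ and $D_x=-i\partial_x$,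 let $G_\kappa(t)=\sum_n\mathcal G_{\kappa,n}(t)\mathbb P_n$, where $\mathbb P_n$ is the projection onto the span of $e_n$ and $$\mathcal G_{\kappa,n}(t)=\frac{e^{t\psi_n(D_x)}}{1+\kappa e^{t\psi_n(D_x)}},\qquad \psi_n(\xi)=\Big((n+\tfrac12)^{\frac{s+1}2}+\langle\xi\rangle^{\frac{3s+1}{2s+1}}\Big)^{\frac{2s}{3s+1}},$$ that is, $G_\kappa(t)=\dfrac{\exp\big(t(\mathcal H^{\frac{s+1}2}+\langle D_x\rangle^{\frac{3s+1}{2s+1}})^{\frac{2s}{3s+1}}\big)}{1+\kappa\exp\big(t(\mathcal H^{\frac{s+1}2}+\langle D_x\rangle^{\frac{3s+1}{2s+1}})^{\frac{2s}{3s+1}}\big)}$. Let $\chi,\varphi:\mathbb R\to[0,1]$ be smooth, $\operatorname{supp}\chi\subset\{|\xi|\le\frac43\}$, $\operatorname{supp}\varphi\subset\{\frac34\le|\xi|\le\frac83\}$, $\chi(\xi)+\sum_{q\ge0}\varphi(2^{-q}\xi)=1$; put $\Delta_{-1}=\chi(D_x)$, $\Delta_q=\varphi(2^{-q}D_x)$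 for $q\ge0$, $\Delta_q=0$ for $q\le-2$. Let $\|w\|_{B^\sigma_{2,1}}=\sum_{q\ge-1}2^{q\sigma}\|\Delta_qw\|_{L^2_x}$, $\|u\|_{L^2_v(B^\sigma_{2,1})}=\big(\int_{\mathbb R}\|u(\cdot,v)\|_{B^\sigma_{2,1}}^2dv\big)^{1/2}$, let $\|u\|_{L^\varrho_TL^2_v(B^\sigma_{2,1})}$ be the $L^\varrho(0,T)$ norm of $t\mapsto\|u(t)\|_{L^2_v(B^\sigma_{2,1})}$, and let $\|u\|_{\widetilde L^\varrho_T\widetilde L^2_v(B^\sigma_{2,1})}=\sum_{q\ge-1}2^{q\sigma}\|\Delta_qu\|_{L^\varrho_TL^2_vL^2_x}$. **Lemma.** (i) There is a constant $C>0$, depending only on $s$ and $(\chi,\varphi)$, such that for all $f,g,h\in\mathcal S(\mathbb R^2_{x,v})$, $t\ge0$, $0<\kappa\le1$ and $p\ge-1$ one has $\Gamma(G_\kappa(t)^{-1}f,G_\kappa(t)^{-1}g)\in L^2_{x,v}$ and $$\begin{aligned} \big|\big(G_\kappa(t)\Delta_p\Gamma(G_\kappa(t)^{-1}f,G_\kappa(t)^{-1}g),\Delta_ph\big)_{L^2_{x,v}}\big|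 \le{}&C\sum_{|j-p|\le4}\|\Delta_jf\|_{L^2_{x,v}}\|\mathcal H^{\frac s2}g\|_{L^2_v(B^{1/2}_{2,1})}\|\mathcal H^{\frac s2}\Delta_ph\|_{L^2_{x,v}}\\ &+C\sum_{j\ge p-4}\|f\|_{L^2_v(B^{1/2}_{2,1})}\|\mathcal H^{\frac s2}\Delta_jg\|_{L^2_{x,v}}\|\mathcal H^{\frac s2}\Delta_ph\|_{L^2_{x,v}}. \end{aligned}$$ (ii) For functions $f,g,h\in L^2_{x,v}$ that need not be smooth, the pairing on the left is understood weakly, as $$\sum_{n\ge0}\big(\mathcal G_{\kappa,n}(t)\Delta_p\Gamma_n,\Delta_ph_n\big)_{L^2_x},$$ where, with $F=\mu^{1/2}G_\kappa(t)^{-1}f$ and $G=\mu^{1/2}G_\kappa(t)^{-1}g$, $$\Gamma_n(x)=\int_{|\theta|\le\pi/4}\beta(\theta)\int_{\mathbb R}\Big(\int_{\mathbb R}\big(\breve F(x,v_*')G(x,v')-\breve F(x,v_*)G(x,v)\big)dv_*\Big)\mu(v)^{-1/2}e_n(v)\,dv\,d\theta$$ ($\breve F$ is the even part in the velocity). For $f,g,h\in\mathcal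 S(\mathbb R^2_{x,v})$ this agrees with the inner product in (i). (iii) Let $\sigma>0$. There is a constant $C_1>0$, depending only on $\sigma$, $s$ and $(\chi,\varphi)$, such that the following holds for all $T>0$ and $0<\kappa\le1$. Let $f,g,h$ be strongly measurable functions on $(0,T)$ with values in $L^2_{x,v}$, with $g(t),h(t)$ in the domain of $\mathcal H^{\frac s2}$ for almost every $t$, such that all the norms on the right-hand side below are finite. Then for almost every $t\in(0,T)$ and all $p\ge-1$ the weak pairing of (ii) for $f(t),g(t),h(t)$ is well defined ($\Gamma_n\in L^2_x$ for all $n$, and the series converges absolutely), it is measurable in $t$, and $$\begin{aligned} \sum_{p\ge-1}2^{p\sigma}\Big[\int_0^T\big|\big(G_\kappa(t)\Delta_p\Gamma(G_\kappa(t)^{-1}f,G_\kappa(t)^{-1}g),\Delta_ph\big)_{L^2_{x,v}}\big|dt\Big]^{1/2} \le{}&C_1\|f\|^{1/2}_{\widetilde L^\infty_T\widetilde L^2_v(B^\sigma_{2,1})}\|\mathcal H^{\frac s2}g\|^{1/2}_{L^2_TL^2_v(B^{1/2}_{2,1})}\|\mathcal H^{\frac s2}h\|^{1/2}_{\widetilde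 L^2_T\widetilde L^2_v(B^\sigma_{2,1})}\\ &+C_1\|f\|^{1/2}_{L^\infty_TL^2_v(B^{1/2}_{2,1})}\|\mathcal H^{\frac s2}g\|^{1/2}_{\widetilde L^2_T\widetilde L^2_v(B^\sigma_{2,1})}\|\mathcal H^{\frac s2}h\|^{1/2}_{\widetilde L^2_T\widetilde L^2_v(B^\sigma_{2,1})}. \end{aligned}$$ -/

import Mathlib

open MeasureTheory
open scoped FourierTransform ENNReal NNReal SchwartzMap ContDiff

noncomputable section

namespace Kac

/-! ### Square integrable functions and Fourier multipliers -/

/-- `L²(ℝ_x)`. -/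
abbrev L2x : Type := Lp ℂ 2 (volume : Measure ℝ)

/-- `L²(ℝ²_{x,v})`; a point of the plane is `(x, v)`. -/
abbrev L2xv : Type := Lp ℂ 2 (volume : Measure (ℝ × ℝ))

open Classical in
/-- The class in `L²` of a square integrable function (and `0` for any other function). -/
def toL2 {α : Type} [MeasureSpace α] (f : α → ℂ) : Lp ℂ 2 (volume : Measure α) :=
  if h : MemLp f 2 volume then h.toLp f else 0

/-- The class in `L²(ℝ²_{x,v})` of a Schwartz function. -/
def ofSchwartz (f : 𝓢(ℝ × ℝ, ℂ)) : L2xv := toL2 (fun z => f z)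

/-- The Fourier multiplier `m(D_x)` on `L²(ℝ_x)`, where `D_x = -i ∂_x`. The Fourier transform `𝓕` of
Mathlib has the kernel `exp (-2 π i x ξ)`, so that `D_x` corresponds to multiplication by `2 π ξ`. -/
def fourierMul (m : ℝ → ℝ) (w : L2x) : L2x :=
  𝓕⁻ (toL2 (fun ξ : ℝ => (m (2 * Real.pi * ξ) : ℂ) * (𝓕 w : L2x) ξ))

/-- The Japanese bracket `⟨ξ⟩ = (1 + ξ²)^{1/2}`. -/
def bracket (ξ : ℝ) : ℝ := Real.sqrt (1 + ξ ^ 2)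

/-! ### The Hermite basis and functions of `(𝓗, D_x)` -/

/-- The Hermite functions `e_n = (n!)^{-1/2} (v/2 - d/dv)^n e_0`, `e_0 = (2π)^{-1/4} exp (-v²/4)`,
i.e. `e_n(v) = (n! √(2π))^{-1/2} He_n(v) exp (-v²/4)` with the Hermite polynomials
`He_{n+1} = X He_n - He_n'`. They are the normalized eigenfunctions of the harmonic oscillator
`𝓗 = -d²/dv² + v²/4`, with `𝓗 e_n = (n + 1/2) e_n`. -/
def hermiteFun (n : ℕ) (v : ℝ) : ℝ :=
  Polynomial.aeval v (Polynomial.hermite n) * Real.exp (-v ^ 2 / 4) /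
    Real.sqrt (n.factorial * Real.sqrt (2 * Real.pi))

/-- The Hermite coefficient `u_n(x) = (u(x, ·), e_n)_{L²(ℝ_v)}`, an element of `L²(ℝ_x)`. -/
def hermiteCoeff (n : ℕ) (u : L2xv) : L2x :=
  toL2 (fun x : ℝ => ∫ v : ℝ, u (x, v) * (hermiteFun n v : ℂ))

/-- The `n`-th term `(m_n(D_x) u_n)(x) e_n(v)` of the expansion of `∑_n m_n(D_x) ℙ_n u`. -/
def spectralTerm (m : ℕ → ℝ → ℝ) (u : L2xv) (n : ℕ) : L2xv :=
  toL2 (fun z : ℝ × ℝ => (fourierMul (m n) (hermiteCoeff n u) : L2x) z.1 * (hermiteFun n z.2 : ℂ))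

/-- Functional calculus of the commuting operators `𝓗` (in `v`) and `D_x` (in `x`):
`u ↦ ∑_n m_n(D_x) ℙ_n u`, with `ℙ_n` the projection onto the span of `e_n` in the variable `v`. -/
def spectralMul (m : ℕ → ℝ → ℝ) (u : L2xv) : L2xv :=
  ∑' n : ℕ, spectralTerm m u n

/-- The fractional power `𝓗^r = ∑_n (n + 1/2)^r ℙ_n` of the harmonic oscillator. -/
def oscPow (r : ℝ) (u : L2xv) : L2xv :=
  spectralMul (fun n _ => ((n : ℝ) + 1 / 2) ^ r) u

/-- `u` belongs to the domain of `𝓗^r` in `L²(ℝ²_{x,v})`. -/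
def InOscDomain (r : ℝ) (u : L2xv) : Prop :=
  Summable (fun n : ℕ => spectralTerm (fun n _ => ((n : ℝ) + 1 / 2) ^ r) u n)

/-- The symbol `exp(t ψ_n(ξ)) / (1 + κ exp(t ψ_n(ξ)))` of the exponential weight, where
`ψ_n(ξ) = ((n + 1/2)^{(s+1)/2} + ⟨ξ⟩^{(3s+1)/(2s+1)})^{2s/(3s+1)}`. -/
def weightSymbol (s κ t : ℝ) (n : ℕ) (ξ : ℝ) : ℝ :=
  let E := Real.exp (t * (((n : ℝ) + 1 / 2) ^ ((s + 1) / 2)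
    + bracket ξ ^ ((3 * s + 1) / (2 * s + 1))) ^ (2 * s / (3 * s + 1)))
  E / (1 + κ * E)

/-- The exponential weight `G_κ(t)`. -/
def weight (s κ t : ℝ) (u : L2xv) : L2xv := spectralMul (weightSymbol s κ t) u

/-- The inverse `(G_κ(t))⁻¹` of the exponential weight. -/
def weightInv (s κ t : ℝ) (u : L2xv) : L2xv :=
  spectralMul (fun n ξ => (weightSymbol s κ t n ξ)⁻¹) u

/-! ### Littlewood-Paley theory in the variable `x` -/

/-- The pairs `(χ, φ)` of cut-off functions of the Littlewood-Paley decomposition. -/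
structure IsDyadicPair (χ φ : ℝ → ℝ) : Prop where
  smooth_low : ContDiff ℝ ∞ χ
  smooth_shell : ContDiff ℝ ∞ φ
  range_low : ∀ ξ, χ ξ ∈ Set.Icc (0 : ℝ) 1
  range_shell : ∀ ξ, φ ξ ∈ Set.Icc (0 : ℝ) 1
  supp_low : tsupport χ ⊆ {ξ : ℝ | |ξ| ≤ 4 / 3}
  supp_shell : tsupport φ ⊆ {ξ : ℝ | 3 / 4 ≤ |ξ| ∧ |ξ| ≤ 8 / 3}
  partition : ∀ ξ : ℝ, HasSum (fun q : ℕ => φ ((2 : ℝ) ^ (-(q : ℤ)) * ξ)) (1 - χ ξ)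

/-- The symbol of `Δ_q`: `χ` for `q = -1`, `φ(2^{-q} ·)` for `q ≥ 0`; and `Δ_q = 0` for `q ≤ -2`. -/
def blockSymbol (χ φ : ℝ → ℝ) (q : ℤ) (ξ : ℝ) : ℝ :=
  if q = -1 then χ ξ else if 0 ≤ q then φ ((2 : ℝ) ^ (-q) * ξ) else 0

/-- The dyadic block `Δ_q`, acting in the variable `x` on functions of `(x, v)`. -/
def block (χ φ : ℝ → ℝ) (q : ℤ) (u : L2xv) : L2xv :=
  spectralMul (fun _ ξ => blockSymbol χ φ q ξ) u

/-- The factor `2^{qσ}`. -/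
def dyad (q : ℤ) (σ : ℝ) : ℝ≥0∞ := ENNReal.ofReal ((2 : ℝ) ^ ((q : ℝ) * σ))

/-- The norm of `L²_v(B^σ_{2,1})`: the `L²(ℝ_v)` norm of
`v ↦ ‖u(·, v)‖_{B^σ_{2,1}} = ∑_{q ≥ -1} 2^{qσ} ‖Δ_q u(·, v)‖_{L²_x}`. -/
def besovNorm (χ φ : ℝ → ℝ) (σ : ℝ) (u : L2xv) : ℝ≥0∞ :=
  eLpNorm (fun v : ℝ =>
    ∑' q : ℤ, dyad q σ * eLpNorm (fun x : ℝ => block χ φ q u (x, v)) 2 volume) 2 volume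

/-- The `L^ϱ(0, T)` norm of a function of time with values in `[0, ∞]`. -/
def timeNorm (ϱ : ℝ≥0∞) (T : ℝ) (N : ℝ → ℝ≥0∞) : ℝ≥0∞ :=
  eLpNorm N ϱ (volume.restrict (Set.Ioc 0 T))

/-- The norm of `L^ϱ_T L²_v(B^σ_{2,1})`. -/
def mixedNorm (χ φ : ℝ → ℝ) (ϱ : ℝ≥0∞) (T σ : ℝ) (u : ℝ → L2xv) : ℝ≥0∞ :=
  timeNorm ϱ T (fun t => besovNorm χ φ σ (u t))

/-- The Chemin-Lerner norm of `L̃^ϱ_T L̃²_v(B^σ_{2,1})`, i.e.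
`∑_{q ≥ -1} 2^{qσ} ‖Δ_q u‖_{L^ϱ_T L²_v L²_x}`. -/
def cheminLernerNorm (χ φ : ℝ → ℝ) (ϱ : ℝ≥0∞) (T σ : ℝ) (u : ℝ → L2xv) : ℝ≥0∞ :=
  ∑' q : ℤ, dyad q σ * timeNorm ϱ T (fun t => ‖block χ φ q (u t)‖ₑ)

/-! ### The Kac collision operator -/

/-- The normalized Maxwellian `μ(v) = (2π)^{-1/2} exp (-v²/2)`. -/
def maxwellian (v : ℝ) : ℝ := Real.exp (-v ^ 2 / 2) / Real.sqrt (2 * Real.pi)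

/-- The cross section `β(θ) = |cos(θ/2)| / |sin(θ/2)|^{1+2s}`. -/
def crossSection (s θ : ℝ) : ℝ := |Real.cos (θ / 2)| / |Real.sin (θ / 2)| ^ (1 + 2 * s)

/-- The even part of a function of the velocity. -/
def evenPart (g : ℝ → ℂ) (v : ℝ) : ℂ := (g v + g (-v)) / 2

/-- The gain and loss terms at a fixed angle: `∫ (ğ(v_*') f(v') - ğ(v_*) f(v)) dv_*`, where
`v' = v cos θ - v_* sin θ`, `v_*' = v sin θ + v_* cos θ`, and `ğ` is the even part of `g`. -/
def angular (g f : ℝ → ℂ) (θ v : ℝ) : ℂ :=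
  ∫ w : ℝ, (evenPart g (v * Real.sin θ + w * Real.cos θ) * f (v * Real.cos θ - w * Real.sin θ)
    - evenPart g w * f v)

/-- The non-cutoff Kac collision operator `K(g, f)`. Its integral over `θ` is a finite part; passing
to the even part of `g` turns the finite part into an absolutely convergent integral. -/
def collision (s : ℝ) (g f : ℝ → ℂ) (v : ℝ) : ℂ :=
  ∫ θ in Set.Icc (-(Real.pi / 4)) (Real.pi / 4), (crossSection s θ : ℂ) * angular g f θ v

/-- The function `√μ(v) u(x, v)` of `v`, at a fixed `x`. -/
def weighted (u : ℝ × ℝ → ℂ) (x v : ℝ) : ℂ := (Real.sqrt (maxwellian v) : ℂ) * u (x, v)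

/-- The nonlinear term `Γ(f, g) = μ^{-1/2} K(μ^{1/2} f, μ^{1/2} g)`, as a function of `(x, v)`. -/
def gammaTerm (s : ℝ) (f g : ℝ × ℝ → ℂ) (z : ℝ × ℝ) : ℂ :=
  ((Real.sqrt (maxwellian z.2))⁻¹ : ℂ) * collision s (weighted f z.1) (weighted g z.1) z.2

/-- The Hermite coefficient `x ↦ ⟨Γ(f, g)(x, ·), e_n⟩` of the nonlinear term in the weak sense: the
integrand of `Γ(f, g)` is tested against `e_n` in `v` before it is integrated over `θ`, which makes
sense when `f(x, ·)` and `g(x, ·)` are merely square integrable. -/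
def gammaCoeff (s : ℝ) (n : ℕ) (f g : ℝ × ℝ → ℂ) (x : ℝ) : ℂ :=
  ∫ θ in Set.Icc (-(Real.pi / 4)) (Real.pi / 4), (crossSection s θ : ℂ) *
    ∫ v : ℝ, ((Real.sqrt (maxwellian v))⁻¹ : ℂ) * angular (weighted f x) (weighted g x) θ v *
      (hermiteFun n v : ℂ)

/-! ### The trilinear form -/

/-- The nonlinear term `Γ((G_κ(t))⁻¹ f, (G_κ(t))⁻¹ g)`. -/
def conjGamma (s κ t : ℝ) (f g : L2xv) : ℝ × ℝ → ℂ :=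
  gammaTerm s (weightInv s κ t f) (weightInv s κ t g)

/-- `(G_κ(t) Δ_p Γ((G_κ(t))⁻¹ f, (G_κ(t))⁻¹ g), Δ_p h)_{L²_{x,v}}`, for `Γ(...)` in `L²_{x,v}`. The
inner product of Mathlib is antilinear in its first argument. -/
def form (χ φ : ℝ → ℝ) (s κ t : ℝ) (p : ℤ) (f g h : L2xv) : ℂ :=
  inner ℂ (block χ φ p h) (weight s κ t (block χ φ p (toL2 (conjGamma s κ t f g))))

/-- The Hermite coefficients of `Γ((G_κ(t))⁻¹ f, (G_κ(t))⁻¹ g)` in the weak sense. -/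
def conjGammaCoeff (s κ t : ℝ) (n : ℕ) (f g : L2xv) : ℝ → ℂ :=
  gammaCoeff s n (weightInv s κ t f) (weightInv s κ t g)

/-- The contribution `(𝒢_{κ,n}(t) Δ_p Γ_n, Δ_p h_n)_{L²_x}` of the `n`-th Hermite coefficient
`Γ_n` of `Γ((G_κ(t))⁻¹ f, (G_κ(t))⁻¹ g)` to the trilinear form. -/
def weakTerm (χ φ : ℝ → ℝ) (s κ t : ℝ) (p : ℤ) (f g h : L2xv) (n : ℕ) : ℂ :=
  inner ℂ (fourierMul (blockSymbol χ φ p) (hermiteCoeff n h))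
    (fourierMul (weightSymbol s κ t n)
      (fourierMul (blockSymbol χ φ p) (toL2 (conjGammaCoeff s κ t n f g))))

/-- The trilinear form for functions that need not be smooth: the duality pairing of
`G_κ(t) Δ_p Γ((G_κ(t))⁻¹ f, (G_κ(t))⁻¹ g)` and `Δ_p h`, in Hermite coefficients. -/
def weakForm (χ φ : ℝ → ℝ) (s κ t : ℝ) (p : ℤ) (f g h : L2xv) : ℂ :=
  ∑' n : ℕ, weakTerm χ φ s κ t p f g h n

/-- The weak form makes sense: all coefficients of the nonlinear term belong to `L²_x`, and the
series of the pairing converges absolutely. -/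
def WeakFormDefined (χ φ : ℝ → ℝ) (s κ t : ℝ) (p : ℤ) (f g h : L2xv) : Prop :=
  (∀ n : ℕ, MemLp (conjGammaCoeff s κ t n f g) 2 volume) ∧
    Summable (fun n : ℕ => weakTerm χ φ s κ t p f g h n)

end Kac

end

open MeasureTheory
open scoped FourierTransform ENNReal NNReal SchwartzMap ContDiff

noncomputable section

namespace Kac

/-! ### Hermite polynomials -/

/-- The value at `v` of the `n`-th Hermite polynomial. -/
def hermiteVal (n : ℕ) (v : ℝ) : ℝ := Polynomial.aeval v (Polynomial.hermite n)

theorem derivative_hermite_succ (n : ℕ) :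
    Polynomial.derivative (Polynomial.hermite (n + 1)) = ((n : ℤ) + 1) • Polynomial.hermite n := by
  induction n with
  | zero => simp
  | succ n ih =>
    rw [Polynomial.hermite_succ (n + 1), Polynomial.derivative_sub, Polynomial.derivative_mul, ih,
      Polynomial.derivative_X, one_mul, Polynomial.derivative_smul, Polynomial.hermite_succ n]
    simp only [zsmul_eq_mul]
    push_cast
    ring

theorem hermite_succ_succ (n : ℕ) :
    Polynomial.hermite (n + 2) = Polynomial.X * Polynomial.hermite (n + 1)
      - ((n : ℤ) + 1) • Polynomial.hermite n := by
  rw [Polynomial.hermite_succ (n + 1), derivative_hermite_succ]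

theorem hermiteVal_zero (v : ℝ) : hermiteVal 0 v = 1 := by simp [hermiteVal]

theorem hermiteVal_one (v : ℝ) : hermiteVal 1 v = v := by simp [hermiteVal]

theorem hermiteVal_succ_succ (n : ℕ) (v : ℝ) :
    hermiteVal (n + 2) v = v * hermiteVal (n + 1) v - (n + 1) * hermiteVal n v := by
  simp only [hermiteVal]
  rw [hermite_succ_succ]
  simp [-Polynomial.hermite_succ]

theorem mul_hermiteVal (n : ℕ) (v : ℝ) :
    v * hermiteVal n v = hermiteVal (n + 1) v + n * hermiteVal (n - 1) v := by
  cases n with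
  | zero => simp [hermiteVal_zero, hermiteVal_one]
  | succ n => rw [hermiteVal_succ_succ]; push_cast; simp

theorem hasDerivAt_hermiteVal_succ (n : ℕ) (v : ℝ) :
    HasDerivAt (hermiteVal (n + 1)) ((n + 1) * hermiteVal n v) v := by
  have h := (Polynomial.hermite (n + 1)).hasDerivAt_aeval v
  rw [derivative_hermite_succ] at h
  have e : hermiteVal (n + 1) = fun x : ℝ => Polynomial.aeval x (Polynomial.hermite (n + 1)) := rfl
  rw [e]
  refine h.congr_deriv ?_
  rw [hermiteVal, zsmul_eq_mul, map_mul]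
  simp [-Polynomial.hermite_succ]

theorem hermiteVal_neg (n : ℕ) (v : ℝ) : hermiteVal n (-v) = (-1) ^ n * hermiteVal n v := by
  induction n using Nat.twoStepInduction with
  | zero => simp [hermiteVal_zero]
  | one => simp [hermiteVal_one]
  | more n h0 h1 =>
    rw [hermiteVal_succ_succ, hermiteVal_succ_succ, h0, h1]
    ring

theorem continuous_hermiteVal (n : ℕ) : Continuous (hermiteVal n) := by
  unfold hermiteVal
  exact Polynomial.continuous_aeval _

/-- The Hermite polynomials divided by `n!`. -/
def hermiteDiv (n : ℕ) (v : ℝ) : ℝ := hermiteVal n v / n.factorial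

theorem hermiteDiv_succ_succ (n : ℕ) (v : ℝ) :
    ((n : ℝ) + 2) * hermiteDiv (n + 2) v = v * hermiteDiv (n + 1) v - hermiteDiv n v := by
  unfold hermiteDiv
  rw [hermiteVal_succ_succ, Nat.factorial_succ (n + 1), Nat.factorial_succ n]
  have : (n.factorial : ℝ) ≠ 0 := by positivity
  have h1 : (n : ℝ) + 1 ≠ 0 := by positivity
  have h2 : (n : ℝ) + 2 ≠ 0 := by positivity
  push_cast
  field_simp
  ring

/-- The generating series of the Hermite polynomials. -/
def hermiteSeries (v : ℝ) : PowerSeries ℝ := PowerSeries.mk fun n => hermiteDiv n v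

theorem derivative_hermiteSeries (v : ℝ) :
    PowerSeries.derivative ℝ (hermiteSeries v) =
      (PowerSeries.C v - PowerSeries.X) * hermiteSeries v := by
  ext n
  rw [PowerSeries.coeff_derivative, sub_mul, map_sub, PowerSeries.coeff_C_mul]
  cases n with
  | zero =>
    simp [hermiteSeries, hermiteDiv, hermiteVal_zero, hermiteVal_one]
  | succ n =>
    rw [PowerSeries.coeff_succ_X_mul]
    simp only [hermiteSeries, PowerSeries.coeff_mk]
    rw [← hermiteDiv_succ_succ]
    push_cast
    ring

theorem powerSeries_eq_of_derivative_eq {f g a : PowerSeries ℝ}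
    (hf : PowerSeries.derivative ℝ f = a * f) (hg : PowerSeries.derivative ℝ g = a * g)
    (h : PowerSeries.coeff 0 f = PowerSeries.coeff 0 g) : f = g := by
  ext n
  induction n using Nat.strong_induction_on with
  | _ n ih =>
    cases n with
    | zero => exact h
    | succ n =>
      have h1 := congrArg (PowerSeries.coeff n) hf
      have h2 := congrArg (PowerSeries.coeff n) hg
      rw [PowerSeries.coeff_derivative, PowerSeries.coeff_mul] at h1 h2
      have h3 : (∑ p ∈ Finset.HasAntidiagonal.antidiagonal n, PowerSeries.coeff p.1 a * PowerSeries.coeff p.2 f)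
          = ∑ p ∈ Finset.HasAntidiagonal.antidiagonal n, PowerSeries.coeff p.1 a * PowerSeries.coeff p.2 g := by
        refine Finset.sum_congr rfl fun p hp => ?_
        rw [ih p.2 (by have := Finset.HasAntidiagonal.mem_antidiagonal.1 hp; omega)]
      rw [h3, ← h2] at h1
      exact mul_right_cancel₀ (by positivity) h1

theorem derivative_rescale (c : ℝ) (f : PowerSeries ℝ) :
    PowerSeries.derivative ℝ (PowerSeries.rescale c f) =
      PowerSeries.C c * PowerSeries.rescale c (PowerSeries.derivative ℝ f) := by
  ext n
  rw [PowerSeries.coeff_derivative, PowerSeries.coeff_C_mul, PowerSeries.coeff_rescale,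
    PowerSeries.coeff_rescale, PowerSeries.coeff_derivative]
  ring

theorem hermiteSeries_rotate {c d : ℝ} (h : c ^ 2 + d ^ 2 = 1) (x y : ℝ) :
    hermiteSeries (c * x + d * y) =
      PowerSeries.rescale d (hermiteSeries y) * PowerSeries.rescale c (hermiteSeries x) := by
  refine powerSeries_eq_of_derivative_eq (derivative_hermiteSeries _) ?_ ?_
  · have hr : ∀ e z : ℝ, PowerSeries.derivative ℝ (PowerSeries.rescale e (hermiteSeries z)) =
        (PowerSeries.C (e * z) - PowerSeries.C (e ^ 2) * PowerSeries.X) *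
          PowerSeries.rescale e (hermiteSeries z) := by
      intro e z
      rw [derivative_rescale, derivative_hermiteSeries, map_mul, map_sub, PowerSeries.rescale_X,
        show PowerSeries.rescale e (PowerSeries.C z) = PowerSeries.C z by
          ext n; rw [PowerSeries.coeff_rescale, PowerSeries.coeff_C]; split_ifs with hn <;> simp [hn]]
      simp only [map_mul, map_pow]
      ring
    rw [Derivation.leibniz, hr, hr, smul_eq_mul, smul_eq_mul]
    have hX : (PowerSeries.C c ^ 2 + PowerSeries.C d ^ 2 : PowerSeries ℝ) = 1 := by
      rw [← map_pow, ← map_pow, ← map_add, h, map_one]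
    simp only [map_add, map_mul, map_pow]
    linear_combination (-(PowerSeries.X * PowerSeries.rescale d (hermiteSeries y) *
      PowerSeries.rescale c (hermiteSeries x))) * hX
  · rw [PowerSeries.coeff_mul]
    simp [hermiteSeries, hermiteDiv, hermiteVal_zero]

/-- The addition formula of the Hermite polynomials. -/
theorem hermiteDiv_rotate {c d : ℝ} (h : c ^ 2 + d ^ 2 = 1) (x y : ℝ) (n : ℕ) :
    hermiteDiv n (c * x + d * y) =
      ∑ p ∈ Finset.HasAntidiagonal.antidiagonal n, d ^ p.1 * hermiteDiv p.1 y * (c ^ p.2 * hermiteDiv p.2 x) := by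
  have h1 := congrArg (PowerSeries.coeff n) (hermiteSeries_rotate h x y)
  rw [PowerSeries.coeff_mul] at h1
  simpa [hermiteSeries, PowerSeries.coeff_rescale] using h1

/-! ### Orthonormality of the Hermite functions -/

theorem integrable_pow_mul_gaussian (n : ℕ) {b : ℝ} (hb : 0 < b) :
    Integrable fun v : ℝ => v ^ n * Real.exp (-b * v ^ 2) := by
  simpa using integrable_rpow_mul_exp_neg_mul_sq hb (s := n) (by
    have : (0 : ℝ) ≤ n := by positivity
    linarith)

theorem integrable_aeval_mul_gaussian (p : Polynomial ℤ) {b : ℝ} (hb : 0 < b) :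
    Integrable fun v : ℝ => Polynomial.aeval v p * Real.exp (-b * v ^ 2) := by
  simp only [Polynomial.aeval_eq_sum_range, Finset.sum_mul]
  refine integrable_finsetSum _ fun i _ => ?_
  simpa [zsmul_eq_mul, mul_assoc] using (integrable_pow_mul_gaussian i hb).const_mul (p.coeff i : ℝ)

theorem hasDerivAt_hermiteVal_mul_gaussian (n : ℕ) (v : ℝ) :
    HasDerivAt (fun v => -(hermiteVal n v * Real.exp (-(1 / 2) * v ^ 2)))
      (hermiteVal (n + 1) v * Real.exp (-(1 / 2) * v ^ 2)) v := by
  have h1 : HasDerivAt (hermiteVal n) (v * hermiteVal n v - hermiteVal (n + 1) v) v := by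
    cases n with
    | zero =>
      have : hermiteVal 0 = fun _ => (1 : ℝ) := funext hermiteVal_zero
      simpa [this, hermiteVal_one] using hasDerivAt_const v (1 : ℝ)
    | succ n =>
      have := hasDerivAt_hermiteVal_succ n v
      rw [hermiteVal_succ_succ]
      convert this using 1
      ring
  have h2 : HasDerivAt (fun v : ℝ => Real.exp (-(1 / 2) * v ^ 2))
      (Real.exp (-(1 / 2) * v ^ 2) * (-(1 / 2) * (2 * v))) v := by
    have : HasDerivAt (fun v : ℝ => -(1 / 2) * v ^ 2) (-(1 / 2) * (2 * v)) v := by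
      simpa using (hasDerivAt_pow 2 v).const_mul (-(1 / 2) : ℝ)
    exact this.exp
  exact (h1.mul h2).neg.congr_deriv (by ring)

theorem integrable_hermiteVal_mul (m n : ℕ) {b : ℝ} (hb : 0 < b) :
    Integrable fun v => hermiteVal m v * hermiteVal n v * Real.exp (-b * v ^ 2) := by
  simpa [hermiteVal] using
    integrable_aeval_mul_gaussian (Polynomial.hermite m * Polynomial.hermite n) hb

theorem integral_hermiteVal_succ (m n : ℕ) :
    ∫ v, hermiteVal (m + 1) v * hermiteVal (n + 1) v * Real.exp (-(1 / 2) * v ^ 2) =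
      (m + 1) * ∫ v, hermiteVal m v * hermiteVal n v * Real.exp (-(1 / 2) * v ^ 2) := by
  have e1 := integrable_hermiteVal_mul (m + 1) (n + 1) (b := 1 / 2) (by norm_num)
  have e2 := (integrable_hermiteVal_mul m n (b := 1 / 2) (by norm_num)).const_mul (-((m : ℝ) + 1))
  have e3 := (integrable_hermiteVal_mul (m + 1) n (b := 1 / 2) (by norm_num)).neg
  have h := integral_mul_deriv_eq_deriv_mul_of_integrable
    (fun v _ => hasDerivAt_hermiteVal_succ m v)
    (fun v _ => hasDerivAt_hermiteVal_mul_gaussian n v)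
    (e1.congr (Filter.Eventually.of_forall fun v => by simp only [Pi.mul_apply]; ring))
    (e2.congr (Filter.Eventually.of_forall fun v => by simp only [Pi.mul_apply]; ring))
    (e3.congr (Filter.Eventually.of_forall fun v => by
      simp only [Pi.mul_apply, Pi.neg_apply]; ring))
  calc _ = ∫ v, hermiteVal (m + 1) v * (hermiteVal (n + 1) v * Real.exp (-(1 / 2) * v ^ 2)) := by
        simp only [mul_assoc]
    _ = _ := by
        rw [h, ← integral_const_mul, ← integral_neg]
        congr 1
        ext v
        ring

theorem integral_hermiteVal_zero_succ (n : ℕ) :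
    ∫ v, hermiteVal (n + 1) v * Real.exp (-(1 / 2) * v ^ 2) = 0 := by
  have e1 := integrable_hermiteVal_mul 0 (n + 1) (b := 1 / 2) (by norm_num)
  have e3 := (integrable_hermiteVal_mul 0 n (b := 1 / 2) (by norm_num)).neg
  have h := integral_mul_deriv_eq_deriv_mul_of_integrable
    (fun v _ => hasDerivAt_const v (1 : ℝ))
    (fun v _ => hasDerivAt_hermiteVal_mul_gaussian n v)
    (e1.congr (Filter.Eventually.of_forall fun v => by
      simp only [Pi.mul_apply, hermiteVal_zero]; ring))
    ((integrable_zero ℝ ℝ volume).congr (Filter.Eventually.of_forall fun v => by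
      simp only [Pi.mul_apply, Pi.zero_apply, zero_mul]))
    (e3.congr (Filter.Eventually.of_forall fun v => by
      simp only [Pi.mul_apply, Pi.neg_apply, hermiteVal_zero]; ring))
  simpa using h

theorem integral_hermiteVal_mul (m n : ℕ) :
    ∫ v, hermiteVal m v * hermiteVal n v * Real.exp (-(1 / 2) * v ^ 2) =
      if m = n then n.factorial * Real.sqrt (2 * Real.pi) else 0 := by
  induction m generalizing n with
  | zero =>
    cases n with
    | zero =>
      simp only [hermiteVal_zero]
      have := integral_gaussian (1 / 2)
      simp only [one_mul, this]
      simp [mul_comm]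
    | succ n => simpa [hermiteVal_zero] using integral_hermiteVal_zero_succ n
  | succ m ih =>
    cases n with
    | zero => simpa [hermiteVal_zero] using integral_hermiteVal_zero_succ m
    | succ n =>
      rw [integral_hermiteVal_succ, ih]
      by_cases h : m = n
      · subst h; simp [Nat.factorial_succ, mul_assoc]
      · simp [h]

theorem hermiteFun_eq (n : ℕ) (v : ℝ) :
    hermiteFun n v = hermiteVal n v * Real.exp (-(1 / 4) * v ^ 2) /
      Real.sqrt (n.factorial * Real.sqrt (2 * Real.pi)) := by
  unfold hermiteFun hermiteVal
  congr 3
  ring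

theorem continuous_hermiteFun (n : ℕ) : Continuous (hermiteFun n) := by
  have : hermiteFun n = _ := funext (hermiteFun_eq n)
  rw [this]
  have := continuous_hermiteVal n
  fun_prop

theorem hermiteFun_mul (m n : ℕ) (v : ℝ) : hermiteFun m v * hermiteFun n v =
    hermiteVal m v * hermiteVal n v * Real.exp (-(1 / 2) * v ^ 2) *
      ((Real.sqrt (m.factorial * Real.sqrt (2 * Real.pi)))⁻¹ *
        (Real.sqrt (n.factorial * Real.sqrt (2 * Real.pi)))⁻¹) := by
  rw [hermiteFun_eq, hermiteFun_eq, show -(1 / 2) * v ^ 2 = -(1 / 4) * v ^ 2 + -(1 / 4) * v ^ 2 by ring,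
    Real.exp_add]
  ring

theorem integrable_hermiteFun_mul (m n : ℕ) :
    Integrable fun v => hermiteFun m v * hermiteFun n v := by
  simp only [hermiteFun_mul]
  exact (integrable_hermiteVal_mul m n (by norm_num)).mul_const _

theorem integral_hermiteFun_mul (m n : ℕ) :
    ∫ v, hermiteFun m v * hermiteFun n v = if m = n then 1 else 0 := by
  simp only [hermiteFun_mul, integral_mul_const, integral_hermiteVal_mul]
  split_ifs with h
  · subst h
    have : 0 < (m.factorial : ℝ) * Real.sqrt (2 * Real.pi) := by positivity
    rw [← mul_inv, Real.mul_self_sqrt this.le, mul_inv_cancel₀ this.ne']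
  · simp

theorem memLp_hermiteFun (n : ℕ) : MemLp (hermiteFun n) 2 :=
  (memLp_two_iff_integrable_sq (continuous_hermiteFun n).aestronglyMeasurable).2
    (by simpa [sq] using integrable_hermiteFun_mul n n)

theorem memLp_hermiteFun_ofReal (n : ℕ) : MemLp (fun v => (hermiteFun n v : ℂ)) 2 :=
  (memLp_hermiteFun n).ofReal

/-! ### The Maxwellian -/

theorem sqrt_maxwellian (v : ℝ) : Real.sqrt (maxwellian v) =
    Real.exp (-(1 / 4) * v ^ 2) / Real.sqrt (Real.sqrt (2 * Real.pi)) := by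
  unfold maxwellian
  rw [Real.sqrt_div (Real.exp_pos _).le, Real.sqrt_eq_rpow (Real.exp _), ← Real.exp_mul]
  congr 2
  ring

theorem sqrt_maxwellian_pos (v : ℝ) : 0 < Real.sqrt (maxwellian v) := by
  rw [sqrt_maxwellian]; positivity

theorem hermiteFun_zero (v : ℝ) : hermiteFun 0 v = Real.sqrt (maxwellian v) := by
  rw [hermiteFun_eq, sqrt_maxwellian]
  simp [hermiteVal_zero]

/-- The normalized Hermite polynomials. -/
def hermiteNorm (n : ℕ) (v : ℝ) : ℝ := hermiteVal n v / Real.sqrt n.factorial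

theorem hermiteFun_eq_mul (n : ℕ) (v : ℝ) :
    hermiteFun n v = Real.sqrt (maxwellian v) * hermiteNorm n v := by
  rw [hermiteFun_eq, sqrt_maxwellian, hermiteNorm, Real.sqrt_mul (by positivity)]
  field_simp

theorem sqrt_maxwellian_rotate {v w v' w' : ℝ} (h : v ^ 2 + w ^ 2 = v' ^ 2 + w' ^ 2) :
    Real.sqrt (maxwellian v) * Real.sqrt (maxwellian w) =
      Real.sqrt (maxwellian v') * Real.sqrt (maxwellian w') := by
  simp only [sqrt_maxwellian, div_mul_div_comm, ← Real.exp_add]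
  congr 2
  linear_combination -(1 / 4) * h

theorem hermiteNorm_rotate {c d : ℝ} (h : c ^ 2 + d ^ 2 = 1) (x y : ℝ) (n : ℕ) :
    hermiteNorm n (c * x + d * y) = ∑ p ∈ Finset.HasAntidiagonal.antidiagonal n,
      Real.sqrt (n.choose p.1) * d ^ p.1 * c ^ p.2 * (hermiteNorm p.1 y * hermiteNorm p.2 x) := by
  have h0 : ∀ m z, hermiteNorm m z = Real.sqrt m.factorial * hermiteDiv m z := by
    intro m z
    have : 0 < (m.factorial : ℝ) := by positivity
    rw [hermiteNorm, hermiteDiv, div_eq_iff (by positivity)]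
    have h2 := Real.mul_self_sqrt this.le
    field_simp
    linear_combination (-hermiteVal m z) * h2
  rw [h0, hermiteDiv_rotate h, Finset.mul_sum]
  refine Finset.sum_congr rfl fun p hp => ?_
  have hp' := Finset.HasAntidiagonal.mem_antidiagonal.1 hp
  have h3 : Real.sqrt n.factorial = Real.sqrt (n.choose p.1) * Real.sqrt p.1.factorial *
      Real.sqrt p.2.factorial := by
    rw [← Real.sqrt_mul (by positivity), ← Real.sqrt_mul (by positivity)]
    congr 1
    rw [← hp']
    rw [Nat.choose_symm_add]
    exact_mod_cast (Nat.add_choose_mul_factorial_mul_factorial p.1 p.2).symm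
  rw [h0, h0, h3]
  ring

/-! ### Classes in `L²` -/

section ToL2

variable {α : Type} [MeasureSpace α]

theorem coeFn_toL2 {f : α → ℂ} (h : MemLp f 2 volume) : toL2 f =ᵐ[volume] f := by
  rw [toL2, dif_pos h]
  exact h.coeFn_toLp

theorem toL2_congr {f g : α → ℂ} (h : f =ᵐ[volume] g) : toL2 f = toL2 g := by
  by_cases hf : MemLp f 2 volume
  · have hg : MemLp g 2 volume := (memLp_congr_ae h).1 hf
    rw [toL2, toL2, dif_pos hf, dif_pos hg]
    exact (MemLp.toLp_eq_toLp_iff hf hg).2 h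
  · have hg : ¬ MemLp g 2 volume := fun hg => hf ((memLp_congr_ae h).2 hg)
    rw [toL2, toL2, dif_neg hf, dif_neg hg]

theorem toL2_coeFn (u : Lp ℂ 2 (volume : Measure α)) : toL2 (fun x => u x) = u := by
  rw [toL2, dif_pos (Lp.memLp u)]
  exact Lp.toLp_coeFn u (Lp.memLp u)

theorem eq_toL2 {u : Lp ℂ 2 (volume : Measure α)} {f : α → ℂ} (h : u =ᵐ[volume] f) : u = toL2 f := by
  rw [← toL2_congr h, toL2_coeFn]

theorem enorm_toL2 {f : α → ℂ} (h : MemLp f 2 volume) : ‖toL2 f‖ₑ = eLpNorm f 2 volume := by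
  rw [Lp.enorm_def, eLpNorm_congr_ae (coeFn_toL2 h)]

theorem enorm_sq_eq_lintegral (u : Lp ℂ 2 (volume : Measure α)) :
    ‖u‖ₑ ^ 2 = ∫⁻ x, ‖u x‖ₑ ^ 2 := by
  rw [Lp.enorm_def, eLpNorm_eq_lintegral_rpow_enorm_toReal (by norm_num) (by norm_num)]
  rw [← ENNReal.rpow_natCast, ← ENNReal.rpow_mul]
  norm_num

theorem eLpNorm_two_sq {β : Type*} [ENorm β] (μ : Measure α) (f : α → β) :
    eLpNorm f 2 μ ^ 2 = ∫⁻ x, ‖f x‖ₑ ^ 2 ∂μ := by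
  rw [eLpNorm_eq_lintegral_rpow_enorm_toReal (by norm_num) (by norm_num)]
  rw [← ENNReal.rpow_natCast, ← ENNReal.rpow_mul]
  norm_num

theorem memLp_two_of_lintegral {f : α → ℂ} (hf : AEStronglyMeasurable f volume)
    (h : ∫⁻ x, ‖f x‖ₑ ^ 2 < ⊤) : MemLp f 2 volume := by
  refine ⟨hf, ?_⟩
  rw [← eLpNorm_two_sq] at h
  exact (ENNReal.pow_lt_top_iff).1 h |>.resolve_right (by norm_num)

theorem lintegral_mul_sq_le {μ : Measure α} {f g : α → ℝ≥0∞} (hf : AEMeasurable f μ)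
    (hg : AEMeasurable g μ) :
    (∫⁻ x, f x * g x ∂μ) ^ 2 ≤ (∫⁻ x, f x ^ 2 ∂μ) * ∫⁻ x, g x ^ 2 ∂μ := by
  have h := ENNReal.lintegral_mul_le_Lp_mul_Lq μ Real.HolderConjugate.two_two hf hg
  calc (∫⁻ x, f x * g x ∂μ) ^ 2 ≤ _ := pow_le_pow_left₀ (by positivity) h 2
    _ = _ := by
      rw [mul_pow]
      simp only [← ENNReal.rpow_natCast, ← ENNReal.rpow_mul]
      norm_num

end ToL2

/-! ### The Fourier transform on `L¹ ∩ L²` -/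

theorem integral_fourierInv_mul {a g : ℝ → ℂ} (ha : Integrable a) (hg : Integrable g) :
    ∫ x, 𝓕⁻ a x * g x = ∫ x, a x * 𝓕⁻ g x := by
  have h := VectorFourier.integral_fourierIntegral_smul_eq_flip (L := -innerₗ ℝ) (μ := volume)
    (ν := volume) Real.continuous_fourierChar (by
      have : Continuous fun p : ℝ × ℝ => -inner ℝ p.1 p.2 := by fun_prop
      simpa using this) ha hg
  have e : (-innerₗ ℝ : ℝ →ₗ[ℝ] ℝ →ₗ[ℝ] ℝ).flip = -innerₗ ℝ := by
    ext; simp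
  rw [e] at h
  simpa [FourierTransformInv.fourierInv, smul_eq_mul] using h

theorem continuous_fourierInv {a : ℝ → ℂ} (ha : Integrable a) : Continuous (𝓕⁻ a) := by
  have := VectorFourier.fourierIntegral_continuous (L := -innerₗ ℝ) (μ := volume)
    Real.continuous_fourierChar (by
      have : Continuous fun p : ℝ × ℝ => -inner ℝ p.1 p.2 := by fun_prop
      simpa using this) ha
  exact this

theorem norm_fourierInv_le (a : ℝ → ℂ) (x : ℝ) : ‖𝓕⁻ a x‖ ≤ ∫ η, ‖a η‖ :=
  VectorFourier.norm_fourierIntegral_le_integral_norm _ _ _ a x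

/-- The inverse Fourier transform of `L²` is given by the Fourier integral on `L¹ ∩ L²`. -/
theorem fourierInv_toL2 {a : ℝ → ℂ} (h1 : Integrable a) (h2 : MemLp a 2) :
    (𝓕⁻ (toL2 a) : L2x) =ᵐ[volume] 𝓕⁻ a := by
  refine ae_eq_of_integral_contDiff_smul_eq
    ((Lp.memLp (𝓕⁻ (toL2 a) : L2x)).locallyIntegrable (by norm_num))
    (continuous_fourierInv h1).locallyIntegrable ?_
  intro g hg hg'
  have hgc : ContDiff ℝ ∞ (fun x => (g x : ℂ)) := Complex.ofRealCLM.contDiff.comp hg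
  have hgs : HasCompactSupport (fun x => (g x : ℂ)) := hg'.comp_left Complex.ofReal_zero
  set G : 𝓢(ℝ, ℂ) := hgs.toSchwartzMap hgc with hG
  have hGg : ∀ x, G x = (g x : ℂ) := fun x => rfl
  have e := congrArg (fun T : 𝓢'(ℝ, ℂ) => T G)
    (Lp.fourierInv_toTemperedDistribution_eq (toL2 a))
  simp only [TemperedDistribution.fourierInv_apply, Lp.toTemperedDistribution_apply] at e
  have e1 : ∫ x, g x • (𝓕⁻ (toL2 a) : L2x) x = ∫ x, G x • (𝓕⁻ (toL2 a) : L2x) x := by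
    congr 1
  rw [e1, ← e]
  have e2 : ∫ x, (𝓕⁻ G) x • (toL2 a) x = ∫ x, a x * 𝓕⁻ (G : ℝ → ℂ) x := by
    refine integral_congr_ae ?_
    filter_upwards [coeFn_toL2 h2] with x hx
    rw [hx, SchwartzMap.fourierInv_coe, smul_eq_mul, mul_comm]
  rw [e2, ← integral_fourierInv_mul h1 G.integrable]
  refine integral_congr_ae (Filter.Eventually.of_forall fun x => ?_)
  simp only [hGg]
  rw [mul_comm, Complex.real_smul]

theorem fourier_eq_fourierInv_comp_neg (a : ℝ → ℂ) (x : ℝ) : 𝓕 a x = 𝓕⁻ a (-x) := by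
  rw [Real.fourierInv_eq_fourier_neg, neg_neg]

theorem integral_fourier_mul {a g : ℝ → ℂ} (ha : Integrable a) (hg : Integrable g) :
    ∫ x, 𝓕 a x * g x = ∫ x, a x * 𝓕 g x := by
  have h := VectorFourier.integral_fourierIntegral_smul_eq_flip (L := innerₗ ℝ) (μ := volume)
    (ν := volume) Real.continuous_fourierChar (by
      have : Continuous fun p : ℝ × ℝ => inner ℝ p.1 p.2 := by fun_prop
      simpa using this) ha hg
  rw [flip_innerₗ] at h
  simpa [FourierTransform.fourier, smul_eq_mul] using h

/-- The Fourier transform of `L²` is given by the Fourier integral on `L¹ ∩ L²`. -/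
theorem fourier_toL2 {a : ℝ → ℂ} (h1 : Integrable a) (h2 : MemLp a 2) :
    (𝓕 (toL2 a) : L2x) =ᵐ[volume] 𝓕 a := by
  have hc : Continuous (𝓕 a) := by
    have : 𝓕 a = fun x => 𝓕⁻ a (-x) := funext (fourier_eq_fourierInv_comp_neg a)
    rw [this]
    exact (continuous_fourierInv h1).comp continuous_neg
  refine ae_eq_of_integral_contDiff_smul_eq
    ((Lp.memLp (𝓕 (toL2 a) : L2x)).locallyIntegrable (by norm_num)) hc.locallyIntegrable ?_
  intro g hg hg'
  have hgc : ContDiff ℝ ∞ (fun x => (g x : ℂ)) := Complex.ofRealCLM.contDiff.comp hg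
  have hgs : HasCompactSupport (fun x => (g x : ℂ)) := hg'.comp_left Complex.ofReal_zero
  set G : 𝓢(ℝ, ℂ) := hgs.toSchwartzMap hgc with hG
  have hGg : ∀ x, G x = (g x : ℂ) := fun x => rfl
  have e := congrArg (fun T : 𝓢'(ℝ, ℂ) => T G)
    (Lp.fourier_toTemperedDistribution_eq (toL2 a))
  simp only [TemperedDistribution.fourier_apply, Lp.toTemperedDistribution_apply] at e
  have e1 : ∫ x, g x • (𝓕 (toL2 a) : L2x) x = ∫ x, G x • (𝓕 (toL2 a) : L2x) x := by
    congr 1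
  rw [e1, ← e]
  have e2 : ∫ x, (𝓕 G) x • (toL2 a) x = ∫ x, a x * 𝓕 (G : ℝ → ℂ) x := by
    refine integral_congr_ae ?_
    filter_upwards [coeFn_toL2 h2] with x hx
    rw [hx, SchwartzMap.fourier_coe, smul_eq_mul, mul_comm]
  rw [e2, ← integral_fourier_mul h1 G.integrable]
  refine integral_congr_ae (Filter.Eventually.of_forall fun x => ?_)
  simp only [hGg]
  rw [mul_comm, Complex.real_smul]

/-! ### Fourier multipliers on `L²(ℝ)` -/

theorem memLp_mul_of_bound {α : Type} [MeasureSpace α] {m : α → ℝ} {B : ℝ} (hm : Measurable m)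
    (hB : ∀ ξ, |m ξ| ≤ B) {w : α → ℂ} (hw : MemLp w 2 volume) :
    MemLp (fun ξ => (m ξ : ℂ) * w ξ) 2 volume := by
  refine MemLp.of_le_mul (c := B) hw
    ((Complex.measurable_ofReal.comp hm).aestronglyMeasurable.mul hw.1) ?_
  refine Filter.Eventually.of_forall fun ξ => ?_
  rw [norm_mul, Complex.norm_real, Real.norm_eq_abs]
  exact mul_le_mul_of_nonneg_right (hB ξ) (norm_nonneg _)

theorem measurable_comp_two_pi {m : ℝ → ℝ} (hm : Measurable m) :
    Measurable fun ξ : ℝ => m (2 * Real.pi * ξ) :=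
  hm.comp (measurable_const.mul measurable_id)

theorem fourier_fourierMul_eq (m : ℝ → ℝ) (w : L2x) :
    𝓕 (fourierMul m w) = toL2 (fun ξ : ℝ => (m (2 * Real.pi * ξ) : ℂ) * (𝓕 w : L2x) ξ) := by
  exact FourierTransform.fourier_fourierInv_eq (E := L2x) (F := L2x) _

theorem fourier_fourierMul {m : ℝ → ℝ} {B : ℝ} (hm : Measurable m) (hB : ∀ ξ, |m ξ| ≤ B) (w : L2x) :
    (𝓕 (fourierMul m w) : L2x) =ᵐ[volume]
      fun ξ => (m (2 * Real.pi * ξ) : ℂ) * (𝓕 w : L2x) ξ := by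
  rw [fourier_fourierMul_eq]
  exact coeFn_toL2 (memLp_mul_of_bound (measurable_comp_two_pi hm) (fun ξ => hB _) (Lp.memLp _))

theorem fourier_injective {u w : L2x} (h : (𝓕 u : L2x) =ᵐ[volume] (𝓕 w : L2x)) : u = w := by
  exact (Lp.fourierTransformₗᵢ ℝ ℂ).injective (Lp.ext h)

theorem fourierMul_add {m : ℝ → ℝ} {B : ℝ} (hm : Measurable m) (hB : ∀ ξ, |m ξ| ≤ B) (u w : L2x) :
    fourierMul m (u + w) = fourierMul m u + fourierMul m w := by
  refine fourier_injective ?_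
  rw [FourierTransform.fourier_add]
  have h := FourierTransform.fourier_add u w
  filter_upwards [fourier_fourierMul hm hB (u + w), fourier_fourierMul hm hB u,
    fourier_fourierMul hm hB w, Lp.coeFn_add (𝓕 (fourierMul m u)) (𝓕 (fourierMul m w)),
    Lp.coeFn_add (𝓕 u : L2x) (𝓕 w)] with ξ h1 h2 h3 h4 h5
  rw [h1, h4, Pi.add_apply, h2, h3, h, h5, Pi.add_apply, mul_add]

theorem fourierMul_smul {m : ℝ → ℝ} {B : ℝ} (hm : Measurable m) (hB : ∀ ξ, |m ξ| ≤ B) (c : ℂ)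
    (u : L2x) : fourierMul m (c • u) = c • fourierMul m u := by
  refine fourier_injective ?_
  rw [FourierTransform.fourier_smul]
  have h := FourierTransform.fourier_smul c u
  filter_upwards [fourier_fourierMul hm hB (c • u), fourier_fourierMul hm hB u,
    Lp.coeFn_smul c (𝓕 (fourierMul m u)),
    Lp.coeFn_smul c (𝓕 u : L2x)] with ξ h1 h2 h4 h5
  rw [h1, h4, Pi.smul_apply, h2, h, h5, Pi.smul_apply, smul_eq_mul, smul_eq_mul]
  ring

theorem norm_fourierMul_le {m : ℝ → ℝ} {B : ℝ} (hm : Measurable m) (hB : ∀ ξ, |m ξ| ≤ B) (w : L2x) :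
    ‖fourierMul m w‖ ≤ B * ‖w‖ := by
  rw [← Lp.norm_fourier_eq, ← Lp.norm_fourier_eq w]
  refine Lp.norm_le_mul_norm_of_ae_le_mul ?_
  filter_upwards [fourier_fourierMul hm hB w] with ξ h1
  rw [h1, norm_mul, Complex.norm_real, Real.norm_eq_abs]
  exact mul_le_mul_of_nonneg_right (hB _) (norm_nonneg _)

theorem inner_fourierMul {m : ℝ → ℝ} {B : ℝ} (hm : Measurable m) (hB : ∀ ξ, |m ξ| ≤ B) (u w : L2x) :
    inner ℂ (fourierMul m u) w = inner ℂ u (fourierMul m w) := by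
  rw [← Lp.inner_fourier_eq, ← Lp.inner_fourier_eq u, L2.inner_def, L2.inner_def]
  refine integral_congr_ae ?_
  filter_upwards [fourier_fourierMul hm hB u, fourier_fourierMul hm hB w] with ξ h1 h2
  rw [h1, h2, RCLike.inner_apply, RCLike.inner_apply]
  simp only [map_mul, Complex.conj_ofReal]
  ring

/-! ### Completeness of the Hermite functions -/

theorem memLp_gaussian {b : ℝ} (hb : 0 < b) : MemLp (fun v : ℝ => Real.exp (-b * v ^ 2)) 2 := by
  have hc : Continuous fun v : ℝ => Real.exp (-b * v ^ 2) := by fun_prop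
  refine (memLp_two_iff_integrable_sq hc.aestronglyMeasurable).2 ?_
  refine (integrable_exp_neg_mul_sq (b := 2 * b) (by positivity)).congr
    (Filter.Eventually.of_forall fun v => ?_)
  simp only [← Real.exp_nat_mul]
  congr 1; push_cast; ring

theorem memLp_exp_mul_gaussian (c : ℝ) :
    MemLp (fun v : ℝ => Real.exp (c * |v|) * Real.exp (-(1 / 4) * v ^ 2)) 2 := by
  have hc : Continuous fun v : ℝ => Real.exp (c * |v|) * Real.exp (-(1 / 4) * v ^ 2) := by fun_prop
  refine MemLp.of_le_mul (c := Real.exp (2 * c ^ 2)) (memLp_gaussian (b := 1 / 8) (by norm_num))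
    hc.aestronglyMeasurable (Filter.Eventually.of_forall fun v => ?_)
  rw [Real.norm_of_nonneg (by positivity), Real.norm_of_nonneg (by positivity), ← Real.exp_add,
    ← Real.exp_add]
  refine Real.exp_le_exp.2 ?_
  nlinarith [sq_nonneg (|v| - 4 * c), sq_abs v]

theorem integrable_mul_exp_mul_gaussian {g : ℝ → ℂ} (hg : MemLp g 2) (c : ℝ) :
    Integrable fun v => ‖g v‖ * (Real.exp (c * |v|) * Real.exp (-(1 / 4) * v ^ 2)) :=
  hg.norm.integrable_mul (memLp_exp_mul_gaussian c)

theorem abs_pow_le_exp (n : ℕ) (v : ℝ) : |v| ^ n ≤ n.factorial * Real.exp |v| := by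
  have h := Real.pow_div_factorial_le_exp |v| (abs_nonneg v) n
  rwa [div_le_iff₀ (by positivity), mul_comm] at h

theorem integrable_mul_pow_mul_hermite {g : ℝ → ℂ} (hg : MemLp g 2) (j n : ℕ) :
    Integrable fun v => g v * ((v ^ j * hermiteVal n v * Real.exp (-(1 / 4) * v ^ 2) : ℝ) : ℂ) := by
  refine MemLp.integrable_mul (q := 2) hg (MemLp.ofReal ?_)
  have hc : Continuous fun v => v ^ j * hermiteVal n v * Real.exp (-(1 / 4) * v ^ 2) := by
    have := continuous_hermiteVal n
    fun_prop
  refine (memLp_two_iff_integrable_sq hc.aestronglyMeasurable).2 ?_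
  have h := integrable_aeval_mul_gaussian
    ((Polynomial.X ^ j * Polynomial.hermite n) ^ 2) (b := 1 / 2) (by norm_num)
  refine h.congr (Filter.Eventually.of_forall fun v => ?_)
  simp only [map_pow, map_mul, Polynomial.aeval_X, hermiteVal, mul_pow, ← Real.exp_nat_mul]
  congr 2; push_cast; ring

theorem integral_mul_pow_mul_hermite {g : ℝ → ℂ} (hg : MemLp g 2)
    (h : ∀ n, ∫ v, g v * (hermiteFun n v : ℂ) = 0) (j n : ℕ) :
    ∫ v, g v * ((v ^ j * hermiteVal n v * Real.exp (-(1 / 4) * v ^ 2) : ℝ) : ℂ) = 0 := by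
  induction j generalizing n with
  | zero =>
    have h1 := h n
    have e : ∀ v, g v * (hermiteFun n v : ℂ) =
        g v * ((v ^ 0 * hermiteVal n v * Real.exp (-(1 / 4) * v ^ 2) : ℝ) : ℂ) *
          ((Real.sqrt (n.factorial * Real.sqrt (2 * Real.pi)))⁻¹ : ℝ) := fun v => by
      rw [hermiteFun_eq]; push_cast; ring
    simp only [e] at h1
    rw [integral_mul_const] at h1
    refine (mul_eq_zero.1 h1).resolve_right ?_
    exact_mod_cast inv_ne_zero (by positivity)
  | succ j ih =>
    have e : ∀ v, g v * ((v ^ (j + 1) * hermiteVal n v * Real.exp (-(1 / 4) * v ^ 2) : ℝ) : ℂ) =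
        g v * ((v ^ j * hermiteVal (n + 1) v * Real.exp (-(1 / 4) * v ^ 2) : ℝ) : ℂ) +
        (n : ℂ) * (g v * ((v ^ j * hermiteVal (n - 1) v * Real.exp (-(1 / 4) * v ^ 2) : ℝ) : ℂ)) := by
      intro v
      have h2 : v ^ (j + 1) * hermiteVal n v =
          v ^ j * hermiteVal (n + 1) v + n * (v ^ j * hermiteVal (n - 1) v) := by
        rw [pow_succ, mul_assoc, mul_hermiteVal]; ring
      rw [h2]; push_cast; ring
    simp only [e]
    rw [integral_add (integrable_mul_pow_mul_hermite hg _ _)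
      ((integrable_mul_pow_mul_hermite hg _ _).const_mul _), integral_const_mul, ih, ih]
    simp

/-- A square integrable function orthogonal to all Hermite functions vanishes. -/
theorem ae_eq_zero_of_hermite_orthogonal {g : ℝ → ℂ} (hg : MemLp g 2)
    (h : ∀ n, ∫ v, g v * (hermiteFun n v : ℂ) = 0) : g =ᵐ[volume] 0 := by
  set f : ℝ → ℂ := fun v => g v * (Real.exp (-(1 / 4) * v ^ 2) : ℂ) with hf
  have hf1 : Integrable f := hg.integrable_mul (memLp_gaussian (by norm_num)).ofReal
  have hf2 : MemLp f 2 := by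
    refine hg.of_le_mul (c := 1) hf1.1 (Filter.Eventually.of_forall fun v => ?_)
    rw [hf, norm_mul, Complex.norm_real, Real.norm_of_nonneg (Real.exp_pos _).le, mul_comm]
    refine mul_le_mul_of_nonneg_right (Real.exp_le_one_iff.2 ?_) (norm_nonneg _)
    nlinarith [sq_nonneg v]
  have hmom : ∀ n : ℕ, ∫ v, f v * (v : ℂ) ^ n = 0 := fun n => by
    rw [← integral_mul_pow_mul_hermite hg h n 0]
    congr 1; ext v
    rw [hf, hermiteVal_zero]; push_cast; ring
  have hF : ∀ ξ, 𝓕 f ξ = 0 := by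
    intro ξ
    have hs : HasSum (fun n : ℕ => ∫ v : ℝ, ((-2 * Real.pi * ξ * Complex.I) * v) ^ n / n.factorial * f v)
        (∫ v : ℝ, Complex.exp ((-2 * Real.pi * ξ * Complex.I) * v) * f v) := by
      refine hasSum_integral_of_dominated_convergence
        (fun n v => (2 * Real.pi * |ξ| * |v|) ^ n / n.factorial * ‖f v‖) ?_ ?_ ?_ ?_ ?_
      · intro n
        refine Continuous.aestronglyMeasurable ?_ |>.mul hf1.1
        fun_prop
      · intro n
        refine Filter.Eventually.of_forall fun v => ?_
        simp only [norm_mul, norm_div, norm_pow]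
        simp [abs_of_pos Real.pi_pos]
      · refine Filter.Eventually.of_forall fun v => ?_
        exact (Real.summable_pow_div_factorial _).mul_right _
      · have := integrable_mul_exp_mul_gaussian hg (2 * Real.pi * |ξ|)
        refine this.congr (Filter.Eventually.of_forall fun v => ?_)
        simp only [tsum_mul_right]
        have e : ∑' n : ℕ, (2 * Real.pi * |ξ| * |v|) ^ n / n.factorial =
            Real.exp (2 * Real.pi * |ξ| * |v|) := by
          rw [Real.exp_eq_exp_ℝ, NormedSpace.exp_eq_tsum_div]
        rw [e, hf, norm_mul, Complex.norm_real, Real.norm_of_nonneg (Real.exp_pos _).le]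
        ring
      · refine Filter.Eventually.of_forall fun v => ?_
        have := NormedSpace.expSeries_div_hasSum_exp (𝔸 := ℂ) ((-2 * Real.pi * ξ * Complex.I) * v)
        rw [← Complex.exp_eq_exp_ℂ] at this
        exact this.mul_right _
    have h0 : ∀ n : ℕ, ∫ v : ℝ, ((-2 * Real.pi * ξ * Complex.I) * v) ^ n / n.factorial * f v = 0 := by
      intro n
      have e : ∀ v : ℝ, ((-2 * Real.pi * ξ * Complex.I) * (v : ℂ)) ^ n / n.factorial * f v =
          ((-2 * Real.pi * ξ * Complex.I) ^ n / n.factorial) * (f v * (v : ℂ) ^ n) := fun v => by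
        rw [mul_pow]; ring
      simp only [e]
      rw [integral_const_mul, hmom, mul_zero]
    simp only [h0] at hs
    rw [Real.fourier_eq', ← hs.unique hasSum_zero]
    congr 1; ext v
    simp only [smul_eq_mul]
    congr 2
    simp
    ring
  have hz : toL2 f = 0 := by
    refine fourier_injective ?_
    have e0 : (𝓕 (0 : L2x) : L2x) = 0 := map_zero (Lp.fourierTransformₗᵢ ℝ ℂ)
    rw [e0]
    filter_upwards [fourier_toL2 hf1 hf2, Lp.coeFn_zero ℂ 2 (volume : Measure ℝ)] with ξ h1 h2
    rw [h1, hF, h2]; rfl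
  have hz' := coeFn_toL2 hf2
  rw [hz] at hz'
  filter_upwards [hz', Lp.coeFn_zero ℂ 2 (volume : Measure ℝ)] with v h1 h2
  rw [h2] at h1
  have h3 : g v * (Real.exp (-(1 / 4) * v ^ 2) : ℂ) = 0 := h1.symm
  exact (mul_eq_zero.1 h3).resolve_right (by exact_mod_cast (Real.exp_pos _).ne')

theorem inner_toL2 {α : Type} [MeasureSpace α] {f g : α → ℂ} (hf : MemLp f 2 volume)
    (hg : MemLp g 2 volume) :
    inner ℂ (toL2 f) (toL2 g) = ∫ x, g x * (starRingEnd ℂ) (f x) := by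
  rw [L2.inner_def]
  refine integral_congr_ae ?_
  filter_upwards [coeFn_toL2 hf, coeFn_toL2 hg] with x h1 h2
  rw [h1, h2, RCLike.inner_apply]

theorem orthonormal_hermite :
    Orthonormal ℂ (fun n : ℕ => toL2 (fun v : ℝ => (hermiteFun n v : ℂ))) := by
  rw [orthonormal_iff_ite]
  intro m n
  rw [inner_toL2 (memLp_hermiteFun_ofReal m) (memLp_hermiteFun_ofReal n)]
  simp only [Complex.conj_ofReal, ← Complex.ofReal_mul]
  rw [integral_complex_ofReal, integral_hermiteFun_mul]
  by_cases h : m = n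
  · simp [h]
  · simp [h, Ne.symm h]

theorem inner_hermite {g : ℝ → ℂ} (hg : MemLp g 2) (n : ℕ) :
    inner ℂ (toL2 (fun v : ℝ => (hermiteFun n v : ℂ))) (toL2 g) =
      ∫ v, g v * (hermiteFun n v : ℂ) := by
  rw [inner_toL2 (memLp_hermiteFun_ofReal n) hg]
  simp only [Complex.conj_ofReal]

/-- The Hilbert basis of Hermite functions. -/
def hermiteBasis : HilbertBasis ℕ ℂ L2x :=
  HilbertBasis.mkOfOrthogonalEqBot orthonormal_hermite (by
    rw [Submodule.eq_bot_iff]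
    intro w hw
    rw [Submodule.mem_orthogonal] at hw
    have h := ae_eq_zero_of_hermite_orthogonal (Lp.memLp w) (fun n => by
      rw [← inner_hermite (Lp.memLp w) n, toL2_coeFn]
      exact hw _ (Submodule.subset_span ⟨n, rfl⟩))
    exact (Lp.eq_zero_iff_ae_eq_zero).2 h)

/-- Parseval's identity for the Hermite functions. -/
theorem lintegral_eq_tsum_hermite {g : ℝ → ℂ} (hg : MemLp g 2) :
    ∫⁻ v, ‖g v‖ₑ ^ 2 = ∑' n : ℕ, ‖∫ v, g v * (hermiteFun n v : ℂ)‖ₑ ^ 2 := by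
  have h := hermiteBasis.hasSum_inner_mul_inner (toL2 g) (toL2 g)
  have e : ∀ n, inner ℂ (toL2 g) (hermiteBasis n) * inner ℂ (hermiteBasis n) (toL2 g) =
      ((‖∫ v, g v * (hermiteFun n v : ℂ)‖ ^ 2 : ℝ) : ℂ) := fun n => by
    have : hermiteBasis n = toL2 (fun v : ℝ => (hermiteFun n v : ℂ)) := by
      rw [hermiteBasis, HilbertBasis.coe_mkOfOrthogonalEqBot]
    rw [← inner_conj_symm, this, inner_hermite hg, RCLike.conj_mul]
    norm_cast
  simp only [e] at h
  rw [inner_self_eq_norm_sq_to_K] at h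
  have h' : HasSum (fun n => ‖∫ v, g v * (hermiteFun n v : ℂ)‖ ^ 2) (‖toL2 g‖ ^ 2) := by
    exact Complex.hasSum_ofReal.1 (by simpa using h)
  have h3 : ∫⁻ v, ‖g v‖ₑ ^ 2 = ‖toL2 g‖ₑ ^ 2 := by
    rw [enorm_toL2 hg, eLpNorm_two_sq]
  rw [h3, ← ofReal_norm, ← ENNReal.ofReal_pow (norm_nonneg _), ← h'.tsum_eq,
    ENNReal.ofReal_tsum_of_nonneg (fun n => by positivity) h'.summable]
  congr 1; ext n
  rw [ENNReal.ofReal_pow (norm_nonneg _), ofReal_norm]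

/-! ### Slices and Hermite coefficients of functions of two variables -/

theorem lintegral_plane {f : ℝ × ℝ → ℝ≥0∞} (hf : AEMeasurable f volume) :
    ∫⁻ z, f z = ∫⁻ x, ∫⁻ v, f (x, v) := by
  rw [Measure.volume_eq_prod] at hf ⊢
  exact lintegral_prod f hf

theorem lintegral_plane_swap {f : ℝ × ℝ → ℝ≥0∞} (hf : AEMeasurable f volume) :
    ∫⁻ z, f z = ∫⁻ v, ∫⁻ x, f (x, v) := by
  rw [Measure.volume_eq_prod] at hf ⊢
  exact lintegral_prod_symm f hf

theorem integral_plane {f : ℝ × ℝ → ℂ} (hf : Integrable f volume) :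
    ∫ z, f z = ∫ x, ∫ v, f (x, v) := by
  rw [Measure.volume_eq_prod] at hf ⊢
  exact integral_prod f hf

theorem measurable_L2xv (u : L2xv) : Measurable (fun z => u z) :=
  (Lp.stronglyMeasurable u).measurable

theorem enorm_sq_eq_lintegral_slices (u : L2xv) :
    ‖u‖ₑ ^ 2 = ∫⁻ x, ∫⁻ v, ‖u (x, v)‖ₑ ^ 2 := by
  rw [enorm_sq_eq_lintegral, lintegral_plane]
  exact ((measurable_L2xv u).enorm.pow_const 2).aemeasurable

theorem enorm_sq_eq_lintegral_slices_swap (u : L2xv) :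
    ‖u‖ₑ ^ 2 = ∫⁻ v, ∫⁻ x, ‖u (x, v)‖ₑ ^ 2 := by
  rw [enorm_sq_eq_lintegral, lintegral_plane_swap]
  exact ((measurable_L2xv u).enorm.pow_const 2).aemeasurable

theorem measurable_slice_lintegral (u : L2xv) : Measurable fun x => ∫⁻ v, ‖u (x, v)‖ₑ ^ 2 :=
  ((measurable_L2xv u).enorm.pow_const 2).lintegral_prod_right'

theorem ae_lintegral_slice_lt_top (u : L2xv) : ∀ᵐ x : ℝ, ∫⁻ v, ‖u (x, v)‖ₑ ^ 2 < ⊤ := by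
  refine ae_lt_top (measurable_slice_lintegral u) ?_
  rw [← enorm_sq_eq_lintegral_slices]
  exact ENNReal.pow_ne_top enorm_ne_top

theorem memLp_slice_of_lt_top (u : L2xv) {x : ℝ} (h : ∫⁻ v, ‖u (x, v)‖ₑ ^ 2 < ⊤) :
    MemLp (fun v => u (x, v)) 2 :=
  memLp_two_of_lintegral ((measurable_L2xv u).comp measurable_prodMk_left).aestronglyMeasurable h

theorem ae_memLp_slice (u : L2xv) : ∀ᵐ x : ℝ, MemLp (fun v => u (x, v)) 2 := by
  filter_upwards [ae_lintegral_slice_lt_top u] with x hx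
  exact memLp_slice_of_lt_top u hx

theorem enorm_integral_mul_sq_le {g w : ℝ → ℂ} (hg : AEStronglyMeasurable g volume)
    (hw : AEStronglyMeasurable w volume) :
    ‖∫ v, g v * w v‖ₑ ^ 2 ≤ (∫⁻ v, ‖g v‖ₑ ^ 2) * ∫⁻ v, ‖w v‖ₑ ^ 2 := by
  refine le_trans (pow_le_pow_left₀ (by positivity) (enorm_integral_le_lintegral_enorm _) 2) ?_
  simp only [enorm_mul]
  exact lintegral_mul_sq_le hg.enorm hw.enorm

theorem lintegral_enorm_sq_lt_top {α : Type} [MeasureSpace α] {w : α → ℂ} (hw : MemLp w 2 volume) :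
    ∫⁻ v, ‖w v‖ₑ ^ 2 < ⊤ := by
  rw [← eLpNorm_two_sq]
  exact ENNReal.pow_lt_top hw.2

theorem aestronglyMeasurable_integral_mul (u : L2xv) {w : ℝ → ℂ}
    (hw : AEStronglyMeasurable w volume) :
    AEStronglyMeasurable (fun x : ℝ => ∫ v : ℝ, u (x, v) * w v) volume := by
  have h : AEStronglyMeasurable (fun z : ℝ × ℝ => u z * w z.2) (volume.prod volume) :=
    (measurable_L2xv u).aestronglyMeasurable.mul hw.comp_snd
  exact h.integral_prod_right'

theorem memLp_integral_mul (u : L2xv) {w : ℝ → ℂ} (hw : MemLp w 2) :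
    MemLp (fun x : ℝ => ∫ v : ℝ, u (x, v) * w v) 2 := by
  refine memLp_two_of_lintegral (aestronglyMeasurable_integral_mul u hw.1) ?_
  calc ∫⁻ x : ℝ, ‖∫ v : ℝ, u (x, v) * w v‖ₑ ^ 2
      ≤ ∫⁻ x : ℝ, (∫⁻ v, ‖u (x, v)‖ₑ ^ 2) * ∫⁻ v, ‖w v‖ₑ ^ 2 :=
        lintegral_mono fun x => enorm_integral_mul_sq_le
          ((measurable_L2xv u).comp measurable_prodMk_left).aestronglyMeasurable hw.1
    _ = ‖u‖ₑ ^ 2 * ∫⁻ v, ‖w v‖ₑ ^ 2 := by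
        rw [lintegral_mul_const _ (measurable_slice_lintegral u), ← enorm_sq_eq_lintegral_slices]
    _ < ⊤ := ENNReal.mul_lt_top (ENNReal.pow_lt_top enorm_lt_top) (lintegral_enorm_sq_lt_top hw)

theorem coeFn_hermiteCoeff (n : ℕ) (u : L2xv) :
    hermiteCoeff n u =ᵐ[volume] fun x => ∫ v : ℝ, u (x, v) * (hermiteFun n v : ℂ) :=
  coeFn_toL2 (memLp_integral_mul u (memLp_hermiteFun_ofReal n))

/-- Parseval's identity in the velocity variable. -/
theorem enorm_sq_eq_tsum (u : L2xv) : ‖u‖ₑ ^ 2 = ∑' n : ℕ, ‖hermiteCoeff n u‖ₑ ^ 2 := by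
  have h : ∫⁻ x, ∫⁻ v, ‖u (x, v)‖ₑ ^ 2 =
      ∫⁻ x, ∑' n : ℕ, ‖∫ v : ℝ, u (x, v) * (hermiteFun n v : ℂ)‖ₑ ^ 2 := by
    refine lintegral_congr_ae ?_
    filter_upwards [ae_memLp_slice u] with x hx
    exact lintegral_eq_tsum_hermite hx
  rw [enorm_sq_eq_lintegral_slices, h, lintegral_tsum fun n =>
    ((aestronglyMeasurable_integral_mul u (memLp_hermiteFun_ofReal n).1).enorm.pow_const 2)]
  congr 1; ext n
  rw [enorm_sq_eq_lintegral]
  refine lintegral_congr_ae ?_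
  filter_upwards [coeFn_hermiteCoeff n u] with x hx
  rw [hx]

theorem ae_slice_eq {u w : ℝ × ℝ → ℂ} (h : u =ᵐ[volume] w) :
    ∀ᵐ x : ℝ, ∀ᵐ v : ℝ, u (x, v) = w (x, v) := by
  rw [Measure.volume_eq_prod] at h
  exact Measure.ae_ae_of_ae_prod h

theorem hermiteCoeff_add (n : ℕ) (u w : L2xv) :
    hermiteCoeff n (u + w) = hermiteCoeff n u + hermiteCoeff n w := by
  refine Lp.ext ?_
  filter_upwards [coeFn_hermiteCoeff n (u + w), coeFn_hermiteCoeff n u, coeFn_hermiteCoeff n w,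
    Lp.coeFn_add (hermiteCoeff n u) (hermiteCoeff n w), ae_slice_eq (Lp.coeFn_add u w),
    ae_memLp_slice u, ae_memLp_slice w] with x h1 h2 h3 h4 h5 h6 h7
  have i1 : Integrable fun v : ℝ => u (x, v) * (hermiteFun n v : ℂ) :=
    h6.integrable_mul (memLp_hermiteFun_ofReal n)
  have i2 : Integrable fun v : ℝ => w (x, v) * (hermiteFun n v : ℂ) :=
    h7.integrable_mul (memLp_hermiteFun_ofReal n)
  rw [h1, h4, Pi.add_apply, h2, h3, ← integral_add i1 i2]
  refine integral_congr_ae ?_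
  filter_upwards [h5] with v hv
  rw [hv, Pi.add_apply, add_mul]

theorem hermiteCoeff_smul (n : ℕ) (c : ℂ) (u : L2xv) :
    hermiteCoeff n (c • u) = c • hermiteCoeff n u := by
  refine Lp.ext ?_
  filter_upwards [coeFn_hermiteCoeff n (c • u), coeFn_hermiteCoeff n u,
    Lp.coeFn_smul c (hermiteCoeff n u), ae_slice_eq (Lp.coeFn_smul c u)] with x h1 h2 h4 h5
  rw [h1, h4, Pi.smul_apply, h2, smul_eq_mul, ← integral_const_mul]
  refine integral_congr_ae ?_
  filter_upwards [h5] with v hv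
  rw [hv, Pi.smul_apply, smul_eq_mul, mul_assoc]

theorem enorm_hermiteCoeff_le (n : ℕ) (u : L2xv) : ‖hermiteCoeff n u‖ₑ ≤ ‖u‖ₑ := by
  have h : ‖hermiteCoeff n u‖ₑ ^ 2 ≤ ‖u‖ₑ ^ 2 := by
    rw [enorm_sq_eq_tsum u]
    exact ENNReal.le_tsum (f := fun n => ‖hermiteCoeff n u‖ₑ ^ 2) n
  exact (ENNReal.pow_le_pow_left_iff (by norm_num)).1 h

theorem norm_hermiteCoeff_le (n : ℕ) (u : L2xv) : ‖hermiteCoeff n u‖ ≤ ‖u‖ := by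
  have h := enorm_hermiteCoeff_le n u
  rw [← ofReal_norm, ← ofReal_norm] at h
  exact (ENNReal.ofReal_le_ofReal_iff (norm_nonneg _)).1 h

/-- The Hermite coefficient as a continuous linear map. -/
def hermiteCoeffCLM (n : ℕ) : L2xv →L[ℂ] L2x :=
  LinearMap.mkContinuous
    { toFun := hermiteCoeff n
      map_add' := hermiteCoeff_add n
      map_smul' := hermiteCoeff_smul n } 1 (fun u => by
        rw [one_mul]; exact norm_hermiteCoeff_le n u)

theorem hermiteCoeffCLM_apply (n : ℕ) (u : L2xv) : hermiteCoeffCLM n u = hermiteCoeff n u := rfl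

theorem hermiteCoeff_ext {u w : L2xv} (h : ∀ n, hermiteCoeff n u = hermiteCoeff n w) : u = w := by
  rw [← sub_eq_zero, ← enorm_eq_zero, ← pow_eq_zero_iff (n := 2) (by norm_num), enorm_sq_eq_tsum]
  refine ENNReal.tsum_eq_zero.2 fun n => ?_
  have : hermiteCoeff n (u - w) = 0 := by
    rw [← hermiteCoeffCLM_apply, map_sub, hermiteCoeffCLM_apply, hermiteCoeffCLM_apply, h, sub_self]
  simp [this]

/-! ### Tensor products with the Hermite functions -/

theorem lintegral_tensor_sq {a b : ℝ → ℂ} (ha : AEStronglyMeasurable a volume)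
    (hb : AEStronglyMeasurable b volume) :
    ∫⁻ z : ℝ × ℝ, ‖a z.1 * b z.2‖ₑ ^ 2 = (∫⁻ x, ‖a x‖ₑ ^ 2) * ∫⁻ v, ‖b v‖ₑ ^ 2 := by
  simp only [enorm_mul, mul_pow]
  rw [Measure.volume_eq_prod]
  exact lintegral_prod_mul (f := fun x => ‖a x‖ₑ ^ 2) (g := fun v => ‖b v‖ₑ ^ 2)
    (ha.enorm.pow_const 2) (hb.enorm.pow_const 2)

theorem memLp_tensor {a b : ℝ → ℂ} (ha : MemLp a 2) (hb : MemLp b 2) :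
    MemLp (fun z : ℝ × ℝ => a z.1 * b z.2) 2 volume := by
  refine memLp_two_of_lintegral ?_ ?_
  · rw [Measure.volume_eq_prod]
    exact ha.1.comp_fst.mul hb.1.comp_snd
  · rw [lintegral_tensor_sq ha.1 hb.1]
    exact ENNReal.mul_lt_top (lintegral_enorm_sq_lt_top ha) (lintegral_enorm_sq_lt_top hb)

/-- The function `w(x) e_n(v)`. -/
def tensor (n : ℕ) (w : L2x) : L2xv :=
  toL2 (fun z : ℝ × ℝ => w z.1 * (hermiteFun n z.2 : ℂ))

theorem memLp_tensor_hermite (n : ℕ) (w : L2x) :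
    MemLp (fun z : ℝ × ℝ => w z.1 * (hermiteFun n z.2 : ℂ)) 2 volume :=
  memLp_tensor (Lp.memLp w) (memLp_hermiteFun_ofReal n)

theorem coeFn_tensor (n : ℕ) (w : L2x) :
    tensor n w =ᵐ[volume] fun z : ℝ × ℝ => w z.1 * (hermiteFun n z.2 : ℂ) :=
  coeFn_toL2 (memLp_tensor_hermite n w)

theorem integral_hermiteFun_mul_ofReal (m n : ℕ) :
    ∫ v, (hermiteFun m v : ℂ) * (hermiteFun n v : ℂ) = if m = n then 1 else 0 := by
  simp only [← Complex.ofReal_mul]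
  rw [integral_complex_ofReal, integral_hermiteFun_mul]
  split_ifs <;> simp

theorem hermiteCoeff_tensor (m n : ℕ) (w : L2x) :
    hermiteCoeff m (tensor n w) = if m = n then w else 0 := by
  refine Lp.ext ?_
  filter_upwards [coeFn_hermiteCoeff m (tensor n w), ae_slice_eq (coeFn_tensor n w)]
    with x h1 h2
  rw [h1]
  have e : ∫ v : ℝ, (tensor n w) (x, v) * (hermiteFun m v : ℂ) =
      ∫ v : ℝ, w x * ((hermiteFun n v : ℂ) * (hermiteFun m v : ℂ)) := by
    refine integral_congr_ae ?_
    filter_upwards [h2] with v hv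
    rw [hv, mul_assoc]
  rw [e, integral_const_mul, integral_hermiteFun_mul_ofReal]
  by_cases h : n = m
  · simp [h]
  · simp [h, Ne.symm h]

theorem enorm_tensor (n : ℕ) (w : L2x) : ‖tensor n w‖ₑ = ‖w‖ₑ := by
  have h : ‖tensor n w‖ₑ ^ 2 = ‖w‖ₑ ^ 2 := by
    rw [enorm_sq_eq_tsum, tsum_eq_single n]
    · rw [hermiteCoeff_tensor, if_pos rfl]
    · intro m hm
      rw [hermiteCoeff_tensor, if_neg hm]
      simp
  exact le_antisymm ((ENNReal.pow_le_pow_left_iff (by norm_num)).1 h.le)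
    ((ENNReal.pow_le_pow_left_iff (by norm_num)).1 h.ge)

/-- Tensorization with `e_n` as a linear isometry. -/
def tensorIso (n : ℕ) : L2x →ₗᵢ[ℂ] L2xv where
  toFun := tensor n
  map_add' a b := hermiteCoeff_ext fun m => by
    rw [hermiteCoeff_add]
    simp only [hermiteCoeff_tensor]
    split_ifs <;> simp
  map_smul' c a := hermiteCoeff_ext fun m => by
    rw [RingHom.id_apply, hermiteCoeff_smul]
    simp only [hermiteCoeff_tensor]
    split_ifs <;> simp
  norm_map' w := by
    have h := enorm_tensor n w
    rw [← ofReal_norm, ← ofReal_norm] at h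
    exact (ENNReal.ofReal_eq_ofReal_iff (norm_nonneg _) (norm_nonneg _)).1 h

theorem tensorIso_apply (n : ℕ) (w : L2x) : tensorIso n w = tensor n w := rfl

theorem inner_tensor (n : ℕ) (w : L2x) (u : L2xv) :
    inner ℂ (tensor n w) u = inner ℂ w (hermiteCoeff n u) := by
  have hi := L2.integrable_inner (𝕜 := ℂ) (tensor n w) u
  rw [L2.inner_def, L2.inner_def]
  rw [integral_plane hi]
  refine integral_congr_ae ?_
  filter_upwards [coeFn_hermiteCoeff n u, ae_slice_eq (coeFn_tensor n w)] with x h1 h2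
  rw [h1, RCLike.inner_apply, ← integral_mul_const]
  refine integral_congr_ae ?_
  filter_upwards [h2] with v hv
  rw [RCLike.inner_apply, hv]
  simp only [map_mul, Complex.conj_ofReal]
  ring

theorem orthogonalFamily_tensor :
    OrthogonalFamily ℂ (fun _ : ℕ => L2x) (fun n => tensorIso n) := by
  intro m n hmn a b
  rw [tensorIso_apply, inner_tensor, tensorIso_apply, hermiteCoeff_tensor, if_neg hmn,
    inner_zero_right]

theorem summable_tensor_iff (w : ℕ → L2x) :
    Summable (fun n => tensor n (w n)) ↔ Summable fun n => ‖w n‖ ^ 2 :=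
  orthogonalFamily_tensor.summable_iff_norm_sq_summable w

theorem hermiteCoeff_tsum_tensor {w : ℕ → L2x} (h : Summable fun n => tensor n (w n)) (m : ℕ) :
    hermiteCoeff m (∑' n, tensor n (w n)) = w m := by
  rw [← hermiteCoeffCLM_apply, ContinuousLinearMap.map_tsum _ h, tsum_eq_single m]
  · rw [hermiteCoeffCLM_apply, hermiteCoeff_tensor, if_pos rfl]
  · intro n hn
    rw [hermiteCoeffCLM_apply, hermiteCoeff_tensor, if_neg hn.symm]

theorem summable_norm_sq_hermiteCoeff (u : L2xv) : Summable fun n => ‖hermiteCoeff n u‖ ^ 2 := by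
  have h := enorm_sq_eq_tsum u
  have h2 : ∑' n : ℕ, ENNReal.ofReal (‖hermiteCoeff n u‖ ^ 2) ≠ ⊤ := by
    have e : ∀ n, ENNReal.ofReal (‖hermiteCoeff n u‖ ^ 2) = ‖hermiteCoeff n u‖ₑ ^ 2 := fun n => by
      rw [ENNReal.ofReal_pow (norm_nonneg _), ofReal_norm]
    simp only [e, ← h]
    exact ENNReal.pow_ne_top enorm_ne_top
  have h3 := ENNReal.summable_toReal h2
  simpa [ENNReal.toReal_ofReal] using h3

theorem summable_tensor_hermiteCoeff (u : L2xv) : Summable fun n => tensor n (hermiteCoeff n u) :=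
  (summable_tensor_iff _).2 (summable_norm_sq_hermiteCoeff u)

theorem tsum_tensor_hermiteCoeff (u : L2xv) : ∑' n, tensor n (hermiteCoeff n u) = u :=
  hermiteCoeff_ext fun m => hermiteCoeff_tsum_tensor (summable_tensor_hermiteCoeff u) m

theorem hasSum_inner_hermiteCoeff (u w : L2xv) :
    HasSum (fun n => inner ℂ (hermiteCoeff n u) (hermiteCoeff n w)) (inner ℂ u w) := by
  have h := (summable_tensor_hermiteCoeff u).hasSum
  rw [tsum_tensor_hermiteCoeff] at h
  have h2 := h.mapL ((innerSL ℂ).flip w)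
  simpa [inner_tensor] using h2

/-! ### Functional calculus -/

theorem spectralTerm_eq (m : ℕ → ℝ → ℝ) (u : L2xv) (n : ℕ) :
    spectralTerm m u n = tensor n (fourierMul (m n) (hermiteCoeff n u)) := rfl

theorem hermiteCoeff_spectralMul_of_summable {m : ℕ → ℝ → ℝ} {u : L2xv}
    (h : Summable (spectralTerm m u)) (n : ℕ) :
    hermiteCoeff n (spectralMul m u) = fourierMul (m n) (hermiteCoeff n u) :=
  hermiteCoeff_tsum_tensor h n

theorem summable_spectralTerm {m : ℕ → ℝ → ℝ} {B : ℝ} (hm : ∀ n, Measurable (m n))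
    (hB : ∀ n ξ, |m n ξ| ≤ B) (u : L2xv) : Summable (spectralTerm m u) := by
  refine (summable_tensor_iff _).2 ?_
  refine Summable.of_nonneg_of_le (fun n => by positivity) (fun n => ?_)
    ((summable_norm_sq_hermiteCoeff u).mul_left (B ^ 2))
  rw [← mul_pow]
  exact pow_le_pow_left₀ (norm_nonneg _) (norm_fourierMul_le (hm n) (hB n) _) 2

theorem hermiteCoeff_spectralMul {m : ℕ → ℝ → ℝ} {B : ℝ} (hm : ∀ n, Measurable (m n))
    (hB : ∀ n ξ, |m n ξ| ≤ B) (u : L2xv) (n : ℕ) :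
    hermiteCoeff n (spectralMul m u) = fourierMul (m n) (hermiteCoeff n u) :=
  hermiteCoeff_spectralMul_of_summable (summable_spectralTerm hm hB u) n

theorem fourierMul_const (c : ℝ) (w : L2x) : fourierMul (fun _ => c) w = (c : ℂ) • w := by
  refine fourier_injective ?_
  rw [FourierTransform.fourier_smul]
  filter_upwards [fourier_fourierMul (m := fun _ => c) (B := |c|) measurable_const (by simp) w,
    Lp.coeFn_smul (c : ℂ) (𝓕 w : L2x)] with ξ h1 h2
  rw [h1, h2]; rfl

theorem inOscDomain_iff (r : ℝ) (u : L2xv) :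
    InOscDomain r u ↔ Summable fun n : ℕ => (((n : ℝ) + 1 / 2) ^ r * ‖hermiteCoeff n u‖) ^ 2 := by
  unfold InOscDomain
  simp only [spectralTerm_eq]
  rw [summable_tensor_iff]
  refine summable_congr fun n => ?_
  rw [fourierMul_const, norm_smul, Complex.norm_real, Real.norm_of_nonneg (by positivity)]

theorem hermiteCoeff_oscPow {r : ℝ} {u : L2xv} (h : InOscDomain r u) (n : ℕ) :
    hermiteCoeff n (oscPow r u) = (((n : ℝ) + 1 / 2) ^ r : ℝ) • hermiteCoeff n u := by
  have h1 := hermiteCoeff_spectralMul_of_summable h n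
  rw [fourierMul_const] at h1
  exact h1

/-! ### Angular integrals -/

/-- The function equal to `|u|^a` for `|u| ≤ 1` and to `|u|^(-b)` for `|u| > 1`. -/
def twoPow (a b u : ℝ) : ℝ := if |u| ≤ 1 then |u| ^ a else |u| ^ (-b)

theorem twoPow_nonneg (a b u : ℝ) : 0 ≤ twoPow a b u := by
  unfold twoPow; split_ifs <;> positivity

theorem measurable_twoPow (a b : ℝ) : Measurable (twoPow a b) := by
  unfold twoPow
  refine Measurable.ite (measurableSet_le (by fun_prop) measurable_const) ?_ ?_ <;> fun_prop

theorem integrable_twoPow {a b : ℝ} (ha : -1 < a) (hb : 1 < b) : Integrable (twoPow a b) := by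
  have h1 : IntegrableOn (twoPow a b) (Set.Ioc 0 1) := by
    have h := (intervalIntegral.intervalIntegrable_rpow' (a := 0) (b := 1) ha)
    rw [intervalIntegrable_iff_integrableOn_Ioc_of_le zero_le_one] at h
    refine h.congr_fun (fun u hu => ?_) measurableSet_Ioc
    simp only [twoPow, abs_of_pos hu.1, if_pos hu.2]
  have h2 : IntegrableOn (twoPow a b) (Set.Ioi 1) := by
    have h := integrableOn_Ioi_rpow_of_lt (a := -b) (by linarith) zero_lt_one
    refine h.congr_fun (fun u hu => ?_) measurableSet_Ioi
    have hu' : (1 : ℝ) < u := hu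
    have : |u| = u := abs_of_pos (by linarith)
    simp only [twoPow, this, if_neg (not_le.2 hu')]
  have h3 : IntegrableOn (twoPow a b) (Set.Ioi 0) := by
    rw [← Set.Ioc_union_Ioi_eq_Ioi zero_le_one]
    exact h1.union h2
  have h4 : IntegrableOn (twoPow a b) (Set.Iio 0) := by
    have h := (Measure.measurePreserving_neg (volume : Measure ℝ)).integrableOn_comp_preimage
      (MeasurableEquiv.neg ℝ).measurableEmbedding (f := twoPow a b) (s := Set.Ioi 0)
    have e : (fun x : ℝ => -x) ⁻¹' Set.Ioi 0 = Set.Iio 0 := by ext; simp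
    have e2 : twoPow a b ∘ (fun x : ℝ => -x) = twoPow a b := by
      ext u; simp [twoPow]
    have h5 := h.2 h3
    rw [show (Neg.neg : ℝ → ℝ) = fun x => -x from rfl, e, e2] at h5
    exact h5
  have h5 : IntegrableOn (twoPow a b) (Set.Iic 0) := (integrableOn_Iic_iff_integrableOn_Iio).2 h4
  rw [← integrableOn_univ, ← Set.Iic_union_Ioi (a := (0 : ℝ))]
  exact h5.union h3

theorem lintegral_twoPow_comp_mul (a b : ℝ) {r : ℝ} (hr : 0 < r) (ha : -1 < a) (hb : 1 < b) :
    ∫⁻ θ : ℝ, ENNReal.ofReal (r * twoPow a b (r * θ)) = ENNReal.ofReal (∫ u, twoPow a b u) := by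
  rw [← ofReal_integral_eq_lintegral_ofReal
    (((integrable_twoPow ha hb).comp_mul_left' hr.ne').const_mul r)
    (Filter.Eventually.of_forall fun θ => mul_nonneg hr.le (twoPow_nonneg _ _ _)),
    integral_const_mul, Measure.integral_comp_mul_left, smul_eq_mul, abs_of_pos (inv_pos.2 hr),
    mul_inv_cancel_left₀ hr.ne']

/-- The interval of integration in the collision angle. -/
abbrev angles : Set ℝ := Set.Icc (-(Real.pi / 4)) (Real.pi / 4)

theorem abs_le_of_mem_angles {θ : ℝ} (h : θ ∈ angles) : |θ| ≤ Real.pi / 4 := abs_le.2 h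

theorem crossSection_nonneg (s θ : ℝ) : 0 ≤ crossSection s θ := by
  unfold crossSection; positivity

theorem measurable_crossSection (s : ℝ) : Measurable (crossSection s) := by
  unfold crossSection; fun_prop

theorem crossSection_le {s : ℝ} (hs : 0 < s) {θ : ℝ} (h : θ ∈ angles) (h0 : θ ≠ 0) :
    crossSection s θ ≤ Real.pi ^ (1 + 2 * s) * |θ| ^ (-(1 + 2 * s)) := by
  have hθ := abs_le_of_mem_angles h
  have hp := Real.pi_pos
  have h1 : |θ| / Real.pi ≤ |Real.sin (θ / 2)| := by
    have := Real.mul_abs_le_abs_sin (x := θ / 2) (by rw [abs_div, abs_two]; linarith)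
    rw [abs_div, abs_two] at this
    calc |θ| / Real.pi = 2 / Real.pi * (|θ| / 2) := by ring
      _ ≤ _ := this
  have h2 : 0 < |θ| / Real.pi := div_pos (abs_pos.2 h0) hp
  calc crossSection s θ ≤ 1 / (|θ| / Real.pi) ^ (1 + 2 * s) := by
        unfold crossSection
        refine div_le_div₀ zero_le_one (Real.abs_cos_le_one _) (by positivity) ?_
        exact Real.rpow_le_rpow h2.le h1 (by linarith)
    _ = _ := by
        rw [Real.div_rpow (abs_nonneg _) hp.le, Real.rpow_neg (abs_nonneg _)]
        field_simp

theorem cos_ge_of_mem_angles {θ : ℝ} (h : θ ∈ angles) : 0 ≤ Real.cos θ ∧ 1 / 2 ≤ Real.cos θ ^ 2 := by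
  have hp := Real.pi_pos
  have hc : Real.sqrt 2 / 2 ≤ Real.cos θ := by
    rw [← Real.cos_pi_div_four, ← Real.cos_abs θ]
    exact Real.cos_le_cos_of_nonneg_of_le_pi (abs_nonneg _) (by linarith) (abs_le_of_mem_angles h)
  have h2 : 0 ≤ Real.sqrt 2 / 2 := by positivity
  refine ⟨h2.trans hc, ?_⟩
  have := pow_le_pow_left₀ h2 hc 2
  rw [div_pow, Real.sq_sqrt (by norm_num)] at this
  linarith

theorem sin_sq_le (θ : ℝ) : Real.sin θ ^ 2 ≤ θ ^ 2 := by
  rw [← sq_abs (Real.sin θ), ← sq_abs θ]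
  exact pow_le_pow_left₀ (abs_nonneg _) (Real.abs_sin_le_abs) 2

theorem abs_cos_pow_sub_one_le (l : ℕ) {θ : ℝ} (h : θ ∈ angles) :
    |Real.cos θ ^ l - 1| ≤ min 1 (l * θ ^ 2) := by
  obtain ⟨h0, -⟩ := cos_ge_of_mem_angles h
  have h1 : Real.cos θ ^ l ≤ 1 := pow_le_one₀ h0 (Real.cos_le_one θ)
  have h2 : 0 ≤ Real.cos θ ^ l := pow_nonneg h0 l
  rw [abs_sub_comm, abs_of_nonneg (by linarith)]
  refine le_min (by linarith) ?_
  have h3 := one_add_mul_le_pow (a := Real.cos θ - 1) (by linarith) l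
  have h4 := Real.one_sub_sq_div_two_le_cos (x := θ)
  rw [add_sub_cancel] at h3
  have h5 : (l : ℝ) * (1 - Real.cos θ) ≤ l * θ ^ 2 := by
    refine mul_le_mul_of_nonneg_left ?_ (Nat.cast_nonneg l)
    nlinarith [sq_nonneg θ]
  linarith

theorem sin_pow_mul_cos_pow_le {k : ℕ} (hk : 2 ≤ k) (l : ℕ) (θ : ℝ) :
    |Real.sin θ ^ k * Real.cos θ ^ l| ≤ θ ^ 2 := by
  rw [abs_mul, abs_pow, abs_pow]
  calc |Real.sin θ| ^ k * |Real.cos θ| ^ l ≤ |Real.sin θ| ^ 2 * 1 := by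
        refine mul_le_mul ?_ (pow_le_one₀ (abs_nonneg _) (Real.abs_cos_le_one _)) (by positivity)
          (by positivity)
        exact pow_le_pow_of_le_one (abs_nonneg _) (Real.abs_sin_le_one _) hk
    _ ≤ θ ^ 2 := by rw [mul_one, sq_abs]; exact sin_sq_le θ

theorem ae_angles_ne_zero : ∀ᵐ θ ∂(volume.restrict angles), θ ∈ angles ∧ θ ≠ 0 := by
  rw [ae_restrict_iff' measurableSet_Icc]
  have : ∀ᵐ θ : ℝ, θ ≠ 0 := by
    simp [ae_iff]
  filter_upwards [this] with θ h1 h2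
  exact ⟨h2, h1⟩

theorem integrableOn_crossSection_mul_sq {s : ℝ} (hs : 0 < s) (hs' : s < 1) :
    IntegrableOn (fun θ => crossSection s θ * θ ^ 2) angles := by
  have h := ((integrable_twoPow (a := 1 - 2 * s) (b := 2) (by linarith) (by norm_num)).const_mul
    (Real.pi ^ (1 + 2 * s))).integrableOn (s := angles)
  refine h.mono' ((measurable_crossSection s).mul (by fun_prop)).aestronglyMeasurable ?_
  filter_upwards [ae_angles_ne_zero] with θ hθ
  have h1 : |θ| ≤ 1 := (abs_le_of_mem_angles hθ.1).trans (by linarith [Real.pi_lt_four])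
  have h2 : 0 < |θ| := abs_pos.2 hθ.2
  rw [Real.norm_of_nonneg (mul_nonneg (crossSection_nonneg _ _) (sq_nonneg _)), twoPow, if_pos h1]
  calc crossSection s θ * θ ^ 2
      ≤ (Real.pi ^ (1 + 2 * s) * |θ| ^ (-(1 + 2 * s))) * |θ| ^ (2 : ℝ) := by
        rw [Real.rpow_two, sq_abs]
        exact mul_le_mul_of_nonneg_right (crossSection_le hs hθ.1 hθ.2) (sq_nonneg _)
    _ = _ := by
        rw [mul_assoc, ← Real.rpow_add h2]; congr 2; ring

theorem integrableOn_crossSection_mul {s : ℝ} (hs : 0 < s) (hs' : s < 1) {T : ℝ → ℝ}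
    (hT : Measurable T) {c : ℝ} (h : ∀ θ ∈ angles, |T θ| ≤ c * θ ^ 2) :
    IntegrableOn (fun θ => crossSection s θ * T θ) angles := by
  refine ((integrableOn_crossSection_mul_sq hs hs').const_mul c).mono'
    ((measurable_crossSection s).mul hT).aestronglyMeasurable ?_
  filter_upwards [ae_restrict_mem measurableSet_Icc] with θ hθ
  rw [norm_mul, Real.norm_of_nonneg (crossSection_nonneg _ _), Real.norm_eq_abs]
  calc crossSection s θ * |T θ| ≤ crossSection s θ * (c * θ ^ 2) :=
        mul_le_mul_of_nonneg_left (h θ hθ) (crossSection_nonneg _ _)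
    _ = _ := by ring

/-- The trigonometric factor of the coefficients of the collision operator at a fixed angle. -/
def angleFactor (k l : ℕ) (θ : ℝ) : ℝ :=
  if k = 0 then Real.cos θ ^ l - 1
  else if Odd k then 0
  else Real.sqrt ((k + l).choose k) * (Real.sin θ ^ k * Real.cos θ ^ l)

/-- The coefficients `Γ(e_k, e_l) = α_{k,l} e_{k+l}` of the collision operator. -/
def alphaCoeff (s : ℝ) (k l : ℕ) : ℝ := ∫ θ in angles, crossSection s θ * angleFactor k l θ

theorem measurable_angleFactor (k l : ℕ) : Measurable (angleFactor k l) := by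
  unfold angleFactor
  split_ifs <;> fun_prop

theorem two_le_of_not_odd {k : ℕ} (h0 : k ≠ 0) (h1 : ¬ Odd k) : 2 ≤ k := by
  rcases k with _ | _ | k
  · exact absurd rfl h0
  · exact absurd odd_one h1
  · omega

theorem abs_angleFactor_le_aux (k l : ℕ) : ∃ c : ℝ, ∀ θ ∈ angles, |angleFactor k l θ| ≤ c * θ ^ 2 := by
  unfold angleFactor
  split_ifs with h1 h2
  · exact ⟨l, fun θ hθ => (abs_cos_pow_sub_one_le l hθ).trans (min_le_right _ _)⟩
  · exact ⟨0, fun θ _ => by simp⟩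
  · refine ⟨Real.sqrt ((k + l).choose k), fun θ _ => ?_⟩
    rw [abs_mul, abs_of_nonneg (Real.sqrt_nonneg _)]
    exact mul_le_mul_of_nonneg_left (sin_pow_mul_cos_pow_le (two_le_of_not_odd h1 h2) l θ)
      (Real.sqrt_nonneg _)

theorem integrableOn_crossSection_mul_angleFactor {s : ℝ} (hs : 0 < s) (hs' : s < 1) (k l : ℕ) :
    IntegrableOn (fun θ => crossSection s θ * angleFactor k l θ) angles := by
  obtain ⟨c, hc⟩ := abs_angleFactor_le_aux k l
  exact integrableOn_crossSection_mul hs hs' (measurable_angleFactor k l) hc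

/-! ### Binomial tails -/

/-- The probability of at least two successes in `N` Bernoulli trials. -/
theorem binomial_tail_le {p q : ℝ} (hp : 0 ≤ p) (hq : 0 ≤ q) (hpq : p + q = 1) (N : ℕ) :
    ∑ k ∈ (Finset.range (N + 1)).filter (2 ≤ ·), (N.choose k : ℝ) * p ^ k * q ^ (N - k) ≤
      min 1 ((N : ℝ) ^ 2 * p ^ 2) := by
  have hnn : ∀ k, 0 ≤ (N.choose k : ℝ) * p ^ k * q ^ (N - k) := fun k => by positivity
  have htot : ∑ k ∈ Finset.range (N + 1), (N.choose k : ℝ) * p ^ k * q ^ (N - k) = 1 := by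
    have h := add_pow p q N
    rw [hpq, one_pow] at h
    rw [h]
    exact Finset.sum_congr rfl fun k _ => by ring
  refine le_min ?_ ?_
  · rw [← htot]
    exact Finset.sum_le_sum_of_subset_of_nonneg (Finset.filter_subset _ _) fun k _ _ => hnn k
  · rcases N with _ | N
    · simp [Finset.sum_filter]
    have hsplit := Finset.sum_filter_add_sum_filter_not (Finset.range (N + 1 + 1)) (2 ≤ ·)
      (fun k => ((N + 1).choose k : ℝ) * p ^ k * q ^ (N + 1 - k))
    rw [htot] at hsplit
    have hfil : (Finset.range (N + 1 + 1)).filter (fun k => ¬ 2 ≤ k) = {0, 1} := by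
      ext k; simp; omega
    rw [hfil, Finset.sum_pair (by norm_num)] at hsplit
    simp only [Nat.choose_zero_right, Nat.cast_one, pow_zero, Nat.sub_zero, Nat.choose_one_right,
      pow_one, Nat.add_sub_cancel, one_mul, mul_one] at hsplit
    have hp1 : p ≤ 1 := by linarith
    have b1 := one_add_mul_le_pow (a := -p) (by linarith) (N + 1)
    have b2 := one_add_mul_le_pow (a := -p) (by linarith) N
    have hq' : 1 + -p = q := by linarith
    rw [hq'] at b1 b2
    push_cast at b1 hsplit ⊢
    have b3 : ((N : ℝ) + 1) * p * (1 + N * -p) ≤ ((N : ℝ) + 1) * p * q ^ N :=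
      mul_le_mul_of_nonneg_left b2 (by positivity)
    nlinarith [mul_nonneg (Nat.cast_nonneg (α := ℝ) N) (sq_nonneg p), sq_nonneg p]

theorem add_one_mul_choose_div (n k : ℕ) (hk : k ≤ n) :
    (n.choose k : ℝ) * ((n + 1) / ((n - k : ℕ) + 1)) = (n + 1).choose k := by
  have h := Nat.choose_mul_succ_eq n k
  have h2 : n + 1 - k = (n - k) + 1 := by omega
  rw [h2] at h
  have h3 : ((n.choose k : ℝ)) * (n + 1) = (n + 1).choose k * ((n - k : ℕ) + 1) := by exact_mod_cast h
  have h4 : ((n - k : ℕ) : ℝ) + 1 ≠ 0 := by positivity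
  rw [mul_div_assoc', h3]
  field_simp

theorem rpow_neg_half_le {s : ℝ} (hs : 0 < s) (hs' : s < 1) (n l : ℕ) :
    ((l : ℝ) + 1 / 2) ^ (-s) ≤ 2 * ((n : ℝ) + 1) ^ (-s) * (1 + ((n : ℝ) + 1) / (l + 1)) := by
  have hl : (0 : ℝ) < l + 1 := by positivity
  have hn : (0 : ℝ) < n + 1 := by positivity
  have h1 : ((l : ℝ) + 1 / 2) ^ (-s) ≤ 2 * ((l : ℝ) + 1) ^ (-s) := by
    calc ((l : ℝ) + 1 / 2) ^ (-s) ≤ (((l : ℝ) + 1) / 2) ^ (-s) :=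
          Real.rpow_le_rpow_of_nonpos (by positivity) (by linarith [Nat.cast_nonneg (α := ℝ) l])
            (by linarith)
      _ = 2 ^ s * ((l : ℝ) + 1) ^ (-s) := by
          rw [Real.div_rpow hl.le (by norm_num), Real.rpow_neg (by norm_num : (0 : ℝ) ≤ 2)]
          field_simp
      _ ≤ 2 ^ (1 : ℝ) * ((l : ℝ) + 1) ^ (-s) := by
          refine mul_le_mul_of_nonneg_right ?_ (by positivity)
          exact Real.rpow_le_rpow_of_exponent_le (by norm_num) hs'.le
      _ = _ := by rw [Real.rpow_one]
  have h2 : ((l : ℝ) + 1) ^ (-s) = ((n : ℝ) + 1) ^ (-s) * (((n : ℝ) + 1) / (l + 1)) ^ s := by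
    rw [Real.div_rpow hn.le hl.le, Real.rpow_neg hn.le, Real.rpow_neg hl.le]
    have : ((n : ℝ) + 1) ^ s ≠ 0 := by positivity
    field_simp
  have h3 : (((n : ℝ) + 1) / (l + 1)) ^ s ≤ 1 + ((n : ℝ) + 1) / (l + 1) := by
    have hx : 0 ≤ ((n : ℝ) + 1) / (l + 1) := by positivity
    calc (((n : ℝ) + 1) / (l + 1)) ^ s ≤ (1 + ((n : ℝ) + 1) / (l + 1)) ^ s :=
          Real.rpow_le_rpow hx (by linarith) hs.le
      _ ≤ (1 + ((n : ℝ) + 1) / (l + 1)) ^ (1 : ℝ) :=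
          Real.rpow_le_rpow_of_exponent_le (by linarith) hs'.le
      _ = _ := Real.rpow_one _
  calc _ ≤ _ := h1
    _ = 2 * ((n : ℝ) + 1) ^ (-s) * (((n : ℝ) + 1) / (l + 1)) ^ s := by rw [h2]; ring
    _ ≤ _ := mul_le_mul_of_nonneg_left h3 (by positivity)

theorem sum_binomial_rpow_le {s : ℝ} (hs : 0 < s) (hs' : s < 1) {p q : ℝ} (hp : 0 ≤ p)
    (hq : 1 / 2 ≤ q) (hpq : p + q = 1) (n : ℕ) :
    ∑ k ∈ (Finset.range (n + 1)).filter (2 ≤ ·),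
        (n.choose k : ℝ) * p ^ k * q ^ (n - k) * (((n - k : ℕ) : ℝ) + 1 / 2) ^ (-s) ≤
      6 * ((n : ℝ) + 1) ^ (-s) * min 1 (((n : ℝ) + 1) ^ 2 * p ^ 2) := by
  have hq0 : 0 ≤ q := by linarith
  have hterm : ∀ k ∈ (Finset.range (n + 1)).filter (2 ≤ ·),
      (n.choose k : ℝ) * p ^ k * q ^ (n - k) * (((n - k : ℕ) : ℝ) + 1 / 2) ^ (-s) ≤
      2 * ((n : ℝ) + 1) ^ (-s) * ((n.choose k : ℝ) * p ^ k * q ^ (n - k) +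
        2 * (((n + 1).choose k : ℝ) * p ^ k * q ^ (n + 1 - k))) := by
    intro k hk
    have hkn : k ≤ n := by simp at hk; omega
    have e : n + 1 - k = (n - k) + 1 := by omega
    calc _ ≤ (n.choose k : ℝ) * p ^ k * q ^ (n - k) *
          (2 * ((n : ℝ) + 1) ^ (-s) * (1 + ((n : ℝ) + 1) / ((n - k : ℕ) + 1))) :=
          mul_le_mul_of_nonneg_left (rpow_neg_half_le hs hs' n (n - k)) (by positivity)
      _ = 2 * ((n : ℝ) + 1) ^ (-s) * ((n.choose k : ℝ) * p ^ k * q ^ (n - k) +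
        (n.choose k : ℝ) * (((n : ℝ) + 1) / ((n - k : ℕ) + 1)) * p ^ k * q ^ (n - k)) := by ring
      _ = 2 * ((n : ℝ) + 1) ^ (-s) * ((n.choose k : ℝ) * p ^ k * q ^ (n - k) +
        1 * (((n + 1).choose k : ℝ) * p ^ k * q ^ (n - k))) := by
          rw [add_one_mul_choose_div n k hkn]; ring
      _ ≤ _ := by
          rw [e, pow_succ]
          refine mul_le_mul_of_nonneg_left ?_ (by positivity)
          have h0 : 0 ≤ ((n + 1).choose k : ℝ) * p ^ k * q ^ (n - k) := by positivity
          nlinarith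
  refine (Finset.sum_le_sum hterm).trans ?_
  rw [← Finset.mul_sum, Finset.sum_add_distrib, ← Finset.mul_sum]
  have t1 := binomial_tail_le hp hq0 hpq n
  have t2 : ∑ k ∈ (Finset.range (n + 1)).filter (2 ≤ ·),
      ((n + 1).choose k : ℝ) * p ^ k * q ^ (n + 1 - k) ≤ min 1 (((n : ℝ) + 1) ^ 2 * p ^ 2) := by
    have h := binomial_tail_le hp hq0 hpq (n + 1)
    push_cast at h
    refine le_trans (Finset.sum_le_sum_of_subset_of_nonneg ?_ fun k _ _ => by positivity) h
    intro k hk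
    simp at hk ⊢
    omega
  have t3 : min 1 ((n : ℝ) ^ 2 * p ^ 2) ≤ min 1 (((n : ℝ) + 1) ^ 2 * p ^ 2) := by
    refine min_le_min le_rfl (mul_le_mul_of_nonneg_right ?_ (sq_nonneg p))
    exact pow_le_pow_left₀ (Nat.cast_nonneg n) (by linarith) 2
  have hpos : 0 ≤ ((n : ℝ) + 1) ^ (-s) := by positivity
  calc _ ≤ 2 * ((n : ℝ) + 1) ^ (-s) * (min 1 (((n : ℝ) + 1) ^ 2 * p ^ 2) +
        2 * min 1 (((n : ℝ) + 1) ^ 2 * p ^ 2)) :=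
        mul_le_mul_of_nonneg_left (by linarith) (by positivity)
    _ = _ := by ring

/-! ### Bounds of the coefficients of the collision operator -/

theorem lintegral_mul_sq_le_weighted {α : Type} [MeasurableSpace α] {μ : Measure α}
    {X Z : α → ℝ≥0∞} (hX : AEMeasurable X μ) (hZ : AEMeasurable Z μ) :
    (∫⁻ x, X x * Z x ∂μ) ^ 2 ≤ (∫⁻ x, X x ∂μ) * ∫⁻ x, X x * Z x ^ 2 ∂μ := by
  have hh : ∀ x, X x ^ (1 / 2 : ℝ) * X x ^ (1 / 2 : ℝ) = X x := fun x => by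
    rw [← ENNReal.rpow_add_of_nonneg _ _ (by norm_num) (by norm_num)]; norm_num
  have h := ENNReal.lintegral_mul_le_Lp_mul_Lq μ Real.HolderConjugate.two_two
    (hX.pow_const (1 / 2 : ℝ)) ((hX.pow_const (1 / 2 : ℝ)).mul hZ)
  have e1 : ∀ x, X x ^ (1 / 2 : ℝ) * (X x ^ (1 / 2 : ℝ) * Z x) = X x * Z x := fun x => by
    rw [← mul_assoc, hh]
  have e2 : ∀ x, (X x ^ (1 / 2 : ℝ)) ^ (2 : ℝ) = X x := fun x => by
    rw [← ENNReal.rpow_mul]; norm_num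
  have e3 : ∀ x, (X x ^ (1 / 2 : ℝ) * Z x) ^ (2 : ℝ) = X x * Z x ^ 2 := fun x => by
    rw [ENNReal.mul_rpow_of_nonneg _ _ (by norm_num), e2, ENNReal.rpow_two]
  simp only [Pi.mul_apply, e1, e2, e3] at h
  refine (pow_le_pow_left₀ (by positivity) h 2).trans (le_of_eq ?_)
  rw [mul_pow]
  simp only [← ENNReal.rpow_natCast, ← ENNReal.rpow_mul]
  norm_num

theorem enorm_setIntegral_crossSection_le {s : ℝ} (hs : 0 < s) {T X : ℝ → ℝ}
    (h : ∀ θ ∈ angles, θ ≠ 0 → |θ| ^ (-(1 + 2 * s)) * |T θ| ≤ X θ) :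
    ‖∫ θ in angles, crossSection s θ * T θ‖ₑ ≤
      ENNReal.ofReal (Real.pi ^ (1 + 2 * s)) * ∫⁻ θ in angles, ENNReal.ofReal (X θ) := by
  refine (enorm_integral_le_lintegral_enorm _).trans ?_
  rw [← lintegral_const_mul' _ _ ENNReal.ofReal_ne_top]
  refine lintegral_mono_ae ?_
  filter_upwards [ae_angles_ne_zero] with θ hθ
  rw [← ENNReal.ofReal_mul (by positivity), ← ofReal_norm]
  refine ENNReal.ofReal_le_ofReal ?_
  rw [norm_mul, Real.norm_of_nonneg (crossSection_nonneg _ _), Real.norm_eq_abs]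
  calc crossSection s θ * |T θ|
      ≤ Real.pi ^ (1 + 2 * s) * |θ| ^ (-(1 + 2 * s)) * |T θ| :=
        mul_le_mul_of_nonneg_right (crossSection_le hs hθ.1 hθ.2) (abs_nonneg _)
    _ ≤ _ := by
        rw [mul_assoc]
        exact mul_le_mul_of_nonneg_left (h θ hθ.1 hθ.2) (by positivity)

theorem exists_alphaCoeff_zero_le {s : ℝ} (hs : 0 < s) (hs' : s < 1) :
    ∃ C : ℝ, 0 ≤ C ∧ ∀ l : ℕ, |alphaCoeff s 0 l| ≤ C * ((l : ℝ) + 1 / 2) ^ s := by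
  set J : ℝ := ∫ u, twoPow (1 - 2 * s) (1 + 2 * s) u with hJ
  have hJ0 : 0 ≤ J := integral_nonneg fun u => twoPow_nonneg _ _ _
  refine ⟨Real.pi ^ (1 + 2 * s) * (2 * J), by positivity, fun l => ?_⟩
  set L : ℝ := (l : ℝ) + 1 / 2 with hL
  have hLpos : 0 < L := by positivity
  set r : ℝ := Real.sqrt L with hr
  have hr0 : 0 < r := Real.sqrt_pos.2 hLpos
  have hr2 : r ^ 2 = L := Real.sq_sqrt hLpos.le
  have hrs : r ^ (2 * s) = L ^ s := by
    rw [Real.rpow_mul hr0.le, Real.rpow_two, hr2]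
  have key := enorm_setIntegral_crossSection_le hs (T := angleFactor 0 l)
    (X := fun θ => 2 * r ^ (2 * s) * (r * twoPow (1 - 2 * s) (1 + 2 * s) (r * θ)))
    (by
      intro θ hθ h0
      have hθ0 : 0 < |θ| := abs_pos.2 h0
      have hru : 0 < r * |θ| := mul_pos hr0 hθ0
      have h1 : |angleFactor 0 l θ| ≤ min 1 ((r * |θ|) ^ 2) := by
        refine (abs_cos_pow_sub_one_le l hθ).trans (min_le_min le_rfl ?_)
        rw [mul_pow, hr2, sq_abs]
        exact mul_le_mul_of_nonneg_right (by rw [hL]; linarith) (sq_nonneg _)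
      have e0 : |θ| ^ (-(1 + 2 * s)) = r ^ (2 * s) * r * (r * |θ|) ^ (-(1 + 2 * s)) := by
        rw [Real.mul_rpow hr0.le hθ0.le]
        have : r ^ (2 * s) * r * r ^ (-(1 + 2 * s)) = 1 := by
          nth_rewrite 2 [← Real.rpow_one r]
          rw [← Real.rpow_add hr0, ← Real.rpow_add hr0]
          ring_nf
          exact Real.rpow_zero r
        rw [← mul_assoc, this, one_mul]
      have e1 : (r * |θ|) ^ (-(1 + 2 * s)) * min 1 ((r * |θ|) ^ 2) ≤
          twoPow (1 - 2 * s) (1 + 2 * s) (r * θ) := by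
        rw [twoPow, abs_mul, abs_of_pos hr0]
        split_ifs with hu
        · calc _ ≤ (r * |θ|) ^ (-(1 + 2 * s)) * (r * |θ|) ^ (2 : ℝ) := by
                rw [Real.rpow_two]
                exact mul_le_mul_of_nonneg_left (min_le_right _ _) (by positivity)
            _ = _ := by rw [← Real.rpow_add hru]; congr 1; ring
        · calc _ ≤ (r * |θ|) ^ (-(1 + 2 * s)) * 1 :=
                mul_le_mul_of_nonneg_left (min_le_left _ _) (by positivity)
            _ = _ := by rw [mul_one]
      calc |θ| ^ (-(1 + 2 * s)) * |angleFactor 0 l θ|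
          ≤ r ^ (2 * s) * r * (r * |θ|) ^ (-(1 + 2 * s)) * min 1 ((r * |θ|) ^ 2) := by
            rw [e0]
            exact mul_le_mul_of_nonneg_left h1 (by positivity)
        _ = r ^ (2 * s) * r * ((r * |θ|) ^ (-(1 + 2 * s)) * min 1 ((r * |θ|) ^ 2)) := by ring
        _ ≤ r ^ (2 * s) * r * twoPow (1 - 2 * s) (1 + 2 * s) (r * θ) :=
            mul_le_mul_of_nonneg_left e1 (by positivity)
        _ ≤ _ := by
            have := mul_nonneg (by positivity : 0 ≤ r ^ (2 * s) * r)
              (twoPow_nonneg (1 - 2 * s) (1 + 2 * s) (r * θ))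
            linarith)
  have h2 : ∫⁻ θ in angles, ENNReal.ofReal
      (2 * r ^ (2 * s) * (r * twoPow (1 - 2 * s) (1 + 2 * s) (r * θ))) ≤
      ENNReal.ofReal (2 * r ^ (2 * s) * J) := by
    refine (setLIntegral_le_lintegral _ _).trans ?_
    simp only [ENNReal.ofReal_mul (by positivity : 0 ≤ 2 * r ^ (2 * s))]
    rw [lintegral_const_mul' _ _ ENNReal.ofReal_ne_top,
      lintegral_twoPow_comp_mul _ _ hr0 (by linarith) (by linarith)]
  have h3 : ‖alphaCoeff s 0 l‖ₑ ≤
      ENNReal.ofReal (Real.pi ^ (1 + 2 * s) * (2 * r ^ (2 * s) * J)) := by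
    rw [ENNReal.ofReal_mul (by positivity)]
    exact key.trans (by gcongr)
  rw [← ofReal_norm, ENNReal.ofReal_le_ofReal_iff (by positivity), Real.norm_eq_abs, hrs] at h3
  linarith

theorem angle_weight_aux {r s δ t : ℝ} (hr : 0 < r) (ht : 0 < t) :
    r * twoPow (δ - 1) (1 + δ) (r * t) * (r ^ (2 * s) * twoPow (-2 * s - δ) (2 * s - δ) (r * t)) =
      t ^ (-(1 + 2 * s)) := by
  have hru : 0 < r * t := mul_pos hr ht
  have hrr : r * r ^ (2 * s) = (r ^ (-(1 + 2 * s)))⁻¹ := by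
    rw [← Real.rpow_neg hr.le, neg_neg, Real.rpow_add hr, Real.rpow_one]
  have e : ∀ a b : ℝ, a + b = -(1 + 2 * s) →
      r * (r * t) ^ a * (r ^ (2 * s) * (r * t) ^ b) = t ^ (-(1 + 2 * s)) := by
    intro a b hab
    calc _ = (r * r ^ (2 * s)) * ((r * t) ^ a * (r * t) ^ b) := by ring
      _ = _ := by
        rw [← Real.rpow_add hru, hab, Real.mul_rpow hr.le ht.le, hrr, inv_mul_cancel_left₀]
        positivity
  unfold twoPow
  rw [abs_of_pos hru]
  split_ifs
  · exact e _ _ (by ring)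
  · exact e _ _ (by ring)

theorem angle_weight_aux' {r s δ t : ℝ} (hr : 0 < r) (ht : 0 < t) :
    r * twoPow (δ - 1) (1 + δ) (r * t) * (r ^ (2 * s) * twoPow (-2 * s - δ) (2 * s - δ) (r * t)) ^ 2 *
      min 1 ((r * t) ^ 4) ≤
      r ^ (4 * s) * (r * twoPow (3 - 4 * s - δ) (1 + 4 * s - δ) (r * t)) := by
  have hru : 0 < r * t := mul_pos hr ht
  have hrr : (r ^ (2 * s)) ^ 2 = r ^ (4 * s) := by
    rw [← Real.rpow_mul_natCast hr.le]; congr 1; push_cast; ring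
  have hsq : ∀ b : ℝ, ((r * t) ^ b) ^ 2 = (r * t) ^ (2 * b) := fun b => by
    rw [← Real.rpow_mul_natCast hru.le]; congr 1; push_cast; ring
  have e : ∀ a b : ℝ, r * (r * t) ^ a * (r ^ (2 * s) * (r * t) ^ b) ^ 2 =
      r ^ (4 * s) * (r * (r * t) ^ (a + 2 * b)) := by
    intro a b
    rw [mul_pow, hrr, hsq, Real.rpow_add hru]
    ring
  unfold twoPow
  rw [abs_of_pos hru]
  split_ifs
  · rw [e]
    calc _ ≤ r ^ (4 * s) * (r * (r * t) ^ (δ - 1 + 2 * (-2 * s - δ))) * (r * t) ^ (4 : ℝ) := by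
          refine mul_le_mul_of_nonneg_left ?_ (by positivity)
          exact_mod_cast min_le_right _ _
      _ = r ^ (4 * s) * (r * ((r * t) ^ (δ - 1 + 2 * (-2 * s - δ)) * (r * t) ^ (4 : ℝ))) := by ring
      _ = _ := by rw [← Real.rpow_add hru]; congr 3; ring
  · rw [e]
    calc _ ≤ r ^ (4 * s) * (r * (r * t) ^ (-(1 + δ) + 2 * (-(2 * s - δ)))) * 1 :=
          mul_le_mul_of_nonneg_left (min_le_left _ _) (by positivity)
      _ = _ := by rw [mul_one]; congr 3; ring

theorem twoPow_abs (a b u : ℝ) : twoPow a b |u| = twoPow a b u := by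
  simp [twoPow]

theorem exists_sum_alphaCoeff_sq_le {s : ℝ} (hs : 0 < s) (hs' : s < 1) :
    ∃ C : ℝ, 0 ≤ C ∧ ∀ n : ℕ, ∑ k ∈ (Finset.range (n + 1)).filter (2 ≤ ·),
      alphaCoeff s k (n - k) ^ 2 * (((n - k : ℕ) : ℝ) + 1 / 2) ^ (-s) ≤ C * ((n : ℝ) + 1) ^ s := by
  set δ : ℝ := 2 * s * (1 - s) with hδ
  have hδ0 : 0 < δ := by have : 0 < 1 - s := by linarith
                         positivity
  have hδ1 : δ < 4 * s := by nlinarith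
  have hδ2 : 4 * s + δ < 4 := by nlinarith
  set J1 : ℝ := ∫ u, twoPow (δ - 1) (1 + δ) u with hJ1
  set J2 : ℝ := ∫ u, twoPow (3 - 4 * s - δ) (1 + 4 * s - δ) u with hJ2
  have hJ10 : 0 ≤ J1 := integral_nonneg fun u => twoPow_nonneg _ _ _
  have hJ20 : 0 ≤ J2 := integral_nonneg fun u => twoPow_nonneg _ _ _
  set P : ℝ := Real.pi ^ (1 + 2 * s) with hP
  have hP0 : 0 ≤ P := by positivity
  refine ⟨6 * P ^ 2 * J1 * J2, by positivity, fun n => ?_⟩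
  set r : ℝ := Real.sqrt ((n : ℝ) + 1) with hr
  have hn1 : (0 : ℝ) < n + 1 := by positivity
  have hr0 : 0 < r := Real.sqrt_pos.2 hn1
  have hr2 : r ^ 2 = (n : ℝ) + 1 := Real.sq_sqrt hn1.le
  have hr4 : r ^ (4 * s) = ((n : ℝ) + 1) ^ s * ((n : ℝ) + 1) ^ s := by
    rw [show 4 * s = 2 * (s + s) by ring, Real.rpow_mul hr0.le, Real.rpow_two, hr2, Real.rpow_add hn1]
  set X : ℝ → ℝ := fun θ => r * twoPow (δ - 1) (1 + δ) (r * θ) with hX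
  set Y : ℝ → ℝ := fun θ => r ^ (2 * s) * twoPow (-2 * s - δ) (2 * s - δ) (r * θ) with hY
  have hX0 : ∀ θ, 0 ≤ X θ := fun θ => mul_nonneg hr0.le (twoPow_nonneg _ _ _)
  have hY0 : ∀ θ, 0 ≤ Y θ := fun θ => mul_nonneg (by positivity) (twoPow_nonneg _ _ _)
  have hXm : Measurable X := by
    have := measurable_twoPow (δ - 1) (1 + δ); rw [hX]; fun_prop
  have hYm : Measurable Y := by
    have := measurable_twoPow (-2 * s - δ) (2 * s - δ); rw [hY]; fun_prop
  set w : ℕ → ℝ := fun k => (((n - k : ℕ) : ℝ) + 1 / 2) ^ (-s) with hw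
  have hw0 : ∀ k, 0 ≤ w k := fun k => by positivity
  set T : ℕ → ℝ → ℝ := fun k θ =>
    Real.sqrt (n.choose k) * (|Real.sin θ| ^ k * |Real.cos θ| ^ (n - k)) with hT
  have hT0 : ∀ k θ, 0 ≤ T k θ := fun k θ => by positivity
  have hTm : ∀ k, Measurable (T k) := fun k => by rw [hT]; fun_prop
  have habs : ∀ k ∈ (Finset.range (n + 1)).filter (2 ≤ ·), ∀ θ,
      |angleFactor k (n - k) θ| ≤ T k θ := by
    intro k hk θ
    have hkn : k ≤ n ∧ 2 ≤ k := by simp at hk; omega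
    have e : k + (n - k) = n := by omega
    unfold angleFactor
    rw [if_neg (by omega), e]
    split_ifs
    · simpa using hT0 k θ
    · rw [abs_mul, abs_mul, abs_pow, abs_pow, abs_of_nonneg (Real.sqrt_nonneg _)]
  have hα : ∀ k ∈ (Finset.range (n + 1)).filter (2 ≤ ·),
      ENNReal.ofReal (alphaCoeff s k (n - k) ^ 2) ≤ ENNReal.ofReal (P ^ 2 * J1) *
        ∫⁻ θ in angles, ENNReal.ofReal (X θ * (Y θ * T k θ) ^ 2) := by
    intro k hk
    have h1 := enorm_setIntegral_crossSection_le hs (T := angleFactor k (n - k))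
      (X := fun θ => X θ * (Y θ * T k θ))
      (by
        intro θ hθ h0
        have e := angle_weight_aux (s := s) (δ := δ) hr0 (abs_pos.2 h0)
        rw [← e, ← twoPow_abs _ _ (r * |θ|), abs_mul, abs_abs, ← abs_mul, twoPow_abs,
          ← twoPow_abs _ _ (r * |θ|), abs_mul, abs_abs, ← abs_mul, twoPow_abs]
        calc _ ≤ X θ * Y θ * T k θ :=
              mul_le_mul_of_nonneg_left (habs k hk θ) (mul_nonneg (hX0 θ) (hY0 θ))
          _ = _ := by ring)
    have h2 : (∫⁻ θ in angles, ENNReal.ofReal (X θ * (Y θ * T k θ))) ^ 2 ≤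
        ENNReal.ofReal J1 * ∫⁻ θ in angles, ENNReal.ofReal (X θ * (Y θ * T k θ) ^ 2) := by
      simp only [ENNReal.ofReal_mul (hX0 _),
        ENNReal.ofReal_pow (mul_nonneg (hY0 _) (hT0 k _))]
      refine (lintegral_mul_sq_le_weighted hXm.ennreal_ofReal.aemeasurable
        (hYm.mul (hTm k)).ennreal_ofReal.aemeasurable).trans ?_
      refine mul_le_mul_left ?_ _
      exact (setLIntegral_le_lintegral _ _).trans
        (lintegral_twoPow_comp_mul _ _ hr0 (by linarith) (by linarith)).le
    calc ENNReal.ofReal (alphaCoeff s k (n - k) ^ 2) = ‖alphaCoeff s k (n - k)‖ₑ ^ 2 := by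
          rw [← ofReal_norm, ← ENNReal.ofReal_pow (norm_nonneg _), Real.norm_eq_abs, sq_abs]
      _ ≤ (ENNReal.ofReal P * ∫⁻ θ in angles, ENNReal.ofReal (X θ * (Y θ * T k θ))) ^ 2 :=
          pow_le_pow_left₀ (by positivity) h1 2
      _ ≤ _ := by
          rw [mul_pow, ← ENNReal.ofReal_pow hP0, ENNReal.ofReal_mul (by positivity), mul_assoc]
          exact mul_le_mul_right h2 _
  have hsum : ∀ θ ∈ angles, θ ≠ 0 → ∑ k ∈ (Finset.range (n + 1)).filter (2 ≤ ·),
      X θ * (Y θ * T k θ) ^ 2 * w k ≤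
      6 * ((n : ℝ) + 1) ^ (-s) * (r ^ (4 * s) *
        (r * twoPow (3 - 4 * s - δ) (1 + 4 * s - δ) (r * θ))) := by
    intro θ hθ h0
    have hb := sum_binomial_rpow_le hs hs' (p := Real.sin θ ^ 2) (q := Real.cos θ ^ 2) (sq_nonneg _)
      (cos_ge_of_mem_angles hθ).2 (Real.sin_sq_add_cos_sq θ) n
    have e1 : ∀ k, X θ * (Y θ * T k θ) ^ 2 * w k = X θ * Y θ ^ 2 * ((n.choose k : ℝ) *
        (Real.sin θ ^ 2) ^ k * (Real.cos θ ^ 2) ^ (n - k) * w k) := by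
      intro k
      have h1 : Real.sqrt (n.choose k) ^ 2 = n.choose k := Real.sq_sqrt (Nat.cast_nonneg _)
      have h2 : T k θ ^ 2 = (n.choose k : ℝ) * (Real.sin θ ^ 2) ^ k * (Real.cos θ ^ 2) ^ (n - k) := by
        rw [hT]
        simp only
        rw [mul_pow, h1, mul_pow, ← pow_mul, ← pow_mul, mul_comm k, mul_comm (n - k), pow_mul,
          pow_mul, sq_abs, sq_abs]
        ring
      rw [mul_pow, h2]; ring
    have h3 : min 1 (((n : ℝ) + 1) ^ 2 * (Real.sin θ ^ 2) ^ 2) ≤ min 1 ((r * |θ|) ^ 4) := by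
      refine min_le_min le_rfl ?_
      have : (r * |θ|) ^ 4 = ((n : ℝ) + 1) ^ 2 * (θ ^ 2) ^ 2 := by
        rw [← hr2, ← sq_abs θ]; ring
      rw [this]
      exact mul_le_mul_of_nonneg_left (pow_le_pow_left₀ (sq_nonneg _) (sin_sq_le θ) 2)
        (by positivity)
    have h4 := angle_weight_aux' (s := s) (δ := δ) hr0 (abs_pos.2 h0)
    have e2 : ∀ a b : ℝ, twoPow a b (r * |θ|) = twoPow a b (r * θ) := fun a b => by
      rw [← twoPow_abs a b (r * |θ|), abs_mul, abs_abs, ← abs_mul, twoPow_abs]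
    simp only [e2] at h4
    simp only [e1]
    rw [← Finset.mul_sum]
    calc _ ≤ X θ * Y θ ^ 2 * (6 * ((n : ℝ) + 1) ^ (-s) * min 1 ((r * |θ|) ^ 4)) := by
          refine mul_le_mul_of_nonneg_left (hb.trans ?_) (mul_nonneg (hX0 θ) (sq_nonneg _))
          exact mul_le_mul_of_nonneg_left h3 (by positivity)
      _ = 6 * ((n : ℝ) + 1) ^ (-s) * (X θ * Y θ ^ 2 * min 1 ((r * |θ|) ^ 4)) := by ring
      _ ≤ _ := mul_le_mul_of_nonneg_left h4 (by positivity)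
  have hm : ∀ k, Measurable fun θ => X θ * (Y θ * T k θ) ^ 2 * w k := fun k =>
    (hXm.mul ((hYm.mul (hTm k)).pow_const 2)).mul_const _
  have hfin : ENNReal.ofReal (∑ k ∈ (Finset.range (n + 1)).filter (2 ≤ ·),
      alphaCoeff s k (n - k) ^ 2 * w k) ≤
      ENNReal.ofReal (P ^ 2 * J1 * (6 * ((n : ℝ) + 1) ^ (-s) * (r ^ (4 * s) * J2))) := by
    rw [ENNReal.ofReal_sum_of_nonneg fun k _ => mul_nonneg (sq_nonneg _) (hw0 k)]
    calc _ ≤ ∑ k ∈ (Finset.range (n + 1)).filter (2 ≤ ·), ENNReal.ofReal (P ^ 2 * J1) *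
          ∫⁻ θ in angles, ENNReal.ofReal (X θ * (Y θ * T k θ) ^ 2 * w k) := by
          refine Finset.sum_le_sum fun k hk => ?_
          have e : ∀ θ, ENNReal.ofReal (X θ * (Y θ * T k θ) ^ 2 * w k) =
              ENNReal.ofReal (X θ * (Y θ * T k θ) ^ 2) * ENNReal.ofReal (w k) := fun θ =>
            ENNReal.ofReal_mul (mul_nonneg (hX0 θ) (sq_nonneg _))
          simp only [e]
          rw [ENNReal.ofReal_mul (sq_nonneg _), lintegral_mul_const' _ _ ENNReal.ofReal_ne_top,
            ← mul_assoc]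
          exact mul_le_mul_left (hα k hk) _
      _ = ENNReal.ofReal (P ^ 2 * J1) * ∫⁻ θ in angles,
          ENNReal.ofReal (∑ k ∈ (Finset.range (n + 1)).filter (2 ≤ ·),
            X θ * (Y θ * T k θ) ^ 2 * w k) := by
          rw [← Finset.mul_sum, ← lintegral_finsetSum _ fun k _ => (hm k).ennreal_ofReal]
          congr 2
          ext θ
          rw [ENNReal.ofReal_sum_of_nonneg fun k _ =>
            mul_nonneg (mul_nonneg (hX0 θ) (sq_nonneg _)) (hw0 k)]
      _ ≤ ENNReal.ofReal (P ^ 2 * J1) * ∫⁻ θ in angles, ENNReal.ofReal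
          (6 * ((n : ℝ) + 1) ^ (-s) * (r ^ (4 * s) *
            (r * twoPow (3 - 4 * s - δ) (1 + 4 * s - δ) (r * θ)))) := by
          refine mul_le_mul_right ?_ _
          refine lintegral_mono_ae ?_
          filter_upwards [ae_angles_ne_zero] with θ hθ
          exact ENNReal.ofReal_le_ofReal (hsum θ hθ.1 hθ.2)
      _ ≤ _ := by
          rw [ENNReal.ofReal_mul (by positivity : 0 ≤ P ^ 2 * J1)]
          refine mul_le_mul_right ((setLIntegral_le_lintegral _ _).trans (le_of_eq ?_)) _
          simp only [← mul_assoc (6 * ((n : ℝ) + 1) ^ (-s)) (r ^ (4 * s))]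
          simp only [ENNReal.ofReal_mul (by positivity : 0 ≤ 6 * ((n : ℝ) + 1) ^ (-s) * r ^ (4 * s))]
          rw [lintegral_const_mul' _ _ ENNReal.ofReal_ne_top,
            lintegral_twoPow_comp_mul _ _ hr0 (by linarith) (by linarith)]
  rw [ENNReal.ofReal_le_ofReal_iff (by positivity), hr4, Real.rpow_neg hn1.le] at hfin
  refine hfin.trans (le_of_eq ?_)
  have : ((n : ℝ) + 1) ^ s ≠ 0 := by positivity
  field_simp

/-! ### The trilinear bound of the coefficients -/

/-- The coefficients `β_{k,l}` define a bounded trilinear form on `ℓ²`. -/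
def TrilinearBound (β : ℕ → ℕ → ℝ) (K : ℝ) : Prop :=
  ∀ (N : ℕ) (A B C : ℕ → ℝ), (∀ n, 0 ≤ A n) → (∀ n, 0 ≤ B n) → (∀ n, 0 ≤ C n) →
    ∑ k ∈ Finset.range N, ∑ l ∈ Finset.range N, |β k l| * (A k * B l * C (k + l)) ≤
      K * (Real.sqrt (∑ k ∈ Finset.range N, A k ^ 2) * Real.sqrt (∑ l ∈ Finset.range N, B l ^ 2) *
        Real.sqrt (∑ n ∈ Finset.range (2 * N), C n ^ 2))

theorem TrilinearBound.swap {β : ℕ → ℕ → ℝ} {K : ℝ} (h : TrilinearBound β K) :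
    TrilinearBound (fun k l => β l k) K := by
  intro N A B C hA hB hC
  rw [Finset.sum_comm]
  have := h N B A C hB hA hC
  refine (le_of_eq ?_).trans (this.trans (le_of_eq ?_))
  · refine Finset.sum_congr rfl fun k _ => Finset.sum_congr rfl fun l _ => ?_
    rw [add_comm l k]; ring
  · ring

/-- The coefficients of the collision operator relative to the weights of `𝓗^{s/2}`. -/
def betaCoeff (s : ℝ) (k l : ℕ) : ℝ :=
  alphaCoeff s k l * (((l : ℝ) + 1 / 2) ^ (-(s / 2)) * (((k + l : ℕ) : ℝ) + 1 / 2) ^ (-(s / 2)))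

theorem sum_range_prod_le {N : ℕ} {f : ℕ × ℕ → ℝ} (hf : ∀ x, 0 ≤ f x) :
    ∑ k ∈ Finset.range N, ∑ l ∈ Finset.range N, f (k, l) ≤
      ∑ n ∈ Finset.range (2 * N), ∑ k ∈ Finset.range (n + 1), f (k, n - k) := by
  rw [← Finset.sum_product' (Finset.range N) (Finset.range N) fun k l => f (k, l)]
  have hmaps : ∀ x ∈ Finset.range N ×ˢ Finset.range N, x.1 + x.2 ∈ Finset.range (2 * N) := by
    intro x hx; simp at hx ⊢; omega
  rw [← Finset.sum_fiberwise_of_maps_to hmaps]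
  refine Finset.sum_le_sum fun n _ => ?_
  have e : ∑ k ∈ Finset.range (n + 1), f (k, n - k) =
      ∑ x ∈ (Finset.range (n + 1)).image (fun k => (k, n - k)), f x := by
    rw [Finset.sum_image]
    intro a _ b _ hab
    exact (Prod.mk.inj hab).1
  rw [e]
  refine Finset.sum_le_sum_of_subset_of_nonneg ?_ fun x _ _ => hf x
  intro x hx
  simp only [Finset.mem_filter, Finset.mem_product, Finset.mem_range, Finset.mem_image] at hx ⊢
  exact ⟨x.1, by omega, by ext <;> simp; omega⟩

theorem alphaCoeff_one (s : ℝ) (l : ℕ) : alphaCoeff s 1 l = 0 := by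
  simp [alphaCoeff, angleFactor]

theorem exists_trilinearBound_betaCoeff {s : ℝ} (hs : 0 < s) (hs' : s < 1) :
    ∃ K : ℝ, 0 ≤ K ∧ TrilinearBound (betaCoeff s) K := by
  obtain ⟨C0, hC0, h0⟩ := exists_alphaCoeff_zero_le hs hs'
  obtain ⟨C1, hC1, h1⟩ := exists_sum_alphaCoeff_sq_le hs hs'
  have hb0 : ∀ l, |betaCoeff s 0 l| ≤ C0 := by
    intro l
    have hp : (0 : ℝ) < (l : ℝ) + 1 / 2 := by positivity
    unfold betaCoeff
    rw [zero_add, ← Real.rpow_add hp, abs_mul, abs_of_nonneg (Real.rpow_nonneg hp.le _)]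
    refine (mul_le_mul_of_nonneg_right (h0 l) (by positivity)).trans (le_of_eq ?_)
    rw [mul_assoc, ← Real.rpow_add hp]
    ring_nf
    rw [Real.rpow_zero, mul_one]
  have hb1 : ∀ n : ℕ, ∑ k ∈ Finset.range (n + 1),
      (if k = 0 then 0 else betaCoeff s k (n - k) ^ 2) ≤ 2 * C1 := by
    intro n
    have hn : (0 : ℝ) < (n : ℝ) + 1 / 2 := by positivity
    have e : ∑ k ∈ Finset.range (n + 1), (if k = 0 then 0 else betaCoeff s k (n - k) ^ 2) =
        (∑ k ∈ (Finset.range (n + 1)).filter (2 ≤ ·),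
          alphaCoeff s k (n - k) ^ 2 * (((n - k : ℕ) : ℝ) + 1 / 2) ^ (-s)) *
          ((n : ℝ) + 1 / 2) ^ (-s) := by
      rw [Finset.sum_filter, Finset.sum_mul]
      refine Finset.sum_congr rfl fun k hk => ?_
      have hk' : k + (n - k) = n := by simp at hk; omega
      rcases k with _ | _ | k
      · simp
      · simp [betaCoeff, alphaCoeff_one]
      · rw [if_neg (by omega), if_pos (by omega), betaCoeff, hk', mul_pow, mul_pow,
          ← Real.rpow_mul_natCast (by positivity), ← Real.rpow_mul_natCast (by positivity)]
        rw [show -(s / 2) * ((2 : ℕ) : ℝ) = -s by push_cast; ring]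
        ring
    rw [e]
    have h2 : ((n : ℝ) + 1) ^ s ≤ 2 * ((n : ℝ) + 1 / 2) ^ s := by
      calc ((n : ℝ) + 1) ^ s ≤ (2 * ((n : ℝ) + 1 / 2)) ^ s :=
            Real.rpow_le_rpow (by positivity) (by linarith [Nat.cast_nonneg (α := ℝ) n]) hs.le
        _ = 2 ^ s * ((n : ℝ) + 1 / 2) ^ s := Real.mul_rpow (by norm_num) hn.le
        _ ≤ 2 ^ (1 : ℝ) * ((n : ℝ) + 1 / 2) ^ s := mul_le_mul_of_nonneg_right
            (Real.rpow_le_rpow_of_exponent_le (by norm_num) hs'.le) (by positivity)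
        _ = _ := by rw [Real.rpow_one]
    calc _ ≤ (C1 * (2 * ((n : ℝ) + 1 / 2) ^ s)) * ((n : ℝ) + 1 / 2) ^ (-s) :=
          mul_le_mul_of_nonneg_right ((h1 n).trans (mul_le_mul_of_nonneg_left h2 hC1))
            (by positivity)
      _ = _ := by
          rw [Real.rpow_neg hn.le]
          have : ((n : ℝ) + 1 / 2) ^ s ≠ 0 := by positivity
          field_simp
  refine ⟨C0 + Real.sqrt (2 * C1), by positivity, ?_⟩
  intro N A B C hA hB hC
  rcases N with _ | N
  · simp
  set nA := Real.sqrt (∑ k ∈ Finset.range (N + 1), A k ^ 2) with hnA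
  set nB := Real.sqrt (∑ k ∈ Finset.range (N + 1), B k ^ 2) with hnB
  set nC := Real.sqrt (∑ k ∈ Finset.range (2 * (N + 1)), C k ^ 2) with hnC
  set b' : ℕ → ℕ → ℝ := fun k l => if k = 0 then 0 else |betaCoeff s k l| with hb'
  have hsplit : ∑ k ∈ Finset.range (N + 1), ∑ l ∈ Finset.range (N + 1),
      |betaCoeff s k l| * (A k * B l * C (k + l)) =
      (∑ l ∈ Finset.range (N + 1), |betaCoeff s 0 l| * (A 0 * B l * C l)) +
      ∑ k ∈ Finset.range (N + 1), ∑ l ∈ Finset.range (N + 1), b' k l * (A k * B l * C (k + l)) := by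
    have e : ∀ k, ∑ l ∈ Finset.range (N + 1), |betaCoeff s k l| * (A k * B l * C (k + l)) =
        (if k = 0 then ∑ l ∈ Finset.range (N + 1), |betaCoeff s 0 l| * (A 0 * B l * C l) else 0) +
        ∑ l ∈ Finset.range (N + 1), b' k l * (A k * B l * C (k + l)) := by
      intro k
      rcases k with _ | k
      · simp [hb']
      · simp [hb']
    rw [Finset.sum_congr rfl fun k _ => e k, Finset.sum_add_distrib, Finset.sum_ite_eq']
    simp
  have hA0 : A 0 ≤ nA := by
    rw [hnA]
    refine Real.le_sqrt_of_sq_le ?_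
    exact Finset.single_le_sum (f := fun k => A k ^ 2) (fun k _ => sq_nonneg _) (by simp)
  have hBC : ∑ l ∈ Finset.range (N + 1), B l * C l ≤ nB * nC := by
    refine (Real.sum_mul_le_sqrt_mul_sqrt _ _ _).trans ?_
    refine mul_le_mul_of_nonneg_left (Real.sqrt_le_sqrt ?_) (Real.sqrt_nonneg _)
    refine Finset.sum_le_sum_of_subset_of_nonneg ?_ fun k _ _ => sq_nonneg _
    intro k hk; simp at hk ⊢; omega
  have hfirst : ∑ l ∈ Finset.range (N + 1), |betaCoeff s 0 l| * (A 0 * B l * C l) ≤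
      C0 * (nA * nB * nC) := by
    calc _ ≤ ∑ l ∈ Finset.range (N + 1), C0 * (A 0 * (B l * C l)) := by
          refine Finset.sum_le_sum fun l _ => ?_
          rw [mul_assoc (A 0)]
          exact mul_le_mul_of_nonneg_right (hb0 l)
            (mul_nonneg (hA 0) (mul_nonneg (hB l) (hC l)))
      _ = C0 * (A 0 * ∑ l ∈ Finset.range (N + 1), B l * C l) := by
          rw [← Finset.mul_sum, ← Finset.mul_sum]
      _ ≤ C0 * (nA * (nB * nC)) := by
          refine mul_le_mul_of_nonneg_left ?_ hC0
          exact mul_le_mul hA0 hBC (Finset.sum_nonneg fun l _ => mul_nonneg (hB l) (hC l))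
            (Real.sqrt_nonneg _)
      _ = _ := by ring
  have hsecond : ∑ k ∈ Finset.range (N + 1), ∑ l ∈ Finset.range (N + 1),
      b' k l * (A k * B l * C (k + l)) ≤ Real.sqrt (2 * C1) * (nA * nB * nC) := by
    have e1 : ∑ k ∈ Finset.range (N + 1), ∑ l ∈ Finset.range (N + 1),
        b' k l * (A k * B l * C (k + l)) =
        ∑ x ∈ Finset.range (N + 1) ×ˢ Finset.range (N + 1),
          (A x.1 * B x.2) * (b' x.1 x.2 * C (x.1 + x.2)) := by
      rw [Finset.sum_product]
      refine Finset.sum_congr rfl fun k _ => Finset.sum_congr rfl fun l _ => by ring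
    rw [e1]
    refine (Real.sum_mul_le_sqrt_mul_sqrt _ _ _).trans ?_
    have e2 : ∑ x ∈ Finset.range (N + 1) ×ˢ Finset.range (N + 1), (A x.1 * B x.2) ^ 2 =
        (∑ k ∈ Finset.range (N + 1), A k ^ 2) * ∑ k ∈ Finset.range (N + 1), B k ^ 2 := by
      rw [Finset.sum_mul_sum, Finset.sum_product]
      refine Finset.sum_congr rfl fun k _ => Finset.sum_congr rfl fun l _ => by ring
    have e3 : ∑ x ∈ Finset.range (N + 1) ×ˢ Finset.range (N + 1),
        (b' x.1 x.2 * C (x.1 + x.2)) ^ 2 ≤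
        2 * C1 * ∑ n ∈ Finset.range (2 * (N + 1)), C n ^ 2 := by
      rw [Finset.sum_product]
      refine (sum_range_prod_le (f := fun x => (b' x.1 x.2 * C (x.1 + x.2)) ^ 2)
        fun x => sq_nonneg _).trans ?_
      rw [Finset.mul_sum]
      refine Finset.sum_le_sum fun n _ => ?_
      have : ∑ k ∈ Finset.range (n + 1), (b' k (n - k) * C (k + (n - k))) ^ 2 =
          (∑ k ∈ Finset.range (n + 1), (if k = 0 then 0 else betaCoeff s k (n - k) ^ 2)) *
            C n ^ 2 := by
        rw [Finset.sum_mul]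
        refine Finset.sum_congr rfl fun k hk => ?_
        have hk' : k + (n - k) = n := by simp at hk; omega
        rw [hk', mul_pow, hb']
        simp only
        split_ifs <;> simp
      rw [this]
      exact mul_le_mul_of_nonneg_right (hb1 n) (sq_nonneg _)
    rw [e2, Real.sqrt_mul (Finset.sum_nonneg fun k _ => sq_nonneg _), ← hnA, ← hnB]
    calc _ ≤ nA * nB * (Real.sqrt (2 * C1) * nC) := by
          refine mul_le_mul_of_nonneg_left ?_ (by positivity)
          rw [hnC, ← Real.sqrt_mul (by positivity)]
          exact Real.sqrt_le_sqrt e3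
      _ = _ := by ring
  rw [hsplit]
  linarith

/-! ### The Hermite coefficients of the collision operator -/

/-- The rotation `(v, v_*) ↦ (v', v_*')`. -/
def rot (θ : ℝ) (z : ℝ × ℝ) : ℝ × ℝ :=
  (z.1 * Real.cos θ - z.2 * Real.sin θ, z.1 * Real.sin θ + z.2 * Real.cos θ)

theorem continuous_rot (θ : ℝ) : Continuous (rot θ) := by
  unfold rot; fun_prop

theorem measurePreserving_rot (θ : ℝ) : MeasurePreserving (rot θ) volume volume := by
  refine ⟨(continuous_rot θ).measurable, ?_⟩
  have e : rot θ = Matrix.toLin (Module.Basis.finTwoProd ℝ) (Module.Basis.finTwoProd ℝ)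
      !![Real.cos θ, -Real.sin θ; Real.sin θ, Real.cos θ] := by
    ext z <;> simp [rot, Matrix.toLin_finTwoProd_apply] <;> ring
  have hd : LinearMap.det (Matrix.toLin (Module.Basis.finTwoProd ℝ) (Module.Basis.finTwoProd ℝ)
      !![Real.cos θ, -Real.sin θ; Real.sin θ, Real.cos θ]) = 1 := by
    rw [LinearMap.det_toLin, Matrix.det_fin_two_of]
    have := Real.sin_sq_add_cos_sq θ
    nlinarith
  rw [e, Measure.map_linearMap_addHaar_eq_smul_addHaar _ (by rw [hd]; norm_num), hd]
  simp

theorem hermiteFun_neg (n : ℕ) (v : ℝ) : hermiteFun n (-v) = (-1) ^ n * hermiteFun n v := by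
  rw [hermiteFun_eq, hermiteFun_eq, hermiteVal_neg]
  ring_nf

theorem memLp_evenPart {a : ℝ → ℂ} (ha : MemLp a 2) : MemLp (evenPart a) 2 := by
  have h := ha.comp_measurePreserving (Measure.measurePreserving_neg (volume : Measure ℝ))
  have h2 := (ha.add h).const_mul (1 / 2 : ℂ)
  refine (memLp_congr_ae (Filter.Eventually.of_forall fun v => ?_)).1 h2
  simp [evenPart]
  ring

theorem integral_evenPart_mul {a : ℝ → ℂ} (ha : MemLp a 2) (k : ℕ) :
    ∫ v, evenPart a v * (hermiteFun k v : ℂ) =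
      if Odd k then 0 else ∫ v, a v * (hermiteFun k v : ℂ) := by
  have i1 : Integrable fun v => a v * (hermiteFun k v : ℂ) :=
    MemLp.integrable_mul (q := 2) ha (memLp_hermiteFun_ofReal k)
  have i2 : Integrable fun v => a (-v) * (hermiteFun k v : ℂ) :=
    MemLp.integrable_mul (q := 2)
      (ha.comp_measurePreserving (Measure.measurePreserving_neg (volume : Measure ℝ)))
      (memLp_hermiteFun_ofReal k)
  have e : ∫ v, a (-v) * (hermiteFun k v : ℂ) = (-1) ^ k * ∫ v, a v * (hermiteFun k v : ℂ) := by
    rw [← integral_neg_eq_self, ← integral_const_mul]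
    refine integral_congr_ae (Filter.Eventually.of_forall fun v => ?_)
    simp only [neg_neg, hermiteFun_neg]
    push_cast
    ring
  have e2 : ∀ v, evenPart a v * (hermiteFun k v : ℂ) =
      (1 / 2 : ℂ) * (a v * (hermiteFun k v : ℂ) + a (-v) * (hermiteFun k v : ℂ)) := fun v => by
    unfold evenPart; ring
  simp only [e2]
  rw [integral_const_mul, integral_add i1 i2, e]
  split_ifs with hk
  · rw [hk.neg_one_pow]; ring
  · rw [(Nat.not_odd_iff_even.1 hk).neg_one_pow]; ring

/-- The product `ă(v_*') b(v')` of the gain term. -/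
def gain (a b : ℝ → ℂ) (θ : ℝ) (z : ℝ × ℝ) : ℂ := evenPart a (rot θ z).2 * b (rot θ z).1

theorem memLp_gain {a b : ℝ → ℂ} (ha : MemLp a 2) (hb : MemLp b 2) (θ : ℝ) :
    MemLp (gain a b θ) 2 volume := by
  have h := (memLp_tensor hb (memLp_evenPart ha)).comp_measurePreserving (measurePreserving_rot θ)
  refine (memLp_congr_ae (Filter.Eventually.of_forall fun z => ?_)).1 h
  simp [gain, mul_comm]

theorem hermiteFun_tensor_rot (n : ℕ) (θ : ℝ) (z : ℝ × ℝ) :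
    hermiteFun n z.1 * hermiteFun 0 z.2 =
      ∑ p ∈ Finset.HasAntidiagonal.antidiagonal n,
        Real.sqrt (n.choose p.1) * Real.sin θ ^ p.1 * Real.cos θ ^ p.2 *
          (hermiteFun p.1 (rot θ z).2 * hermiteFun p.2 (rot θ z).1) := by
  have h := Real.sin_sq_add_cos_sq θ
  have e1 : z.1 = Real.cos θ * (rot θ z).1 + Real.sin θ * (rot θ z).2 := by
    simp only [rot]; linear_combination -z.1 * h
  have e2 : z.1 ^ 2 + z.2 ^ 2 = (rot θ z).1 ^ 2 + (rot θ z).2 ^ 2 := by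
    simp only [rot]; linear_combination -(z.1 ^ 2 + z.2 ^ 2) * h
  rw [hermiteFun_eq_mul, hermiteFun_zero, mul_right_comm, sqrt_maxwellian_rotate e2]
  nth_rewrite 1 [e1]
  rw [hermiteNorm_rotate (by linarith), Finset.mul_sum]
  refine Finset.sum_congr rfl fun p _ => ?_
  rw [hermiteFun_eq_mul, hermiteFun_eq_mul]
  ring

theorem integral_gain_mul {a b : ℝ → ℂ} (ha : MemLp a 2) (hb : MemLp b 2) (θ : ℝ) (n : ℕ) :
    ∫ z : ℝ × ℝ, gain a b θ z * ((hermiteFun n z.1 : ℂ) * (hermiteFun 0 z.2 : ℂ)) =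
      ∑ p ∈ Finset.HasAntidiagonal.antidiagonal n,
        ((Real.sqrt (n.choose p.1) * Real.sin θ ^ p.1 * Real.cos θ ^ p.2 : ℝ) : ℂ) *
          ((∫ v, evenPart a v * (hermiteFun p.1 v : ℂ)) * ∫ v, b v * (hermiteFun p.2 v : ℂ)) := by
  set T : ℝ × ℝ → ℂ := fun y => ∑ p ∈ Finset.HasAntidiagonal.antidiagonal n,
        ((Real.sqrt (n.choose p.1) * Real.sin θ ^ p.1 * Real.cos θ ^ p.2 : ℝ) : ℂ) *
          ((b y.1 * (hermiteFun p.2 y.1 : ℂ)) * (evenPart a y.2 * (hermiteFun p.1 y.2 : ℂ))) with hT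
  have hi : ∀ p : ℕ × ℕ, Integrable (fun y : ℝ × ℝ => (b y.1 * (hermiteFun p.2 y.1 : ℂ)) *
      (evenPart a y.2 * (hermiteFun p.1 y.2 : ℂ))) volume := fun p =>
    Integrable.mul_prod (f := fun v => b v * (hermiteFun p.2 v : ℂ))
      (MemLp.integrable_mul (q := 2) hb (memLp_hermiteFun_ofReal _))
      (MemLp.integrable_mul (q := 2) (memLp_evenPart ha) (memLp_hermiteFun_ofReal _))
  have e : ∀ z, gain a b θ z * ((hermiteFun n z.1 : ℂ) * (hermiteFun 0 z.2 : ℂ)) = T (rot θ z) := by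
    intro z
    rw [← Complex.ofReal_mul, hermiteFun_tensor_rot n θ z, hT, Complex.ofReal_sum, Finset.mul_sum]
    refine Finset.sum_congr rfl fun p _ => ?_
    rw [gain]
    push_cast
    ring
  have hTi : Integrable T volume := integrable_finsetSum _ fun p _ => (hi p).const_mul _
  simp only [e]
  have hmap : ∫ z, T (rot θ z) = ∫ y, T y := by
    have h := integral_map (φ := rot θ) (μ := volume) (f := T) (continuous_rot θ).measurable.aemeasurable
      (by rw [(measurePreserving_rot θ).map_eq]; exact hTi.aestronglyMeasurable)
    rw [(measurePreserving_rot θ).map_eq] at h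
    exact h.symm
  rw [hmap, hT, integral_finsetSum _ fun p _ => (hi p).const_mul _]
  refine Finset.sum_congr rfl fun p _ => ?_
  rw [integral_const_mul]
  congr 1
  rw [mul_comm]
  exact integral_prod_mul (μ := volume) (ν := volume) (fun v => b v * (hermiteFun p.2 v : ℂ))
    fun v => evenPart a v * (hermiteFun p.1 v : ℂ)

/-- The angular collision term divided by the square root of the Maxwellian. -/
def angularTerm (a b : ℝ → ℂ) (θ v : ℝ) : ℂ :=
  (∫ w, gain a b θ (v, w) * (hermiteFun 0 w : ℂ)) - (∫ w, a w * (hermiteFun 0 w : ℂ)) * b v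

theorem inv_mul_angular_eq {a b : ℝ → ℂ} (ha : MemLp a 2) {θ v : ℝ}
    (hg : MemLp (fun w => gain a b θ (v, w)) 2) :
    ((Real.sqrt (maxwellian v))⁻¹ : ℂ) *
      angular (fun w => (Real.sqrt (maxwellian w) : ℂ) * a w)
        (fun w => (Real.sqrt (maxwellian w) : ℂ) * b w) θ v = angularTerm a b θ v := by
  have hne : (Real.sqrt (maxwellian v) : ℂ) ≠ 0 := by
    exact_mod_cast (sqrt_maxwellian_pos v).ne'
  have heven : ∀ w, evenPart (fun w => (Real.sqrt (maxwellian w) : ℂ) * a w) w =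
      (Real.sqrt (maxwellian w) : ℂ) * evenPart a w := by
    intro w
    have : maxwellian (-w) = maxwellian w := by simp [maxwellian]
    simp only [evenPart, this]
    ring
  have e : ∀ w, evenPart (fun w => (Real.sqrt (maxwellian w) : ℂ) * a w)
        (v * Real.sin θ + w * Real.cos θ) *
        ((Real.sqrt (maxwellian (v * Real.cos θ - w * Real.sin θ)) : ℂ) *
          b (v * Real.cos θ - w * Real.sin θ)) -
      evenPart (fun w => (Real.sqrt (maxwellian w) : ℂ) * a w) w *
        ((Real.sqrt (maxwellian v) : ℂ) * b v) =
      (Real.sqrt (maxwellian v) : ℂ) * (gain a b θ (v, w) * (hermiteFun 0 w : ℂ) -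
        evenPart a w * (hermiteFun 0 w : ℂ) * b v) := by
    intro w
    have h := Real.sin_sq_add_cos_sq θ
    have h2 := sqrt_maxwellian_rotate (v := v) (w := w) (v' := v * Real.cos θ - w * Real.sin θ)
      (w' := v * Real.sin θ + w * Real.cos θ) (by linear_combination -(v ^ 2 + w ^ 2) * h)
    have h3 : (Real.sqrt (maxwellian v) : ℂ) * (Real.sqrt (maxwellian w) : ℂ) =
      (Real.sqrt (maxwellian (v * Real.cos θ - w * Real.sin θ)) : ℂ) *
      (Real.sqrt (maxwellian (v * Real.sin θ + w * Real.cos θ)) : ℂ) := by exact_mod_cast h2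
    rw [heven, heven, hermiteFun_zero]
    simp only [gain, rot]
    linear_combination -evenPart a (v * Real.sin θ + w * Real.cos θ) *
      b (v * Real.cos θ - w * Real.sin θ) * h3
  unfold angular angularTerm
  simp only [e]
  have i1 : Integrable fun w => gain a b θ (v, w) * (hermiteFun 0 w : ℂ) :=
    MemLp.integrable_mul (q := 2) hg (memLp_hermiteFun_ofReal 0)
  have i2 : Integrable fun w => evenPart a w * (hermiteFun 0 w : ℂ) * b v :=
    (MemLp.integrable_mul (q := 2) (memLp_evenPart ha) (memLp_hermiteFun_ofReal 0)).mul_const _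
  rw [integral_const_mul, ← mul_assoc, inv_mul_cancel₀ hne, one_mul, integral_sub i1 i2,
    integral_mul_const, integral_evenPart_mul ha 0]
  simp

theorem ae_memLp_slice_of_memLp {f : ℝ × ℝ → ℂ} (hf : MemLp f 2 volume) :
    ∀ᵐ v : ℝ, MemLp (fun w => f (v, w)) 2 := by
  filter_upwards [ae_memLp_slice (toL2 f), ae_slice_eq (coeFn_toL2 hf)] with v h1 h2
  exact (memLp_congr_ae h2).1 h1

theorem memLp_slice_integral {f : ℝ × ℝ → ℂ} (hf : MemLp f 2 volume) {w : ℝ → ℂ} (hw : MemLp w 2) :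
    MemLp (fun x : ℝ => ∫ v : ℝ, f (x, v) * w v) 2 := by
  refine (memLp_congr_ae ?_).1 (memLp_integral_mul (toL2 f) hw)
  filter_upwards [ae_slice_eq (coeFn_toL2 hf)] with x hx
  refine integral_congr_ae ?_
  filter_upwards [hx] with v hv
  rw [hv]

theorem memLp_angularTerm {a b : ℝ → ℂ} (ha : MemLp a 2) (hb : MemLp b 2) (θ : ℝ) :
    MemLp (angularTerm a b θ) 2 :=
  (memLp_slice_integral (memLp_gain ha hb θ) (memLp_hermiteFun_ofReal 0)).sub (hb.const_mul _)

theorem integral_angularTerm_mul {a b : ℝ → ℂ} (ha : MemLp a 2) (hb : MemLp b 2) (θ : ℝ) (n : ℕ) :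
    ∫ v, angularTerm a b θ v * (hermiteFun n v : ℂ) =
      ∑ p ∈ Finset.HasAntidiagonal.antidiagonal n, (angleFactor p.1 p.2 θ : ℂ) *
        ((∫ v, a v * (hermiteFun p.1 v : ℂ)) * ∫ v, b v * (hermiteFun p.2 v : ℂ)) := by
  have i1 : Integrable fun v => (∫ w, gain a b θ (v, w) * (hermiteFun 0 w : ℂ)) *
      (hermiteFun n v : ℂ) :=
    MemLp.integrable_mul (q := 2)
      (memLp_slice_integral (memLp_gain ha hb θ) (memLp_hermiteFun_ofReal 0))
      (memLp_hermiteFun_ofReal n)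
  have i2 : Integrable fun v => (∫ w, a w * (hermiteFun 0 w : ℂ)) * (b v * (hermiteFun n v : ℂ)) :=
    (MemLp.integrable_mul (q := 2) hb (memLp_hermiteFun_ofReal n)).const_mul _
  have i3 : Integrable (fun z : ℝ × ℝ => gain a b θ z *
      ((hermiteFun n z.1 : ℂ) * (hermiteFun 0 z.2 : ℂ))) volume :=
    MemLp.integrable_mul (q := 2) (memLp_gain ha hb θ)
      (memLp_tensor (memLp_hermiteFun_ofReal n) (memLp_hermiteFun_ofReal 0))
  have e1 : ∫ v, (∫ w, gain a b θ (v, w) * (hermiteFun 0 w : ℂ)) * (hermiteFun n v : ℂ) =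
      ∫ z : ℝ × ℝ, gain a b θ z * ((hermiteFun n z.1 : ℂ) * (hermiteFun 0 z.2 : ℂ)) := by
    rw [integral_plane i3]
    refine integral_congr_ae (Filter.Eventually.of_forall fun v => ?_)
    simp only
    rw [← integral_mul_const]
    refine integral_congr_ae (Filter.Eventually.of_forall fun w => ?_)
    simp only
    ring
  have e2 : ∀ v, angularTerm a b θ v * (hermiteFun n v : ℂ) =
      (∫ w, gain a b θ (v, w) * (hermiteFun 0 w : ℂ)) * (hermiteFun n v : ℂ) -
      (∫ w, a w * (hermiteFun 0 w : ℂ)) * (b v * (hermiteFun n v : ℂ)) := fun v => by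
    unfold angularTerm; ring
  simp only [e2]
  rw [integral_sub i1 i2, e1, integral_gain_mul ha hb, integral_const_mul]
  have hmem : ((0, n) : ℕ × ℕ) ∈ Finset.HasAntidiagonal.antidiagonal n := by
    rw [Finset.HasAntidiagonal.mem_antidiagonal]; simp
  rw [← Finset.add_sum_erase _ _ hmem, ← Finset.add_sum_erase _ (fun p : ℕ × ℕ =>
    (angleFactor p.1 p.2 θ : ℂ) * _) hmem, add_sub_right_comm]
  congr 1
  · simp [angleFactor, integral_evenPart_mul ha]
    ring
  · refine Finset.sum_congr rfl fun p hp => ?_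
    rw [Finset.mem_erase, Finset.HasAntidiagonal.mem_antidiagonal] at hp
    have h0 : p.1 ≠ 0 := by
      intro h0
      apply hp.1
      ext
      · exact h0
      · simpa [h0] using hp.2
    rw [angleFactor, if_neg h0, integral_evenPart_mul ha, hp.2]
    split_ifs
    · simp
    · push_cast; ring

theorem gammaCoeff_eq {s : ℝ} (hs : 0 < s) (hs' : s < 1) {f g : ℝ × ℝ → ℂ} {x : ℝ}
    (hf : MemLp (fun v => f (x, v)) 2) (hg : MemLp (fun v => g (x, v)) 2) (n : ℕ) :
    gammaCoeff s n f g x = ∑ p ∈ Finset.HasAntidiagonal.antidiagonal n,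
      (alphaCoeff s p.1 p.2 : ℂ) * ((∫ v, f (x, v) * (hermiteFun p.1 v : ℂ)) *
        ∫ v, g (x, v) * (hermiteFun p.2 v : ℂ)) := by
  have e : ∀ θ, ∫ v : ℝ, ((Real.sqrt (maxwellian v))⁻¹ : ℂ) *
      angular (weighted f x) (weighted g x) θ v * (hermiteFun n v : ℂ) =
      ∑ p ∈ Finset.HasAntidiagonal.antidiagonal n, (angleFactor p.1 p.2 θ : ℂ) *
        ((∫ v, f (x, v) * (hermiteFun p.1 v : ℂ)) * ∫ v, g (x, v) * (hermiteFun p.2 v : ℂ)) := by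
    intro θ
    rw [← integral_angularTerm_mul hf hg]
    refine integral_congr_ae ?_
    filter_upwards [ae_memLp_slice_of_memLp (memLp_gain hf hg θ)] with v hv
    rw [← inv_mul_angular_eq hf hv]
    rfl
  have hi : ∀ p : ℕ × ℕ, IntegrableOn (fun θ =>
      ((crossSection s θ * angleFactor p.1 p.2 θ : ℝ) : ℂ) *
        ((∫ v, f (x, v) * (hermiteFun p.1 v : ℂ)) * ∫ v, g (x, v) * (hermiteFun p.2 v : ℂ)))
      angles := fun p =>
    (Integrable.ofReal (integrableOn_crossSection_mul_angleFactor hs hs' p.1 p.2)).mul_const _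
  unfold gammaCoeff
  have e2 : ∀ θ, (crossSection s θ : ℂ) * ∫ v : ℝ, ((Real.sqrt (maxwellian v))⁻¹ : ℂ) *
      angular (weighted f x) (weighted g x) θ v * (hermiteFun n v : ℂ) =
      ∑ p ∈ Finset.HasAntidiagonal.antidiagonal n,
        ((crossSection s θ * angleFactor p.1 p.2 θ : ℝ) : ℂ) *
        ((∫ v, f (x, v) * (hermiteFun p.1 v : ℂ)) * ∫ v, g (x, v) * (hermiteFun p.2 v : ℂ)) := by
    intro θ
    rw [e, Finset.mul_sum]
    refine Finset.sum_congr rfl fun p _ => ?_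
    push_cast
    ring
  simp only [e2]
  rw [integral_finsetSum _ fun p _ => hi p]
  refine Finset.sum_congr rfl fun p _ => ?_
  rw [integral_mul_const, integral_complex_ofReal]
  rfl

/-! ### Trilinear integrals in frequency -/

theorem norm_fourierInv_L2 (b : L2x) : ‖(𝓕⁻ b : L2x)‖ = ‖b‖ := by
  have h := Lp.norm_fourier_eq (𝓕⁻ b : L2x)
  rwa [FourierTransform.fourier_fourierInv_eq, eq_comm] at h

theorem inner_fourierInv_L2 (b c : L2x) : inner ℂ (𝓕⁻ b : L2x) (𝓕⁻ c : L2x) = inner ℂ b c := by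
  have h := Lp.inner_fourier_eq (𝓕⁻ b : L2x) (𝓕⁻ c : L2x)
  rwa [FourierTransform.fourier_fourierInv_eq, FourierTransform.fourier_fourierInv_eq,
    eq_comm] at h

theorem continuous_fourierInv_L2 : Continuous fun b : L2x => (𝓕⁻ b : L2x) :=
  (Lp.fourierTransformₗᵢ ℝ ℂ).symm.continuous

theorem memLp_translate {c : ℝ → ℂ} (hc : MemLp c 2) (η : ℝ) : MemLp (fun ζ => c (η + ζ)) 2 :=
  hc.comp_measurePreserving (measurePreserving_add_left volume η)

/-- The inverse Fourier transform turns translations into modulations. -/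
theorem fourierInv_translate (b : ℝ → ℂ) (η x : ℝ) :
    𝓕⁻ (fun ζ => b (ζ - η)) x = (Real.fourierChar (x * η) : ℂ) * 𝓕⁻ b x := by
  rw [Real.fourierInv_eq', Real.fourierInv_eq', ← integral_const_mul,
    ← integral_add_right_eq_self _ η]
  refine integral_congr_ae (Filter.Eventually.of_forall fun ζ => ?_)
  simp only [add_sub_cancel_right, smul_eq_mul, Real.fourierChar_apply]
  rw [← mul_assoc, ← Complex.exp_add]
  congr 2
  simp
  ring

theorem fourierInv_mul_conj (b c : L2x) (η : ℝ) :
    𝓕⁻ (fun x => (𝓕⁻ b : L2x) x * (starRingEnd ℂ) ((𝓕⁻ c : L2x) x)) η =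
      ∫ ζ, b ζ * (starRingEnd ℂ) (c (η + ζ)) := by
  have hch : Continuous fun x : ℝ => (starRingEnd ℂ) (Real.fourierChar (x * η) : ℂ) := by
    have : Continuous fun x : ℝ => (Real.fourierChar (x * η) : ℂ) := by fun_prop
    exact Complex.continuous_conj.comp this
  have hmod : MemLp (fun x => (starRingEnd ℂ) (Real.fourierChar (x * η) : ℂ) * (𝓕⁻ c : L2x) x) 2 := by
    refine MemLp.of_le (Lp.memLp (𝓕⁻ c : L2x))
      (hch.aestronglyMeasurable.mul (Lp.aestronglyMeasurable _))
      (Filter.Eventually.of_forall fun x => ?_)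
    rw [norm_mul, RCLike.norm_conj, Circle.norm_coe, one_mul]
  have htr : MemLp (fun ζ => c (η + ζ)) 2 := memLp_translate (Lp.memLp c) η
  have e1 : ∀ b : L2x, 𝓕⁻ (fun x => (𝓕⁻ b : L2x) x * (starRingEnd ℂ) ((𝓕⁻ c : L2x) x)) η =
      inner ℂ (toL2 fun x => (starRingEnd ℂ) (Real.fourierChar (x * η) : ℂ) * (𝓕⁻ c : L2x) x)
        (𝓕⁻ b : L2x) := by
    intro b
    rw [← toL2_coeFn (𝓕⁻ b : L2x), inner_toL2 hmod (Lp.memLp _), Real.fourierInv_eq', toL2_coeFn]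
    refine integral_congr_ae (Filter.Eventually.of_forall fun x => ?_)
    simp only [smul_eq_mul, map_mul, Complex.conj_conj, Real.fourierChar_apply]
    have : Complex.exp (((2 * Real.pi * inner ℝ x η : ℝ) : ℂ) * Complex.I) =
        Complex.exp (((2 * Real.pi * (x * η) : ℝ) : ℂ) * Complex.I) := by
      congr 3; simp; ring
    rw [this]
    ring
  have e2 : ∀ b : L2x, ∫ ζ, b ζ * (starRingEnd ℂ) (c (η + ζ)) =
      inner ℂ (toL2 fun ζ => c (η + ζ)) b := by
    intro b
    nth_rewrite 2 [← toL2_coeFn b]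
    rw [inner_toL2 htr (Lp.memLp _)]
  rw [e1, e2]
  have key : ∀ b0 : ℝ → ℂ, Integrable b0 → MemLp b0 2 →
      inner ℂ (toL2 fun x => (starRingEnd ℂ) (Real.fourierChar (x * η) : ℂ) * (𝓕⁻ c : L2x) x)
        (𝓕⁻ (toL2 b0) : L2x) = inner ℂ (toL2 fun ζ => c (η + ζ)) (toL2 b0) := by
    intro b0 h1 h2
    have mp := measurePreserving_sub_right (volume : Measure ℝ) η
    have h1' : Integrable (fun ζ => b0 (ζ - η)) := mp.integrable_comp_of_integrable h1
    have h2' : MemLp (fun ζ => b0 (ζ - η)) 2 := h2.comp_measurePreserving mp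
    have e3 : inner ℂ (𝓕⁻ c : L2x) (𝓕⁻ (toL2 fun ζ => b0 (ζ - η)) : L2x) =
        inner ℂ c (toL2 fun ζ => b0 (ζ - η)) := inner_fourierInv_L2 _ _
    have e4 : inner ℂ c (toL2 fun ζ => b0 (ζ - η)) =
        inner ℂ (toL2 fun ζ => c (η + ζ)) (toL2 b0) := by
      nth_rewrite 1 [← toL2_coeFn c]
      rw [inner_toL2 (Lp.memLp c) h2', inner_toL2 htr h2, ← integral_add_left_eq_self _ η]
      simp
    rw [← e4, ← e3]
    nth_rewrite 2 [← toL2_coeFn (𝓕⁻ c : L2x)]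
    nth_rewrite 1 [← toL2_coeFn (𝓕⁻ (toL2 b0) : L2x)]
    nth_rewrite 1 [← toL2_coeFn (𝓕⁻ (toL2 fun ζ => b0 (ζ - η)) : L2x)]
    rw [inner_toL2 hmod (Lp.memLp _), inner_toL2 (Lp.memLp _) (Lp.memLp _)]
    refine integral_congr_ae ?_
    filter_upwards [fourierInv_toL2 h1 h2, fourierInv_toL2 h1' h2'] with x hx hx'
    rw [hx, hx', fourierInv_translate, map_mul, Complex.conj_conj]
    ring
  revert b
  refine Lp.induction (by norm_num) _ ?_ ?_ ?_
  · intro z S hS hμ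
    have hi : Integrable (S.indicator fun _ : ℝ => z) :=
      (integrable_indicator_iff hS).2 (integrableOn_const hμ.ne)
    have hm : MemLp (S.indicator fun _ : ℝ => z) 2 volume := memLp_indicator_const 2 hS z (Or.inr hμ.ne)
    have : ((Lp.simpleFunc.indicatorConst 2 hS hμ.ne z : Lp.simpleFunc ℂ 2 volume) : L2x) =
        toL2 (S.indicator fun _ : ℝ => z) := by
      rw [Lp.simpleFunc.coe_indicatorConst]
      exact eq_toL2 indicatorConstLp_coeFn
    rw [this]
    exact key _ hi hm
  · intro f g hf hg _ h1 h2
    rw [FourierTransform.fourierInv_add, inner_add_right, inner_add_right, h1, h2]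
  · exact isClosed_eq (continuous_const.inner continuous_fourierInv_L2)
      (continuous_const.inner continuous_id)

theorem integrable_trilinear {a b c : ℝ → ℂ} (ha : Integrable a) (hb : MemLp b 2) (hc : MemLp c 2) :
    Integrable (fun z : ℝ × ℝ => a z.1 * (b z.2 * (starRingEnd ℂ) (c (z.1 + z.2)))) volume := by
  have hm : AEStronglyMeasurable
      (fun z : ℝ × ℝ => a z.1 * (b z.2 * (starRingEnd ℂ) (c (z.1 + z.2)))) volume := by
    refine (ha.aestronglyMeasurable.comp_quasiMeasurePreserving
      Measure.quasiMeasurePreserving_fst).mul ((hb.1.comp_quasiMeasurePreserving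
      Measure.quasiMeasurePreserving_snd).mul (Complex.continuous_conj.comp_aestronglyMeasurable ?_))
    exact hc.1.comp_quasiMeasurePreserving (quasiMeasurePreserving_add volume volume)
  refine ⟨hm, ?_⟩
  rw [hasFiniteIntegral_iff_enorm, lintegral_plane hm.enorm]
  have h : ∀ η, ∫⁻ ζ, ‖a η * (b ζ * (starRingEnd ℂ) (c (η + ζ)))‖ₑ ≤
      ‖a η‖ₑ * (eLpNorm b 2 volume * eLpNorm c 2 volume) := by
    intro η
    simp only [enorm_mul, RCLike.enorm_conj]
    rw [lintegral_const_mul' _ _ enorm_ne_top]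
    refine mul_le_mul_right ?_ _
    have h1 := lintegral_mul_sq_le hb.1.enorm (memLp_translate hc η).1.enorm
    have h2 : ∫⁻ ζ, ‖c (η + ζ)‖ₑ ^ 2 = ∫⁻ ζ, ‖c ζ‖ₑ ^ 2 :=
      lintegral_add_left_eq_self (fun ζ => ‖c ζ‖ₑ ^ 2) η
    rw [h2, ← eLpNorm_two_sq, ← eLpNorm_two_sq, ← mul_pow] at h1
    exact (ENNReal.pow_le_pow_left_iff two_ne_zero).1 h1
  refine (lintegral_mono h).trans_lt ?_
  rw [lintegral_mul_const' _ _ (ENNReal.mul_ne_top hb.2.ne hc.2.ne)]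
  exact ENNReal.mul_lt_top ha.2 (ENNReal.mul_lt_top hb.2 hc.2)

theorem integral_fourierInv_mul_mul_conj {a : ℝ → ℂ} (ha : Integrable a) (b c : L2x) :
    ∫ x, 𝓕⁻ a x * ((𝓕⁻ b : L2x) x * (starRingEnd ℂ) ((𝓕⁻ c : L2x) x)) =
      ∫ z : ℝ × ℝ, a z.1 * (b z.2 * (starRingEnd ℂ) (c (z.1 + z.2))) := by
  have hg : Integrable (fun x => (𝓕⁻ b : L2x) x * (starRingEnd ℂ) ((𝓕⁻ c : L2x) x)) :=
    MemLp.integrable_mul (q := 2) (Lp.memLp _) (Lp.memLp (𝓕⁻ c : L2x)).star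
  rw [integral_fourierInv_mul ha hg, integral_plane (integrable_trilinear ha (Lp.memLp b) (Lp.memLp c))]
  refine integral_congr_ae (Filter.Eventually.of_forall fun η => ?_)
  simp only
  rw [fourierInv_mul_conj, integral_const_mul]

/-! ### The symbol of the exponential weight -/

theorem one_le_bracket (ξ : ℝ) : 1 ≤ bracket ξ := by
  unfold bracket
  rw [Real.one_le_sqrt]
  nlinarith [sq_nonneg ξ]

theorem bracket_pos (ξ : ℝ) : 0 < bracket ξ := zero_lt_one.trans_le (one_le_bracket ξ)

theorem continuous_bracket : Continuous bracket := by
  unfold bracket; fun_prop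

theorem abs_le_bracket (ξ : ℝ) : |ξ| ≤ bracket ξ := by
  unfold bracket
  exact Real.abs_le_sqrt (by linarith)

theorem bracket_le_one_add (ξ : ℝ) : bracket ξ ≤ 1 + |ξ| := by
  unfold bracket
  rw [Real.sqrt_le_left (by positivity)]
  nlinarith [sq_abs ξ, abs_nonneg ξ]

theorem bracket_mono {ξ η : ℝ} (h : |ξ| ≤ |η|) : bracket ξ ≤ bracket η := by
  unfold bracket
  exact Real.sqrt_le_sqrt (by linarith [sq_le_sq.2 h])

theorem bracket_add_le (ξ η : ℝ) : bracket (ξ + η) ≤ bracket ξ + bracket η := by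
  have h1 := abs_le_bracket ξ
  have h2 := abs_le_bracket η
  have h3 : ξ * η ≤ bracket ξ * bracket η := (le_abs_self _).trans (by
    rw [abs_mul]; exact mul_le_mul h1 h2 (abs_nonneg _) (bracket_pos _).le)
  have e1 : bracket ξ ^ 2 = 1 + ξ ^ 2 := Real.sq_sqrt (by positivity)
  have e2 : bracket η ^ 2 = 1 + η ^ 2 := Real.sq_sqrt (by positivity)
  nth_rewrite 1 [bracket]
  rw [Real.sqrt_le_left (by linarith [bracket_pos ξ, bracket_pos η])]
  nlinarith

/-- The phase `ψ_n(ξ)` of the exponential weight. -/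
def phase (s : ℝ) (n : ℕ) (ξ : ℝ) : ℝ :=
  (((n : ℝ) + 1 / 2) ^ ((s + 1) / 2) + bracket ξ ^ ((3 * s + 1) / (2 * s + 1))) ^
    (2 * s / (3 * s + 1))

/-- The exponent `2s/(2s+1)` of the gain of regularity in `x`. -/
def gainExp (s : ℝ) : ℝ := 2 * s / (2 * s + 1)

theorem gainExp_pos {s : ℝ} (hs : 0 < s) : 0 < gainExp s := by unfold gainExp; positivity

theorem gainExp_lt_one {s : ℝ} (hs : 0 < s) : gainExp s < 1 := by
  unfold gainExp; rw [div_lt_one (by positivity)]; linarith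

theorem phase_nonneg (s : ℝ) (n : ℕ) (ξ : ℝ) : 0 ≤ phase s n ξ := by
  have := bracket_pos ξ
  unfold phase; positivity

/-- The phase as a power of an `ℓ^q` norm. -/
theorem phase_eq {s : ℝ} (hs : 0 < s) (n : ℕ) (ξ : ℝ) :
    phase s n ξ = ((((n : ℝ) + 1 / 2) ^ ((s + 1) / 2) + bracket ξ ^ ((3 * s + 1) / (2 * s + 1))) ^
      (1 / ((3 * s + 1) / (2 * s + 1)))) ^ gainExp s := by
  have := bracket_pos ξ
  rw [← Real.rpow_mul (by positivity), phase, gainExp]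
  congr 1
  field_simp

theorem le_phaseBase {s : ℝ} (hs : 0 < s) (n : ℕ) (ξ : ℝ) :
    bracket ξ ≤ (((n : ℝ) + 1 / 2) ^ ((s + 1) / 2) + bracket ξ ^ ((3 * s + 1) / (2 * s + 1))) ^
      (1 / ((3 * s + 1) / (2 * s + 1))) := by
  have hb := bracket_pos ξ
  calc bracket ξ = (bracket ξ ^ ((3 * s + 1) / (2 * s + 1))) ^ (1 / ((3 * s + 1) / (2 * s + 1))) := by
        rw [← Real.rpow_mul hb.le, mul_one_div_cancel (by positivity), Real.rpow_one]
    _ ≤ _ := Real.rpow_le_rpow (by positivity) (le_add_of_nonneg_left (by positivity)) (by positivity)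

theorem rpow_bracket_le_phase {s : ℝ} (hs : 0 < s) (n : ℕ) (ξ : ℝ) :
    bracket ξ ^ gainExp s ≤ phase s n ξ := by
  rw [phase_eq hs]
  exact Real.rpow_le_rpow (bracket_pos ξ).le (le_phaseBase hs n ξ) (gainExp_pos hs).le

theorem phase_zero_le {s : ℝ} (hs : 0 < s) (ξ : ℝ) : phase s 0 ξ ≤ 2 * bracket ξ ^ gainExp s := by
  have hb := one_le_bracket ξ
  have hb0 := bracket_pos ξ
  set q := (3 * s + 1) / (2 * s + 1) with hq
  have hq0 : 0 < q := by positivity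
  have h1 : (((0 : ℕ) : ℝ) + 1 / 2) ^ ((s + 1) / 2) ≤ bracket ξ ^ q := by
    calc _ ≤ (1 : ℝ) := Real.rpow_le_one (by norm_num) (by norm_num) (by positivity)
      _ ≤ _ := Real.one_le_rpow hb hq0.le
  have h2 : 2 * s / (3 * s + 1) ≤ 1 := by rw [div_le_one (by positivity)]; linarith
  have h3 : q * (2 * s / (3 * s + 1)) = gainExp s := by rw [hq, gainExp]; field_simp
  calc phase s 0 ξ ≤ (2 * bracket ξ ^ q) ^ (2 * s / (3 * s + 1)) :=
        Real.rpow_le_rpow (by positivity) (by linarith) (by positivity)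
    _ = 2 ^ (2 * s / (3 * s + 1)) * bracket ξ ^ gainExp s := by
        rw [Real.mul_rpow (by norm_num) (by positivity), ← Real.rpow_mul hb0.le, h3]
    _ ≤ 2 ^ (1 : ℝ) * bracket ξ ^ gainExp s := by
        refine mul_le_mul_of_nonneg_right ?_ (by positivity)
        exact Real.rpow_le_rpow_of_exponent_le (by norm_num) h2
    _ = _ := by rw [Real.rpow_one]

theorem phase_mono {s : ℝ} (hs : 0 < s) (n : ℕ) {ξ η : ℝ} (h : |ξ| ≤ |η|) :
    phase s n ξ ≤ phase s n η := by
  have hb := bracket_pos ξ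
  unfold phase
  refine Real.rpow_le_rpow (by positivity) ?_ (by positivity)
  have := Real.rpow_le_rpow hb.le (bracket_mono h)
    (by positivity : 0 ≤ (3 * s + 1) / (2 * s + 1))
  linarith

theorem add_rpow_le_sub {x y r : ℝ} (hx : 0 < x) (hy : 0 < y) (hr : 0 < r) (hr1 : r < 1) :
    (x + y) ^ r ≤ x ^ r + y ^ r - (1 - r) * min x y ^ r := by
  wlog hxy : y ≤ x generalizing x y
  · rw [add_comm x, add_comm (x ^ r), min_comm]
    exact this hy hx (le_of_not_ge hxy)
  rw [min_eq_right hxy]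
  have h1 : (1 + y / x) ^ r ≤ 1 + r * (y / x) :=
    rpow_one_add_le_one_add_mul_self (by have := div_pos hy hx; linarith) hr.le hr1.le
  have h2 : (x + y) ^ r = x ^ r * (1 + y / x) ^ r := by
    rw [← Real.mul_rpow hx.le (by positivity)]; congr 1; field_simp
  have h3 : x ^ r * (y / x) ≤ y ^ r := by
    have : (y / x) ≤ (y / x) ^ r := by
      nth_rewrite 1 [← Real.rpow_one (y / x)]
      exact Real.rpow_le_rpow_of_exponent_ge (by positivity) ((div_le_one hx).2 hxy) hr1.le
    calc x ^ r * (y / x) ≤ x ^ r * (y / x) ^ r := mul_le_mul_of_nonneg_left this (by positivity)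
      _ = _ := by rw [← Real.mul_rpow hx.le (by positivity)]; congr 1; field_simp
  rw [h2]
  calc x ^ r * (1 + y / x) ^ r ≤ x ^ r * (1 + r * (y / x)) :=
        mul_le_mul_of_nonneg_left h1 (by positivity)
    _ = x ^ r + r * (x ^ r * (y / x)) := by ring
    _ ≤ x ^ r + r * y ^ r := by
        have := mul_le_mul_of_nonneg_left h3 hr.le
        linarith
    _ = _ := by ring

theorem phaseBase_add_le {s : ℝ} (hs : 0 < s) (hs' : s < 1) (k l : ℕ) (η ζ : ℝ) :
    ((((k + l : ℕ) : ℝ) + 1 / 2) ^ ((s + 1) / 2) +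
        bracket (η + ζ) ^ ((3 * s + 1) / (2 * s + 1))) ^ (1 / ((3 * s + 1) / (2 * s + 1))) ≤
      (((k : ℝ) + 1 / 2) ^ ((s + 1) / 2) + bracket η ^ ((3 * s + 1) / (2 * s + 1))) ^
        (1 / ((3 * s + 1) / (2 * s + 1))) +
      (((l : ℝ) + 1 / 2) ^ ((s + 1) / 2) + bracket ζ ^ ((3 * s + 1) / (2 * s + 1))) ^
        (1 / ((3 * s + 1) / (2 * s + 1))) := by
  set q := (3 * s + 1) / (2 * s + 1) with hq
  have hq0 : 0 < q := by positivity
  have hq1 : 1 ≤ q := by rw [hq, one_le_div (by positivity)]; linarith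
  set r := (s + 1) / 2 / q with hr
  have hr0 : 0 < r := by positivity
  have hr1 : r ≤ 1 := by
    rw [hr, hq, div_div_eq_mul_div, div_le_one (by positivity)]
    nlinarith
  have hrq : r * q = (s + 1) / 2 := by rw [hr]; field_simp
  have hb1 := bracket_pos η
  have hb2 := bracket_pos ζ
  have e : ∀ n : ℕ, ((n : ℝ) + 1 / 2) ^ ((s + 1) / 2) = (((n : ℝ) + 1 / 2) ^ r) ^ q := fun n => by
    rw [← Real.rpow_mul (by positivity), hrq]
  have h1 : (((k + l : ℕ) : ℝ) + 1 / 2) ^ r ≤ ((k : ℝ) + 1 / 2) ^ r + ((l : ℝ) + 1 / 2) ^ r := by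
    refine (Real.rpow_le_rpow (by positivity) ?_ hr0.le).trans
      (Real.rpow_add_le_add_rpow (by positivity : (0 : ℝ) ≤ (k : ℝ) + 1 / 2)
        (by positivity : (0 : ℝ) ≤ (l : ℝ) + 1 / 2) hr0.le hr1)
    push_cast
    linarith
  have h2 := Real.Lp_add_le_of_nonneg (Finset.univ : Finset (Fin 2)) hq1
    (f := ![((k : ℝ) + 1 / 2) ^ r, bracket η]) (g := ![((l : ℝ) + 1 / 2) ^ r, bracket ζ])
    (by intro i _; fin_cases i <;> simp <;> positivity)
    (by intro i _; fin_cases i <;> simp <;> positivity)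
  simp only [Fin.sum_univ_two, Matrix.cons_val_zero, Matrix.cons_val_one] at h2
  rw [e, e, e]
  refine le_trans ?_ h2
  have hb3 := bracket_pos (η + ζ)
  refine Real.rpow_le_rpow (by positivity) (add_le_add ?_ ?_) (by positivity)
  · exact Real.rpow_le_rpow (by positivity) h1 hq0.le
  · exact Real.rpow_le_rpow hb3.le (bracket_add_le _ _) hq0.le

theorem phase_add_le {s : ℝ} (hs : 0 < s) (hs' : s < 1) (k l : ℕ) (η ζ : ℝ) :
    phase s (k + l) (η + ζ) ≤ phase s k η + phase s l ζ -
      (1 - gainExp s) * min (bracket η) (bracket ζ) ^ gainExp s := by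
  have h0 := gainExp_pos hs
  have h1 := gainExp_lt_one hs
  have hb1 := bracket_pos η
  have hb2 := bracket_pos ζ
  have hb3 := bracket_pos (η + ζ)
  have hk := le_phaseBase hs k η
  have hl := le_phaseBase hs l ζ
  rw [phase_eq hs, phase_eq hs, phase_eq hs]
  refine (Real.rpow_le_rpow (by positivity) (phaseBase_add_le hs hs' k l η ζ) h0.le).trans ?_
  refine (add_rpow_le_sub (hb1.trans_le hk) (hb2.trans_le hl) h0 h1).trans ?_
  have := Real.rpow_le_rpow (le_min hb1.le hb2.le) (min_le_min hk hl) h0.le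
  have := mul_le_mul_of_nonneg_left this (by linarith : 0 ≤ 1 - gainExp s)
  linarith

theorem phase_add_le' {s : ℝ} (hs : 0 < s) (hs' : s < 1) (k l : ℕ) (η ζ : ℝ) :
    phase s (k + l) (η + ζ) ≤ phase s k η + phase s l ζ := by
  have h1 := gainExp_lt_one hs
  have hb : 0 < min (bracket η) (bracket ζ) := lt_min (bracket_pos η) (bracket_pos ζ)
  have := mul_nonneg (by linarith : 0 ≤ 1 - gainExp s) (Real.rpow_nonneg hb.le (gainExp s))
  linarith [phase_add_le hs hs' k l η ζ]

/-- The function `e^x / (1 + κ e^x)`. -/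
def expRatio (κ x : ℝ) : ℝ := Real.exp x / (1 + κ * Real.exp x)

theorem weightSymbol_eq (s κ t : ℝ) (n : ℕ) (ξ : ℝ) :
    weightSymbol s κ t n ξ = expRatio κ (t * phase s n ξ) := rfl

theorem expRatio_pos {κ : ℝ} (hκ : 0 < κ) (x : ℝ) : 0 < expRatio κ x := by unfold expRatio; positivity

theorem inv_expRatio {κ : ℝ} (hκ : 0 < κ) (x : ℝ) : (expRatio κ x)⁻¹ = Real.exp (-x) + κ := by
  have := Real.exp_pos x
  rw [expRatio, Real.exp_neg]
  field_simp

theorem expRatio_le_exp {κ : ℝ} (hκ : 0 < κ) (x : ℝ) : expRatio κ x ≤ Real.exp x := by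
  unfold expRatio
  exact div_le_self (Real.exp_pos x).le (by have := Real.exp_pos x; nlinarith)

theorem mul_expRatio_le {κ : ℝ} (hκ : 0 < κ) (x : ℝ) : κ * expRatio κ x ≤ 1 := by
  unfold expRatio
  have := Real.exp_pos x
  rw [← mul_div_assoc, div_le_one (by positivity)]
  linarith

theorem expRatio_mono {κ : ℝ} (hκ : 0 < κ) {x y : ℝ} (h : x ≤ y) : expRatio κ x ≤ expRatio κ y := by
  have h1 : (expRatio κ y)⁻¹ ≤ (expRatio κ x)⁻¹ := by
    rw [inv_expRatio hκ, inv_expRatio hκ]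
    linarith [Real.exp_le_exp.2 (neg_le_neg h)]
  exact (inv_le_inv₀ (expRatio_pos hκ y) (expRatio_pos hκ x)).1 h1

theorem expRatio_add_le {κ : ℝ} (hκ : 0 < κ) (x : ℝ) {d : ℝ} (hd : 0 ≤ d) :
    expRatio κ (x + d) ≤ Real.exp d * expRatio κ x := by
  have h1 := Real.exp_pos x
  have h2 := Real.one_le_exp hd
  unfold expRatio
  rw [← mul_div_assoc, Real.exp_add, mul_comm (Real.exp x) (Real.exp d)]
  refine div_le_div_of_nonneg_left (by positivity) (by positivity) ?_
  have := mul_le_mul_of_nonneg_right h2 (mul_nonneg hκ.le h1.le)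
  nlinarith

theorem expRatio_quotient_le {κ : ℝ} (hκ : 0 < κ) (hκ1 : κ ≤ 1) {x y z : ℝ} (hx : 0 ≤ x) (hy : 0 ≤ y) (hz : z ≤ x + y) :
    expRatio κ z * (expRatio κ x)⁻¹ * (expRatio κ y)⁻¹ ≤ 4 := by
  have hp := expRatio_pos hκ z
  have h1 : expRatio κ z * (Real.exp (-x) * Real.exp (-y)) ≤ 1 := by
    rw [← Real.exp_add]
    calc _ ≤ Real.exp z * Real.exp (-x + -y) :=
          mul_le_mul_of_nonneg_right (expRatio_le_exp hκ z) (Real.exp_pos _).le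
      _ ≤ 1 := by rw [← Real.exp_add, Real.exp_le_one_iff]; linarith
  have h2 := mul_expRatio_le hκ z
  have hx1 : Real.exp (-x) ≤ 1 := Real.exp_le_one_iff.2 (by linarith)
  have hy1 : Real.exp (-y) ≤ 1 := Real.exp_le_one_iff.2 (by linarith)
  rw [inv_expRatio hκ, inv_expRatio hκ]
  have a1 := mul_le_mul h2 hx1 (Real.exp_pos _).le zero_le_one
  have a2 := mul_le_mul h2 hy1 (Real.exp_pos _).le zero_le_one
  have a3 := mul_le_mul h2 hκ1 hκ.le zero_le_one
  nlinarith

theorem expRatio_quotient_sub_le {κ : ℝ} (hκ : 0 < κ) {x y z d : ℝ} (hz : z ≤ x + y - d) :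
    |expRatio κ z * (expRatio κ x)⁻¹ * (expRatio κ y)⁻¹ - κ * expRatio κ z * (expRatio κ y)⁻¹| ≤
      Real.exp (-d) + Real.exp (-x) := by
  have hp := expRatio_pos hκ z
  have e : expRatio κ z * (expRatio κ x)⁻¹ * (expRatio κ y)⁻¹ -
      κ * expRatio κ z * (expRatio κ y)⁻¹ =
      expRatio κ z * (Real.exp (-x) * Real.exp (-y)) + κ * expRatio κ z * Real.exp (-x) := by
    rw [inv_expRatio hκ, inv_expRatio hκ]; ring
  rw [e, abs_of_nonneg (by positivity)]
  refine add_le_add ?_ ?_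
  · rw [← Real.exp_add]
    calc _ ≤ Real.exp z * Real.exp (-x + -y) :=
          mul_le_mul_of_nonneg_right (expRatio_le_exp hκ z) (Real.exp_pos _).le
      _ ≤ _ := by rw [← Real.exp_add, Real.exp_le_exp]; linarith
  · calc _ ≤ 1 * Real.exp (-x) :=
          mul_le_mul_of_nonneg_right (mul_expRatio_le hκ z) (Real.exp_pos _).le
      _ = _ := one_mul _

theorem expRatio_quotient_freeze {κ : ℝ} (hκ : 0 < κ) {x x0 y z d : ℝ} (h0 : x0 ≤ x) (h1 : x ≤ x0 + d) {B : ℝ}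
    (hB : expRatio κ z * (expRatio κ x)⁻¹ * (expRatio κ y)⁻¹ ≤ B) :
    expRatio κ z * (expRatio κ x0)⁻¹ * (expRatio κ y)⁻¹ ≤ B * Real.exp d ∧
    |expRatio κ z * (expRatio κ x)⁻¹ * (expRatio κ y)⁻¹ -
      expRatio κ z * (expRatio κ x0)⁻¹ * (expRatio κ y)⁻¹| ≤ B * (Real.exp d - 1) := by
  have px := expRatio_pos hκ x
  have px0 := expRatio_pos hκ x0
  have py := expRatio_pos hκ y
  have pz := expRatio_pos hκ z
  have hd : 0 ≤ d := by linarith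
  set M := expRatio κ z * (expRatio κ x)⁻¹ * (expRatio κ y)⁻¹ with hM
  have hM0 : 0 < M := by positivity
  set r := expRatio κ x / expRatio κ x0 with hr
  have hr1 : 1 ≤ r := (one_le_div px0).2 (expRatio_mono hκ h0)
  have hr2 : r ≤ Real.exp d := by
    rw [hr, div_le_iff₀ px0]
    exact (expRatio_mono hκ h1).trans (expRatio_add_le hκ x0 hd)
  have e : expRatio κ z * (expRatio κ x0)⁻¹ * (expRatio κ y)⁻¹ = M * r := by
    rw [hM, hr]; field_simp
  rw [e]
  refine ⟨mul_le_mul hB hr2 (by linarith) (hM0.le.trans hB), ?_⟩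
  rw [show M - M * r = -(M * (r - 1)) by ring, abs_neg,
    abs_of_nonneg (mul_nonneg hM0.le (by linarith))]
  exact mul_le_mul hB (by linarith) (by linarith) (hM0.le.trans hB)

/-! ### The Poisson kernel -/

theorem exp_eq_integral_poisson {y : ℝ} (hy : y ≤ 0) :
    (Real.exp y : ℂ) = ∫ τ : ℝ, ((Real.pi⁻¹ * (1 + τ ^ 2)⁻¹ : ℝ) : ℂ) *
      Complex.exp ((τ * y : ℝ) * Complex.I) := by
  have hπ := Real.pi_pos
  set f : ℝ → ℂ := fun x => (Real.exp (-(2 * Real.pi) * |x|) : ℂ) with hf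
  have hfc : Continuous f := by
    rw [hf]; fun_prop
  have e1 : ∀ ξ : ℝ, ∀ x ∈ Set.Ioi (0 : ℝ), Complex.exp ((-(2 * Real.pi) - 2 * Real.pi * ξ * Complex.I) * x) =
      Complex.exp (((-2 * Real.pi * (x * ξ) : ℝ) : ℂ) * Complex.I) • f x := by
    intro ξ x hx
    have : |x| = x := abs_of_pos hx
    simp only [hf, this, smul_eq_mul]
    rw [Complex.ofReal_exp, ← Complex.exp_add]
    congr 1
    push_cast
    ring
  have e2 : ∀ ξ : ℝ, ∀ x ∈ Set.Iic (0 : ℝ), Complex.exp (((2 * Real.pi) - 2 * Real.pi * ξ * Complex.I) * x) =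
      Complex.exp (((-2 * Real.pi * (x * ξ) : ℝ) : ℂ) * Complex.I) • f x := by
    intro ξ x hx
    have : |x| = -x := abs_of_nonpos hx
    simp only [hf, this, smul_eq_mul]
    rw [Complex.ofReal_exp, ← Complex.exp_add]
    congr 1
    push_cast
    ring
  have r1 : ∀ ξ : ℝ, (-(2 * Real.pi) - 2 * Real.pi * ξ * Complex.I : ℂ).re < 0 := fun ξ => by
    simp; positivity
  have r2 : ∀ ξ : ℝ, 0 < ((2 * Real.pi) - 2 * Real.pi * ξ * Complex.I : ℂ).re := fun ξ => by
    simp; positivity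
  have i1 : ∀ ξ : ℝ, IntegrableOn
      (fun x => Complex.exp (((-2 * Real.pi * (x * ξ) : ℝ) : ℂ) * Complex.I) • f x) (Set.Ioi 0) :=
    fun ξ => (integrableOn_exp_mul_complex_Ioi (r1 ξ) 0).congr_fun (e1 ξ) measurableSet_Ioi
  have i2 : ∀ ξ : ℝ, IntegrableOn
      (fun x => Complex.exp (((-2 * Real.pi * (x * ξ) : ℝ) : ℂ) * Complex.I) • f x) (Set.Iic 0) :=
    fun ξ => (integrableOn_exp_mul_complex_Iic (r2 ξ) 0).congr_fun (e2 ξ) measurableSet_Iic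
  have hfi : Integrable f := by
    have h := (i2 0).union (i1 0)
    rw [Set.Iic_union_Ioi, integrableOn_univ] at h
    simpa using h
  have hF : 𝓕 f = fun ξ => ((Real.pi⁻¹ * (1 + ξ ^ 2)⁻¹ : ℝ) : ℂ) := by
    funext ξ
    rw [Real.fourier_eq']
    have e3 : ∀ x : ℝ, Complex.exp (((-2 * Real.pi * inner ℝ x ξ : ℝ) : ℂ) * Complex.I) • f x =
        Complex.exp (((-2 * Real.pi * (x * ξ) : ℝ) : ℂ) * Complex.I) • f x := fun x => by
      simp [mul_comm ξ x]
    simp only [e3]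
    rw [← setIntegral_univ, ← Set.Iic_union_Ioi (a := (0 : ℝ)), setIntegral_union
      (Set.Iic_disjoint_Ioi le_rfl) measurableSet_Ioi (i2 ξ) (i1 ξ),
      ← setIntegral_congr_fun measurableSet_Iic (e2 ξ), ← setIntegral_congr_fun measurableSet_Ioi (e1 ξ),
      integral_exp_mul_complex_Ioi (r1 ξ), integral_exp_mul_complex_Iic (r2 ξ)]
    have hz1 : (1 - ξ * Complex.I : ℂ) ≠ 0 := fun h => by
      have := congrArg Complex.re h; simp at this
    have hz2 : (1 + ξ * Complex.I : ℂ) ≠ 0 := fun h => by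
      have := congrArg Complex.re h; simp at this
    have hz3 : (1 + (ξ : ℂ) ^ 2) = (1 - ξ * Complex.I) * (1 + ξ * Complex.I) := by
      linear_combination ((ξ : ℂ) ^ 2) * Complex.I_sq
    have hpc : (Real.pi : ℂ) ≠ 0 := by exact_mod_cast hπ.ne'
    push_cast
    rw [hz3, show (2 * Real.pi - 2 * Real.pi * ξ * Complex.I : ℂ) =
      2 * Real.pi * (1 - ξ * Complex.I) by ring, show (-(2 * Real.pi) - 2 * Real.pi * ξ * Complex.I : ℂ) =
      -(2 * Real.pi * (1 + ξ * Complex.I)) by ring]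
    simp only [mul_zero, Complex.exp_zero]
    field_simp
    ring
  have hFi : Integrable (𝓕 f) := by
    rw [hF]
    exact (integrable_inv_one_add_sq.const_mul _).ofReal
  have h := congrFun (hfc.fourierInv_fourier_eq hfi hFi) (y / (2 * Real.pi))
  rw [hF, Real.fourierInv_eq'] at h
  have e4 : f (y / (2 * Real.pi)) = (Real.exp y : ℂ) := by
    simp only [hf]
    rw [abs_of_nonpos (div_nonpos_of_nonpos_of_nonneg hy (by positivity))]
    congr 2
    field_simp
  rw [e4] at h
  rw [← h]
  refine integral_congr_ae (Filter.Eventually.of_forall fun τ => ?_)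
  simp only [smul_eq_mul]
  rw [mul_comm]
  congr 4
  simp
  field_simp

/-! ### Trilinear forms in frequency -/

/-- The root of the sum of squares of the first `N` components. -/
def rms (N : ℕ) (x : ℕ → ℂ) : ℝ := Real.sqrt (∑ k ∈ Finset.range N, ‖x k‖ ^ 2)

theorem rms_nonneg (N : ℕ) (x : ℕ → ℂ) : 0 ≤ rms N x := Real.sqrt_nonneg _

theorem rms_mono {N : ℕ} {x y : ℕ → ℂ} (h : ∀ k, ‖x k‖ ≤ ‖y k‖) : rms N x ≤ rms N y :=
  Real.sqrt_le_sqrt (Finset.sum_le_sum fun k _ => pow_le_pow_left₀ (norm_nonneg _) (h k) 2)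

theorem ofReal_rms_sq (N : ℕ) (x : ℕ → ℂ) :
    ENNReal.ofReal (rms N x) ^ 2 = ∑ k ∈ Finset.range N, ‖x k‖ₑ ^ 2 := by
  rw [← ENNReal.ofReal_pow (rms_nonneg _ _), rms,
    Real.sq_sqrt (Finset.sum_nonneg fun k _ => sq_nonneg _),
    ENNReal.ofReal_sum_of_nonneg fun k _ => sq_nonneg _]
  refine Finset.sum_congr rfl fun k _ => ?_
  rw [ENNReal.ofReal_pow (norm_nonneg _), ofReal_norm]

theorem aemeasurable_rms {α : Type} [MeasurableSpace α] {μ : Measure α} {N : ℕ} {f : ℕ → α → ℂ}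
    (hf : ∀ k, AEStronglyMeasurable (f k) μ) : AEMeasurable (fun x => rms N fun k => f k x) μ := by
  unfold rms
  refine Real.continuous_sqrt.measurable.comp_aemeasurable ?_
  exact Finset.aemeasurable_fun_sum _ fun k _ => (hf k).norm.aemeasurable.pow_const 2

theorem TrilinearBound.enorm_le {β : ℕ → ℕ → ℝ} {K : ℝ} (h : TrilinearBound β K)
    (N : ℕ) (x y w : ℕ → ℂ) :
    ∑ k ∈ Finset.range N, ∑ l ∈ Finset.range N,
      ‖(β k l : ℂ)‖ₑ * (‖x k‖ₑ * (‖y l‖ₑ * ‖w (k + l)‖ₑ)) ≤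
      ENNReal.ofReal K * (ENNReal.ofReal (rms N x) *
        (ENNReal.ofReal (rms N y) * ENNReal.ofReal (rms (2 * N) w))) := by
  have h1 := h N (fun k => ‖x k‖) (fun k => ‖y k‖) (fun k => ‖w k‖) (fun _ => norm_nonneg _)
    (fun _ => norm_nonneg _) (fun _ => norm_nonneg _)
  have e : ∑ k ∈ Finset.range N, ∑ l ∈ Finset.range N,
      ‖(β k l : ℂ)‖ₑ * (‖x k‖ₑ * (‖y l‖ₑ * ‖w (k + l)‖ₑ)) =
      ENNReal.ofReal (∑ k ∈ Finset.range N, ∑ l ∈ Finset.range N,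
        |β k l| * (‖x k‖ * ‖y l‖ * ‖w (k + l)‖)) := by
    rw [ENNReal.ofReal_sum_of_nonneg fun k _ => Finset.sum_nonneg fun l _ => by positivity]
    refine Finset.sum_congr rfl fun k _ => ?_
    rw [ENNReal.ofReal_sum_of_nonneg fun l _ => by positivity]
    refine Finset.sum_congr rfl fun l _ => ?_
    rw [ENNReal.ofReal_mul (abs_nonneg _), ENNReal.ofReal_mul (by positivity),
      ENNReal.ofReal_mul (by positivity), ofReal_norm, ofReal_norm, ofReal_norm, mul_assoc]
    rw [← ofReal_norm (β k l : ℂ), Complex.norm_real, Real.norm_eq_abs]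
  rw [e]
  refine (ENNReal.ofReal_le_ofReal h1).trans (le_of_eq ?_)
  rw [ENNReal.ofReal_mul' (by positivity), ENNReal.ofReal_mul (by positivity),
    ENNReal.ofReal_mul (by positivity), mul_assoc (ENNReal.ofReal √_)]
  rfl

theorem sum_lintegral_le {α ι : Type} [MeasurableSpace α] {μ : Measure α} (S : Finset ι)
    (f : ι → α → ℝ≥0∞) : ∑ i ∈ S, ∫⁻ x, f i x ∂μ ≤ ∫⁻ x, ∑ i ∈ S, f i x ∂μ := by
  classical
  induction S using Finset.induction_on with
  | empty => simp
  | insert i S hi ih =>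
    simp only [Finset.sum_insert hi]
    exact (add_le_add le_rfl ih).trans (le_lintegral_add _ _)

theorem lintegral_rms_mul_rms_le {b c : ℕ → ℝ → ℂ} {N M : ℕ} {B C : ℝ≥0∞}
    (hb : ∀ l, AEStronglyMeasurable (b l) volume) (hc : ∀ l, AEStronglyMeasurable (c l) volume)
    (hB : ∑ l ∈ Finset.range N, ∫⁻ ζ, ‖b l ζ‖ₑ ^ 2 ≤ B ^ 2)
    (hC : ∑ n ∈ Finset.range M, ∫⁻ ζ, ‖c n ζ‖ₑ ^ 2 ≤ C ^ 2) :
    ∫⁻ ζ, ENNReal.ofReal (rms N fun l => b l ζ) * ENNReal.ofReal (rms M fun n => c n ζ) ≤ B * C := by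
  have h := lintegral_mul_sq_le (aemeasurable_rms (N := N) hb).ennreal_ofReal
    (aemeasurable_rms (N := M) hc).ennreal_ofReal
  simp only [ofReal_rms_sq] at h
  rw [lintegral_finsetSum' _ fun l _ => (hb l).enorm.pow_const 2,
    lintegral_finsetSum' _ fun l _ => (hc l).enorm.pow_const 2] at h
  exact (ENNReal.pow_le_pow_left_iff two_ne_zero).1
    (h.trans ((mul_le_mul' hB hC).trans (mul_pow _ _ _).ge))

/-- The trilinear form with coefficients `β_{k,l}` and the multipliers `m_{k,l}` in frequency. -/
def pairing (β : ℕ → ℕ → ℝ) (N : ℕ) (m : ℕ → ℕ → ℝ × ℝ → ℂ) (a b c : ℕ → ℝ → ℂ) : ℂ :=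
  ∑ k ∈ Finset.range N, ∑ l ∈ Finset.range N, (β k l : ℂ) *
    ∫ z : ℝ × ℝ, m k l z * (a k z.1 * (b l z.2 * (starRingEnd ℂ) (c (k + l) (z.1 + z.2))))

/-- The dyadic shells in frequency. -/
def shell (q : ℕ) : Set ℝ :=
  {η | (2 : ℝ) ^ q ≤ bracket (2 * Real.pi * η) ∧ bracket (2 * Real.pi * η) < 2 ^ (q + 1)}

theorem measurableSet_shell (q : ℕ) : MeasurableSet (shell q) := by
  have h : Continuous fun η : ℝ => bracket (2 * Real.pi * η) := continuous_bracket.comp (by fun_prop)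
  exact (measurableSet_le measurable_const h.measurable).inter
    (measurableSet_lt h.measurable measurable_const)

theorem iUnion_shell : ⋃ q, shell q = Set.univ := by
  refine Set.eq_univ_of_forall fun η => ?_
  obtain ⟨q, hq⟩ := exists_nat_pow_near (one_le_bracket (2 * Real.pi * η)) (one_lt_two)
  exact Set.mem_iUnion.2 ⟨q, hq⟩

/-- Families of functions of the frequency whose inverse Fourier transforms are bounded in `x` with
values in `ℓ²`, and whose parts in dyadic shells are integrable with values in `ℓ²`. -/
structure LowFamily (N : ℕ) (a : ℕ → ℝ → ℂ) (W : ℝ≥0∞) : Prop where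
  memLp : ∀ k, MemLp (a k) 2
  lintegral_le : ∀ c : ℕ → ℂ,
    ∫⁻ η, ‖∑ k ∈ Finset.range N, c k * a k η‖ₑ ≤ W * ENNReal.ofReal (rms N c)
  lintegral_shell_le : ∀ q, ∫⁻ η in shell q, ENNReal.ofReal (rms N fun k => a k η) ≤ W

theorem LowFamily.mul {N : ℕ} {a : ℕ → ℝ → ℂ} {W : ℝ≥0∞} (h : LowFamily N a W) {u : ℕ → ℂ}
    (hu : ∀ k, ‖u k‖ ≤ 1) {r : ℝ → ℝ} (hr : Measurable r) (hr1 : ∀ η, |r η| ≤ 1) :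
    LowFamily N (fun k η => u k * ((r η : ℂ) * a k η)) W := by
  have hr2 : ∀ η, ‖(r η : ℂ)‖ ≤ 1 := fun η => by
    rw [Complex.norm_real]; exact hr1 η
  refine ⟨fun k => (memLp_mul_of_bound hr hr1 (h.memLp k)).const_mul _, fun c => ?_, fun q => ?_⟩
  · calc ∫⁻ η, ‖∑ k ∈ Finset.range N, c k * (u k * ((r η : ℂ) * a k η))‖ₑ
        ≤ ∫⁻ η, ‖∑ k ∈ Finset.range N, (c k * u k) * a k η‖ₑ := by
          refine lintegral_mono fun η => ?_
          have e : ∑ k ∈ Finset.range N, c k * (u k * ((r η : ℂ) * a k η)) =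
              (r η : ℂ) * ∑ k ∈ Finset.range N, (c k * u k) * a k η := by
            rw [Finset.mul_sum]
            exact Finset.sum_congr rfl fun k _ => by ring
          simp only [e, enorm_mul]
          calc _ ≤ 1 * ‖∑ k ∈ Finset.range N, (c k * u k) * a k η‖ₑ := by
                refine mul_le_mul_left ?_ _
                rw [← ofReal_norm]
                exact ENNReal.ofReal_le_one.2 (hr2 η)
            _ = _ := one_mul _
      _ ≤ W * ENNReal.ofReal (rms N fun k => c k * u k) := h.lintegral_le _
      _ ≤ _ := by
          refine mul_le_mul_right (ENNReal.ofReal_le_ofReal (rms_mono fun k => ?_)) _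
          rw [norm_mul]
          exact mul_le_of_le_one_right (norm_nonneg _) (hu k)
  · refine (lintegral_mono fun η => ENNReal.ofReal_le_ofReal (rms_mono fun k => ?_)).trans
      (h.lintegral_shell_le q)
    rw [norm_mul, norm_mul]
    exact (mul_le_of_le_one_left (by positivity) (hu k)).trans
      (mul_le_of_le_one_left (norm_nonneg _) (hr2 η))

theorem rms_single {N k : ℕ} (hk : k < N) : rms N (Pi.single k (1 : ℂ)) = 1 := by
  rw [rms, Finset.sum_eq_single k]
  · simp
  · intro j _ hj; simp [hj]
  · intro h; exact absurd (Finset.mem_range.2 hk) h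

theorem LowFamily.integrable {N : ℕ} {a : ℕ → ℝ → ℂ} {W : ℝ≥0∞} (h : LowFamily N a W)
    (hW : W ≠ ⊤) {k : ℕ} (hk : k < N) : Integrable (a k) := by
  refine ⟨(h.memLp k).1, ?_⟩
  have h1 := h.lintegral_le (Pi.single k 1)
  rw [rms_single hk] at h1
  have e : ∀ η, ∑ j ∈ Finset.range N, (Pi.single k 1 : ℕ → ℂ) j * a j η = a k η := fun η => by
    rw [Finset.sum_eq_single k]
    · simp
    · intro j _ hj; simp [hj]
    · intro h; exact absurd (Finset.mem_range.2 hk) h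
  simp only [e] at h1
  exact h1.trans_lt (ENNReal.mul_lt_top hW.lt_top ENNReal.ofReal_lt_top)

theorem LowFamily.rms_fourierInv_le {N : ℕ} {a : ℕ → ℝ → ℂ} {W : ℝ≥0∞} (h : LowFamily N a W)
    (hW : W ≠ ⊤) (x : ℝ) : ENNReal.ofReal (rms N fun k => 𝓕⁻ (a k) x) ≤ W := by
  set A : ℝ := rms N fun k => 𝓕⁻ (a k) x with hA
  set c : ℕ → ℂ := fun k => (starRingEnd ℂ) (𝓕⁻ (a k) x) with hc
  have hcA : rms N c = A := by simp [rms, hc, hA]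
  have h1 : ENNReal.ofReal (A ^ 2) ≤ W * ENNReal.ofReal A := by
    have e : ((A ^ 2 : ℝ) : ℂ) = 𝓕⁻ (fun η => ∑ k ∈ Finset.range N, c k * a k η) x := by
      rw [hA, rms, Real.sq_sqrt (Finset.sum_nonneg fun k _ => sq_nonneg _), Real.fourierInv_eq']
      simp only [smul_eq_mul, Finset.mul_sum]
      rw [integral_finsetSum]
      · rw [Complex.ofReal_sum]
        refine Finset.sum_congr rfl fun k _ => ?_
        have : ∀ η : ℝ, Complex.exp (((2 * Real.pi * inner ℝ η x : ℝ) : ℂ) * Complex.I) *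
            (c k * a k η) = c k * (Complex.exp (((2 * Real.pi * inner ℝ η x : ℝ) : ℂ) * Complex.I) *
              a k η) := fun η => by ring
        simp only [this]
        rw [integral_const_mul, hc]
        simp only
        rw [Real.fourierInv_eq', Complex.ofReal_pow, ← Complex.conj_mul']
        simp only [smul_eq_mul]
      · intro k hk
        have hi := ((h.integrable hW (Finset.mem_range.1 hk)).const_mul (c k))
        refine hi.bdd_mul (c := 1) ?_ (Filter.Eventually.of_forall fun η => ?_)
        · exact Continuous.aestronglyMeasurable (by fun_prop)
        · rw [Complex.norm_exp_ofReal_mul_I]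
    calc ENNReal.ofReal (A ^ 2) = ‖((A ^ 2 : ℝ) : ℂ)‖ₑ := by
          rw [← ofReal_norm, Complex.norm_real, Real.norm_of_nonneg (sq_nonneg _)]
      _ ≤ ∫⁻ η, ‖∑ k ∈ Finset.range N, c k * a k η‖ₑ := by
          rw [e, Real.fourierInv_eq']
          refine (enorm_integral_le_lintegral_enorm _).trans (le_of_eq ?_)
          refine lintegral_congr fun η => ?_
          rw [enorm_smul, ← ofReal_norm (Complex.exp _), Complex.norm_exp_ofReal_mul_I]
          simp
      _ ≤ _ := by rw [← hcA]; exact h.lintegral_le c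
  have hA0 : 0 ≤ A := rms_nonneg _ _
  rcases hA0.eq_or_lt with h0 | h0
  · rw [← h0]; simp
  · rw [pow_two, ENNReal.ofReal_mul hA0] at h1
    exact (ENNReal.mul_le_mul_iff_left (ENNReal.ofReal_pos.2 h0).ne' ENNReal.ofReal_ne_top).1 h1

/-- The estimate by absolute values. -/
theorem pairing_le_of_abs {β : ℕ → ℕ → ℝ} {K : ℝ} (hβ : TrilinearBound β K) {N : ℕ}
    {a b c : ℕ → ℝ → ℂ} {B C : ℝ≥0∞} (ha : ∀ k, MemLp (a k) 2) (hb : ∀ k, MemLp (b k) 2)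
    (hc : ∀ k, MemLp (c k) 2) (hB : ∑ l ∈ Finset.range N, ∫⁻ ζ, ‖b l ζ‖ₑ ^ 2 ≤ B ^ 2)
    (hC : ∑ n ∈ Finset.range (2 * N), ∫⁻ ζ, ‖c n ζ‖ₑ ^ 2 ≤ C ^ 2)
    {m : ℕ → ℕ → ℝ × ℝ → ℂ} {ε : ℝ → ℝ≥0∞} (hε : Measurable ε)
    (hm : ∀ k l z, a k z.1 ≠ 0 → b l z.2 ≠ 0 → c (k + l) (z.1 + z.2) ≠ 0 → ‖m k l z‖ₑ ≤ ε z.1) :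
    ‖pairing β N m a b c‖ₑ ≤ ENNReal.ofReal K *
      ((∫⁻ η, ε η * ENNReal.ofReal (rms N fun k => a k η)) * (B * C)) := by
  have hca : AEMeasurable (fun z : ℝ × ℝ => ENNReal.ofReal (rms (2 * N) fun n => c n (z.1 + z.2)))
      volume :=
    (aemeasurable_rms (N := 2 * N) fun n => (hc n).1).ennreal_ofReal.comp_quasiMeasurePreserving
      (quasiMeasurePreserving_add volume volume)
  have hba : AEMeasurable (fun z : ℝ × ℝ => ENNReal.ofReal (rms N fun l => b l z.2)) volume :=
    (aemeasurable_rms (N := N) fun n => (hb n).1).ennreal_ofReal.comp_quasiMeasurePreserving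
      Measure.quasiMeasurePreserving_snd
  have haa' : AEMeasurable (fun η : ℝ => ε η * ENNReal.ofReal (rms N fun k => a k η)) volume :=
    hε.aemeasurable.mul (aemeasurable_rms (N := N) fun n => (ha n).1).ennreal_ofReal
  have haa : AEMeasurable (fun z : ℝ × ℝ => ε z.1 * ENNReal.ofReal (rms N fun k => a k z.1)) volume :=
    haa'.comp_quasiMeasurePreserving Measure.quasiMeasurePreserving_fst
  calc ‖pairing β N m a b c‖ₑ
      ≤ ∑ k ∈ Finset.range N, ∑ l ∈ Finset.range N, ∫⁻ z : ℝ × ℝ, ‖(β k l : ℂ)‖ₑ *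
          (ε z.1 * (‖a k z.1‖ₑ * (‖b l z.2‖ₑ * ‖c (k + l) (z.1 + z.2)‖ₑ))) := by
        unfold pairing
        refine (enorm_sum_le _ _).trans (Finset.sum_le_sum fun k _ => ?_)
        refine (enorm_sum_le _ _).trans (Finset.sum_le_sum fun l _ => ?_)
        rw [enorm_mul, lintegral_const_mul' _ _ enorm_ne_top]
        refine mul_le_mul_right ((enorm_integral_le_lintegral_enorm _).trans
          (lintegral_mono fun z => ?_)) _
        simp only [enorm_mul, RCLike.enorm_conj]
        by_cases h1 : a k z.1 = 0
        · simp [h1]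
        by_cases h2 : b l z.2 = 0
        · simp [h2]
        by_cases h3 : c (k + l) (z.1 + z.2) = 0
        · simp [h3]
        exact mul_le_mul_left (hm k l z h1 h2 h3) _
    _ ≤ ∫⁻ z : ℝ × ℝ, ∑ k ∈ Finset.range N, ∑ l ∈ Finset.range N, ‖(β k l : ℂ)‖ₑ *
          (ε z.1 * (‖a k z.1‖ₑ * (‖b l z.2‖ₑ * ‖c (k + l) (z.1 + z.2)‖ₑ))) :=
        (Finset.sum_le_sum fun k _ => sum_lintegral_le _ _).trans (sum_lintegral_le _ _)
    _ ≤ ∫⁻ z : ℝ × ℝ, ENNReal.ofReal K * ((ε z.1 * ENNReal.ofReal (rms N fun k => a k z.1)) *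
          (ENNReal.ofReal (rms N fun l => b l z.2) *
            ENNReal.ofReal (rms (2 * N) fun n => c n (z.1 + z.2)))) := by
        refine lintegral_mono fun z => ?_
        have h := mul_le_mul_right (hβ.enorm_le N (fun k => a k z.1) (fun l => b l z.2)
          (fun n => c n (z.1 + z.2))) (ε z.1)
        refine (le_of_eq ?_).trans (h.trans (le_of_eq ?_))
        · simp only [Finset.mul_sum]
          refine Finset.sum_congr rfl fun k _ => Finset.sum_congr rfl fun l _ => by ring
        · ring
    _ = ENNReal.ofReal K * ∫⁻ η, (ε η * ENNReal.ofReal (rms N fun k => a k η)) *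
          ∫⁻ ζ, ENNReal.ofReal (rms N fun l => b l ζ) *
            ENNReal.ofReal (rms (2 * N) fun n => c n (η + ζ)) := by
        have e := lintegral_plane (haa.mul (hba.mul hca))
        simp only [Pi.mul_apply] at e
        rw [lintegral_const_mul' _ _ ENNReal.ofReal_ne_top, e]
        congr 1
        refine lintegral_congr fun η => ?_
        refine lintegral_const_mul'' _ ?_
        exact ((aemeasurable_rms (N := N) fun n => (hb n).1).ennreal_ofReal).mul
          (aemeasurable_rms (N := 2 * N) fun n => (memLp_translate (hc n) η).1).ennreal_ofReal
    _ ≤ ENNReal.ofReal K * ∫⁻ η, (ε η * ENNReal.ofReal (rms N fun k => a k η)) * (B * C) := by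
        refine mul_le_mul_right (lintegral_mono fun η => mul_le_mul_right ?_ _) _
        refine lintegral_rms_mul_rms_le (fun l => (hb l).1) (fun n => (memLp_translate (hc n) η).1) hB ?_
        refine (le_of_eq ?_).trans hC
        exact Finset.sum_congr rfl fun n _ => lintegral_add_left_eq_self (fun ζ => ‖c n ζ‖ₑ ^ 2) η
    _ = _ := by rw [lintegral_mul_const'' _ haa']

theorem lintegral_fourierInv_sq {b : ℝ → ℂ} (hb : MemLp b 2) :
    ∫⁻ x, ‖(𝓕⁻ (toL2 b) : L2x) x‖ₑ ^ 2 = ∫⁻ ζ, ‖b ζ‖ₑ ^ 2 := by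
  rw [← enorm_sq_eq_lintegral, ← ofReal_norm, norm_fourierInv_L2, ofReal_norm,
    enorm_sq_eq_lintegral]
  refine lintegral_congr_ae ?_
  filter_upwards [coeFn_toL2 hb] with ζ hζ
  rw [hζ]

/-- The estimate of the form without multipliers. -/
theorem pairing_one_le {β : ℕ → ℕ → ℝ} {K : ℝ} (hβ : TrilinearBound β K) {N : ℕ}
    {a b c : ℕ → ℝ → ℂ} {W B C : ℝ≥0∞} (ha : LowFamily N a W) (hW : W ≠ ⊤)
    (hb : ∀ k, MemLp (b k) 2) (hc : ∀ k, MemLp (c k) 2)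
    (hB : ∑ l ∈ Finset.range N, ∫⁻ ζ, ‖b l ζ‖ₑ ^ 2 ≤ B ^ 2)
    (hC : ∑ n ∈ Finset.range (2 * N), ∫⁻ ζ, ‖c n ζ‖ₑ ^ 2 ≤ C ^ 2) :
    ‖pairing β N (fun _ _ _ => 1) a b c‖ₑ ≤ ENNReal.ofReal K * (W * (B * C)) := by
  have e : ∀ k ∈ Finset.range N, ∀ l,
      ∫ z : ℝ × ℝ, (1 : ℂ) * (a k z.1 * (b l z.2 * (starRingEnd ℂ) (c (k + l) (z.1 + z.2)))) =
      ∫ x, 𝓕⁻ (a k) x * ((𝓕⁻ (toL2 (b l)) : L2x) x *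
        (starRingEnd ℂ) ((𝓕⁻ (toL2 (c (k + l))) : L2x) x)) := by
    intro k hk l
    rw [integral_fourierInv_mul_mul_conj (ha.integrable hW (Finset.mem_range.1 hk))]
    refine integral_congr_ae ?_
    have h1 := Measure.quasiMeasurePreserving_snd (μ := (volume : Measure ℝ))
      (ν := (volume : Measure ℝ)) |>.ae (coeFn_toL2 (hb l))
    have h2 := (quasiMeasurePreserving_add (volume : Measure ℝ) volume).ae (coeFn_toL2 (hc (k + l)))
    filter_upwards [h1, h2] with z h1 h2
    rw [h1, h2, one_mul]
  calc ‖pairing β N (fun _ _ _ => 1) a b c‖ₑ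
      ≤ ∑ k ∈ Finset.range N, ∑ l ∈ Finset.range N, ∫⁻ x, ‖(β k l : ℂ)‖ₑ *
          (‖𝓕⁻ (a k) x‖ₑ * (‖(𝓕⁻ (toL2 (b l)) : L2x) x‖ₑ *
            ‖(𝓕⁻ (toL2 (c (k + l))) : L2x) x‖ₑ)) := by
        unfold pairing
        refine (enorm_sum_le _ _).trans (Finset.sum_le_sum fun k hk => ?_)
        refine (enorm_sum_le _ _).trans (Finset.sum_le_sum fun l _ => ?_)
        rw [enorm_mul, lintegral_const_mul' _ _ enorm_ne_top, e k hk]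
        refine mul_le_mul_right ((enorm_integral_le_lintegral_enorm _).trans
          (le_of_eq (lintegral_congr fun z => ?_))) _
        simp only [enorm_mul, RCLike.enorm_conj]
    _ ≤ ∫⁻ x, ∑ k ∈ Finset.range N, ∑ l ∈ Finset.range N, ‖(β k l : ℂ)‖ₑ *
          (‖𝓕⁻ (a k) x‖ₑ * (‖(𝓕⁻ (toL2 (b l)) : L2x) x‖ₑ *
            ‖(𝓕⁻ (toL2 (c (k + l))) : L2x) x‖ₑ)) :=
        (Finset.sum_le_sum fun k _ => sum_lintegral_le _ _).trans (sum_lintegral_le _ _)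
    _ ≤ ∫⁻ x, ENNReal.ofReal K * (W * (ENNReal.ofReal (rms N fun l => (𝓕⁻ (toL2 (b l)) : L2x) x) *
          ENNReal.ofReal (rms (2 * N) fun n => (𝓕⁻ (toL2 (c n)) : L2x) x))) := by
        refine lintegral_mono fun x => ?_
        refine (hβ.enorm_le N (fun k => 𝓕⁻ (a k) x) (fun l => (𝓕⁻ (toL2 (b l)) : L2x) x)
          (fun n => (𝓕⁻ (toL2 (c n)) : L2x) x)).trans ?_
        exact mul_le_mul_right (mul_le_mul_left (ha.rms_fourierInv_le hW x) _) _
    _ ≤ _ := by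
        rw [lintegral_const_mul' _ _ ENNReal.ofReal_ne_top, lintegral_const_mul' _ _ hW]
        refine mul_le_mul_right (mul_le_mul_right ?_ _) _
        refine lintegral_rms_mul_rms_le (fun l => Lp.aestronglyMeasurable _)
          (fun n => Lp.aestronglyMeasurable _) ?_ ?_
        · simpa only [lintegral_fourierInv_sq (hb _)] using hB
        · simpa only [lintegral_fourierInv_sq (hc _)] using hC

/-! ### Pairings with unimodular multipliers -/

theorem pairing_congr {β : ℕ → ℕ → ℝ} {N : ℕ} {m m' : ℕ → ℕ → ℝ × ℝ → ℂ}
    {a b c a' b' c' : ℕ → ℝ → ℂ}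
    (h : ∀ k l z, m k l z * (a k z.1 * (b l z.2 * (starRingEnd ℂ) (c (k + l) (z.1 + z.2)))) =
      m' k l z * (a' k z.1 * (b' l z.2 * (starRingEnd ℂ) (c' (k + l) (z.1 + z.2))))) :
    pairing β N m a b c = pairing β N m' a' b' c' := by
  unfold pairing
  refine Finset.sum_congr rfl fun k _ => Finset.sum_congr rfl fun l _ => ?_
  simp only [h]

theorem pairing_add {β : ℕ → ℕ → ℝ} {N : ℕ} {m m' : ℕ → ℕ → ℝ × ℝ → ℂ} {a b c : ℕ → ℝ → ℂ}
    (h : ∀ k < N, ∀ l, Integrable (fun z : ℝ × ℝ =>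
      m k l z * (a k z.1 * (b l z.2 * (starRingEnd ℂ) (c (k + l) (z.1 + z.2))))) volume)
    (h' : ∀ k < N, ∀ l, Integrable (fun z : ℝ × ℝ =>
      m' k l z * (a k z.1 * (b l z.2 * (starRingEnd ℂ) (c (k + l) (z.1 + z.2))))) volume) :
    pairing β N (fun k l z => m k l z + m' k l z) a b c =
      pairing β N m a b c + pairing β N m' a b c := by
  unfold pairing
  rw [← Finset.sum_add_distrib]
  refine Finset.sum_congr rfl fun k hk => ?_
  rw [← Finset.sum_add_distrib]
  refine Finset.sum_congr rfl fun l _ => ?_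
  simp only [add_mul]
  rw [integral_add (h k (Finset.mem_range.1 hk) l) (h' k (Finset.mem_range.1 hk) l), mul_add]

theorem sum_lintegral_mul_le {b : ℕ → ℝ → ℂ} {N : ℕ} {B : ℝ≥0∞} {m : ℕ → ℝ → ℂ}
    (hB : ∑ l ∈ Finset.range N, ∫⁻ ζ, ‖b l ζ‖ₑ ^ 2 ≤ B ^ 2) {r : ℝ≥0∞} (hm : ∀ l ζ, ‖m l ζ‖ₑ ≤ r)
    (hr : r ≠ ⊤) :
    ∑ l ∈ Finset.range N, ∫⁻ ζ, ‖m l ζ * b l ζ‖ₑ ^ 2 ≤ (r * B) ^ 2 := by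
  rw [mul_pow]
  refine le_trans ?_ (mul_le_mul_right hB _)
  rw [Finset.mul_sum]
  refine Finset.sum_le_sum fun l _ => ?_
  rw [← lintegral_const_mul' _ _ (ENNReal.pow_ne_top hr)]
  refine lintegral_mono fun ζ => ?_
  rw [enorm_mul, mul_pow]
  exact mul_le_mul_left (pow_le_pow_left₀ (by positivity) (hm l ζ) 2) _

theorem memLp_mul_of_norm_le {b m : ℝ → ℂ} (hb : MemLp b 2) (hm : Measurable m) {r : ℝ}
    (h : ∀ ζ, ‖m ζ‖ ≤ r) : MemLp (fun ζ => m ζ * b ζ) 2 := by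
  refine MemLp.of_le_mul (c := r) hb (hm.aestronglyMeasurable.mul hb.1)
    (Filter.Eventually.of_forall fun ζ => ?_)
  rw [norm_mul]
  exact mul_le_mul_of_nonneg_right (h ζ) (norm_nonneg _)

theorem lintegral_poisson : ∫⁻ τ : ℝ, ‖((Real.pi⁻¹ * (1 + τ ^ 2)⁻¹ : ℝ) : ℂ)‖ₑ = 1 := by
  have hπ := Real.pi_pos
  have e : ∀ τ : ℝ, ‖((Real.pi⁻¹ * (1 + τ ^ 2)⁻¹ : ℝ) : ℂ)‖ₑ =
      ENNReal.ofReal (Real.pi⁻¹ * (1 + τ ^ 2)⁻¹) := fun τ => by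
    rw [← ofReal_norm, Complex.norm_real, Real.norm_of_nonneg (by positivity)]
  simp only [e]
  rw [← ofReal_integral_eq_lintegral_ofReal (integrable_inv_one_add_sq.const_mul _)
    (Filter.Eventually.of_forall fun τ => by positivity), integral_const_mul,
    integral_univ_inv_one_add_sq, inv_mul_cancel₀ hπ.ne']
  simp

/-- Multipliers `exp (A_{k+l}(η + ζ) - E_k - D_l(ζ)) ≤ 1` are superpositions of products of
unimodular multipliers. -/
theorem pairing_exp_le {β : ℕ → ℕ → ℝ} {K : ℝ} (hβ : TrilinearBound β K) {N : ℕ}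
    {a b c : ℕ → ℝ → ℂ} {W B C : ℝ≥0∞} (ha : LowFamily N a W) (hW : W ≠ ⊤)
    (hb : ∀ k, MemLp (b k) 2) (hc : ∀ k, MemLp (c k) 2)
    (hB : ∑ l ∈ Finset.range N, ∫⁻ ζ, ‖b l ζ‖ₑ ^ 2 ≤ B ^ 2)
    (hC : ∑ n ∈ Finset.range (2 * N), ∫⁻ ζ, ‖c n ζ‖ₑ ^ 2 ≤ C ^ 2)
    {A D : ℕ → ℝ → ℝ} {E : ℕ → ℝ} (hA : ∀ n, Measurable (A n)) (hD : ∀ l, Measurable (D l))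
    (hy : ∀ (k l : ℕ) (z : ℝ × ℝ), a k z.1 ≠ 0 → b l z.2 ≠ 0 → c (k + l) (z.1 + z.2) ≠ 0 →
      A (k + l) (z.1 + z.2) - E k - D l z.2 ≤ 0) :
    ‖pairing β N (fun k l z => (Real.exp (A (k + l) (z.1 + z.2) - E k - D l z.2) : ℂ)) a b c‖ₑ ≤
      ENNReal.ofReal K * (W * (B * C)) := by
  set p : ℝ → ℂ := fun τ => ((Real.pi⁻¹ * (1 + τ ^ 2)⁻¹ : ℝ) : ℂ) with hp
  have hpi : Integrable p := (integrable_inv_one_add_sq.const_mul _).ofReal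
  set F : ℕ → ℕ → ℝ × ℝ → ℂ := fun k l z =>
    a k z.1 * (b l z.2 * (starRingEnd ℂ) (c (k + l) (z.1 + z.2))) with hF
  set y : ℕ → ℕ → ℝ × ℝ → ℝ := fun k l z => A (k + l) (z.1 + z.2) - E k - D l z.2 with hyy
  have hym : ∀ k l, Measurable (y k l) := fun k l =>
    (((hA _).comp (measurable_fst.add measurable_snd)).sub_const _).sub ((hD l).comp measurable_snd)
  have hFi : ∀ k < N, ∀ l, Integrable (F k l) volume := fun k hk l =>
    integrable_trilinear (ha.integrable hW hk) (hb l) (hc _)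
  have hG : ∀ k < N, ∀ l, Integrable (fun q : (ℝ × ℝ) × ℝ =>
      Complex.exp ((q.2 * y k l q.1 : ℝ) * Complex.I) * (F k l q.1 * p q.2))
      ((volume : Measure (ℝ × ℝ)).prod volume) := by
    intro k hk l
    refine ((hFi k hk l).mul_prod hpi).bdd_mul (c := 1) ?_ (Filter.Eventually.of_forall fun q => ?_)
    · have := hym k l
      exact Measurable.aestronglyMeasurable (by fun_prop)
    · rw [Complex.norm_exp_ofReal_mul_I]
  have e1 : ∀ k < N, ∀ l, ∫ z : ℝ × ℝ, (Real.exp (y k l z) : ℂ) * F k l z =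
      ∫ τ : ℝ, p τ * ∫ z : ℝ × ℝ, Complex.exp ((τ * y k l z : ℝ) * Complex.I) * F k l z := by
    intro k hk l
    have e2 : ∀ z, (Real.exp (y k l z) : ℂ) * F k l z =
        ∫ τ : ℝ, Complex.exp ((τ * y k l z : ℝ) * Complex.I) * (F k l z * p τ) := by
      intro z
      by_cases h0 : F k l z = 0
      · simp [h0]
      have h1 : a k z.1 ≠ 0 := left_ne_zero_of_mul h0
      have h2 : b l z.2 ≠ 0 := left_ne_zero_of_mul (right_ne_zero_of_mul h0)
      have h3 : c (k + l) (z.1 + z.2) ≠ 0 := by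
        intro h
        apply h0
        simp [hF, h]
      rw [exp_eq_integral_poisson (hy k l z h1 h2 h3), ← integral_mul_const]
      refine integral_congr_ae (Filter.Eventually.of_forall fun τ => ?_)
      simp only [hp]
      ring
    simp only [e2]
    rw [integral_integral_swap (hG k hk l)]
    refine integral_congr_ae (Filter.Eventually.of_forall fun τ => ?_)
    simp only
    rw [← integral_const_mul]
    refine integral_congr_ae (Filter.Eventually.of_forall fun z => ?_)
    simp only
    ring
  have hint : ∀ k < N, ∀ l, Integrable fun τ : ℝ => p τ *
      ∫ z : ℝ × ℝ, Complex.exp ((τ * y k l z : ℝ) * Complex.I) * F k l z := by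
    intro k hk l
    refine (hG k hk l).integral_prod_right.congr (Filter.Eventually.of_forall fun τ => ?_)
    simp only
    rw [← integral_const_mul]
    refine integral_congr_ae (Filter.Eventually.of_forall fun z => ?_)
    simp only
    ring
  have e3 : pairing β N (fun k l z => (Real.exp (y k l z) : ℂ)) a b c =
      ∫ τ : ℝ, p τ *
        pairing β N (fun k l z => Complex.exp ((τ * y k l z : ℝ) * Complex.I)) a b c := by
    unfold pairing
    simp only [Finset.mul_sum]
    rw [integral_finsetSum]
    · refine Finset.sum_congr rfl fun k hk => ?_
      rw [integral_finsetSum]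
      · refine Finset.sum_congr rfl fun l _ => ?_
        rw [e1 k (Finset.mem_range.1 hk) l, ← integral_const_mul]
        refine integral_congr_ae (Filter.Eventually.of_forall fun τ => ?_)
        simp only [hF]
        ring
      · intro l _
        refine ((hint k (Finset.mem_range.1 hk) l).const_mul (β k l : ℂ)).congr
          (Filter.Eventually.of_forall fun τ => ?_)
        simp only [hF]
        ring
    · intro k hk
      refine integrable_finsetSum _ fun l _ => ?_
      refine ((hint k (Finset.mem_range.1 hk) l).const_mul (β k l : ℂ)).congr
          (Filter.Eventually.of_forall fun τ => ?_)
      simp only [hF]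
      ring
  have huni : ∀ x : ℝ, ‖Complex.exp ((x : ℂ) * Complex.I)‖ₑ = 1 := fun x => by
    rw [← ofReal_norm, Complex.norm_exp_ofReal_mul_I, ENNReal.ofReal_one]
  have key : ∀ τ : ℝ,
      ‖pairing β N (fun k l z => Complex.exp ((τ * y k l z : ℝ) * Complex.I)) a b c‖ₑ ≤
      ENNReal.ofReal K * (W * (B * C)) := by
    intro τ
    have e4 : pairing β N (fun k l z => Complex.exp ((τ * y k l z : ℝ) * Complex.I)) a b c =
        pairing β N (fun _ _ _ => 1)
          (fun k η => Complex.exp ((-(τ * E k) : ℝ) * Complex.I) * (((1 : ℝ) : ℂ) * a k η))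
          (fun l ζ => Complex.exp ((-(τ * D l ζ) : ℝ) * Complex.I) * b l ζ)
          (fun n ξ => Complex.exp ((-(τ * A n ξ) : ℝ) * Complex.I) * c n ξ) := by
      refine pairing_congr fun k l z => ?_
      have : Complex.exp ((τ * y k l z : ℝ) * Complex.I) =
          Complex.exp ((-(τ * E k) : ℝ) * Complex.I) * (Complex.exp ((-(τ * D l z.2) : ℝ) * Complex.I) *
            (starRingEnd ℂ) (Complex.exp ((-(τ * A (k + l) (z.1 + z.2)) : ℝ) * Complex.I))) := by
        rw [← Complex.exp_conj, ← Complex.exp_add, ← Complex.exp_add]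
        congr 1
        simp [hyy]
        ring
      rw [this, map_mul]
      push_cast
      ring
    rw [e4]
    refine pairing_one_le hβ (ha.mul (fun k => by rw [Complex.norm_exp_ofReal_mul_I])
      measurable_const (fun _ => by simp)) hW ?_ ?_ ?_ ?_
    · intro l
      have := hD l
      exact memLp_mul_of_norm_le (hb l) (by fun_prop) (r := 1)
        fun ζ => by rw [Complex.norm_exp_ofReal_mul_I]
    · intro n
      have := hA n
      exact memLp_mul_of_norm_le (hc n) (by fun_prop) (r := 1)
        fun ζ => by rw [Complex.norm_exp_ofReal_mul_I]
    · simpa using sum_lintegral_mul_le hB (r := 1)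
        (m := fun l ζ => Complex.exp ((-(τ * D l ζ) : ℝ) * Complex.I))
        (fun l ζ => (huni _).le) ENNReal.one_ne_top
    · simpa using sum_lintegral_mul_le hC (r := 1)
        (m := fun l ζ => Complex.exp ((-(τ * A l ζ) : ℝ) * Complex.I))
        (fun l ζ => (huni _).le) ENNReal.one_ne_top
  rw [e3]
  refine (enorm_integral_le_lintegral_enorm _).trans ?_
  calc _ ≤ ∫⁻ τ : ℝ, ‖p τ‖ₑ * (ENNReal.ofReal K * (W * (B * C))) := by
        refine lintegral_mono fun τ => ?_
        rw [enorm_mul]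
        exact mul_le_mul_right (key τ) _
    _ = _ := by
        rw [lintegral_mul_const'' _ hpi.aestronglyMeasurable.enorm, hp, lintegral_poisson, one_mul]

/-! ### Summation over dyadic shells -/

theorem sum_shell_weight_le {r y : ℝ} (hr : 1 < r) (hy : 0 ≤ y) (n : ℕ) :
    ∑ q ∈ Finset.range n, y * r ^ q / (1 + y * r ^ q) ^ 2 ≤ r / (r - 1) := by
  have hr0 : 0 < r - 1 := by linarith
  have h : ∀ q : ℕ, y * r ^ q / (1 + y * r ^ q) ^ 2 ≤ r / (r - 1) *
      (y * r ^ (q + 1) / (1 + y * r ^ (q + 1)) - y * r ^ q / (1 + y * r ^ q)) := by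
    intro q
    set x := y * r ^ q with hx
    have hx0 : 0 ≤ x := by positivity
    have e : y * r ^ (q + 1) = r * x := by rw [hx]; ring
    rw [e]
    have e2 : r / (r - 1) * (r * x / (1 + r * x) - x / (1 + x)) = r * x / ((1 + x) * (1 + r * x)) := by
      have h1 : 1 + r * x ≠ 0 := by positivity
      have h2 : 1 + x ≠ 0 := by positivity
      field_simp
      ring
    rw [e2, div_le_div_iff₀ (by positivity) (by positivity)]
    nlinarith [mul_nonneg hx0 (by positivity : 0 ≤ 1 + x), mul_nonneg (mul_nonneg hx0 hr0.le) (by positivity : 0 ≤ 1 + x)]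
  refine (Finset.sum_le_sum fun q _ => h q).trans ?_
  rw [← Finset.mul_sum, Finset.sum_range_sub (fun q => y * r ^ q / (1 + y * r ^ q))]
  have h1 : y * r ^ n / (1 + y * r ^ n) ≤ 1 := by
    rw [div_le_one (by positivity)]; linarith
  have h2 : 0 ≤ y * r ^ 0 / (1 + y * r ^ 0) := by positivity
  calc _ ≤ r / (r - 1) * 1 := mul_le_mul_of_nonneg_left (by linarith) (by positivity)
    _ = _ := mul_one _

theorem lintegral_shell_weight_le {ρ t : ℝ} (hρ : 0 < ρ) (hρ1 : ρ < 1) (ht : 0 ≤ t)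
    {f : ℝ → ℝ≥0∞} {W : ℝ≥0∞} (hf : ∀ q, ∫⁻ η in shell q, f η ≤ W) :
    ∫⁻ η, ENNReal.ofReal (t * bracket (2 * Real.pi * η) ^ ρ /
        (1 + t * bracket (2 * Real.pi * η) ^ ρ) ^ 2) * f η ≤
      ENNReal.ofReal (2 * (2 ^ ρ / (2 ^ ρ - 1))) * W := by
  set r : ℝ := 2 ^ ρ with hr
  have hr1 : 1 < r := Real.one_lt_rpow one_lt_two hρ
  have hr2 : r ≤ 2 := by
    calc r ≤ 2 ^ (1 : ℝ) := Real.rpow_le_rpow_of_exponent_le (by norm_num) hρ1.le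
      _ = 2 := Real.rpow_one 2
  have hr0 : 0 < r - 1 := by linarith
  set g : ℕ → ℝ := fun q => t * r ^ q / (1 + t * r ^ q) ^ 2 with hg
  have hg0 : ∀ q, 0 ≤ g q := fun q => by positivity
  have hshell : ∀ q : ℕ, ∀ η ∈ shell q, t * bracket (2 * Real.pi * η) ^ ρ /
        (1 + t * bracket (2 * Real.pi * η) ^ ρ) ^ 2 ≤ 2 * g q := by
    intro q η hη
    have hb := bracket_pos (2 * Real.pi * η)
    have e : ∀ m : ℕ, ((2 : ℝ) ^ m) ^ ρ = r ^ m := fun m => by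
      rw [hr, ← Real.rpow_natCast, ← Real.rpow_natCast, ← Real.rpow_mul (by norm_num),
        ← Real.rpow_mul (by norm_num), mul_comm]
    have h1 : r ^ q ≤ bracket (2 * Real.pi * η) ^ ρ := by
      rw [← e]; exact Real.rpow_le_rpow (by positivity) hη.1 hρ.le
    have h2 : bracket (2 * Real.pi * η) ^ ρ ≤ 2 * r ^ q := by
      calc _ ≤ r ^ (q + 1) := by rw [← e]; exact Real.rpow_le_rpow hb.le hη.2.le hρ.le
        _ = r * r ^ q := by ring
        _ ≤ _ := mul_le_mul_of_nonneg_right hr2 (by positivity)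
    rw [hg]
    simp only
    rw [← mul_div_assoc]
    refine div_le_div₀ (by positivity) ?_ (by positivity) ?_
    · calc _ ≤ t * (2 * r ^ q) := mul_le_mul_of_nonneg_left h2 ht
        _ = _ := by ring
    · exact pow_le_pow_left₀ (by positivity)
        (by linarith [mul_le_mul_of_nonneg_left h1 ht]) 2
  calc _ = ∫⁻ η in ⋃ q, shell q, ENNReal.ofReal (t * bracket (2 * Real.pi * η) ^ ρ /
        (1 + t * bracket (2 * Real.pi * η) ^ ρ) ^ 2) * f η := by
        rw [iUnion_shell, setLIntegral_univ]
    _ ≤ ∑' q, ∫⁻ η in shell q, ENNReal.ofReal (t * bracket (2 * Real.pi * η) ^ ρ /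
        (1 + t * bracket (2 * Real.pi * η) ^ ρ) ^ 2) * f η := lintegral_iUnion_le _ _
    _ ≤ ∑' q, ENNReal.ofReal (2 * g q) * W := by
        refine ENNReal.tsum_le_tsum fun q => ?_
        calc _ ≤ ∫⁻ η in shell q, ENNReal.ofReal (2 * g q) * f η := by
              refine setLIntegral_mono' (measurableSet_shell q) fun η hη => ?_
              exact mul_le_mul_left (ENNReal.ofReal_le_ofReal (hshell q η hη)) _
          _ = ENNReal.ofReal (2 * g q) * ∫⁻ η in shell q, f η :=
              lintegral_const_mul' _ _ ENNReal.ofReal_ne_top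
          _ ≤ _ := mul_le_mul_right (hf q) _
    _ = (∑' q, ENNReal.ofReal (2 * g q)) * W := ENNReal.tsum_mul_right
    _ ≤ _ := by
        refine mul_le_mul_left ?_ _
        refine ENNReal.tsum_le_of_sum_range_le fun n => ?_
        rw [← ENNReal.ofReal_sum_of_nonneg fun q _ => by have := hg0 q; positivity]
        refine ENNReal.ofReal_le_ofReal ?_
        rw [← Finset.mul_sum]
        exact mul_le_mul_of_nonneg_left (sum_shell_weight_le hr1 ht n) (by norm_num)

/-! ### The pairing with the exponential weights -/

/-- The symbol of the exponential weight in the frequency variable of Mathlib. -/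
def weightFreq (s κ t : ℝ) (n : ℕ) (η : ℝ) : ℝ := weightSymbol s κ t n (2 * Real.pi * η)

/-- The quotient `𝒢_{k+l}(η + ζ) / (𝒢_k(η) 𝒢_l(ζ))`. -/
def weightRatio (s κ t : ℝ) (k l : ℕ) (z : ℝ × ℝ) : ℂ :=
  ((weightFreq s κ t (k + l) (z.1 + z.2) * (weightFreq s κ t k z.1)⁻¹ *
    (weightFreq s κ t l z.2)⁻¹ : ℝ) : ℂ)

theorem continuous_phase {s : ℝ} (hs : 0 < s) (n : ℕ) : Continuous (phase s n) := by
  have hb := continuous_bracket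
  unfold phase
  refine Continuous.rpow_const ?_ fun x => Or.inr (by positivity)
  exact continuous_const.add (hb.rpow_const fun x => Or.inr (by positivity))

theorem continuous_expRatio {κ : ℝ} (hκ : 0 < κ) : Continuous (expRatio κ) := by
  unfold expRatio
  exact Real.continuous_exp.div (by fun_prop) fun x => by positivity

theorem continuous_weightSymbol {s κ : ℝ} (hs : 0 < s) (hκ : 0 < κ) (t : ℝ) (n : ℕ) :
    Continuous (weightSymbol s κ t n) :=
  (continuous_expRatio hκ).comp (continuous_const.mul (continuous_phase hs n))

theorem continuous_weightFreq {s κ : ℝ} (hs : 0 < s) (hκ : 0 < κ) (t : ℝ) (n : ℕ) :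
    Continuous (weightFreq s κ t n) :=
  (continuous_weightSymbol hs hκ t n).comp (by fun_prop)

theorem weightSymbol_pos {κ : ℝ} (hκ : 0 < κ) (s t : ℝ) (n : ℕ) (ξ : ℝ) :
    0 < weightSymbol s κ t n ξ := expRatio_pos hκ _

theorem weightFreq_pos {κ : ℝ} (hκ : 0 < κ) (s t : ℝ) (n : ℕ) (η : ℝ) :
    0 < weightFreq s κ t n η := expRatio_pos hκ _

theorem mul_weightSymbol_le {κ : ℝ} (hκ : 0 < κ) (s t : ℝ) (n : ℕ) (ξ : ℝ) :
    κ * weightSymbol s κ t n ξ ≤ 1 := mul_expRatio_le hκ _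

theorem inv_weightSymbol_le {κ t : ℝ} (hκ : 0 < κ) (hκ1 : κ ≤ 1) (ht : 0 ≤ t) (s : ℝ) (n : ℕ)
    (ξ : ℝ) : (weightSymbol s κ t n ξ)⁻¹ ≤ 2 := by
  rw [weightSymbol_eq, inv_expRatio hκ]
  have : Real.exp (-(t * phase s n ξ)) ≤ 1 :=
    Real.exp_le_one_iff.2 (neg_nonpos.2 (mul_nonneg ht (phase_nonneg _ _ _)))
  linarith

theorem le_div_one_add_sq {Y : ℝ} (h0 : 0 ≤ Y) (h1 : Y ≤ 1) : Y ≤ 4 * (Y / (1 + Y) ^ 2) := by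
  rw [← mul_div_assoc, le_div_iff₀ (by positivity)]
  nlinarith [pow_le_pow_left₀ (by linarith : 0 ≤ 1 + Y) (by linarith : 1 + Y ≤ 2) 2]

theorem inv_le_div_one_add_sq {Y : ℝ} (h1 : 1 ≤ Y) : Y⁻¹ ≤ 4 * (Y / (1 + Y) ^ 2) := by
  have h0 : 0 < Y := by linarith
  rw [← mul_div_assoc, le_div_iff₀ (by positivity), inv_mul_le_iff₀ h0]
  nlinarith

/-- The bound of the quotient of the weights, and its approximations by products. -/
theorem weightRatio_approx {s : ℝ} (hs : 0 < s) (hs' : s < 1) {R : ℝ} (hR : 1 ≤ R) {κ t : ℝ}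
    (hκ : 0 < κ) (hκ1 : κ ≤ 1) (ht : 0 ≤ t) (k l : ℕ) (η ζ : ℝ) :
    let Y := t * bracket (2 * Real.pi * η) ^ gainExp s
    let G := weightFreq s κ t
    G (k + l) (η + ζ) * (G k η)⁻¹ * (G l ζ)⁻¹ ≤ 4 ∧
    (Y ≤ 1 → G (k + l) (η + ζ) * (G k 0)⁻¹ * (G l ζ)⁻¹ ≤ 4 * Real.exp 2 ∧
      |G (k + l) (η + ζ) * (G k η)⁻¹ * (G l ζ)⁻¹ - G (k + l) (η + ζ) * (G k 0)⁻¹ * (G l ζ)⁻¹| ≤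
        (32 * Real.exp 2 + 8 / ((1 - gainExp s) * R⁻¹ ^ gainExp s)) * (Y / (1 + Y) ^ 2)) ∧
    (1 < Y → bracket (2 * Real.pi * η) ≤ R * bracket (2 * Real.pi * ζ) →
      |G (k + l) (η + ζ) * (G k η)⁻¹ * (G l ζ)⁻¹ - κ * G (k + l) (η + ζ) * (G l ζ)⁻¹| ≤
        (32 * Real.exp 2 + 8 / ((1 - gainExp s) * R⁻¹ ^ gainExp s)) * (Y / (1 + Y) ^ 2)) := by
  intro Y G
  have hρ0 := gainExp_pos hs
  have hρ1 := gainExp_lt_one hs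
  have hb := bracket_pos (2 * Real.pi * η)
  have hb' := bracket_pos (2 * Real.pi * ζ)
  set x := t * phase s k (2 * Real.pi * η) with hx
  set x0 := t * phase s k (2 * Real.pi * 0) with hx0
  set y := t * phase s l (2 * Real.pi * ζ) with hy
  set z := t * phase s (k + l) (2 * Real.pi * (η + ζ)) with hz
  have hY0 : 0 ≤ Y := by positivity
  have ex : G k η = expRatio κ x := rfl
  have ex0 : G k 0 = expRatio κ x0 := rfl
  have ey : G l ζ = expRatio κ y := rfl
  have ez : G (k + l) (η + ζ) = expRatio κ z := rfl
  have hxn : 0 ≤ x := mul_nonneg ht (phase_nonneg _ _ _)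
  have hyn : 0 ≤ y := mul_nonneg ht (phase_nonneg _ _ _)
  have hzxy : z ≤ x + y := by
    rw [hz, hx, hy, ← mul_add, mul_add (2 * Real.pi)]
    exact mul_le_mul_of_nonneg_left (phase_add_le' hs hs' k l _ _) ht
  set c0 := (1 - gainExp s) * R⁻¹ ^ gainExp s with hc0
  have hRi : 0 < R⁻¹ := by positivity
  have hc0pos : 0 < c0 := mul_pos (by linarith) (by positivity)
  have hc01 : c0 ≤ 1 := by
    have : R⁻¹ ^ gainExp s ≤ 1 := Real.rpow_le_one hRi.le (inv_le_one_of_one_le₀ hR) hρ0.le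
    exact mul_le_one₀ (by linarith) (by positivity) this
  rw [ex, ex0, ey, ez]
  have h4 := expRatio_quotient_le hκ hκ1 hxn hyn hzxy
  have he : (0 : ℝ) < Real.exp 2 := Real.exp_pos 2
  have hq0 : 0 ≤ Y / (1 + Y) ^ 2 := by positivity
  refine ⟨h4, fun hY1 => ?_, fun hY1 hsupp => ?_⟩
  · have h1 : x0 ≤ x := by
      refine mul_le_mul_of_nonneg_left (phase_mono hs k ?_) ht
      simp
    have h2 : x ≤ x0 + 2 * Y := by
      have := phase_add_le' hs hs' k 0 (2 * Real.pi * 0) (2 * Real.pi * η)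
      rw [add_zero, mul_zero, zero_add] at this
      have h3 := phase_zero_le hs (2 * Real.pi * η)
      calc x ≤ t * (phase s k 0 + 2 * bracket (2 * Real.pi * η) ^ gainExp s) :=
            mul_le_mul_of_nonneg_left (by linarith) ht
        _ = _ := by rw [hx0, mul_zero]; ring
    obtain ⟨f1, f2⟩ := expRatio_quotient_freeze hκ h1 h2 h4
    refine ⟨f1.trans ?_, f2.trans ?_⟩
    · exact mul_le_mul_of_nonneg_left (Real.exp_le_exp.2 (by linarith)) (by norm_num)
    · have h5 : Real.exp (2 * Y) - 1 ≤ 2 * Y * Real.exp (2 * Y) := by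
        have h6 := Real.add_one_le_exp (-(2 * Y))
        have h7 : Real.exp (-(2 * Y)) * Real.exp (2 * Y) = 1 := by rw [← Real.exp_add]; simp
        nlinarith [Real.exp_pos (2 * Y)]
      have h6 : Real.exp (2 * Y) ≤ Real.exp 2 := Real.exp_le_exp.2 (by linarith)
      have h7 := le_div_one_add_sq hY0 hY1
      calc 4 * (Real.exp (2 * Y) - 1) ≤ 4 * (2 * Y * Real.exp 2) := by
            refine mul_le_mul_of_nonneg_left (h5.trans ?_) (by norm_num)
            exact mul_le_mul_of_nonneg_left h6 (by positivity)
        _ = 8 * Real.exp 2 * Y := by ring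
        _ ≤ 8 * Real.exp 2 * (4 * (Y / (1 + Y) ^ 2)) := mul_le_mul_of_nonneg_left h7 (by positivity)
        _ = 32 * Real.exp 2 * (Y / (1 + Y) ^ 2) := by ring
        _ ≤ _ := mul_le_mul_of_nonneg_right (le_add_of_nonneg_right (by positivity)) hq0
  · have h1 : Y ≤ x := mul_le_mul_of_nonneg_left (rpow_bracket_le_phase hs k _) ht
    have h2 : z ≤ x + y - c0 * Y := by
      have h3 := phase_add_le hs hs' k l (2 * Real.pi * η) (2 * Real.pi * ζ)
      have h4 : R⁻¹ * bracket (2 * Real.pi * η) ≤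
          min (bracket (2 * Real.pi * η)) (bracket (2 * Real.pi * ζ)) := by
        refine le_min ?_ ?_
        · exact mul_le_of_le_one_left hb.le (inv_le_one_of_one_le₀ hR)
        · rw [inv_mul_le_iff₀ (by linarith)]; exact hsupp
      have h5 : R⁻¹ ^ gainExp s * bracket (2 * Real.pi * η) ^ gainExp s ≤
          min (bracket (2 * Real.pi * η)) (bracket (2 * Real.pi * ζ)) ^ gainExp s := by
        rw [← Real.mul_rpow hRi.le hb.le]
        exact Real.rpow_le_rpow (by positivity) h4 hρ0.le
      have h6 := mul_le_mul_of_nonneg_left h5 (by linarith : 0 ≤ 1 - gainExp s)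
      calc z = t * phase s (k + l) (2 * Real.pi * η + 2 * Real.pi * ζ) := by rw [hz, mul_add]
        _ ≤ t * (phase s k (2 * Real.pi * η) + phase s l (2 * Real.pi * ζ) -
            (1 - gainExp s) * (R⁻¹ ^ gainExp s * bracket (2 * Real.pi * η) ^ gainExp s)) :=
          mul_le_mul_of_nonneg_left (by linarith) ht
        _ = _ := by rw [hc0]; ring
    refine (expRatio_quotient_sub_le hκ h2).trans ?_
    have hcY : 0 < c0 * Y := by positivity
    have h3 : Real.exp (-x) ≤ Real.exp (-(c0 * Y)) := Real.exp_le_exp.2 (by nlinarith)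
    have h5 : Real.exp (-(c0 * Y)) ≤ (c0 * Y)⁻¹ := by
      rw [Real.exp_neg]
      exact inv_anti₀ hcY (by linarith [Real.add_one_le_exp (c0 * Y)])
    have h6 := inv_le_div_one_add_sq hY1.le
    calc _ ≤ 2 * (c0 * Y)⁻¹ := by linarith
      _ = 2 / c0 * Y⁻¹ := by rw [mul_inv]; ring
      _ ≤ 2 / c0 * (4 * (Y / (1 + Y) ^ 2)) := mul_le_mul_of_nonneg_left h6 (by positivity)
      _ = 8 / c0 * (Y / (1 + Y) ^ 2) := by ring
      _ ≤ _ := mul_le_mul_of_nonneg_right (le_add_of_nonneg_left (by positivity)) hq0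

/-- The pairing with the exponential weights is bounded by the product of the norms, uniformly in
`t` and `κ`, if the frequency of the family `a` is dominated by that of `b`. -/
theorem exists_pairing_weightRatio_le {s : ℝ} (hs : 0 < s) (hs' : s < 1) {R : ℝ} (hR : 1 ≤ R) :
    ∃ C0 : ℝ≥0, ∀ (κ t : ℝ), 0 < κ → κ ≤ 1 → 0 ≤ t →
      ∀ (β : ℕ → ℕ → ℝ) (K : ℝ), TrilinearBound β K → ∀ (N : ℕ) (a b c : ℕ → ℝ → ℂ)
      (W B C : ℝ≥0∞), LowFamily N a W → W ≠ ⊤ → (∀ k, MemLp (b k) 2) → (∀ k, MemLp (c k) 2) →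
      ∑ l ∈ Finset.range N, ∫⁻ ζ, ‖b l ζ‖ₑ ^ 2 ≤ B ^ 2 →
      ∑ n ∈ Finset.range (2 * N), ∫⁻ ζ, ‖c n ζ‖ₑ ^ 2 ≤ C ^ 2 →
      (∀ (k l : ℕ) (z : ℝ × ℝ), a k z.1 ≠ 0 → b l z.2 ≠ 0 → c (k + l) (z.1 + z.2) ≠ 0 →
        bracket (2 * Real.pi * z.1) ≤ R * bracket (2 * Real.pi * z.2)) →
      ‖pairing β N (weightRatio s κ t) a b c‖ₑ ≤ C0 * (ENNReal.ofReal K * (W * (B * C))) := by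
  set ρ := gainExp s with hρ
  have hρ0 : 0 < ρ := gainExp_pos hs
  have hρ1 : ρ < 1 := gainExp_lt_one hs
  set C1 : ℝ := 32 * Real.exp 2 + 8 / ((1 - ρ) * R⁻¹ ^ ρ) with hC1
  have hC10 : 0 ≤ C1 := by
    have : 0 < 1 - ρ := by linarith
    positivity
  set C2 : ℝ := C1 * (2 * (2 ^ ρ / (2 ^ ρ - 1))) with hC2
  set B0 : ℝ := 4 * Real.exp 2 with hB0
  have hB0pos : 0 < B0 := by positivity
  refine ⟨C2.toNNReal + B0.toNNReal + 2, ?_⟩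
  intro κ t hκ hκ1 ht β K hβ N a b c W B C ha hW hb hc hB hC hsupp
  set G := weightFreq s κ t with hG
  have hGc : ∀ n, Continuous (G n) := fun n => continuous_weightFreq hs hκ t n
  have hGp : ∀ n η, 0 < G n η := fun n η => weightFreq_pos hκ s t n η
  set Y : ℝ → ℝ := fun η => t * bracket (2 * Real.pi * η) ^ ρ with hY
  have hbc : Continuous fun η : ℝ => bracket (2 * Real.pi * η) := continuous_bracket.comp (by fun_prop)
  have hYc : Continuous Y := continuous_const.mul (hbc.rpow_const fun x => Or.inr hρ0.le)
  have hY0 : ∀ η, 0 ≤ Y η := fun η => by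
    have := bracket_pos (2 * Real.pi * η)
    simp only [hY]; positivity
  have happrox := fun k l η ζ => weightRatio_approx hs hs' hR hκ hκ1 ht k l η ζ
  set rL : ℝ → ℝ := fun η => if Y η ≤ 1 then 1 else 0 with hrL
  set rH : ℝ → ℝ := fun η => if Y η ≤ 1 then 0 else 1 with hrH
  have hYle : MeasurableSet {η | Y η ≤ 1} := measurableSet_le hYc.measurable measurable_const
  have hrLm : Measurable rL := Measurable.ite hYle measurable_const measurable_const
  have hrHm : Measurable rH := Measurable.ite hYle measurable_const measurable_const
  have hrL1 : ∀ η, |rL η| ≤ 1 := fun η => by simp only [hrL]; split_ifs <;> simp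
  have hrH1 : ∀ η, |rH η| ≤ 1 := fun η => by simp only [hrH]; split_ifs <;> simp
  set Mt : ℕ → ℕ → ℝ × ℝ → ℝ := fun k l z => G (k + l) (z.1 + z.2) * (G k 0)⁻¹ * (G l z.2)⁻¹ with hMt
  set Mh : ℕ → ℕ → ℝ × ℝ → ℝ := fun k l z => κ * G (k + l) (z.1 + z.2) * (G l z.2)⁻¹ with hMh
  set mL : ℕ → ℕ → ℝ × ℝ → ℂ := fun k l z => ((rL z.1 * Mt k l z : ℝ) : ℂ) with hmL
  set mH : ℕ → ℕ → ℝ × ℝ → ℂ := fun k l z => ((rH z.1 * Mh k l z : ℝ) : ℂ) with hmH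
  set mE : ℕ → ℕ → ℝ × ℝ → ℂ := fun k l z => weightRatio s κ t k l z - (mL k l z + mH k l z) with hmE
  have hMpos : ∀ (k l : ℕ) (z : ℝ × ℝ), 0 ≤ G (k + l) (z.1 + z.2) * (G k z.1)⁻¹ * (G l z.2)⁻¹ := fun k l z => by
    have := hGp (k + l) (z.1 + z.2); have := hGp k z.1; have := hGp l z.2
    positivity
  have hinv2 : ∀ l ζ, (G l ζ)⁻¹ ≤ 2 := fun l ζ => inv_weightSymbol_le hκ hκ1 ht s l _
  have hκG : ∀ n ξ, κ * G n ξ ≤ 1 := fun n ξ => mul_weightSymbol_le hκ s t n _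
  have hsum : Continuous fun z : ℝ × ℝ => z.1 + z.2 := by fun_prop
  have hiG : ∀ n, Continuous fun η => (G n η)⁻¹ := fun n => (hGc n).inv₀ fun η => (hGp n η).ne'
  have hMtc : ∀ k l, Continuous (Mt k l) := fun k l =>
    (((hGc _).comp hsum).mul continuous_const).mul ((hiG l).comp continuous_snd)
  have hMhc : ∀ k l, Continuous (Mh k l) := fun k l =>
    (continuous_const.mul ((hGc _).comp hsum)).mul ((hiG l).comp continuous_snd)
  have hRc : ∀ k l, Continuous (weightRatio s κ t k l) := fun k l =>
    Complex.continuous_ofReal.comp ((((hGc _).comp hsum).mul ((hiG k).comp continuous_fst)).mul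
      ((hiG l).comp continuous_snd))
  have hmLm : ∀ k l, Measurable (mL k l) := fun k l =>
    Complex.measurable_ofReal.comp ((hrLm.comp measurable_fst).mul (hMtc k l).measurable)
  have hmHm : ∀ k l, Measurable (mH k l) := fun k l =>
    Complex.measurable_ofReal.comp ((hrHm.comp measurable_fst).mul (hMhc k l).measurable)
  have hMtp : ∀ k l z, 0 < Mt k l z := fun k l z => by
    have := hGp (k + l) (z.1 + z.2); have := hGp k 0; have := hGp l z.2
    simp only [hMt]; positivity
  have hMhp : ∀ k l z, 0 < Mh k l z := fun k l z => by
    have := hGp (k + l) (z.1 + z.2); have := hGp l z.2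
    simp only [hMh]; positivity
  have hmLb : ∀ k l z, ‖mL k l z‖ ≤ B0 := fun k l z => by
    simp only [hmL, hrL, Complex.norm_real, Real.norm_eq_abs]
    split_ifs with h
    · rw [one_mul, abs_of_pos (hMtp k l z)]
      exact ((happrox k l z.1 z.2).2.1 h).1
    · simpa using hB0pos.le
  have hmHb : ∀ k l z, ‖mH k l z‖ ≤ 2 := fun k l z => by
    simp only [hmH, hrH, Complex.norm_real, Real.norm_eq_abs]
    split_ifs with h
    · simp
    · rw [one_mul, abs_of_pos (hMhp k l z)]
      have := hGp l z.2
      calc Mh k l z ≤ 1 * 2 := mul_le_mul (hκG _ _) (hinv2 _ _) (by positivity) zero_le_one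
        _ = 2 := one_mul 2
  have hRb : ∀ k l z, ‖weightRatio s κ t k l z‖ ≤ 4 := fun k l z => by
    rw [weightRatio, Complex.norm_real, Real.norm_of_nonneg (hMpos k l z)]
    exact (happrox k l z.1 z.2).1
  have hF : ∀ k < N, ∀ l, Integrable (fun z : ℝ × ℝ =>
      a k z.1 * (b l z.2 * (starRingEnd ℂ) (c (k + l) (z.1 + z.2)))) volume := fun k hk l =>
    integrable_trilinear (ha.integrable hW hk) (hb l) (hc _)
  have hiL : ∀ k < N, ∀ l, Integrable (fun z : ℝ × ℝ => mL k l z *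
      (a k z.1 * (b l z.2 * (starRingEnd ℂ) (c (k + l) (z.1 + z.2))))) volume := fun k hk l =>
    (hF k hk l).bdd_mul (hmLm k l).aestronglyMeasurable (Filter.Eventually.of_forall (hmLb k l))
  have hiH : ∀ k < N, ∀ l, Integrable (fun z : ℝ × ℝ => mH k l z *
      (a k z.1 * (b l z.2 * (starRingEnd ℂ) (c (k + l) (z.1 + z.2))))) volume := fun k hk l =>
    (hF k hk l).bdd_mul (hmHm k l).aestronglyMeasurable (Filter.Eventually.of_forall (hmHb k l))
  have hiLH : ∀ k < N, ∀ l, Integrable (fun z : ℝ × ℝ => (mL k l z + mH k l z) *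
      (a k z.1 * (b l z.2 * (starRingEnd ℂ) (c (k + l) (z.1 + z.2))))) volume := fun k hk l => by
    simp only [add_mul]
    exact (hiL k hk l).add (hiH k hk l)
  have hiE : ∀ k < N, ∀ l, Integrable (fun z : ℝ × ℝ => mE k l z *
      (a k z.1 * (b l z.2 * (starRingEnd ℂ) (c (k + l) (z.1 + z.2))))) volume := fun k hk l => by
    have h1 := (hF k hk l).bdd_mul (hRc k l).aestronglyMeasurable
      (Filter.Eventually.of_forall (hRb k l))
    simp only [hmE, sub_mul _ (mL k l _ + mH k l _)]
    exact h1.sub (hiLH k hk l)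
  have hdec : pairing β N (weightRatio s κ t) a b c =
      pairing β N mE a b c + (pairing β N mL a b c + pairing β N mH a b c) := by
    rw [← pairing_add hiL hiH, ← pairing_add hiE hiLH]
    refine pairing_congr fun k l z => ?_
    simp only [hmE]
    ring
  have hEbound : ‖pairing β N mE a b c‖ₑ ≤
      ENNReal.ofReal C2 * (ENNReal.ofReal K * (W * (B * C))) := by
    have hYq : Continuous fun η => Y η / (1 + Y η) ^ 2 :=
      hYc.div ((continuous_const.add hYc).pow 2) fun η => by have := hY0 η; positivity
    refine (pairing_le_of_abs hβ ha.memLp hb hc hB hC (m := mE)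
      (ε := fun η => ENNReal.ofReal (C1 * (Y η / (1 + Y η) ^ 2)))
      (continuous_const.mul hYq).measurable.ennreal_ofReal ?_).trans ?_
    · intro k l z h1 h2 h3
      rw [← ofReal_norm]
      refine ENNReal.ofReal_le_ofReal ?_
      simp only [hmE, hmL, hmH, weightRatio, ← Complex.ofReal_add, ← Complex.ofReal_sub,
        Complex.norm_real, Real.norm_eq_abs, hrL, hrH]
      split_ifs with h
      · simpa using ((happrox k l z.1 z.2).2.1 h).2
      · simpa using (happrox k l z.1 z.2).2.2 (not_le.1 h) (hsupp k l z h1 h2 h3)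
    · have h1 := lintegral_shell_weight_le hρ0 hρ1 ht ha.lintegral_shell_le
      have e : ∀ η, ENNReal.ofReal (C1 * (Y η / (1 + Y η) ^ 2)) * ENNReal.ofReal (rms N fun k => a k η) =
          ENNReal.ofReal C1 * (ENNReal.ofReal (Y η / (1 + Y η) ^ 2) *
            ENNReal.ofReal (rms N fun k => a k η)) := fun η => by
        rw [ENNReal.ofReal_mul hC10, mul_assoc]
      simp only [e]
      rw [lintegral_const_mul' _ _ ENNReal.ofReal_ne_top, hC2, ENNReal.ofReal_mul hC10]
      calc _ ≤ ENNReal.ofReal K * (ENNReal.ofReal C1 *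
            (ENNReal.ofReal (2 * (2 ^ ρ / (2 ^ ρ - 1))) * W) * (B * C)) :=
            mul_le_mul_right (mul_le_mul_left (mul_le_mul_right h1 _) _) _
        _ = _ := by ring
  have hLbound : ‖pairing β N mL a b c‖ₑ ≤
      ENNReal.ofReal B0 * (ENNReal.ofReal K * (W * (B * C))) := by
    have e : pairing β N mL a b c = pairing β N (fun k l z => (Real.exp
        ((Real.log (G (k + l) (z.1 + z.2)) - Real.log B0) - Real.log (G k 0) -
          Real.log (G l z.2)) : ℂ))
        (fun k η => 1 * ((rL η : ℂ) * a k η)) b (fun n ξ => (B0 : ℂ) * c n ξ) := by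
      refine pairing_congr fun k l z => ?_
      have : Real.exp ((Real.log (G (k + l) (z.1 + z.2)) - Real.log B0) - Real.log (G k 0) -
          Real.log (G l z.2)) = Mt k l z * B0⁻¹ := by
        rw [Real.exp_sub, Real.exp_sub, Real.exp_sub, Real.exp_log (hGp _ _), Real.exp_log hB0pos,
          Real.exp_log (hGp _ _), Real.exp_log (hGp _ _)]
        simp only [hMt]
        field_simp
      rw [this]
      have hB0c : (B0 : ℂ) ≠ 0 := by exact_mod_cast hB0pos.ne'
      simp only [hmL, map_mul, Complex.conj_ofReal]
      push_cast
      field_simp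
    rw [e]
    have hC' : ∑ n ∈ Finset.range (2 * N), ∫⁻ ξ, ‖(B0 : ℂ) * c n ξ‖ₑ ^ 2 ≤
        (ENNReal.ofReal B0 * C) ^ 2 := by
      refine sum_lintegral_mul_le hC (m := fun _ _ => (B0 : ℂ)) (fun l ζ => ?_) ENNReal.ofReal_ne_top
      rw [← ofReal_norm, Complex.norm_real, Real.norm_of_nonneg hB0pos.le]
    refine (pairing_exp_le hβ (ha.mul (u := fun _ => 1) (fun k => by simp) hrLm hrL1) hW hb
      (fun n => (hc n).const_mul _) hB hC'
      (A := fun n ξ => Real.log (G n ξ) - Real.log B0) (D := fun l ζ => Real.log (G l ζ))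
      (E := fun k => Real.log (G k 0))
      (fun n => (Real.measurable_log.comp (hGc n).measurable).sub_const _)
      (fun n => Real.measurable_log.comp (hGc n).measurable) ?_).trans (le_of_eq (by ring))
    intro k l z h1 _ _
    have hYz : Y z.1 ≤ 1 := by
      by_contra h
      simp [hrL, h] at h1
    have h2 := ((happrox k l z.1 z.2).2.1 hYz).1
    have h3 : Real.log (Mt k l z) ≤ Real.log B0 := Real.log_le_log (hMtp k l z) h2
    have h4 : Real.log (Mt k l z) = Real.log (G (k + l) (z.1 + z.2)) - Real.log (G k 0) -
        Real.log (G l z.2) := by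
      simp only [hMt]
      rw [Real.log_mul (mul_pos (hGp _ _) (inv_pos.2 (hGp _ _))).ne' (inv_pos.2 (hGp _ _)).ne',
        Real.log_mul (hGp _ _).ne' (inv_pos.2 (hGp _ _)).ne', Real.log_inv, Real.log_inv]
      ring
    linarith
  have hHbound : ‖pairing β N mH a b c‖ₑ ≤ 2 * (ENNReal.ofReal K * (W * (B * C))) := by
    have e : pairing β N mH a b c = pairing β N (fun _ _ _ => 1)
        (fun k η => 1 * ((rH η : ℂ) * a k η)) (fun l ζ => (((G l ζ)⁻¹ : ℝ) : ℂ) * b l ζ)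
        (fun n ξ => ((κ * G n ξ : ℝ) : ℂ) * c n ξ) := by
      refine pairing_congr fun k l z => ?_
      simp only [hmH, hMh, map_mul, Complex.conj_ofReal]
      push_cast
      ring
    rw [e]
    have hGi : ∀ l ζ, ‖(((G l ζ)⁻¹ : ℝ) : ℂ)‖ ≤ 2 := fun l ζ => by
      rw [Complex.norm_real, Real.norm_of_nonneg (inv_pos.2 (hGp l ζ)).le]
      exact hinv2 l ζ
    have hGk : ∀ l ζ, ‖((κ * G l ζ : ℝ) : ℂ)‖ ≤ 1 := fun l ζ => by
      rw [Complex.norm_real, Real.norm_of_nonneg (mul_pos hκ (hGp l ζ)).le]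
      exact hκG l ζ
    have hB' : ∑ l ∈ Finset.range N, ∫⁻ ζ, ‖(((G l ζ)⁻¹ : ℝ) : ℂ) * b l ζ‖ₑ ^ 2 ≤ (2 * B) ^ 2 := by
      refine sum_lintegral_mul_le hB (m := fun l ζ => (((G l ζ)⁻¹ : ℝ) : ℂ)) (fun l ζ => ?_) (by simp)
      rw [← ofReal_norm]
      exact (ENNReal.ofReal_le_ofReal (hGi l ζ)).trans (by simp)
    have hC' : ∑ n ∈ Finset.range (2 * N), ∫⁻ ζ, ‖((κ * G n ζ : ℝ) : ℂ) * c n ζ‖ₑ ^ 2 ≤ (1 * C) ^ 2 := by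
      refine sum_lintegral_mul_le hC (m := fun l ζ => ((κ * G l ζ : ℝ) : ℂ)) (fun l ζ => ?_) (by simp)
      rw [← ofReal_norm]
      exact (ENNReal.ofReal_le_ofReal (hGk l ζ)).trans (by simp)
    refine (pairing_one_le hβ (ha.mul (u := fun _ => 1) (fun k => by simp) hrHm hrH1) hW
      (fun l => memLp_mul_of_norm_le (hb l)
        (Complex.measurable_ofReal.comp (hiG l).measurable) (hGi l))
      (fun n => memLp_mul_of_norm_le (hc n)
        (Complex.measurable_ofReal.comp (measurable_const.mul (hGc n).measurable)) (hGk n))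
      hB' hC').trans (le_of_eq (by ring))
  rw [hdec]
  refine (enorm_add_le _ _).trans ((add_le_add hEbound ((enorm_add_le _ _).trans
    (add_le_add hLbound hHbound))).trans (le_of_eq ?_))
  push_cast
  simp only [ENNReal.ofReal]
  ring

/-! ### Symbols of the dyadic blocks -/

section DyadicPair

variable {χ φ : ℝ → ℝ}

theorem measurable_blockSymbol (h : IsDyadicPair χ φ) (q : ℤ) : Measurable (blockSymbol χ φ q) := by
  unfold blockSymbol
  split_ifs
  · exact h.smooth_low.continuous.measurable
  · exact (h.smooth_shell.continuous.comp (continuous_const.mul continuous_id)).measurable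
  · exact measurable_const

theorem blockSymbol_nonneg (h : IsDyadicPair χ φ) (q : ℤ) (ξ : ℝ) : 0 ≤ blockSymbol χ φ q ξ := by
  unfold blockSymbol
  split_ifs
  · exact (h.range_low _).1
  · exact (h.range_shell _).1
  · exact le_rfl

theorem blockSymbol_le_one (h : IsDyadicPair χ φ) (q : ℤ) (ξ : ℝ) : blockSymbol χ φ q ξ ≤ 1 := by
  unfold blockSymbol
  split_ifs
  · exact (h.range_low _).2
  · exact (h.range_shell _).2
  · exact zero_le_one

theorem abs_blockSymbol_le_one (h : IsDyadicPair χ φ) (q : ℤ) (ξ : ℝ) :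
    |blockSymbol χ φ q ξ| ≤ 1 := by
  rw [abs_of_nonneg (blockSymbol_nonneg h q ξ)]
  exact blockSymbol_le_one h q ξ

theorem blockSymbol_of_lt (χ φ : ℝ → ℝ) {q : ℤ} (hq : q < -1) (ξ : ℝ) :
    blockSymbol χ φ q ξ = 0 := by
  rw [blockSymbol, if_neg (by omega), if_neg (by omega)]

theorem neg_one_le_of_blockSymbol_ne_zero {q : ℤ} {ξ : ℝ} (hq : blockSymbol χ φ q ξ ≠ 0) :
    -1 ≤ q := by
  by_contra hlt
  exact hq (blockSymbol_of_lt χ φ (by omega) ξ)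

theorem abs_le_of_blockSymbol_ne_zero (h : IsDyadicPair χ φ) {q : ℤ} {ξ : ℝ}
    (hq : blockSymbol χ φ q ξ ≠ 0) : |ξ| ≤ 8 / 3 * 2 ^ q := by
  have h1 := neg_one_le_of_blockSymbol_ne_zero hq
  rcases h1.eq_or_lt with rfl | h2
  · rw [blockSymbol, if_pos rfl] at hq
    have := h.supp_low (subset_tsupport _ hq)
    rw [Set.mem_ofPred_eq] at this
    norm_num
    linarith
  · rw [blockSymbol, if_neg (by omega), if_pos (by omega)] at hq
    have := (h.supp_shell (subset_tsupport _ hq)).2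
    rw [abs_mul, abs_of_pos (by positivity), zpow_neg, inv_mul_le_iff₀ (by positivity)] at this
    linarith

theorem le_abs_of_blockSymbol_ne_zero (h : IsDyadicPair χ φ) {q : ℤ} (h0 : 0 ≤ q) {ξ : ℝ}
    (hq : blockSymbol χ φ q ξ ≠ 0) : 3 / 4 * 2 ^ q ≤ |ξ| := by
  rw [blockSymbol, if_neg (by omega), if_pos (by omega)] at hq
  have := (h.supp_shell (subset_tsupport _ hq)).1
  rw [abs_mul, abs_of_pos (a := (2 : ℝ) ^ (-q)) (by positivity), zpow_neg,
    le_inv_mul_iff₀ (by positivity)] at this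
  linarith

theorem hasSum_blockSymbol (h : IsDyadicPair χ φ) (ξ : ℝ) :
    HasSum (fun q : ℤ => blockSymbol χ φ q ξ) 1 := by
  have hinj : Function.Injective (fun n : ℕ => (n : ℤ) - 1) := fun a b hab => by
    simpa using hab
  have hout : ∀ q : ℤ, q ∉ Set.range (fun n : ℕ => (n : ℤ) - 1) → blockSymbol χ φ q ξ = 0 := by
    intro q hq
    refine blockSymbol_of_lt χ φ ?_ ξ
    by_contra hlt
    exact hq ⟨(q + 1).toNat, by simp only; omega⟩
  rw [← hinj.hasSum_iff hout]
  rw [← hasSum_nat_add_iff' 1]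
  have h1 := h.partition ξ
  have e1 : (fun n : ℕ => φ ((2 : ℝ) ^ (-(n : ℤ)) * ξ)) =
      fun n => ((fun q : ℤ => blockSymbol χ φ q ξ) ∘ fun n : ℕ => (n : ℤ) - 1) (n + 1) := by
    funext n
    simp only [Function.comp, blockSymbol]
    rw [if_neg (by omega), if_pos (by omega)]
    congr 3
    push_cast
    ring
  have e2 : 1 - ∑ i ∈ Finset.range 1,
      ((fun q : ℤ => blockSymbol χ φ q ξ) ∘ fun n : ℕ => (n : ℤ) - 1) i = 1 - χ ξ := by
    simp [blockSymbol]
  rw [e1] at h1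
  rw [e2]
  exact h1

theorem sum_blockSymbol_le_one (h : IsDyadicPair χ φ) (S : Finset ℤ) (ξ : ℝ) :
    ∑ q ∈ S, blockSymbol χ φ q ξ ≤ 1 :=
  sum_le_hasSum S (fun q _ => blockSymbol_nonneg h q ξ) (hasSum_blockSymbol h ξ)

theorem sum_blockSymbol_nonneg (h : IsDyadicPair χ φ) (S : Finset ℤ) (ξ : ℝ) :
    0 ≤ ∑ q ∈ S, blockSymbol χ φ q ξ :=
  Finset.sum_nonneg fun q _ => blockSymbol_nonneg h q ξ

theorem sum_blockSymbol_eq_one (h : IsDyadicPair χ φ) {S : Finset ℤ} {ξ : ℝ}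
    (hS : ∀ q, blockSymbol χ φ q ξ ≠ 0 → q ∈ S) : ∑ q ∈ S, blockSymbol χ φ q ξ = 1 :=
  (hasSum_sum_of_ne_finset_zero fun q hq => by
    by_contra h0
    exact hq (hS q h0)).unique (hasSum_blockSymbol h ξ)

/-- A sum of symbols of dyadic blocks. -/
def blockSum (χ φ : ℝ → ℝ) (S : Finset ℤ) (ξ : ℝ) : ℝ := ∑ q ∈ S, blockSymbol χ φ q ξ

theorem measurable_blockSum (h : IsDyadicPair χ φ) (S : Finset ℤ) :
    Measurable (blockSum χ φ S) :=
  Finset.measurable_fun_sum _ fun q _ => measurable_blockSymbol h q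

theorem abs_blockSum_le_one (h : IsDyadicPair χ φ) (S : Finset ℤ) (ξ : ℝ) :
    |blockSum χ φ S ξ| ≤ 1 := by
  rw [blockSum, abs_of_nonneg (sum_blockSymbol_nonneg h S ξ)]
  exact sum_blockSymbol_le_one h S ξ

/-! ### Dyadic blocks in frequency -/

theorem hermiteCoeff_block (h : IsDyadicPair χ φ) (q : ℤ) (u : L2xv) (n : ℕ) :
    hermiteCoeff n (block χ φ q u) = fourierMul (blockSymbol χ φ q) (hermiteCoeff n u) :=
  hermiteCoeff_spectralMul (B := 1) (fun _ => measurable_blockSymbol h q)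
    (fun _ => abs_blockSymbol_le_one h q) u n

/-- The Fourier transform in `x` of the Hermite coefficients in `v`. -/
def uhat (k : ℕ) (u : L2xv) : ℝ → ℂ := fun η => (𝓕 (hermiteCoeff k u) : L2x) η

theorem memLp_uhat (k : ℕ) (u : L2xv) : MemLp (uhat k u) 2 := Lp.memLp _

theorem lintegral_uhat_sq (k : ℕ) (u : L2xv) :
    ∫⁻ η, ‖uhat k u η‖ₑ ^ 2 = ‖hermiteCoeff k u‖ₑ ^ 2 := by
  have h : ‖hermiteCoeff k u‖ₑ = ‖(𝓕 (hermiteCoeff k u) : L2x)‖ₑ := by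
    rw [← ofReal_norm, ← ofReal_norm, Lp.norm_fourier_eq]
  rw [h, enorm_sq_eq_lintegral]
  rfl

theorem tsum_lintegral_uhat_sq (u : L2xv) :
    ∑' k : ℕ, ∫⁻ η, ‖uhat k u η‖ₑ ^ 2 = ‖u‖ₑ ^ 2 := by
  rw [enorm_sq_eq_tsum]
  exact tsum_congr fun k => lintegral_uhat_sq k u

theorem sum_lintegral_uhat_sq_le (N : ℕ) (u : L2xv) :
    ∑ k ∈ Finset.range N, ∫⁻ η, ‖uhat k u η‖ₑ ^ 2 ≤ ‖u‖ₑ ^ 2 := by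
  rw [← tsum_lintegral_uhat_sq]
  exact ENNReal.sum_le_tsum _

theorem uhat_block (h : IsDyadicPair χ φ) (q : ℤ) (u : L2xv) (k : ℕ) :
    uhat k (block χ φ q u) =ᵐ[volume]
      fun η => (blockSymbol χ φ q (2 * Real.pi * η) : ℂ) * uhat k u η := by
  unfold uhat
  rw [hermiteCoeff_block h]
  exact fourier_fourierMul (measurable_blockSymbol h q) (abs_blockSymbol_le_one h q) _

theorem enorm_block_le (h : IsDyadicPair χ φ) (q : ℤ) (u : L2xv) : ‖block χ φ q u‖ₑ ≤ ‖u‖ₑ := by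
  refine (ENNReal.pow_le_pow_left_iff two_ne_zero).1 ?_
  rw [enorm_sq_eq_tsum, enorm_sq_eq_tsum u]
  refine ENNReal.tsum_le_tsum fun n => pow_le_pow_left₀ (by positivity) ?_ 2
  rw [hermiteCoeff_block h]
  have h1 := norm_fourierMul_le (measurable_blockSymbol h q) (abs_blockSymbol_le_one h q)
    (hermiteCoeff n u)
  rw [one_mul] at h1
  rw [← ofReal_norm, ← ofReal_norm]
  exact ENNReal.ofReal_le_ofReal h1

theorem block_add (h : IsDyadicPair χ φ) (q : ℤ) (u w : L2xv) :
    block χ φ q (u + w) = block χ φ q u + block χ φ q w := by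
  refine hermiteCoeff_ext fun n => ?_
  rw [hermiteCoeff_block h, hermiteCoeff_add, hermiteCoeff_add,
    fourierMul_add (measurable_blockSymbol h q) (abs_blockSymbol_le_one h q),
    hermiteCoeff_block h, hermiteCoeff_block h]

/-- The integral form of Bernstein's inequality for a dyadic block. -/
theorem lintegral_block_le (h : IsDyadicPair χ φ) (q : ℤ) {g : ℝ → ℝ≥0∞} (hg : AEMeasurable g) :
    (∫⁻ η, ENNReal.ofReal (blockSymbol χ φ q (2 * Real.pi * η)) * g η) ^ 2 ≤
      dyad q (1 / 2) ^ 2 *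
        ∫⁻ η, (ENNReal.ofReal (blockSymbol χ φ q (2 * Real.pi * η)) * g η) ^ 2 := by
  set I : Set ℝ := Set.Icc (-(2 ^ q / 2)) (2 ^ q / 2) with hI
  have hm : AEMeasurable fun η =>
      ENNReal.ofReal (blockSymbol χ φ q (2 * Real.pi * η)) * g η :=
    (measurable_comp_two_pi (measurable_blockSymbol h q)).ennreal_ofReal.aemeasurable.mul hg
  have hsupp : ∀ η, ENNReal.ofReal (blockSymbol χ φ q (2 * Real.pi * η)) * g η =
      I.indicator 1 η * (ENNReal.ofReal (blockSymbol χ φ q (2 * Real.pi * η)) * g η) := by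
    intro η
    by_cases h0 : blockSymbol χ φ q (2 * Real.pi * η) = 0
    · simp [h0]
    · have h1 := abs_le_of_blockSymbol_ne_zero h h0
      have h2 : η ∈ I := by
        rw [hI, Set.mem_Icc, ← abs_le]
        rw [abs_mul, abs_of_pos (by positivity)] at h1
        have h3 := Real.pi_gt_three
        have h4 : 0 ≤ |η| := abs_nonneg _
        nlinarith
      simp [h2]
  have hdy : dyad q (1 / 2) ^ 2 = ENNReal.ofReal (2 ^ q) := by
    rw [dyad, ← ENNReal.ofReal_pow (by positivity), ← Real.rpow_natCast, ← Real.rpow_mul (by norm_num),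
      show (q : ℝ) * (1 / 2) * ((2 : ℕ) : ℝ) = q by push_cast; ring, Real.rpow_intCast]
  rw [hdy, lintegral_congr hsupp]
  refine (lintegral_mul_sq_le (aemeasurable_one.indicator measurableSet_Icc) hm).trans ?_
  refine mul_le_mul_left ?_ _
  have e : ∀ η, (I.indicator 1 η : ℝ≥0∞) ^ 2 = I.indicator 1 η := fun η => by
    by_cases hη : η ∈ I <;> simp [hη]
  refine (lintegral_congr e).le.trans ?_
  rw [lintegral_indicator_one measurableSet_Icc, Real.volume_Icc]
  refine ENNReal.ofReal_le_ofReal ?_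
  linarith

end DyadicPair

/-! ### The Besov norm and families in frequency -/

section Besov

variable {χ φ : ℝ → ℝ}

/-- The norms in `x` of the slices of a function of `(x, v)`. -/
def sliceNorm (u : L2xv) (v : ℝ) : ℝ≥0∞ := eLpNorm (fun x : ℝ => u (x, v)) 2 volume

theorem sliceNorm_sq (u : L2xv) (v : ℝ) : sliceNorm u v ^ 2 = ∫⁻ x, ‖u (x, v)‖ₑ ^ 2 :=
  eLpNorm_two_sq _ _

theorem measurable_sliceNorm (u : L2xv) : Measurable (sliceNorm u) := by
  have h : Measurable fun v => ∫⁻ x, ‖u (x, v)‖ₑ ^ 2 :=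
    ((measurable_L2xv u).enorm.pow_const 2).lintegral_prod_left'
  have e : sliceNorm u = fun v => (∫⁻ x, ‖u (x, v)‖ₑ ^ 2) ^ (1 / 2 : ℝ) := by
    funext v
    rw [← sliceNorm_sq, ← ENNReal.rpow_natCast, ← ENNReal.rpow_mul]
    norm_num
  rw [e]
  exact h.pow_const _

theorem lintegral_sliceNorm_sq (u : L2xv) : ∫⁻ v, sliceNorm u v ^ 2 = ‖u‖ₑ ^ 2 := by
  rw [enorm_sq_eq_lintegral_slices_swap]
  exact lintegral_congr fun v => sliceNorm_sq u v

theorem besovNorm_sq (χ φ : ℝ → ℝ) (σ : ℝ) (u : L2xv) :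
    besovNorm χ φ σ u ^ 2 = ∫⁻ v, (∑' q : ℤ, dyad q σ * sliceNorm (block χ φ q u) v) ^ 2 :=
  eLpNorm_two_sq _ _

theorem measurable_tsum_sliceNorm (χ φ : ℝ → ℝ) (σ : ℝ) (u : L2xv) :
    Measurable fun v => ∑' q : ℤ, dyad q σ * sliceNorm (block χ φ q u) v :=
  Measurable.tsum fun _ => (measurable_sliceNorm _).const_mul _

theorem dyad_mul_enorm_block_le (χ φ : ℝ → ℝ) (σ : ℝ) (q : ℤ) (u : L2xv) :
    dyad q σ * ‖block χ φ q u‖ₑ ≤ besovNorm χ φ σ u := by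
  refine (ENNReal.pow_le_pow_left_iff two_ne_zero).1 ?_
  rw [besovNorm_sq, mul_pow, ← lintegral_sliceNorm_sq,
    ← lintegral_const_mul _ ((measurable_sliceNorm _).pow_const 2)]
  refine lintegral_mono fun v => ?_
  simp only
  rw [← mul_pow]
  exact pow_le_pow_left₀ (by positivity)
    (ENNReal.le_tsum (f := fun q : ℤ => dyad q σ * sliceNorm (block χ φ q u) v) q) 2

theorem le_of_sq_le_mul {A M : ℝ≥0∞} (hA : A ≠ ⊤) (h : A ^ 2 ≤ A * M) : A ≤ M := by
  by_cases h0 : A = 0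
  · rw [h0]; exact zero_le
  · rw [sq] at h
    exact (ENNReal.mul_le_mul_iff_right h0 hA).1 h

/-- Minkowski's inequality for the partial pairing with a function of `v`. -/
theorem eLpNorm_integral_mul_le (u : L2xv) {w : ℝ → ℂ} (hw : MemLp w 2) :
    eLpNorm (fun x : ℝ => ∫ v, u (x, v) * w v) 2 volume ≤ ∫⁻ v, sliceNorm u v * ‖w v‖ₑ := by
  set f : ℝ → ℝ≥0∞ := fun x => ∫⁻ v, ‖u (x, v)‖ₑ * ‖w v‖ₑ with hf
  set M := ∫⁻ v, sliceNorm u v * ‖w v‖ₑ with hM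
  have hmeas : AEMeasurable (fun z : ℝ × ℝ => ‖u z‖ₑ * ‖w z.2‖ₑ) (volume.prod volume) :=
    (measurable_L2xv u).enorm.aemeasurable.mul hw.1.enorm.comp_snd
  have hfm : AEMeasurable f := hmeas.lintegral_prod_right'
  have hle : ∀ x, ‖∫ v, u (x, v) * w v‖ₑ ≤ f x := fun x => by
    refine (enorm_integral_le_lintegral_enorm _).trans (le_of_eq ?_)
    simp only [enorm_mul, hf]
  have hfin : ∫⁻ x, f x ^ 2 < ⊤ := by
    calc ∫⁻ x, f x ^ 2 ≤ ∫⁻ x, (∫⁻ v, ‖u (x, v)‖ₑ ^ 2) * ∫⁻ v, ‖w v‖ₑ ^ 2 :=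
          lintegral_mono fun x => lintegral_mul_sq_le
            ((measurable_L2xv u).comp measurable_prodMk_left).enorm.aemeasurable hw.1.enorm
      _ = ‖u‖ₑ ^ 2 * ∫⁻ v, ‖w v‖ₑ ^ 2 := by
          rw [lintegral_mul_const _ (measurable_slice_lintegral u), ← enorm_sq_eq_lintegral_slices]
      _ < ⊤ := ENNReal.mul_lt_top (ENNReal.pow_lt_top enorm_lt_top) (lintegral_enorm_sq_lt_top hw)
  set A := eLpNorm f 2 volume with hA
  have hA2 : A ^ 2 = ∫⁻ x, f x ^ 2 := by
    rw [hA, eLpNorm_two_sq]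
    simp
  have hAtop : A ≠ ⊤ := by
    intro h
    rw [h] at hA2
    rw [← hA2] at hfin
    simp at hfin
  have hkey : A ^ 2 ≤ A * M := by
    have e1 : ∀ x, f x ^ 2 = ∫⁻ v, f x * (‖u (x, v)‖ₑ * ‖w v‖ₑ) := fun x => by
      have hx : AEMeasurable fun v => ‖u (x, v)‖ₑ * ‖w v‖ₑ :=
        ((measurable_L2xv u).comp measurable_prodMk_left).enorm.aemeasurable.mul hw.1.enorm
      rw [lintegral_const_mul'' _ hx, sq]
    have hm2 : AEMeasurable (fun z : ℝ × ℝ => f z.1 * (‖u z‖ₑ * ‖w z.2‖ₑ)) (volume.prod volume) :=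
      (hfm.comp_fst).mul hmeas
    have hs : AEMeasurable fun v => sliceNorm u v * ‖w v‖ₑ :=
      (measurable_sliceNorm u).aemeasurable.mul hw.1.enorm
    rw [hA2, lintegral_congr e1,
      lintegral_lintegral_swap (f := fun x v => f x * (‖u (x, v)‖ₑ * ‖w v‖ₑ)) hm2, hM,
      ← lintegral_const_mul'' _ hs]
    refine lintegral_mono fun v => ?_
    have e2 : ∫⁻ x, f x * (‖u (x, v)‖ₑ * ‖w v‖ₑ) = (∫⁻ x, f x * ‖u (x, v)‖ₑ) * ‖w v‖ₑ := by
      rw [← lintegral_mul_const' _ _ enorm_ne_top]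
      exact lintegral_congr fun x => (mul_assoc _ _ _).symm
    simp only
    rw [e2, ← mul_assoc]
    refine mul_le_mul_left ((ENNReal.pow_le_pow_left_iff two_ne_zero).1 ?_) _
    rw [mul_pow, hA2, sliceNorm_sq]
    exact lintegral_mul_sq_le hfm
      ((measurable_L2xv u).comp measurable_prodMk_right).enorm.aemeasurable
  have hAM : A ≤ M := le_of_sq_le_mul hAtop hkey
  refine le_trans ?_ hAM
  refine (ENNReal.pow_le_pow_left_iff two_ne_zero).1 ?_
  rw [hA2, eLpNorm_two_sq]
  exact lintegral_mono fun x => pow_le_pow_left₀ (by positivity) (hle x) 2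

theorem lintegral_hermite_sum_sq (N : ℕ) (c : ℕ → ℂ) :
    ∫⁻ v, ‖∑ k ∈ Finset.range N, c k * (hermiteFun k v : ℂ)‖ₑ ^ 2 =
      ENNReal.ofReal (rms N c) ^ 2 := by
  have hm : MemLp (fun v => ∑ k ∈ Finset.range N, c k * (hermiteFun k v : ℂ)) 2 :=
    memLp_finsetSum _ fun k _ => (memLp_hermiteFun_ofReal k).const_mul _
  have hmul : ∀ j k, Integrable fun v => c k * (hermiteFun k v : ℂ) * (hermiteFun j v : ℂ) :=
    fun j k => ((memLp_hermiteFun_ofReal k).const_mul _).integrable_mul (memLp_hermiteFun_ofReal j)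
  have e : ∀ j, ∫ v, (∑ k ∈ Finset.range N, c k * (hermiteFun k v : ℂ)) * (hermiteFun j v : ℂ) =
      if j ∈ Finset.range N then c j else 0 := fun j => by
    simp only [Finset.sum_mul]
    rw [integral_finsetSum _ fun k _ => hmul j k]
    simp only [mul_assoc, integral_const_mul, integral_hermiteFun_mul_ofReal]
    simp
  rw [lintegral_eq_tsum_hermite hm]
  simp only [e]
  rw [tsum_eq_sum (s := Finset.range N) fun j hj => by rw [if_neg hj]; simp, ofReal_rms_sq]
  exact Finset.sum_congr rfl fun j hj => by rw [if_pos hj]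

theorem eLpNorm_sum_hermiteCoeff_le (u : L2xv) (N : ℕ) (c : ℕ → ℂ) :
    eLpNorm (fun x => ∑ k ∈ Finset.range N, c k * hermiteCoeff k u x) 2 volume ≤
      ∫⁻ v, sliceNorm u v * ‖∑ k ∈ Finset.range N, c k * (hermiteFun k v : ℂ)‖ₑ := by
  have hm : MemLp (fun v => ∑ k ∈ Finset.range N, c k * (hermiteFun k v : ℂ)) 2 :=
    memLp_finsetSum _ fun k _ => (memLp_hermiteFun_ofReal k).const_mul _
  refine le_trans (le_of_eq (eLpNorm_congr_ae ?_)) (eLpNorm_integral_mul_le u hm)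
  have hc : ∀ᵐ x : ℝ, ∀ k, hermiteCoeff k u x = ∫ v : ℝ, u (x, v) * (hermiteFun k v : ℂ) :=
    ae_all_iff.2 fun k => coeFn_hermiteCoeff k u
  filter_upwards [hc, ae_memLp_slice u] with x h1 h2
  simp only [h1, Finset.mul_sum]
  have hi : ∀ k, Integrable fun v => u (x, v) * (c k * (hermiteFun k v : ℂ)) := fun k =>
    h2.integrable_mul ((memLp_hermiteFun_ofReal k).const_mul (c k))
  rw [integral_finsetSum _ fun k _ => hi k]
  refine Finset.sum_congr rfl fun k _ => ?_
  rw [← integral_const_mul]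
  exact integral_congr_ae (Filter.Eventually.of_forall fun v => by ring)

theorem lintegral_blockSymbol_sum_le (h : IsDyadicPair χ φ) (q : ℤ) (u : L2xv) (N : ℕ)
    (c : ℕ → ℂ) :
    ∫⁻ η, ENNReal.ofReal (blockSymbol χ φ q (2 * Real.pi * η)) *
        ‖∑ k ∈ Finset.range N, c k * uhat k u η‖ₑ ≤
      dyad q (1 / 2) * ∫⁻ v, sliceNorm (block χ φ q u) v *
        ‖∑ k ∈ Finset.range N, c k * (hermiteFun k v : ℂ)‖ₑ := by
  have hmk : ∀ k, MemLp (uhat k u) 2 := fun k => memLp_uhat k u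
  have hg : AEMeasurable fun η => ‖∑ k ∈ Finset.range N, c k * uhat k u η‖ₑ :=
    (memLp_finsetSum _ fun k _ => (hmk k).const_mul (c k)).1.enorm
  refine (ENNReal.pow_le_pow_left_iff two_ne_zero).1 ?_
  refine (lintegral_block_le h q hg).trans ?_
  rw [mul_pow]
  refine mul_le_mul_right ?_ _
  refine le_trans (le_of_eq ?_) (pow_le_pow_left₀ (by positivity)
    (eLpNorm_sum_hermiteCoeff_le (block χ φ q u) N c) 2)
  set W : L2x := ∑ k ∈ Finset.range N, c k • hermiteCoeff k (block χ φ q u) with hW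
  have e1 : (fun x => ∑ k ∈ Finset.range N, c k * hermiteCoeff k (block χ φ q u) x) =ᵐ[volume]
      fun x => W x := by
    have h1 := Lp.coeFn_finsetSum (Finset.range N)
      (fun k => c k • hermiteCoeff k (block χ φ q u))
    have h2 : ∀ᵐ x : ℝ, ∀ k, (c k • hermiteCoeff k (block χ φ q u)) x =
        c k * hermiteCoeff k (block χ φ q u) x :=
      ae_all_iff.2 fun k => Lp.coeFn_smul (c k) _
    filter_upwards [h1, h2] with x h3 h4
    rw [hW, h3]
    simp [h4]
  have e2 : (𝓕 W : L2x) =ᵐ[volume] fun η => (blockSymbol χ φ q (2 * Real.pi * η) : ℂ) *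
      ∑ k ∈ Finset.range N, c k * uhat k u η := by
    have h0 : (𝓕 W : L2x) = ∑ k ∈ Finset.range N, c k • (𝓕 (hermiteCoeff k (block χ φ q u)) : L2x) := by
      rw [hW, FourierTransform.fourier_sum]
      exact Finset.sum_congr rfl fun k _ => FourierTransform.fourier_smul _ _
    have h1 := Lp.coeFn_finsetSum (Finset.range N)
      (fun k => c k • (𝓕 (hermiteCoeff k (block χ φ q u)) : L2x))
    have h2 : ∀ᵐ x : ℝ, ∀ k, (c k • (𝓕 (hermiteCoeff k (block χ φ q u)) : L2x)) x =
        c k * (𝓕 (hermiteCoeff k (block χ φ q u)) : L2x) x :=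
      ae_all_iff.2 fun k => Lp.coeFn_smul (c k) _
    have h3 : ∀ᵐ x : ℝ, ∀ k, uhat k (block χ φ q u) x =
        (blockSymbol χ φ q (2 * Real.pi * x) : ℂ) * uhat k u x :=
      ae_all_iff.2 fun k => uhat_block h q u k
    filter_upwards [h1, h2, h3] with η h4 h5 h6
    rw [h0, h4, Finset.sum_apply, Finset.mul_sum]
    refine Finset.sum_congr rfl fun k _ => ?_
    rw [h5]
    have := h6 k
    unfold uhat at this ⊢
    rw [this]
    ring
  rw [eLpNorm_congr_ae e1, ← Lp.enorm_def]
  have e3 : ‖W‖ₑ = ‖(𝓕 W : L2x)‖ₑ := by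
    rw [← ofReal_norm, ← ofReal_norm, Lp.norm_fourier_eq]
  rw [e3, enorm_sq_eq_lintegral]
  refine lintegral_congr_ae ?_
  filter_upwards [e2] with η h1
  rw [h1, enorm_mul, ← ofReal_norm (blockSymbol χ φ q (2 * Real.pi * η) : ℂ), Complex.norm_real,
    Real.norm_of_nonneg (blockSymbol_nonneg h _ _)]

theorem tsum_ofReal_blockSymbol (h : IsDyadicPair χ φ) (ξ : ℝ) :
    ∑' q : ℤ, ENNReal.ofReal (blockSymbol χ φ q ξ) = 1 := by
  have h1 := hasSum_blockSymbol h ξ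
  rw [← ENNReal.ofReal_tsum_of_nonneg (fun q => blockSymbol_nonneg h q ξ) h1.summable, h1.tsum_eq,
    ENNReal.ofReal_one]

theorem lintegral_sum_uhat_le (h : IsDyadicPair χ φ) (u : L2xv) (N : ℕ) (c : ℕ → ℂ) :
    ∫⁻ η, ‖∑ k ∈ Finset.range N, c k * uhat k u η‖ₑ ≤
      besovNorm χ φ (1 / 2) u * ENNReal.ofReal (rms N c) := by
  have hg : AEMeasurable fun η => ‖∑ k ∈ Finset.range N, c k * uhat k u η‖ₑ :=
    (memLp_finsetSum _ fun k _ => (memLp_uhat k u).const_mul (c k)).1.enorm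
  have hw : AEMeasurable fun v => ‖∑ k ∈ Finset.range N, c k * (hermiteFun k v : ℂ)‖ₑ :=
    (memLp_finsetSum _ fun k _ => (memLp_hermiteFun_ofReal k).const_mul (c k)).1.enorm
  calc ∫⁻ η, ‖∑ k ∈ Finset.range N, c k * uhat k u η‖ₑ
      = ∫⁻ η, ∑' q : ℤ, ENNReal.ofReal (blockSymbol χ φ q (2 * Real.pi * η)) *
        ‖∑ k ∈ Finset.range N, c k * uhat k u η‖ₑ := by
        refine lintegral_congr fun η => ?_
        rw [ENNReal.tsum_mul_right, tsum_ofReal_blockSymbol h, one_mul]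
    _ = ∑' q : ℤ, ∫⁻ η, ENNReal.ofReal (blockSymbol χ φ q (2 * Real.pi * η)) *
        ‖∑ k ∈ Finset.range N, c k * uhat k u η‖ₑ :=
        lintegral_tsum fun q =>
          (measurable_comp_two_pi (measurable_blockSymbol h q)).ennreal_ofReal.aemeasurable.mul hg
    _ ≤ ∑' q : ℤ, dyad q (1 / 2) * ∫⁻ v, sliceNorm (block χ φ q u) v *
        ‖∑ k ∈ Finset.range N, c k * (hermiteFun k v : ℂ)‖ₑ :=
        ENNReal.tsum_le_tsum fun q => lintegral_blockSymbol_sum_le h q u N c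
    _ = ∫⁻ v, (∑' q : ℤ, dyad q (1 / 2) * sliceNorm (block χ φ q u) v) *
        ‖∑ k ∈ Finset.range N, c k * (hermiteFun k v : ℂ)‖ₑ := by
        have hq : ∀ q : ℤ, AEMeasurable fun v => sliceNorm (block χ φ q u) v *
            ‖∑ k ∈ Finset.range N, c k * (hermiteFun k v : ℂ)‖ₑ := fun q =>
          (measurable_sliceNorm _).aemeasurable.mul hw
        have e : ∀ q : ℤ, dyad q (1 / 2) * ∫⁻ v, sliceNorm (block χ φ q u) v *
            ‖∑ k ∈ Finset.range N, c k * (hermiteFun k v : ℂ)‖ₑ =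
            ∫⁻ v, dyad q (1 / 2) * (sliceNorm (block χ φ q u) v *
            ‖∑ k ∈ Finset.range N, c k * (hermiteFun k v : ℂ)‖ₑ) := fun q =>
          (lintegral_const_mul'' _ (hq q)).symm
        simp only [e]
        rw [← lintegral_tsum fun q => (hq q).const_mul _]
        simp only [← mul_assoc, ENNReal.tsum_mul_right]
    _ ≤ besovNorm χ φ (1 / 2) u * ENNReal.ofReal (rms N c) := by
        refine (ENNReal.pow_le_pow_left_iff two_ne_zero).1 ?_
        rw [mul_pow, besovNorm_sq, ← lintegral_hermite_sum_sq]
        exact lintegral_mul_sq_le (measurable_tsum_sliceNorm χ φ _ u).aemeasurable hw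

theorem mem_Icc_of_mem_shell (h : IsDyadicPair χ φ) {q : ℕ} {η : ℝ} (hη : η ∈ shell q) {j : ℤ}
    (hj : blockSymbol χ φ j (2 * Real.pi * η) ≠ 0) : j ∈ Finset.Icc ((q : ℤ) - 1) (q + 1) := by
  obtain ⟨h1, h2⟩ := hη
  set ξ := 2 * Real.pi * η
  have h3 := abs_le_of_blockSymbol_ne_zero h hj
  have h4 := neg_one_le_of_blockSymbol_ne_zero hj
  rw [Finset.mem_Icc]
  have hb : bracket ξ ^ 2 = 1 + |ξ| ^ 2 := by
    rw [bracket, Real.sq_sqrt (by positivity), sq_abs]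
  have hbp := bracket_pos ξ
  have hpow : ∀ n : ℕ, ((2 : ℝ) ^ n) = 2 ^ (n : ℤ) := fun n => (zpow_natCast _ _).symm
  constructor
  · by_contra hlt
    have hq : j ≤ (q : ℤ) - 2 := by omega
    have h5 : (2 : ℝ) ^ j ≤ 2 ^ ((q : ℤ) - 2) := zpow_le_zpow_right₀ one_le_two hq
    have h6 : (2 : ℝ) ^ ((q : ℤ) - 2) = 2 ^ q / 4 := by
      rw [zpow_sub₀ two_ne_zero, zpow_natCast]; norm_num
    rw [h6] at h5
    have h7 : (2 : ℝ) ≤ 2 ^ q := by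
      have : 1 ≤ q := by omega
      calc (2 : ℝ) = 2 ^ 1 := (pow_one _).symm
        _ ≤ 2 ^ q := pow_le_pow_right₀ one_le_two this
    have h8 : |ξ| ≤ 2 / 3 * 2 ^ q := by linarith
    have h9 : 0 ≤ |ξ| := abs_nonneg ξ
    nlinarith
  · by_contra hlt
    have hq : (q : ℤ) + 2 ≤ j := by omega
    have h5 : (2 : ℝ) ^ ((q : ℤ) + 2) ≤ 2 ^ j := zpow_le_zpow_right₀ one_le_two hq
    have h6 : (2 : ℝ) ^ ((q : ℤ) + 2) = 2 ^ q * 4 := by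
      rw [zpow_add₀ two_ne_zero, zpow_natCast]; norm_num
    have h7 := le_abs_of_blockSymbol_ne_zero h (by omega) hj
    have h8 : 0 < (2 : ℝ) ^ q := by positivity
    have h9 : 3 * 2 ^ q ≤ |ξ| := by linarith
    rw [pow_succ] at h2
    nlinarith

theorem lintegral_blockSymbol_rms_le (h : IsDyadicPair χ φ) (q : ℤ) (u : L2xv) (N : ℕ) :
    ∫⁻ η, ENNReal.ofReal (blockSymbol χ φ q (2 * Real.pi * η)) *
        ENNReal.ofReal (rms N fun k => uhat k u η) ≤ besovNorm χ φ (1 / 2) u := by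
  refine le_trans ?_ (dyad_mul_enorm_block_le χ φ (1 / 2) q u)
  refine (ENNReal.pow_le_pow_left_iff two_ne_zero).1 ?_
  refine (lintegral_block_le h q
    (aemeasurable_rms fun k => (memLp_uhat k u).1).ennreal_ofReal).trans ?_
  rw [mul_pow]
  refine mul_le_mul_right ?_ _
  refine le_trans ?_ (sum_lintegral_uhat_sq_le N (block χ φ q u))
  rw [← lintegral_finsetSum' _ fun k _ => (memLp_uhat k _).1.enorm.pow_const 2]
  refine le_of_eq (lintegral_congr_ae ?_)
  have h3 : ∀ᵐ x : ℝ, ∀ k, uhat k (block χ φ q u) x =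
      (blockSymbol χ φ q (2 * Real.pi * x) : ℂ) * uhat k u x :=
    ae_all_iff.2 fun k => uhat_block h q u k
  filter_upwards [h3] with η h4
  rw [mul_pow, ofReal_rms_sq, Finset.mul_sum]
  refine Finset.sum_congr rfl fun k _ => ?_
  rw [h4, enorm_mul, mul_pow, ← ofReal_norm (blockSymbol χ φ q (2 * Real.pi * η) : ℂ),
    Complex.norm_real, Real.norm_of_nonneg (blockSymbol_nonneg h _ _)]

theorem lowFamily_uhat (h : IsDyadicPair χ φ) (N : ℕ) (u : L2xv) :
    LowFamily N (fun k => uhat k u) (3 * besovNorm χ φ (1 / 2) u) := by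
  refine ⟨fun k => memLp_uhat k u, fun c => ?_, fun q => ?_⟩
  · refine (lintegral_sum_uhat_le h u N c).trans (mul_le_mul_left ?_ _)
    exact le_mul_of_one_le_left zero_le (by norm_num)
  · have hm : AEMeasurable fun η => ENNReal.ofReal (rms N fun k => uhat k u η) :=
      (aemeasurable_rms fun k => (memLp_uhat k u).1).ennreal_ofReal
    have hb : ∀ j : ℤ, AEMeasurable fun η =>
        ENNReal.ofReal (blockSymbol χ φ j (2 * Real.pi * η)) *
          ENNReal.ofReal (rms N fun k => uhat k u η) := fun j =>
      (measurable_comp_two_pi (measurable_blockSymbol h j)).ennreal_ofReal.aemeasurable.mul hm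
    calc ∫⁻ η in shell q, ENNReal.ofReal (rms N fun k => uhat k u η)
        ≤ ∫⁻ η in shell q, ∑ j ∈ Finset.Icc ((q : ℤ) - 1) (q + 1),
          ENNReal.ofReal (blockSymbol χ φ j (2 * Real.pi * η)) *
          ENNReal.ofReal (rms N fun k => uhat k u η) := by
          refine setLIntegral_mono_ae' (measurableSet_shell q)
            (Filter.Eventually.of_forall fun η hη => ?_)
          rw [← Finset.sum_mul, ← ENNReal.ofReal_sum_of_nonneg fun j _ => blockSymbol_nonneg h j _,
            sum_blockSymbol_eq_one h fun j hj => mem_Icc_of_mem_shell h hη hj, ENNReal.ofReal_one,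
            one_mul]
      _ ≤ ∫⁻ η, ∑ j ∈ Finset.Icc ((q : ℤ) - 1) (q + 1),
          ENNReal.ofReal (blockSymbol χ φ j (2 * Real.pi * η)) *
          ENNReal.ofReal (rms N fun k => uhat k u η) := setLIntegral_le_lintegral _ _
      _ = ∑ j ∈ Finset.Icc ((q : ℤ) - 1) (q + 1), ∫⁻ η,
          ENNReal.ofReal (blockSymbol χ φ j (2 * Real.pi * η)) *
          ENNReal.ofReal (rms N fun k => uhat k u η) := lintegral_finsetSum' _ fun j _ => hb j
      _ ≤ ∑ j ∈ Finset.Icc ((q : ℤ) - 1) (q + 1), besovNorm χ φ (1 / 2) u :=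
          Finset.sum_le_sum fun j _ => lintegral_blockSymbol_rms_le h j u N
      _ = 3 * besovNorm χ φ (1 / 2) u := by
          rw [Finset.sum_const, Int.card_Icc, show ((q : ℤ) + 1 + 1 - (q - 1)).toNat = 3 by omega,
            nsmul_eq_mul]
          norm_num

end Besov

/-! ### Measurability of the Besov norm in a parameter -/

theorem ae_slice_eq_swap {u w : ℝ × ℝ → ℂ} (hu : Measurable u) (hw : Measurable w)
    (h : u =ᵐ[volume] w) : ∀ᵐ v : ℝ, ∀ᵐ x : ℝ, u (x, v) = w (x, v) :=
  (Measure.ae_ae_comm (p := fun x v => u (x, v) = w (x, v)) (measurableSet_eq_fun hu hw)).1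
    (ae_slice_eq h)

theorem sliceNorm_add_le (u w : L2xv) :
    ∀ᵐ v : ℝ, sliceNorm (u + w) v ≤ sliceNorm u v + sliceNorm w v := by
  have h := ae_slice_eq_swap (measurable_L2xv (u + w))
    ((measurable_L2xv u).add (measurable_L2xv w)) (Lp.coeFn_add u w)
  filter_upwards [h] with v hv
  unfold sliceNorm
  rw [eLpNorm_congr_ae hv]
  exact eLpNorm_add_le ((measurable_L2xv u).comp measurable_prodMk_right).aestronglyMeasurable
    ((measurable_L2xv w).comp measurable_prodMk_right).aestronglyMeasurable (by norm_num)

section Besov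

variable {χ φ : ℝ → ℝ}

/-- The part of the Besov norm that comes from finitely many dyadic blocks. -/
def besovPart (χ φ : ℝ → ℝ) (σ : ℝ) (S : Finset ℤ) (u : L2xv) : ℝ≥0∞ :=
  eLpNorm (fun v : ℝ => ∑ q ∈ S, dyad q σ * sliceNorm (block χ φ q u) v) 2 volume

theorem measurable_sum_sliceNorm (χ φ : ℝ → ℝ) (σ : ℝ) (S : Finset ℤ) (u : L2xv) :
    Measurable fun v => ∑ q ∈ S, dyad q σ * sliceNorm (block χ φ q u) v :=
  Finset.measurable_fun_sum _ fun _ _ => (measurable_sliceNorm _).const_mul _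

theorem besovNorm_sq_eq_iSup (χ φ : ℝ → ℝ) (σ : ℝ) (u : L2xv) :
    besovNorm χ φ σ u ^ 2 = ⨆ S : Finset ℤ, besovPart χ φ σ S u ^ 2 := by
  rw [besovNorm_sq]
  simp only [ENNReal.tsum_eq_iSup_sum, ENNReal.iSup_pow, besovPart, eLpNorm_two_sq, enorm_eq_self]
  refine lintegral_iSup_directed
    (fun S => ((measurable_sum_sliceNorm χ φ σ S u).pow_const 2).aemeasurable) ?_
  intro S S'
  exact ⟨S ∪ S',
    fun v => pow_le_pow_left₀ (by positivity) (Finset.sum_le_sum_of_subset Finset.subset_union_left) 2,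
    fun v => pow_le_pow_left₀ (by positivity) (Finset.sum_le_sum_of_subset Finset.subset_union_right) 2⟩

theorem dyad_ne_top (q : ℤ) (σ : ℝ) : dyad q σ ≠ ⊤ := ENNReal.ofReal_ne_top

theorem besovPart_le (h : IsDyadicPair χ φ) (σ : ℝ) (S : Finset ℤ) (u : L2xv) :
    besovPart χ φ σ S u ≤ (∑ q ∈ S, dyad q σ) * ‖u‖ₑ := by
  have e : (fun v : ℝ => ∑ q ∈ S, dyad q σ * sliceNorm (block χ φ q u) v) =
      ∑ q ∈ S, fun v => dyad q σ * sliceNorm (block χ φ q u) v := by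
    ext v; simp
  rw [besovPart, e, Finset.sum_mul]
  refine (eLpNorm_sum_le (fun q _ => ((measurable_sliceNorm _).const_mul _).aestronglyMeasurable)
    (by norm_num)).trans (Finset.sum_le_sum fun q _ => ?_)
  refine (ENNReal.pow_le_pow_left_iff two_ne_zero).1 ?_
  rw [eLpNorm_two_sq]
  simp only [enorm_eq_self, mul_pow]
  rw [lintegral_const_mul _ ((measurable_sliceNorm _).pow_const 2), lintegral_sliceNorm_sq]
  exact mul_le_mul_right (pow_le_pow_left₀ (by positivity) (enorm_block_le h q u) 2) _

theorem besovPart_add_le (h : IsDyadicPair χ φ) (σ : ℝ) (S : Finset ℤ) (u w : L2xv) :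
    besovPart χ φ σ S (u + w) ≤ besovPart χ φ σ S u + besovPart χ φ σ S w := by
  refine le_trans ?_ (eLpNorm_add_le (measurable_sum_sliceNorm χ φ σ S u).aestronglyMeasurable
    (measurable_sum_sliceNorm χ φ σ S w).aestronglyMeasurable (by norm_num))
  refine eLpNorm_mono_enorm_ae ?_
  have hq : ∀ᵐ v : ℝ, ∀ q : ℤ, sliceNorm (block χ φ q u + block χ φ q w) v ≤
      sliceNorm (block χ φ q u) v + sliceNorm (block χ φ q w) v :=
    ae_all_iff.2 fun q => sliceNorm_add_le _ _
  filter_upwards [hq] with v hv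
  simp only [enorm_eq_self, Pi.add_apply, ← Finset.sum_add_distrib, ← mul_add]
  refine Finset.sum_le_sum fun q _ => mul_le_mul_right ?_ _
  rw [block_add h]
  exact hv q

theorem continuous_besovPart (h : IsDyadicPair χ φ) (σ : ℝ) (S : Finset ℤ) :
    Continuous (besovPart χ φ σ S) := by
  refine continuous_of_le_add_edist (∑ q ∈ S, dyad q σ)
    (ENNReal.sum_ne_top.2 fun q _ => dyad_ne_top q σ) fun u w => ?_
  have h1 := besovPart_add_le h σ S w (u - w)
  rw [add_sub_cancel] at h1
  refine h1.trans (add_le_add le_rfl ?_)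
  rw [edist_eq_enorm_sub]
  exact besovPart_le h σ S _

theorem aemeasurable_besovNorm (h : IsDyadicPair χ φ) (σ : ℝ) {u : ℝ → L2xv} {μ : Measure ℝ}
    (hu : AEStronglyMeasurable u μ) : AEMeasurable (fun t => besovNorm χ φ σ (u t)) μ := by
  have e : (fun t => besovNorm χ φ σ (u t)) =
      fun t => (⨆ S : Finset ℤ, besovPart χ φ σ S (u t) ^ 2) ^ (1 / 2 : ℝ) := by
    funext t
    rw [← besovNorm_sq_eq_iSup, ← ENNReal.rpow_natCast, ← ENNReal.rpow_mul]
    norm_num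
  rw [e]
  refine AEMeasurable.pow_const (AEMeasurable.iSup fun S => AEMeasurable.pow_const ?_ _) _
  exact ((continuous_besovPart h σ S).comp_aestronglyMeasurable hu).aemeasurable

/-! ### Dyadic blocks and powers of the harmonic oscillator -/

theorem block_smul (h : IsDyadicPair χ φ) (q : ℤ) (c : ℂ) (u : L2xv) :
    block χ φ q (c • u) = c • block χ φ q u := by
  refine hermiteCoeff_ext fun n => ?_
  rw [hermiteCoeff_block h, hermiteCoeff_smul, hermiteCoeff_smul,
    fourierMul_smul (measurable_blockSymbol h q) (abs_blockSymbol_le_one h q),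
    hermiteCoeff_block h]

theorem continuous_block (h : IsDyadicPair χ φ) (q : ℤ) : Continuous (block χ φ q) := by
  let T : L2xv →L[ℂ] L2xv := LinearMap.mkContinuous
    { toFun := block χ φ q
      map_add' := block_add h q
      map_smul' := block_smul h q } 1 (fun u => by
        have h1 := enorm_block_le h q u
        rw [← ofReal_norm, ← ofReal_norm] at h1
        rw [one_mul]
        exact (ENNReal.ofReal_le_ofReal_iff (norm_nonneg _)).1 h1)
  exact T.continuous

theorem norm_fourierMul_blockSymbol_le (h : IsDyadicPair χ φ) (q : ℤ) (w : L2x) :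
    ‖fourierMul (blockSymbol χ φ q) w‖ ≤ ‖w‖ := by
  simpa using norm_fourierMul_le (measurable_blockSymbol h q) (abs_blockSymbol_le_one h q) w

theorem InOscDomain.block (h : IsDyadicPair χ φ) {r : ℝ} {u : L2xv} (hu : InOscDomain r u)
    (q : ℤ) : InOscDomain r (block χ φ q u) := by
  rw [inOscDomain_iff] at hu ⊢
  refine Summable.of_nonneg_of_le (fun n => by positivity) (fun n => ?_) hu
  rw [hermiteCoeff_block h]
  have := norm_fourierMul_blockSymbol_le h q (hermiteCoeff n u)
  gcongr

theorem oscPow_block (h : IsDyadicPair χ φ) {r : ℝ} {u : L2xv} (hu : InOscDomain r u) (q : ℤ) :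
    oscPow r (block χ φ q u) = block χ φ q (oscPow r u) := by
  refine hermiteCoeff_ext fun n => ?_
  rw [hermiteCoeff_oscPow (hu.block h q), hermiteCoeff_block h, hermiteCoeff_block h,
    hermiteCoeff_oscPow hu]
  have := fourierMul_smul (measurable_blockSymbol h q) (abs_blockSymbol_le_one h q)
    ((((n : ℝ) + 1 / 2) ^ r : ℝ) : ℂ) (hermiteCoeff n u)
  exact this.symm

end Besov

theorem uhat_oscPow {r : ℝ} {u : L2xv} (hu : InOscDomain r u) (n : ℕ) :
    uhat n (oscPow r u) =ᵐ[volume] fun η => ((((n : ℝ) + 1 / 2) ^ r : ℝ) : ℂ) * uhat n u η := by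
  unfold uhat
  have h1 : hermiteCoeff n (oscPow r u) =
      ((((n : ℝ) + 1 / 2) ^ r : ℝ) : ℂ) • hermiteCoeff n u := hermiteCoeff_oscPow hu n
  rw [h1, FourierTransform.fourier_smul]
  exact Lp.coeFn_smul _ _

theorem aestronglyMeasurable_oscPow {r : ℝ} {u : ℝ → L2xv} {μ : Measure ℝ}
    (hu : AEStronglyMeasurable u μ) (hd : ∀ᵐ t ∂μ, InOscDomain r (u t)) :
    AEStronglyMeasurable (fun t => oscPow r (u t)) μ := by
  refine aestronglyMeasurable_of_tendsto_ae Filter.atTop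
    (f := fun N t => ∑ n ∈ Finset.range N,
      spectralTerm (fun n _ => ((n : ℝ) + 1 / 2) ^ r) (u t) n) (fun N => ?_) ?_
  · refine Finset.aestronglyMeasurable_fun_sum _ fun n _ => ?_
    simp only [spectralTerm_eq, fourierMul_const]
    have hc : Continuous fun w : L2xv =>
        tensor n (((((n : ℝ) + 1 / 2) ^ r : ℝ) : ℂ) • hermiteCoeff n w) :=
      (tensorIso n).continuous.comp ((hermiteCoeffCLM n).continuous.const_smul
        (((((n : ℝ) + 1 / 2) ^ r : ℝ)) : ℂ))
    exact hc.comp_aestronglyMeasurable hu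
  · filter_upwards [hd] with t ht
    exact ht.hasSum.tendsto_sum_nat

/-! ### The weak form in frequency -/

/-- The Hermite coefficients of `(G_κ(t))⁻¹ u`. -/
def invCoeff (s κ t : ℝ) (k : ℕ) (u : L2xv) : L2x :=
  fourierMul (fun ξ => (weightSymbol s κ t k ξ)⁻¹) (hermiteCoeff k u)

theorem measurable_inv_weightSymbol {s κ : ℝ} (hs : 0 < s) (hκ : 0 < κ) (t : ℝ) (n : ℕ) :
    Measurable fun ξ => (weightSymbol s κ t n ξ)⁻¹ :=
  (continuous_weightSymbol hs hκ t n).measurable.inv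

theorem abs_inv_weightSymbol_le {κ t : ℝ} (hκ : 0 < κ) (hκ1 : κ ≤ 1) (ht : 0 ≤ t) (s : ℝ) (n : ℕ)
    (ξ : ℝ) : |(weightSymbol s κ t n ξ)⁻¹| ≤ 2 := by
  rw [abs_of_pos (inv_pos.2 (weightSymbol_pos hκ s t n ξ))]
  exact inv_weightSymbol_le hκ hκ1 ht s n ξ

theorem abs_weightSymbol_le {κ : ℝ} (hκ : 0 < κ) (s t : ℝ) (n : ℕ) (ξ : ℝ) :
    |weightSymbol s κ t n ξ| ≤ κ⁻¹ := by
  rw [abs_of_pos (weightSymbol_pos hκ s t n ξ), ← one_div, le_div_iff₀ hκ, mul_comm]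
  exact mul_weightSymbol_le hκ s t n ξ

theorem hermiteCoeff_weightInv {s κ t : ℝ} (hs : 0 < s) (hκ : 0 < κ) (hκ1 : κ ≤ 1) (ht : 0 ≤ t)
    (u : L2xv) (k : ℕ) : hermiteCoeff k (weightInv s κ t u) = invCoeff s κ t k u :=
  hermiteCoeff_spectralMul (measurable_inv_weightSymbol hs hκ t)
    (abs_inv_weightSymbol_le hκ hκ1 ht s) u k

theorem fourier_invCoeff {s κ t : ℝ} (hs : 0 < s) (hκ : 0 < κ) (hκ1 : κ ≤ 1) (ht : 0 ≤ t)
    (k : ℕ) (u : L2xv) : (𝓕 (invCoeff s κ t k u) : L2x) =ᵐ[volume]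
      fun η => (((weightFreq s κ t k η)⁻¹ : ℝ) : ℂ) * uhat k u η :=
  fourier_fourierMul (measurable_inv_weightSymbol hs hκ t k)
    (abs_inv_weightSymbol_le hκ hκ1 ht s k) _

theorem memLp_inv_weightFreq_mul {s κ t : ℝ} (hs : 0 < s) (hκ : 0 < κ) (hκ1 : κ ≤ 1) (ht : 0 ≤ t)
    (k : ℕ) {w : ℝ → ℂ} (hw : MemLp w 2) :
    MemLp (fun η => (((weightFreq s κ t k η)⁻¹ : ℝ) : ℂ) * w η) 2 :=
  memLp_mul_of_bound (continuous_weightFreq hs hκ t k).measurable.inv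
    (fun _ => abs_inv_weightSymbol_le hκ hκ1 ht s k _) hw

theorem integrable_inv_weightFreq_mul {s κ t : ℝ} (hs : 0 < s) (hκ : 0 < κ) (hκ1 : κ ≤ 1)
    (ht : 0 ≤ t) (k : ℕ) {w : ℝ → ℂ} (hw : Integrable w) :
    Integrable (fun η => (((weightFreq s κ t k η)⁻¹ : ℝ) : ℂ) * w η) := by
  refine hw.bdd_mul (c := 2) ?_ (Filter.Eventually.of_forall fun η => ?_)
  · exact (Complex.measurable_ofReal.comp
      (continuous_weightFreq hs hκ t k).measurable.inv).aestronglyMeasurable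
  · rw [Complex.norm_real]
    exact abs_inv_weightSymbol_le hκ hκ1 ht s k _

/-- A coefficient with integrable Fourier transform is given by the Fourier integral. -/
theorem invCoeff_ae_eq {s κ t : ℝ} (hs : 0 < s) (hκ : 0 < κ) (hκ1 : κ ≤ 1) (ht : 0 ≤ t)
    (k : ℕ) {u : L2xv} (hu : Integrable (uhat k u)) :
    invCoeff s κ t k u =ᵐ[volume]
      𝓕⁻ (fun η => (((weightFreq s κ t k η)⁻¹ : ℝ) : ℂ) * uhat k u η) := by
  have h1 := fourierInv_toL2 (integrable_inv_weightFreq_mul hs hκ hκ1 ht k hu)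
    (memLp_inv_weightFreq_mul hs hκ hκ1 ht k (memLp_uhat k u))
  have h2 : toL2 (fun η => (((weightFreq s κ t k η)⁻¹ : ℝ) : ℂ) * uhat k u η) =
      (𝓕 (invCoeff s κ t k u) : L2x) := (eq_toL2 (fourier_invCoeff hs hκ hκ1 ht k u)).symm
  have h3 : (𝓕⁻ (𝓕 (invCoeff s κ t k u) : L2x) : L2x) = invCoeff s κ t k u :=
    FourierTransform.fourierInv_fourier_eq (E := L2x) (F := L2x) _
  rw [h2, h3] at h1
  exact h1

/-- The coefficients of the nonlinear term are finite sums of products. -/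
theorem conjGammaCoeff_ae_eq {s κ t : ℝ} (hs : 0 < s) (hs' : s < 1) (hκ : 0 < κ) (hκ1 : κ ≤ 1)
    (ht : 0 ≤ t) (f g : L2xv) (n : ℕ) :
    conjGammaCoeff s κ t n f g =ᵐ[volume] fun x =>
      ∑ p ∈ Finset.HasAntidiagonal.antidiagonal n, (alphaCoeff s p.1 p.2 : ℂ) *
        (invCoeff s κ t p.1 f x * invCoeff s κ t p.2 g x) := by
  have hc : ∀ u : L2xv, ∀ᵐ x : ℝ, ∀ k, invCoeff s κ t k u x =
      ∫ v : ℝ, weightInv s κ t u (x, v) * (hermiteFun k v : ℂ) := fun u =>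
    ae_all_iff.2 fun k => by
      rw [← hermiteCoeff_weightInv hs hκ hκ1 ht]
      exact coeFn_hermiteCoeff k _
  filter_upwards [hc f, hc g, ae_memLp_slice (weightInv s κ t f),
    ae_memLp_slice (weightInv s κ t g)] with x h1 h2 h3 h4
  simp only [conjGammaCoeff, gammaCoeff_eq hs hs' h3 h4 n, h1, h2]

theorem memLp_invCoeff_mul {s κ t : ℝ} (hs : 0 < s) (hκ : 0 < κ) (hκ1 : κ ≤ 1) (ht : 0 ≤ t)
    (k : ℕ) {u : L2xv} (hu : Integrable (uhat k u)) (w : L2x) :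
    MemLp (fun x => invCoeff s κ t k u x * w x) 2 := by
  refine MemLp.of_le_mul (c := ∫ η, ‖(((weightFreq s κ t k η)⁻¹ : ℝ) : ℂ) * uhat k u η‖)
    (Lp.memLp w) ((Lp.aestronglyMeasurable _).mul (Lp.aestronglyMeasurable _)) ?_
  filter_upwards [invCoeff_ae_eq hs hκ hκ1 ht k hu] with x hx
  rw [norm_mul, hx]
  exact mul_le_mul_of_nonneg_right (norm_fourierInv_le _ x) (norm_nonneg _)

theorem memLp_conjGammaCoeff {s κ t : ℝ} (hs : 0 < s) (hs' : s < 1) (hκ : 0 < κ) (hκ1 : κ ≤ 1)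
    (ht : 0 ≤ t) {f : L2xv} (hf : ∀ k, Integrable (uhat k f)) (g : L2xv) (n : ℕ) :
    MemLp (conjGammaCoeff s κ t n f g) 2 := by
  rw [memLp_congr_ae (conjGammaCoeff_ae_eq hs hs' hκ hκ1 ht f g n)]
  exact memLp_finsetSum _ fun p _ => (memLp_invCoeff_mul hs hκ hκ1 ht p.1 (hf p.1) _).const_mul _

theorem quasiMeasurePreserving_add_plane :
    Measure.QuasiMeasurePreserving (fun z : ℝ × ℝ => z.1 + z.2) volume volume := by
  rw [Measure.volume_eq_prod]
  exact Measure.quasiMeasurePreserving_snd.comp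
    (measurePreserving_prod_add (volume : Measure ℝ) (volume : Measure ℝ)).quasiMeasurePreserving

theorem ae_plane_snd {P : ℝ → Prop} (h : ∀ᵐ x : ℝ, P x) : ∀ᵐ z : ℝ × ℝ, P z.2 := by
  rw [Measure.volume_eq_prod]
  exact Measure.quasiMeasurePreserving_snd.ae h

theorem ae_plane_add {P : ℝ → Prop} (h : ∀ᵐ x : ℝ, P x) : ∀ᵐ z : ℝ × ℝ, P (z.1 + z.2) :=
  quasiMeasurePreserving_add_plane.ae h

section Besov

variable {χ φ : ℝ → ℝ}

/-- The test function of the `n`-th term of the weak form. -/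
def testCoeff (χ φ : ℝ → ℝ) (s κ t : ℝ) (p : ℤ) (n : ℕ) (w : L2xv) : L2x :=
  fourierMul (blockSymbol χ φ p) (fourierMul (weightSymbol s κ t n)
    (fourierMul (blockSymbol χ φ p) (hermiteCoeff n w)))

theorem fourier_testCoeff (h : IsDyadicPair χ φ) {s κ : ℝ} (hs : 0 < s) (hκ : 0 < κ) (t : ℝ)
    (p : ℤ) (n : ℕ) (w : L2xv) :
    (𝓕 (testCoeff χ φ s κ t p n w) : L2x) =ᵐ[volume] fun ξ => (weightFreq s κ t n ξ : ℂ) *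
      ((blockSymbol χ φ p (2 * Real.pi * ξ) : ℂ) ^ 2 * uhat n w ξ) := by
  unfold testCoeff
  filter_upwards [fourier_fourierMul (measurable_blockSymbol h p) (abs_blockSymbol_le_one h p)
      (fourierMul (weightSymbol s κ t n) (fourierMul (blockSymbol χ φ p) (hermiteCoeff n w))),
    fourier_fourierMul (continuous_weightSymbol hs hκ t n).measurable (abs_weightSymbol_le hκ s t n)
      (fourierMul (blockSymbol χ φ p) (hermiteCoeff n w)),
    fourier_fourierMul (measurable_blockSymbol h p) (abs_blockSymbol_le_one h p)
      (hermiteCoeff n w)] with ξ h1 h2 h3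
  rw [h1, h2, h3]
  unfold weightFreq uhat
  ring

theorem weakTerm_eq_inner (h : IsDyadicPair χ φ) {s κ : ℝ} (hs : 0 < s) (hκ : 0 < κ) (t : ℝ)
    (p : ℤ) (f g w : L2xv) (n : ℕ) :
    weakTerm χ φ s κ t p f g w n =
      inner ℂ (testCoeff χ φ s κ t p n w) (toL2 (conjGammaCoeff s κ t n f g)) := by
  unfold weakTerm testCoeff
  rw [inner_fourierMul (measurable_blockSymbol h p) (abs_blockSymbol_le_one h p),
    inner_fourierMul (measurable_blockSymbol h p) (abs_blockSymbol_le_one h p),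
    inner_fourierMul (continuous_weightSymbol hs hκ t n).measurable (abs_weightSymbol_le hκ s t n),
    inner_fourierMul (measurable_blockSymbol h p) (abs_blockSymbol_le_one h p)]

theorem weakTerm_eq_sum_integral (h : IsDyadicPair χ φ) {s κ t : ℝ} (hs : 0 < s) (hs' : s < 1)
    (hκ : 0 < κ) (hκ1 : κ ≤ 1) (ht : 0 ≤ t) (p : ℤ) {f : L2xv} (hf : ∀ k, Integrable (uhat k f))
    (g w : L2xv) (n : ℕ) :
    weakTerm χ φ s κ t p f g w n = ∑ q ∈ Finset.HasAntidiagonal.antidiagonal n,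
      (alphaCoeff s q.1 q.2 : ℂ) * ∫ x, invCoeff s κ t q.1 f x * (invCoeff s κ t q.2 g x *
        (starRingEnd ℂ) (testCoeff χ φ s κ t p n w x)) := by
  have hi : ∀ k l, Integrable fun x => invCoeff s κ t k f x * (invCoeff s κ t l g x *
        (starRingEnd ℂ) (testCoeff χ φ s κ t p n w x)) := fun k l => by
    have := (memLp_invCoeff_mul hs hκ hκ1 ht k (hf k) (invCoeff s κ t l g)).integrable_mul
      (Lp.memLp (testCoeff χ φ s κ t p n w)).star
    refine this.congr (Filter.Eventually.of_forall fun x => ?_)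
    simp only [Pi.mul_apply, Pi.star_apply, RCLike.star_def, mul_assoc]
  rw [weakTerm_eq_inner h hs hκ, L2.inner_def]
  have e : ∫ x, inner ℂ (testCoeff χ φ s κ t p n w x) (toL2 (conjGammaCoeff s κ t n f g) x) =
      ∫ x, ∑ q ∈ Finset.HasAntidiagonal.antidiagonal n, (alphaCoeff s q.1 q.2 : ℂ) *
        (invCoeff s κ t q.1 f x * (invCoeff s κ t q.2 g x *
          (starRingEnd ℂ) (testCoeff χ φ s κ t p n w x))) := by
    refine integral_congr_ae ?_
    filter_upwards [coeFn_toL2 (memLp_conjGammaCoeff hs hs' hκ hκ1 ht hf g n),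
      conjGammaCoeff_ae_eq hs hs' hκ hκ1 ht f g n] with x h1 h2
    rw [h1, h2, RCLike.inner_apply, Finset.sum_mul]
    exact Finset.sum_congr rfl fun q _ => by ring
  rw [e, integral_finsetSum _ fun q _ => (hi q.1 q.2).const_mul _]
  simp only [integral_const_mul]

theorem integral_invCoeff_mul (h : IsDyadicPair χ φ) {s κ t : ℝ} (hs : 0 < s)
    (hκ : 0 < κ) (hκ1 : κ ≤ 1) (ht : 0 ≤ t) (p : ℤ) (k l : ℕ) {f : L2xv}
    (hf : Integrable (uhat k f)) (g w : L2xv) :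
    ∫ x, invCoeff s κ t k f x * (invCoeff s κ t l g x *
        (starRingEnd ℂ) (testCoeff χ φ s κ t p (k + l) w x)) =
      ∫ z : ℝ × ℝ, weightRatio s κ t k l z * (uhat k f z.1 * (uhat l g z.2 *
        (starRingEnd ℂ) ((blockSymbol χ φ p (2 * Real.pi * (z.1 + z.2)) : ℂ) ^ 2 *
          uhat (k + l) w (z.1 + z.2)))) := by
  have h1 := integral_fourierInv_mul_mul_conj (integrable_inv_weightFreq_mul hs hκ hκ1 ht k hf)
    (𝓕 (invCoeff s κ t l g) : L2x) (𝓕 (testCoeff χ φ s κ t p (k + l) w) : L2x)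
  have e1 : (𝓕⁻ (𝓕 (invCoeff s κ t l g) : L2x) : L2x) = invCoeff s κ t l g :=
    FourierTransform.fourierInv_fourier_eq (E := L2x) (F := L2x) _
  have e2 : (𝓕⁻ (𝓕 (testCoeff χ φ s κ t p (k + l) w) : L2x) : L2x) =
      testCoeff χ φ s κ t p (k + l) w :=
    FourierTransform.fourierInv_fourier_eq (E := L2x) (F := L2x) _
  rw [e1, e2] at h1
  refine Eq.trans (integral_congr_ae ?_) (h1.trans (integral_congr_ae ?_))
  · filter_upwards [invCoeff_ae_eq hs hκ hκ1 ht k hf] with x hx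
    rw [hx]
  · filter_upwards [ae_plane_snd (fourier_invCoeff hs hκ hκ1 ht l g),
      ae_plane_add (fourier_testCoeff h hs hκ t p (k + l) w)] with z h2 h3
    rw [h2, h3]
    unfold weightRatio
    simp only [map_mul, Complex.conj_ofReal]
    push_cast
    ring

/-- The terms of the weak form as integrals over the frequencies. -/
theorem weakTerm_eq (h : IsDyadicPair χ φ) {s κ t : ℝ} (hs : 0 < s) (hs' : s < 1)
    (hκ : 0 < κ) (hκ1 : κ ≤ 1) (ht : 0 ≤ t) (p : ℤ) {f : L2xv} (hf : ∀ k, Integrable (uhat k f))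
    (g w : L2xv) (n : ℕ) :
    weakTerm χ φ s κ t p f g w n = ∑ q ∈ Finset.HasAntidiagonal.antidiagonal n,
      (alphaCoeff s q.1 q.2 : ℂ) * ∫ z : ℝ × ℝ, weightRatio s κ t q.1 q.2 z *
        (uhat q.1 f z.1 * (uhat q.2 g z.2 *
          (starRingEnd ℂ) ((blockSymbol χ φ p (2 * Real.pi * (z.1 + z.2)) : ℂ) ^ 2 *
          uhat n w (z.1 + z.2)))) := by
  rw [weakTerm_eq_sum_integral h hs hs' hκ hκ1 ht p hf]
  refine Finset.sum_congr rfl fun q hq => ?_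
  rw [← Finset.HasAntidiagonal.mem_antidiagonal.1 hq,
    integral_invCoeff_mul h hs hκ hκ1 ht p q.1 q.2 (hf q.1)]

theorem integrable_uhat (h : IsDyadicPair χ φ) {u : L2xv} (hu : besovNorm χ φ (1 / 2) u ≠ ⊤)
    (k : ℕ) : Integrable (uhat k u) :=
  (lowFamily_uhat h (k + 1) u).integrable (ENNReal.mul_ne_top (by norm_num) hu) (Nat.lt_succ_self k)

end Besov

/-! ### Partial sums of the weak form as pairings -/

theorem sum_range_sum_antidiagonal {N : ℕ} {T : ℕ → ℕ → ℂ} (hT : ∀ k l, N ≤ k + l → T k l = 0) :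
    ∑ n ∈ Finset.range N, ∑ q ∈ Finset.HasAntidiagonal.antidiagonal n, T q.1 q.2 =
      ∑ k ∈ Finset.range N, ∑ l ∈ Finset.range N, T k l := by
  have e : ∀ n, ∑ q ∈ Finset.HasAntidiagonal.antidiagonal n, T q.1 q.2 =
      ∑ k ∈ Finset.range (n + 1), T k (n - k) := fun n =>
    Finset.Nat.sum_antidiagonal_eq_sum_range_succ T n
  simp only [e]
  rw [Finset.sum_range_diag_flip]
  refine Finset.sum_congr rfl fun k _ => ?_
  refine Finset.sum_subset (fun l hl => ?_) fun l _ hl => hT k l ?_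
  · simp only [Finset.mem_range] at hl ⊢; omega
  · simp only [Finset.mem_range] at hl; omega

theorem alphaCoeff_eq_betaCoeff (s : ℝ) (k l : ℕ) :
    alphaCoeff s k l = betaCoeff s k l *
      (((l : ℝ) + 1 / 2) ^ (s / 2) * (((k + l : ℕ) : ℝ) + 1 / 2) ^ (s / 2)) := by
  have h1 : ((l : ℝ) + 1 / 2) ^ (-(s / 2)) * ((l : ℝ) + 1 / 2) ^ (s / 2) = 1 := by
    rw [← Real.rpow_add (by positivity)]; simp
  have h2 : (((k + l : ℕ) : ℝ) + 1 / 2) ^ (-(s / 2)) * (((k + l : ℕ) : ℝ) + 1 / 2) ^ (s / 2) = 1 := by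
    rw [← Real.rpow_add (by positivity)]; simp
  unfold betaCoeff
  calc alphaCoeff s k l = alphaCoeff s k l *
        ((((l : ℝ) + 1 / 2) ^ (-(s / 2)) * ((l : ℝ) + 1 / 2) ^ (s / 2)) *
        ((((k + l : ℕ) : ℝ) + 1 / 2) ^ (-(s / 2)) * (((k + l : ℕ) : ℝ) + 1 / 2) ^ (s / 2))) := by
        rw [h1, h2]; ring
    _ = _ := by ring

section Besov

variable {χ φ : ℝ → ℝ}

/-- The family of test functions of a partial sum of the weak form. -/
def testFamily (χ φ : ℝ → ℝ) (s : ℝ) (p : ℤ) (w : L2xv) (N : ℕ) (o : ℕ → ℂ) (n : ℕ) (ξ : ℝ) : ℂ :=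
  if n < N then (starRingEnd ℂ) (o n) * (((((n : ℝ) + 1 / 2) ^ (s / 2) : ℝ) : ℂ) *
    ((blockSymbol χ φ p (2 * Real.pi * ξ) : ℂ) ^ 2 * uhat n w ξ)) else 0

theorem sum_weakTerm_eq_pairing (h : IsDyadicPair χ φ) {s κ t : ℝ} (hs : 0 < s) (hs' : s < 1)
    (hκ : 0 < κ) (hκ1 : κ ≤ 1) (ht : 0 ≤ t) (p : ℤ) {f : L2xv} (hf : ∀ k, Integrable (uhat k f))
    {g : L2xv} (hg : InOscDomain (s / 2) g) (w : L2xv) (N : ℕ) (o : ℕ → ℂ) :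
    ∑ n ∈ Finset.range N, o n * weakTerm χ φ s κ t p f g w n =
      pairing (betaCoeff s) N (weightRatio s κ t) (fun k => uhat k f)
        (fun l => uhat l (oscPow (s / 2) g)) (testFamily χ φ s p w N o) := by
  set T : ℕ → ℕ → ℂ := fun k l => (betaCoeff s k l : ℂ) * ∫ z : ℝ × ℝ, weightRatio s κ t k l z *
    (uhat k f z.1 * (uhat l (oscPow (s / 2) g) z.2 *
      (starRingEnd ℂ) (testFamily χ φ s p w N o (k + l) (z.1 + z.2)))) with hT
  have hT0 : ∀ k l, N ≤ k + l → T k l = 0 := fun k l hkl => by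
    simp only [hT, testFamily, if_neg (not_lt.2 hkl)]
    simp
  have e := sum_range_sum_antidiagonal hT0
  unfold pairing
  rw [← e]
  refine Finset.sum_congr rfl fun n hn => ?_
  rw [weakTerm_eq h hs hs' hκ hκ1 ht p hf, Finset.mul_sum]
  refine Finset.sum_congr rfl fun q hq => ?_
  obtain ⟨k, l⟩ := q
  rw [Finset.HasAntidiagonal.mem_antidiagonal] at hq
  simp only at hq ⊢
  subst hq
  have hi : ∫ z : ℝ × ℝ, weightRatio s κ t k l z *
      (uhat k f z.1 * (uhat l (oscPow (s / 2) g) z.2 *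
      (starRingEnd ℂ) (testFamily χ φ s p w N o (k + l) (z.1 + z.2)))) =
      ∫ z : ℝ × ℝ, (o (k + l) * ((((l : ℝ) + 1 / 2) ^ (s / 2) *
        (((k + l : ℕ) : ℝ) + 1 / 2) ^ (s / 2) : ℝ) : ℂ)) * (weightRatio s κ t k l z *
      (uhat k f z.1 * (uhat l g z.2 *
      (starRingEnd ℂ) ((blockSymbol χ φ p (2 * Real.pi * (z.1 + z.2)) : ℂ) ^ 2 *
          uhat (k + l) w (z.1 + z.2))))) := by
    refine integral_congr_ae ?_
    filter_upwards [ae_plane_snd (uhat_oscPow hg l)] with z hz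
    rw [hz, testFamily, if_pos (Finset.mem_range.1 hn)]
    simp only [map_mul, Complex.conj_ofReal, Complex.conj_conj]
    push_cast
    ring
  simp only [hT]
  rw [hi, integral_const_mul, alphaCoeff_eq_betaCoeff]
  push_cast
  ring

theorem sum_lintegral_testFamily_le (h : IsDyadicPair χ φ) {s : ℝ} {p : ℤ} {w : L2xv}
    (hw : InOscDomain (s / 2) w) (N M : ℕ) {o : ℕ → ℂ} (ho : ∀ n, ‖o n‖ ≤ 1) :
    ∑ n ∈ Finset.range M, ∫⁻ ξ, ‖testFamily χ φ s p w N o n ξ‖ₑ ^ 2 ≤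
      ‖oscPow (s / 2) (block χ φ p w)‖ₑ ^ 2 := by
  refine le_trans (Finset.sum_le_sum fun n _ => ?_) (sum_lintegral_uhat_sq_le M _)
  refine lintegral_mono_ae ?_
  filter_upwards [uhat_oscPow (hw.block h p) n, uhat_block h p w n] with ξ h1 h2
  refine pow_le_pow_left₀ (by positivity) ?_ 2
  rw [← ofReal_norm, ← ofReal_norm]
  refine ENNReal.ofReal_le_ofReal ?_
  rw [h1, h2, testFamily]
  split_ifs
  · rw [norm_mul, norm_mul, norm_mul, norm_mul, norm_mul, norm_pow, RCLike.norm_conj,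
      Complex.norm_real, Complex.norm_real, Real.norm_of_nonneg (blockSymbol_nonneg h _ _)]
    have h3 := blockSymbol_nonneg h p (2 * Real.pi * ξ)
    have h4 := blockSymbol_le_one h p (2 * Real.pi * ξ)
    have h5 : blockSymbol χ φ p (2 * Real.pi * ξ) ^ 2 ≤ blockSymbol χ φ p (2 * Real.pi * ξ) := by
      nlinarith
    calc ‖o n‖ * (‖((n : ℝ) + 1 / 2) ^ (s / 2)‖ *
          (blockSymbol χ φ p (2 * Real.pi * ξ) ^ 2 * ‖uhat n w ξ‖))
        ≤ 1 * (‖((n : ℝ) + 1 / 2) ^ (s / 2)‖ *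
          (blockSymbol χ φ p (2 * Real.pi * ξ) * ‖uhat n w ξ‖)) := by
          gcongr
          exact ho n
      _ = _ := one_mul _
  · rw [norm_zero]; positivity

theorem memLp_testFamily (h : IsDyadicPair χ φ) (s : ℝ) (p : ℤ) (w : L2xv) (N : ℕ) (o : ℕ → ℂ)
    (n : ℕ) : MemLp (testFamily χ φ s p w N o n) 2 := by
  unfold testFamily
  split_ifs
  · have := memLp_mul_of_bound (m := fun ξ => blockSymbol χ φ p (2 * Real.pi * ξ) ^ 2) (B := 1)
      ((measurable_comp_two_pi (measurable_blockSymbol h p)).pow_const 2) (fun ξ => by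
        rw [abs_pow]
        exact pow_le_one₀ (abs_nonneg _) (abs_blockSymbol_le_one h p _)) (memLp_uhat n w)
    simp only [Complex.ofReal_pow] at this
    exact (this.const_mul _).const_mul _
  · exact MemLp.zero'

theorem blockSymbol_ne_zero_of_testFamily {s : ℝ} {p : ℤ} {w : L2xv} {N : ℕ} {o : ℕ → ℂ} {n : ℕ}
    {ξ : ℝ} (h : testFamily χ φ s p w N o n ξ ≠ 0) : blockSymbol χ φ p (2 * Real.pi * ξ) ≠ 0 := by
  intro h0
  refine h ?_
  simp [testFamily, h0]

/-! ### Minkowski's inequality for dyadic blocks -/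

theorem sum_mul_le_rms (N : ℕ) (x y : ℕ → ℂ) :
    ∑ k ∈ Finset.range N, ‖x k‖ * ‖y k‖ ≤ rms N x * rms N y :=
  Real.sum_mul_le_sqrt_mul_sqrt _ _ _

theorem sum_lintegral_symbol_mul_le (h : IsDyadicPair χ φ) {ι : Type} [Countable ι] (e : ι → ℤ)
    {m : ℝ → ℝ} (hm : Measurable m) (hm1 : ∀ ξ, |m ξ| ≤ 1)
    (hle : ∀ ξ, ENNReal.ofReal |m ξ| ≤ ∑' i, ENNReal.ofReal (blockSymbol χ φ (e i) ξ))
    (u : L2xv) (N : ℕ) :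
    ∑ l ∈ Finset.range N, ∫⁻ ζ, ‖(m (2 * Real.pi * ζ) : ℂ) * uhat l u ζ‖ₑ ^ 2 ≤
      (∑' i, ‖block χ φ (e i) u‖ₑ) ^ 2 := by
  set b : ℕ → ℝ → ℂ := fun l ζ => (m (2 * Real.pi * ζ) : ℂ) * uhat l u ζ with hb
  have hbm : ∀ l, MemLp (b l) 2 := fun l =>
    memLp_mul_of_bound (measurable_comp_two_pi hm) (fun ξ => hm1 _) (memLp_uhat l u)
  set X : ℝ≥0∞ := ∑ l ∈ Finset.range N, ∫⁻ ζ, ‖b l ζ‖ₑ ^ 2 with hX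
  have hXtop : X ≠ ⊤ := ENNReal.sum_ne_top.2 fun l _ => (lintegral_enorm_sq_lt_top (hbm l)).ne
  set A : ℝ≥0∞ := X ^ (1 / 2 : ℝ) with hA
  have hA2 : A ^ 2 = X := by
    rw [hA, ← ENNReal.rpow_natCast, ← ENNReal.rpow_mul]; norm_num
  rw [← hA2]
  refine pow_le_pow_left₀ (by positivity) (le_of_sq_le_mul
    (ENNReal.rpow_ne_top_of_nonneg (by norm_num) hXtop) ?_) 2
  have hj : ∀ i, ∫⁻ ζ, ENNReal.ofReal (rms N fun l => uhat l (block χ φ (e i) u) ζ) *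
      ENNReal.ofReal (rms N fun l => b l ζ) ≤ ‖block χ φ (e i) u‖ₑ * A := fun i =>
    lintegral_rms_mul_rms_le (fun l => (memLp_uhat l _).1) (fun l => (hbm l).1)
      (sum_lintegral_uhat_sq_le N _) hA2.ge
  calc A ^ 2 = ∫⁻ ζ, ∑ l ∈ Finset.range N, ‖b l ζ‖ₑ ^ 2 := by
        rw [hA2, hX, lintegral_finsetSum' _ fun l _ => (hbm l).1.enorm.pow_const 2]
    _ ≤ ∫⁻ ζ, ∑' i, ENNReal.ofReal (rms N fun l => uhat l (block χ φ (e i) u) ζ) *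
          ENNReal.ofReal (rms N fun l => b l ζ) := by
        refine lintegral_mono_ae ?_
        have h1 : ∀ᵐ ζ : ℝ, ∀ (i : ι) (l : ℕ), uhat l (block χ φ (e i) u) ζ =
            (blockSymbol χ φ (e i) (2 * Real.pi * ζ) : ℂ) * uhat l u ζ :=
          ae_all_iff.2 fun i => ae_all_iff.2 fun l => uhat_block h (e i) u l
        filter_upwards [h1] with ζ h2
        have h3 : ∀ i, ENNReal.ofReal (blockSymbol χ φ (e i) (2 * Real.pi * ζ)) *
            ∑ l ∈ Finset.range N, ‖uhat l u ζ‖ₑ * ‖b l ζ‖ₑ ≤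
            ENNReal.ofReal (rms N fun l => uhat l (block χ φ (e i) u) ζ) *
              ENNReal.ofReal (rms N fun l => b l ζ) := fun i => by
          rw [← ENNReal.ofReal_mul (rms_nonneg _ _)]
          refine le_trans (le_of_eq ?_) (ENNReal.ofReal_le_ofReal (sum_mul_le_rms N _ _))
          rw [ENNReal.ofReal_sum_of_nonneg fun l _ => by positivity, Finset.mul_sum]
          refine Finset.sum_congr rfl fun l _ => ?_
          rw [h2, norm_mul, ENNReal.ofReal_mul (by positivity), ENNReal.ofReal_mul (by positivity),
            ofReal_norm (uhat l u ζ), ofReal_norm (b l ζ), Complex.norm_real,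
            Real.norm_of_nonneg (blockSymbol_nonneg h _ _)]
          exact (mul_assoc _ _ _).symm
        refine le_trans ?_ (ENNReal.tsum_le_tsum h3)
        rw [ENNReal.tsum_mul_right]
        calc ∑ l ∈ Finset.range N, ‖b l ζ‖ₑ ^ 2 = ENNReal.ofReal |m (2 * Real.pi * ζ)| *
              ∑ l ∈ Finset.range N, ‖uhat l u ζ‖ₑ * ‖b l ζ‖ₑ := by
              rw [Finset.mul_sum]
              refine Finset.sum_congr rfl fun l _ => ?_
              rw [sq, ← mul_assoc]
              congr 1
              simp only [hb]
              rw [enorm_mul, ← ofReal_norm (m (2 * Real.pi * ζ) : ℂ), Complex.norm_real,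
                Real.norm_eq_abs]
          _ ≤ _ := mul_le_mul_left (hle _) _
    _ = ∑' i, ∫⁻ ζ, ENNReal.ofReal (rms N fun l => uhat l (block χ φ (e i) u) ζ) *
          ENNReal.ofReal (rms N fun l => b l ζ) := by
        refine lintegral_tsum fun i => ?_
        exact (aemeasurable_rms fun l => (memLp_uhat l _).1).ennreal_ofReal.mul
          (aemeasurable_rms fun l => (hbm l).1).ennreal_ofReal
    _ ≤ ∑' i, ‖block χ φ (e i) u‖ₑ * A := ENNReal.tsum_le_tsum hj
    _ = A * ∑' i, ‖block χ φ (e i) u‖ₑ := by rw [ENNReal.tsum_mul_right, mul_comm]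

end Besov

/-! ### The trilinear estimate for the weak form -/

theorem continuous_weightRatio {s κ : ℝ} (hs : 0 < s) (hκ : 0 < κ) (t : ℝ) (k l : ℕ) :
    Continuous (weightRatio s κ t k l) := by
  have hG := continuous_weightFreq hs hκ t
  unfold weightRatio
  refine Complex.continuous_ofReal.comp ?_
  exact (((hG (k + l)).comp (continuous_fst.add continuous_snd)).mul
    (((hG k).comp continuous_fst).inv₀ fun z => (weightFreq_pos hκ s t k _).ne')).mul
    (((hG l).comp continuous_snd).inv₀ fun z => (weightFreq_pos hκ s t l _).ne')

theorem norm_weightRatio_le {s κ t : ℝ} (hs : 0 < s) (hs' : s < 1) (hκ : 0 < κ) (hκ1 : κ ≤ 1)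
    (ht : 0 ≤ t) (k l : ℕ) (z : ℝ × ℝ) : ‖weightRatio s κ t k l z‖ ≤ 4 := by
  have h := (weightRatio_approx hs hs' (le_refl (1 : ℝ)) hκ hκ1 ht k l z.1 z.2).1
  have h1 := weightFreq_pos hκ s t (k + l) (z.1 + z.2)
  have h2 := weightFreq_pos hκ s t k z.1
  have h3 := weightFreq_pos hκ s t l z.2
  rw [weightRatio, Complex.norm_real, Real.norm_of_nonneg (by positivity)]
  exact h

theorem pairing_weightRatio_add {s κ t : ℝ} (hs : 0 < s) (hs' : s < 1) (hκ : 0 < κ) (hκ1 : κ ≤ 1)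
    (ht : 0 ≤ t) (β : ℕ → ℕ → ℝ) {N : ℕ} {a b b' c : ℕ → ℝ → ℂ} (ha : ∀ k, Integrable (a k))
    (hb : ∀ l, MemLp (b l) 2) (hb' : ∀ l, MemLp (b' l) 2) (hc : ∀ n, MemLp (c n) 2) :
    pairing β N (weightRatio s κ t) a (fun l ζ => b l ζ + b' l ζ) c =
      pairing β N (weightRatio s κ t) a b c + pairing β N (weightRatio s κ t) a b' c := by
  have hi : ∀ (d : ℕ → ℝ → ℂ), (∀ l, MemLp (d l) 2) → ∀ k l, Integrable (fun z : ℝ × ℝ =>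
      weightRatio s κ t k l z * (a k z.1 * (d l z.2 *
        (starRingEnd ℂ) (c (k + l) (z.1 + z.2))))) volume := fun d hd k l =>
    (integrable_trilinear (ha k) (hd l) (hc _)).bdd_mul
      (continuous_weightRatio hs hκ t k l).aestronglyMeasurable
      (Filter.Eventually.of_forall fun z => norm_weightRatio_le hs hs' hκ hκ1 ht k l z)
  unfold pairing
  rw [← Finset.sum_add_distrib]
  refine Finset.sum_congr rfl fun k _ => ?_
  rw [← Finset.sum_add_distrib]
  refine Finset.sum_congr rfl fun l _ => ?_
  rw [← mul_add, ← integral_add (hi b hb k l) (hi b' hb' k l)]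
  simp only [add_mul, mul_add]

theorem pairing_swap {s κ t : ℝ} (β : ℕ → ℕ → ℝ) (N : ℕ) (a b c : ℕ → ℝ → ℂ) :
    pairing β N (weightRatio s κ t) a b c =
      pairing (fun k l => β l k) N (weightRatio s κ t) b a c := by
  unfold pairing
  rw [Finset.sum_comm]
  refine Finset.sum_congr rfl fun l _ => Finset.sum_congr rfl fun k _ => ?_
  congr 1
  have h := integral_prod_swap (μ := (volume : Measure ℝ)) (ν := (volume : Measure ℝ))
    (fun z : ℝ × ℝ => weightRatio s κ t k l z *
      (a k z.1 * (b l z.2 * (starRingEnd ℂ) (c (k + l) (z.1 + z.2)))))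
  refine h.symm.trans (integral_congr_ae (Filter.Eventually.of_forall fun z => ?_))
  simp only [weightRatio, Prod.fst_swap, Prod.snd_swap, add_comm k l, add_comm z.2 z.1]
  push_cast
  ring

section Besov

variable {χ φ : ℝ → ℝ}

theorem bracket_le_of_high (h : IsDyadicPair χ φ) {p : ℤ} {ξ ζ : ℝ}
    (hξ : blockSymbol χ φ p ξ ≠ 0)
    (hζ : 1 - blockSum χ φ (Finset.Icc (-1) (p - 5)) ζ ≠ 0) :
    bracket (ξ - ζ) ≤ 59 * bracket ζ := by
  have h0 : ∃ j, blockSymbol χ φ j ζ ≠ 0 ∧ j ∉ Finset.Icc (-1) (p - 5) := by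
    by_contra hcon
    push Not at hcon
    exact hζ (sub_eq_zero.2 (sum_blockSymbol_eq_one h hcon).symm)
  obtain ⟨j, hj, hjS⟩ := h0
  have hj1 := neg_one_le_of_blockSymbol_ne_zero hj
  have hjp : p - 4 ≤ j := by
    rw [Finset.mem_Icc] at hjS
    omega
  have h1 := abs_le_of_blockSymbol_ne_zero h hξ
  have hb1 := one_le_bracket ζ
  have hb2 := abs_le_bracket ζ
  have h2 : (2 : ℝ) ^ p ≤ 64 / 3 * bracket ζ := by
    rcases hj1.eq_or_lt with rfl | hj0
    · have : (2 : ℝ) ^ p ≤ 2 ^ (3 : ℤ) := zpow_le_zpow_right₀ one_le_two (by omega)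
      norm_num at this
      linarith
    · have h3 := le_abs_of_blockSymbol_ne_zero h (by omega) hj
      have h4 : (2 : ℝ) ^ p ≤ 2 ^ (j + 4) := zpow_le_zpow_right₀ one_le_two (by omega)
      rw [zpow_add₀ two_ne_zero] at h4
      norm_num at h4
      linarith
  have h5 := bracket_le_one_add (ξ - ζ)
  have h6 : |ξ - ζ| ≤ |ξ| + |ζ| := abs_sub _ _
  linarith

theorem blockSum_eq_one_of_low (h : IsDyadicPair χ φ) {p : ℤ} {ξ ζ : ℝ}
    (hξ : blockSymbol χ φ p ξ ≠ 0)
    (hζ : blockSum χ φ (Finset.Icc (-1) (p - 5)) ζ ≠ 0) :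
    blockSum χ φ (Finset.Icc (p - 4) (p + 4)) (ξ - ζ) = 1 ∧ |ζ| ≤ |ξ - ζ| := by
  obtain ⟨j, hjS, hj⟩ := Finset.exists_ne_zero_of_sum_ne_zero hζ
  rw [Finset.mem_Icc] at hjS
  have h1 := abs_le_of_blockSymbol_ne_zero h hξ
  have h2 := le_abs_of_blockSymbol_ne_zero h (by omega) hξ
  have h3 := abs_le_of_blockSymbol_ne_zero h hj
  have h4 : (2 : ℝ) ^ (j + 5) ≤ 2 ^ p := zpow_le_zpow_right₀ one_le_two (by omega)
  rw [zpow_add₀ two_ne_zero] at h4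
  norm_num at h4
  have hp : 0 < (2 : ℝ) ^ p := by positivity
  have h5 : |ζ| ≤ 2 ^ p / 12 := by linarith
  have h6 : |ξ| - |ζ| ≤ |ξ - ζ| := abs_sub_abs_le_abs_sub _ _
  have h7 : |ξ - ζ| ≤ |ξ| + |ζ| := abs_sub _ _
  refine ⟨sum_blockSymbol_eq_one h fun i hi => ?_, by linarith⟩
  have hi1 := neg_one_le_of_blockSymbol_ne_zero hi
  have h8 := abs_le_of_blockSymbol_ne_zero h hi
  rw [Finset.mem_Icc]
  constructor
  · by_contra hlt
    have h9 : (2 : ℝ) ^ (i + 5) ≤ 2 ^ p := zpow_le_zpow_right₀ one_le_two (by omega)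
    rw [zpow_add₀ two_ne_zero] at h9
    norm_num at h9
    linarith
  · by_contra hlt
    have h9 : (2 : ℝ) ^ (p + 5) ≤ 2 ^ i := zpow_le_zpow_right₀ one_le_two (by omega)
    have h10 := le_abs_of_blockSymbol_ne_zero h (by omega) hi
    rw [zpow_add₀ two_ne_zero] at h9
    norm_num at h9
    linarith

theorem ofReal_one_sub_blockSum_le (h : IsDyadicPair χ φ) (p : ℤ) (ξ : ℝ) :
    ENNReal.ofReal |1 - blockSum χ φ (Finset.Icc (-1) (p - 5)) ξ| ≤
      ∑' j : {j : ℤ // p - 4 ≤ j}, ENNReal.ofReal (blockSymbol χ φ j ξ) := by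
  set S : Finset ℤ := Finset.Icc (-1) (p - 5) with hS
  have h1 : blockSum χ φ S ξ ≤ 1 := sum_blockSymbol_le_one h S ξ
  rw [abs_of_nonneg (sub_nonneg.2 h1), ENNReal.ofReal_sub _ (show 0 ≤ blockSum χ φ S ξ from sum_blockSymbol_nonneg h S ξ),
    ENNReal.ofReal_one, tsub_le_iff_left, ← tsum_ofReal_blockSymbol h ξ, blockSum,
    ENNReal.ofReal_sum_of_nonneg fun q _ => blockSymbol_nonneg h q ξ, sum_eq_tsum_indicator]
  have e : ∑' j : {j : ℤ // p - 4 ≤ j}, ENNReal.ofReal (blockSymbol χ φ j ξ) =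
      ∑' j : ℤ, Set.indicator {j : ℤ | p - 4 ≤ j}
        (fun j => ENNReal.ofReal (blockSymbol χ φ j ξ)) j :=
    tsum_subtype {j : ℤ | p - 4 ≤ j} fun j => ENNReal.ofReal (blockSymbol χ φ j ξ)
  rw [e, ← ENNReal.tsum_add]
  refine ENNReal.tsum_le_tsum fun q => ?_
  by_cases hq : q ∈ S
  · rw [Set.indicator_of_mem (by exact_mod_cast hq)]
    exact le_self_add
  · by_cases hq1 : q < -1
    · rw [blockSymbol_of_lt χ φ hq1]; simp
    · rw [Set.indicator_of_mem (s := {j : ℤ | p - 4 ≤ j})]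
      · exact le_add_self
      · rw [hS, Finset.mem_Icc] at hq
        rw [Set.mem_ofPred_eq]
        omega

/-- The right-hand side of the trilinear estimate. -/
def trilinearRhs (χ φ : ℝ → ℝ) (s : ℝ) (p : ℤ) (f g w : L2xv) : ℝ≥0∞ :=
  (∑ j ∈ Finset.Icc (p - 4) (p + 4), ‖block χ φ j f‖ₑ * besovNorm χ φ (1 / 2) (oscPow (s / 2) g) *
      ‖oscPow (s / 2) (block χ φ p w)‖ₑ) +
    ∑' j : {j : ℤ // p - 4 ≤ j}, besovNorm χ φ (1 / 2) f * ‖oscPow (s / 2) (block χ φ j g)‖ₑ *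
      ‖oscPow (s / 2) (block χ φ p w)‖ₑ

theorem exists_enorm_pairing_le (h : IsDyadicPair χ φ) {s : ℝ} (hs : 0 < s) (hs' : s < 1) :
    ∃ C : ℝ≥0, ∀ (κ t : ℝ), 0 < κ → κ ≤ 1 → 0 ≤ t → ∀ (p : ℤ) (f g w : L2xv),
      InOscDomain (s / 2) g → InOscDomain (s / 2) w → besovNorm χ φ (1 / 2) f ≠ ⊤ →
      besovNorm χ φ (1 / 2) (oscPow (s / 2) g) ≠ ⊤ → ∀ (N : ℕ) (o : ℕ → ℂ), (∀ n, ‖o n‖ ≤ 1) →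
      ‖pairing (betaCoeff s) N (weightRatio s κ t) (fun k => uhat k f)
        (fun l => uhat l (oscPow (s / 2) g)) (testFamily χ φ s p w N o)‖ₑ ≤
        C * trilinearRhs χ φ s p f g w := by
  obtain ⟨C0, hC0⟩ := exists_pairing_weightRatio_le hs hs' (R := 59) (by norm_num)
  obtain ⟨K, hK0, hK⟩ := exists_trilinearBound_betaCoeff hs hs'
  refine ⟨C0 * (K.toNNReal * 3), fun κ t hκ hκ1 ht p f g w hg hw hbf hbg N o ho => ?_⟩
  set S : Finset ℤ := Finset.Icc (-1) (p - 5) with hS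
  set J : Finset ℤ := Finset.Icc (p - 4) (p + 4) with hJ
  set G := oscPow (s / 2) g with hG
  set c := testFamily χ φ s p w N o with hc
  set D := ‖oscPow (s / 2) (block χ φ p w)‖ₑ with hD
  have hcm : ∀ n, MemLp (c n) 2 := memLp_testFamily h s p w N o
  have hcD : ∑ n ∈ Finset.range (2 * N), ∫⁻ ξ, ‖c n ξ‖ₑ ^ 2 ≤ D ^ 2 :=
    sum_lintegral_testFamily_le h hw N (2 * N) ho
  have hSm := measurable_blockSum h S
  have hmS : Measurable fun ξ => 1 - blockSum χ φ S ξ := measurable_const.sub hSm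
  have hmS1 : ∀ ξ, |1 - blockSum χ φ S ξ| ≤ 1 := fun ξ => by
    have h1 := sum_blockSymbol_nonneg h S ξ
    have h2 := sum_blockSymbol_le_one h S ξ
    rw [abs_le]
    unfold blockSum
    constructor <;> linarith
  set bl : ℕ → ℝ → ℂ := fun l ζ => ((blockSum χ φ S (2 * Real.pi * ζ) : ℝ) : ℂ) * uhat l G ζ with hbl
  set bh : ℕ → ℝ → ℂ := fun l ζ =>
    ((1 - blockSum χ φ S (2 * Real.pi * ζ) : ℝ) : ℂ) * uhat l G ζ with hbh
  set aj : ℕ → ℝ → ℂ := fun k η => ((blockSum χ φ J (2 * Real.pi * η) : ℝ) : ℂ) * uhat k f η with haj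
  have hblm : ∀ l, MemLp (bl l) 2 := fun l =>
    memLp_mul_of_bound (measurable_comp_two_pi hSm) (fun ξ => abs_blockSum_le_one h S _) (memLp_uhat l G)
  have hbhm : ∀ l, MemLp (bh l) 2 := fun l =>
    memLp_mul_of_bound (measurable_comp_two_pi hmS) (fun ξ => hmS1 _) (memLp_uhat l G)
  have hajm : ∀ l, MemLp (aj l) 2 := fun l =>
    memLp_mul_of_bound (measurable_comp_two_pi (measurable_blockSum h J))
      (fun ξ => abs_blockSum_le_one h J _) (memLp_uhat l f)
  have hsplit : (fun l => uhat l G) = fun l ζ => bl l ζ + bh l ζ := by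
    funext l ζ
    simp only [hbl, hbh]
    push_cast
    ring
  rw [hsplit, pairing_weightRatio_add hs hs' hκ hκ1 ht _ (integrable_uhat h hbf) hblm hbhm hcm]
  have hlow : ‖pairing (betaCoeff s) N (weightRatio s κ t) (fun k => uhat k f) bl c‖ₑ ≤
      C0 * (ENNReal.ofReal K * ((3 * besovNorm χ φ (1 / 2) G) *
        ((∑' j : {j : ℤ // j ∈ J}, ‖block χ φ j f‖ₑ) * D))) := by
    have e : pairing (betaCoeff s) N (weightRatio s κ t) (fun k => uhat k f) bl c =
        pairing (betaCoeff s) N (weightRatio s κ t) aj (fun l ζ => 1 * bl l ζ) c := by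
      refine pairing_congr fun k l z => ?_
      by_cases h1 : blockSum χ φ S (2 * Real.pi * z.2) = 0
      · simp [hbl, h1]
      by_cases h2 : c (k + l) (z.1 + z.2) = 0
      · simp [h2]
      have h3 := blockSum_eq_one_of_low h (blockSymbol_ne_zero_of_testFamily h2) h1
      rw [show 2 * Real.pi * (z.1 + z.2) - 2 * Real.pi * z.2 = 2 * Real.pi * z.1 by ring] at h3
      simp only [haj, hJ, h3.1]
      simp
    rw [e, pairing_swap]
    refine hC0 κ t hκ hκ1 ht _ K hK.swap N _ aj c _ _ D
      ((lowFamily_uhat h N G).mul (u := fun _ => 1) (fun _ => by simp)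
        (measurable_comp_two_pi hSm) fun η => abs_blockSum_le_one h S _)
      (ENNReal.mul_ne_top (by norm_num) hbg) hajm hcm ?_ hcD ?_
    · refine sum_lintegral_symbol_mul_le h (fun j : {j : ℤ // j ∈ J} => (j : ℤ))
        (measurable_blockSum h J) (abs_blockSum_le_one h J) (fun ξ => ?_) f N
      rw [abs_of_nonneg (show 0 ≤ blockSum χ φ J ξ from sum_blockSymbol_nonneg h J ξ), blockSum,
        ENNReal.ofReal_sum_of_nonneg fun q _ => blockSymbol_nonneg h q ξ]
      exact (Finset.tsum_subtype J fun j => ENNReal.ofReal (blockSymbol χ φ j ξ)).ge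
    · intro k l z h1 _ h2
      have h4 : blockSum χ φ S (2 * Real.pi * z.1) ≠ 0 := fun h0 => h1 (by simp [hbl, h0])
      have h3 := (blockSum_eq_one_of_low h (blockSymbol_ne_zero_of_testFamily h2) h4).2
      rw [show 2 * Real.pi * (z.1 + z.2) - 2 * Real.pi * z.1 = 2 * Real.pi * z.2 by ring] at h3
      have h5 := bracket_mono h3
      have h6 := bracket_pos (2 * Real.pi * z.2)
      linarith
  have hhigh : ‖pairing (betaCoeff s) N (weightRatio s κ t) (fun k => uhat k f) bh c‖ₑ ≤
      C0 * (ENNReal.ofReal K * ((3 * besovNorm χ φ (1 / 2) f) *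
        ((∑' j : {j : ℤ // p - 4 ≤ j}, ‖block χ φ j G‖ₑ) * D))) := by
    refine hC0 κ t hκ hκ1 ht _ K hK N _ bh c _ _ D (lowFamily_uhat h N f)
      (ENNReal.mul_ne_top (by norm_num) hbf) hbhm hcm ?_ hcD ?_
    · exact sum_lintegral_symbol_mul_le h (fun j : {j : ℤ // p - 4 ≤ j} => (j : ℤ)) hmS hmS1
        (ofReal_one_sub_blockSum_le h p) G N
    · intro k l z _ h1 h2
      have h4 : 1 - blockSum χ φ S (2 * Real.pi * z.2) ≠ 0 := fun h0 => h1 (by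
        simp only [hbh]; rw [h0]; simp)
      have h3 := bracket_le_of_high h (blockSymbol_ne_zero_of_testFamily h2) h4
      rwa [show 2 * Real.pi * (z.1 + z.2) - 2 * Real.pi * z.2 = 2 * Real.pi * z.1 by ring] at h3
  refine (enorm_add_le _ _).trans ((add_le_add hlow hhigh).trans (le_of_eq ?_))
  have e1 : ∑' j : {j : ℤ // j ∈ J}, ‖block χ φ j f‖ₑ = ∑ j ∈ J, ‖block χ φ j f‖ₑ :=
    Finset.tsum_subtype J fun j => ‖block χ φ j f‖ₑ
  rw [e1, trilinearRhs]
  simp only [oscPow_block h hg]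
  rw [← Finset.sum_mul, ← Finset.sum_mul, ENNReal.tsum_mul_right, ENNReal.tsum_mul_left]
  push_cast
  rw [ENNReal.ofReal]
  ring

theorem exists_tsum_weakTerm_le (h : IsDyadicPair χ φ) {s : ℝ} (hs : 0 < s) (hs' : s < 1) :
    ∃ C : ℝ≥0, ∀ (κ t : ℝ), 0 < κ → κ ≤ 1 → 0 ≤ t → ∀ (p : ℤ) (f g w : L2xv),
      InOscDomain (s / 2) g → InOscDomain (s / 2) w → besovNorm χ φ (1 / 2) f ≠ ⊤ →
      besovNorm χ φ (1 / 2) (oscPow (s / 2) g) ≠ ⊤ →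
      ∑' n, ‖weakTerm χ φ s κ t p f g w n‖ₑ ≤ C * trilinearRhs χ φ s p f g w := by
  obtain ⟨C, hC⟩ := exists_enorm_pairing_le h hs hs'
  refine ⟨C, fun κ t hκ hκ1 ht p f g w hg hw hbf hbg => ?_⟩
  rw [ENNReal.tsum_eq_iSup_nat]
  refine iSup_le fun N => ?_
  set T := weakTerm χ φ s κ t p f g w with hT
  set o : ℕ → ℂ := fun n => (starRingEnd ℂ) (T n) / (‖T n‖ : ℂ) with ho
  have ho1 : ∀ n, ‖o n‖ ≤ 1 := fun n => by
    simp only [ho, norm_div, RCLike.norm_conj, Complex.norm_real, norm_norm]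
    exact div_self_le_one _
  have hoT : ∀ n, o n * T n = (‖T n‖ : ℂ) := fun n => by
    simp only [ho]
    rw [div_mul_eq_mul_div, mul_comm, Complex.mul_conj']
    by_cases h0 : (‖T n‖ : ℂ) = 0
    · rw [h0]; simp
    · rw [sq, mul_div_assoc, div_self h0, mul_one]
  have h1 := hC κ t hκ hκ1 ht p f g w hg hw hbf hbg N o ho1
  rw [← sum_weakTerm_eq_pairing h hs hs' hκ hκ1 ht p (integrable_uhat h hbf) hg] at h1
  refine le_trans (le_of_eq ?_) h1
  simp only [← hT, hoT]
  rw [← Complex.ofReal_sum, ← ofReal_norm ((∑ n ∈ Finset.range N, ‖T n‖ : ℝ) : ℂ), Complex.norm_real,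
    Real.norm_of_nonneg (Finset.sum_nonneg fun n _ => norm_nonneg _),
    ENNReal.ofReal_sum_of_nonneg fun n _ => norm_nonneg _]
  simp only [ofReal_norm]

end Besov

/-! ### Measurability of the weak form in time -/

/-- Weak measurability of a function with values in `L²(ℝ)`. -/
def WeaklyMeasurable (μ : Measure ℝ) (F : ℝ → L2x) : Prop :=
  ∀ v : L2x, AEStronglyMeasurable (fun t => inner ℂ v (F t)) μ

theorem aestronglyMeasurable_of_hasSum {μ : Measure ℝ} {a : ℕ → ℝ → ℂ} {b : ℝ → ℂ}
    (ha : ∀ n, AEStronglyMeasurable (a n) μ) (h : ∀ᵐ t ∂μ, HasSum (fun n => a n t) (b t)) :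
    AEStronglyMeasurable b μ := by
  refine aestronglyMeasurable_of_tendsto_ae Filter.atTop
    (f := fun N t => ∑ n ∈ Finset.range N, a n t)
    (fun N => Finset.aestronglyMeasurable_fun_sum _ fun n _ => ha n) ?_
  filter_upwards [h] with t ht
  exact ht.tendsto_sum_nat

theorem WeaklyMeasurable.inner_left {μ : Measure ℝ} {F : ℝ → L2x} (h : WeaklyMeasurable μ F)
    (v : L2x) : AEStronglyMeasurable (fun t => inner ℂ (F t) v) μ := by
  have h1 := Complex.continuous_conj.comp_aestronglyMeasurable (h v)
  refine h1.congr (Filter.Eventually.of_forall fun t => ?_)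
  exact inner_conj_symm _ _

theorem weaklyMeasurable_of_aestronglyMeasurable {μ : Measure ℝ} {F : ℝ → L2x}
    (h : AEStronglyMeasurable F μ) : WeaklyMeasurable μ F := fun v =>
  ((innerSL ℂ v).continuous).comp_aestronglyMeasurable h

theorem WeaklyMeasurable.fourierMul {μ : Measure ℝ} {F : ℝ → L2x} (hF : WeaklyMeasurable μ F)
    {m : ℝ → ℝ → ℝ} (hm : Measurable (Function.uncurry m)) {B : ℝ}
    (hB : ∀ᵐ t ∂μ, ∀ ξ, |m t ξ| ≤ B) : WeaklyMeasurable μ fun t => fourierMul (m t) (F t) := by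
  intro v
  have hmt : ∀ t, Measurable (m t) := fun t => hm.comp measurable_prodMk_left
  refine aestronglyMeasurable_of_hasSum (a := fun j t =>
    (∫ ξ, (m t (2 * Real.pi * ξ) : ℂ) * ((starRingEnd ℂ) ((𝓕 v : L2x) ξ) *
      (𝓕 (hermiteBasis j) : L2x) ξ)) * inner ℂ (hermiteBasis j) (F t)) (fun j => ?_) ?_
  · refine AEStronglyMeasurable.mul ?_ (hF _)
    refine StronglyMeasurable.aestronglyMeasurable ?_
    have h1 : StronglyMeasurable (Function.uncurry fun t ξ : ℝ =>
        (m t (2 * Real.pi * ξ) : ℂ) * ((starRingEnd ℂ) ((𝓕 v : L2x) ξ) *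
        (𝓕 (hermiteBasis j) : L2x) ξ)) := by
      refine StronglyMeasurable.mul ?_ ?_
      · exact (Complex.measurable_ofReal.comp (hm.comp (measurable_fst.prodMk
          (measurable_const.mul measurable_snd)))).stronglyMeasurable
      · exact ((Complex.continuous_conj.comp_stronglyMeasurable (Lp.stronglyMeasurable _)).mul
          (Lp.stronglyMeasurable _)).comp_measurable measurable_snd
    exact h1.integral_prod_right
  · filter_upwards [hB] with t ht
    have h1 := hermiteBasis.hasSum_inner_mul_inner (Kac.fourierMul (m t) v) (F t)
    rw [inner_fourierMul (hmt t) ht] at h1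
    have e : ∀ j, inner ℂ (Kac.fourierMul (m t) v) (hermiteBasis j) =
        ∫ ξ, (m t (2 * Real.pi * ξ) : ℂ) * ((starRingEnd ℂ) ((𝓕 v : L2x) ξ) *
          (𝓕 (hermiteBasis j) : L2x) ξ) := fun j => by
      rw [← Lp.inner_fourier_eq, L2.inner_def]
      refine integral_congr_ae ?_
      filter_upwards [fourier_fourierMul (hmt t) ht v] with ξ hξ
      rw [hξ, RCLike.inner_apply]
      simp only [map_mul, Complex.conj_ofReal]
      ring
    simpa only [e] using h1

theorem coeFn_hermiteBasis (j : ℕ) :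
    hermiteBasis j =ᵐ[volume] fun x => (hermiteFun j x : ℂ) := by
  rw [hermiteBasis, HilbertBasis.coe_mkOfOrthogonalEqBot]
  exact coeFn_toL2 (memLp_hermiteFun_ofReal j)

theorem memLp_hermiteFun_mul (i j : ℕ) :
    MemLp (fun x => (hermiteFun i x : ℂ) * (hermiteFun j x : ℂ)) 2 := by
  have hc : Continuous fun x => (hermiteFun i x : ℂ) * (hermiteFun j x : ℂ) :=
    (Complex.continuous_ofReal.comp (continuous_hermiteFun i)).mul
      (Complex.continuous_ofReal.comp (continuous_hermiteFun j))
  rw [memLp_two_iff_integrable_sq_norm hc.aestronglyMeasurable]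
  have h := (integrable_aeval_mul_gaussian ((Polynomial.hermite i * Polynomial.hermite j) ^ 2)
    one_pos).const_mul ((Real.sqrt (i.factorial * Real.sqrt (2 * Real.pi)))⁻¹ *
      (Real.sqrt (j.factorial * Real.sqrt (2 * Real.pi)))⁻¹) |>.mul_const
      ((Real.sqrt (i.factorial * Real.sqrt (2 * Real.pi)))⁻¹ *
      (Real.sqrt (j.factorial * Real.sqrt (2 * Real.pi)))⁻¹)
  refine h.congr (Filter.Eventually.of_forall fun x => ?_)
  have he : Real.exp (-1 * x ^ 2) = (Real.exp (-x ^ 2 / 4) * Real.exp (-x ^ 2 / 4)) ^ 2 := by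
    rw [← Real.exp_add, ← Real.exp_nat_mul]
    congr 1
    push_cast
    ring
  simp only
  rw [← Complex.ofReal_mul, Complex.norm_real, Real.norm_eq_abs, sq_abs, he, map_pow, map_mul,
    hermiteFun, hermiteFun]
  ring

/-- Trilinear integrals of weakly measurable functions are measurable. -/
theorem aestronglyMeasurable_integral_mul_mul {μ : Measure ℝ} {F G H : ℝ → L2x}
    (hF : WeaklyMeasurable μ F) (hG : WeaklyMeasurable μ G) (hH : WeaklyMeasurable μ H)
    (hb : ∀ᵐ t ∂μ, ∃ C : ℝ, ∀ᵐ x : ℝ, ‖F t x‖ ≤ C) :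
    AEStronglyMeasurable (fun t => ∫ x, F t x * (G t x * (starRingEnd ℂ) (H t x))) μ := by
  have hbd : ∀ᵐ t ∂μ, ∀ w : L2x, MemLp (fun x => F t x * w x) 2 := by
    filter_upwards [hb] with t ht w
    obtain ⟨C, hC⟩ := ht
    refine MemLp.of_le_mul (c := C) (Lp.memLp w)
      ((Lp.aestronglyMeasurable _).mul (Lp.aestronglyMeasurable _)) ?_
    filter_upwards [hC] with x hx
    rw [norm_mul]
    exact mul_le_mul_of_nonneg_right hx (norm_nonneg _)
  have hFw : ∀ i j, AEStronglyMeasurable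
      (fun t => inner ℂ (hermiteBasis i) (toL2 fun x => F t x * hermiteBasis j x)) μ := by
    intro i j
    refine (hF (toL2 fun x => (hermiteFun i x : ℂ) * (hermiteFun j x : ℂ))).congr ?_
    filter_upwards [hbd] with t ht
    rw [L2.inner_def, L2.inner_def]
    refine integral_congr_ae ?_
    filter_upwards [coeFn_toL2 (memLp_hermiteFun_mul i j), coeFn_toL2 (ht (hermiteBasis j)),
      coeFn_hermiteBasis i, coeFn_hermiteBasis j] with x h1 h2 h3 h4
    rw [h1, h2, h3, h4]
    simp only [RCLike.inner_apply, map_mul, Complex.conj_ofReal]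
    ring
  have hX : ∀ j, AEStronglyMeasurable
      (fun t => inner ℂ (H t) (toL2 fun x => F t x * hermiteBasis j x)) μ := fun j =>
    aestronglyMeasurable_of_hasSum (fun i => (hH.inner_left (hermiteBasis i)).mul (hFw i j))
      (Filter.Eventually.of_forall fun t => hermiteBasis.hasSum_inner_mul_inner _ _)
  refine aestronglyMeasurable_of_hasSum (fun j => (hX j).mul (hG (hermiteBasis j))) ?_
  filter_upwards [hbd] with t ht
  have hP : MemLp (fun x => (starRingEnd ℂ) (F t x) * H t x) 2 := by
    refine MemLp.of_le_mul (c := 1) (ht (H t))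
      ((Complex.continuous_conj.comp_aestronglyMeasurable (Lp.aestronglyMeasurable _)).mul
        (Lp.aestronglyMeasurable _)) (Filter.Eventually.of_forall fun x => ?_)
    rw [norm_mul, norm_mul, RCLike.norm_conj, one_mul]
  have h1 := hermiteBasis.hasSum_inner_mul_inner
    (toL2 fun x => (starRingEnd ℂ) (F t x) * H t x) (G t)
  have e1 : inner ℂ (toL2 fun x => (starRingEnd ℂ) (F t x) * H t x) (G t) =
      ∫ x, F t x * (G t x * (starRingEnd ℂ) (H t x)) := by
    rw [L2.inner_def]
    refine integral_congr_ae ?_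
    filter_upwards [coeFn_toL2 hP] with x hx
    rw [hx]
    simp only [RCLike.inner_apply, map_mul, Complex.conj_conj]
    ring
  have e2 : ∀ j, inner ℂ (toL2 fun x => (starRingEnd ℂ) (F t x) * H t x) (hermiteBasis j) =
      inner ℂ (H t) (toL2 fun x => F t x * hermiteBasis j x) := fun j => by
    rw [L2.inner_def, L2.inner_def]
    refine integral_congr_ae ?_
    filter_upwards [coeFn_toL2 hP, coeFn_toL2 (ht (hermiteBasis j))] with x h2 h3
    rw [h2, h3]
    simp only [RCLike.inner_apply, map_mul, Complex.conj_conj]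
    ring
  rw [e1] at h1
  simp only [e2] at h1
  exact h1

theorem measurable_uncurry_weightSymbol {s κ : ℝ} (hs : 0 < s) (hκ : 0 < κ) (n : ℕ) :
    Measurable (Function.uncurry fun t ξ => weightSymbol s κ t n ξ) := by
  have h : Continuous (Function.uncurry fun t ξ => expRatio κ (t * phase s n ξ)) :=
    (continuous_expRatio hκ).comp (continuous_fst.mul ((continuous_phase hs n).comp continuous_snd))
  exact h.measurable

section Besov

variable {χ φ : ℝ → ℝ}

theorem aestronglyMeasurable_weakTerm (h : IsDyadicPair χ φ) {s κ : ℝ} (hs : 0 < s) (hs' : s < 1)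
    (hκ : 0 < κ) (hκ1 : κ ≤ 1) {μ : Measure ℝ} (hμ : ∀ᵐ t ∂μ, 0 ≤ t) {f g w : ℝ → L2xv}
    (hf : AEStronglyMeasurable f μ) (hg : AEStronglyMeasurable g μ) (hw : AEStronglyMeasurable w μ)
    (hfi : ∀ᵐ t ∂μ, ∀ k, Integrable (uhat k (f t))) (p : ℤ) (n : ℕ) :
    AEStronglyMeasurable (fun t => weakTerm χ φ s κ t p (f t) (g t) (w t) n) μ := by
  have hc : ∀ {u : ℝ → L2xv}, AEStronglyMeasurable u μ → ∀ k,
      WeaklyMeasurable μ fun t => hermiteCoeff k (u t) := fun hu k =>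
    weaklyMeasurable_of_aestronglyMeasurable
      ((hermiteCoeffCLM k).continuous.comp_aestronglyMeasurable hu)
  have hinv : ∀ {u : ℝ → L2xv}, AEStronglyMeasurable u μ → ∀ k,
      WeaklyMeasurable μ fun t => invCoeff s κ t k (u t) := fun hu k =>
    (hc hu k).fourierMul (m := fun t ξ => (weightSymbol s κ t k ξ)⁻¹) (B := 2)
      (measurable_uncurry_weightSymbol hs hκ k).inv (by
        filter_upwards [hμ] with t ht
        exact abs_inv_weightSymbol_le hκ hκ1 ht s k)
  have hblock : Measurable (Function.uncurry fun _ ξ : ℝ => blockSymbol χ φ p ξ) :=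
    (measurable_blockSymbol h p).comp measurable_snd
  have hblock1 : ∀ᵐ _ ∂μ, ∀ ξ, |blockSymbol χ φ p ξ| ≤ 1 :=
    Filter.Eventually.of_forall fun _ => abs_blockSymbol_le_one h p
  have htest : WeaklyMeasurable μ fun t => testCoeff χ φ s κ t p n (w t) :=
    (((hc hw n).fourierMul hblock hblock1).fourierMul (B := κ⁻¹)
      (measurable_uncurry_weightSymbol hs hκ n) (Filter.Eventually.of_forall fun t =>
        abs_weightSymbol_le hκ s t n)).fourierMul hblock hblock1
  have h1 : AEStronglyMeasurable (fun t => ∑ q ∈ Finset.HasAntidiagonal.antidiagonal n,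
      (alphaCoeff s q.1 q.2 : ℂ) * ∫ x, invCoeff s κ t q.1 (f t) x * (invCoeff s κ t q.2 (g t) x *
        (starRingEnd ℂ) (testCoeff χ φ s κ t p n (w t) x))) μ := by
    refine Finset.aestronglyMeasurable_fun_sum _ fun q _ => AEStronglyMeasurable.const_mul
      (aestronglyMeasurable_integral_mul_mul (hinv hf q.1) (hinv hg q.2) htest ?_) _
    filter_upwards [hfi, hμ] with t ht ht0
    refine ⟨∫ η, ‖(((weightFreq s κ t q.1 η)⁻¹ : ℝ) : ℂ) * uhat q.1 (f t) η‖, ?_⟩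
    filter_upwards [invCoeff_ae_eq hs hκ hκ1 ht0 q.1 (ht q.1)] with x hx
    rw [hx]
    exact norm_fourierInv_le _ x
  refine h1.congr ?_
  filter_upwards [hfi, hμ] with t ht ht0
  exact (weakTerm_eq_sum_integral h hs hs' hκ hκ1 ht0 p ht _ _ n).symm

end Besov

/-! ### Sums over dyadic blocks -/

theorem dyad_add (m n : ℤ) (a : ℝ) : dyad (m + n) a = dyad m a * dyad n a := by
  unfold dyad
  rw [← ENNReal.ofReal_mul (by positivity), ← Real.rpow_add two_pos]
  push_cast
  rw [add_mul]

theorem dyad_sqrt (m : ℤ) (a : ℝ) : dyad m a ^ (1 / 2 : ℝ) = dyad m (a / 2) := by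
  unfold dyad
  rw [ENNReal.ofReal_rpow_of_nonneg (by positivity) (by norm_num), ← Real.rpow_mul two_pos.le]
  congr 2
  ring

theorem dyad_two_mul (m : ℤ) (a : ℝ) : dyad m a = dyad m (a / 2) * dyad m (a / 2) := by
  unfold dyad
  rw [← ENNReal.ofReal_mul (by positivity), ← Real.rpow_add two_pos]
  congr 2
  ring

/-- The kernel of the sums over the blocks. -/
def kernel (a : ℝ) (m : ℤ) : ℝ≥0∞ := if m ≤ 4 then dyad m a else 0

theorem tsum_kernel_ne_top {a : ℝ} (ha : 0 < a) : ∑' m : ℤ, kernel a m ≠ ⊤ := by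
  have hinj : Function.Injective (fun n : ℕ => (4 : ℤ) - n) := fun x y hxy => by
    simpa using hxy
  have hsupp : Function.support (kernel a) ⊆ Set.range (fun n : ℕ => (4 : ℤ) - n) := fun m hm => by
    refine ⟨(4 - m).toNat, ?_⟩
    have : m ≤ 4 := by
      by_contra hlt
      exact hm (if_neg hlt)
    simp only
    omega
  rw [← hinj.tsum_eq hsupp]
  have e : ∀ n : ℕ, kernel a (4 - n) = dyad 4 a * (ENNReal.ofReal (2 ^ (-a))) ^ n := fun n => by
    rw [kernel, if_pos (by omega), sub_eq_add_neg, dyad_add]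
    congr 1
    rw [dyad, ← ENNReal.ofReal_pow (by positivity), ← Real.rpow_natCast, ← Real.rpow_mul two_pos.le]
    push_cast
    congr 2
    ring
  simp only [e]
  rw [ENNReal.tsum_mul_left, ENNReal.tsum_geometric]
  refine ENNReal.mul_ne_top (dyad_ne_top _ _) (ENNReal.inv_ne_top.2 ?_)
  have h1 : ENNReal.ofReal (2 ^ (-a)) < 1 := by
    rw [← ENNReal.ofReal_one, ENNReal.ofReal_lt_ofReal_iff one_pos]
    exact Real.rpow_lt_one_of_one_lt_of_neg one_lt_two (by linarith)
  exact (tsub_pos_of_lt h1).ne'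

theorem sqrt_tsum_le {ι : Type} (x : ι → ℝ≥0∞) :
    (∑' i, x i) ^ (1 / 2 : ℝ) ≤ ∑' i, x i ^ (1 / 2 : ℝ) := by
  have hx : ∀ y : ℝ≥0∞, y = y ^ (1 / 2 : ℝ) * y ^ (1 / 2 : ℝ) := fun y => by
    rw [← ENNReal.rpow_add_of_nonneg _ _ (by norm_num) (by norm_num)]
    norm_num
  have h : ∑' i, x i ≤ (∑' i, x i ^ (1 / 2 : ℝ)) ^ (2 : ℝ) := by
    rw [ENNReal.rpow_two, sq, ← ENNReal.tsum_mul_right]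
    refine ENNReal.tsum_le_tsum fun i => ?_
    conv_lhs => rw [hx (x i)]
    exact mul_le_mul_right (ENNReal.le_tsum i) _
  refine (ENNReal.rpow_le_rpow h (by norm_num)).trans (le_of_eq ?_)
  rw [← ENNReal.rpow_mul]
  norm_num

theorem sqrt_add_le (x y : ℝ≥0∞) :
    (x + y) ^ (1 / 2 : ℝ) ≤ x ^ (1 / 2 : ℝ) + y ^ (1 / 2 : ℝ) :=
  ENNReal.rpow_add_le_add_rpow _ _ (by norm_num) (by norm_num)

theorem tsum_sqrt_mul_sqrt_le {ι : Type} (x y : ι → ℝ≥0∞) :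
    ∑' i, x i ^ (1 / 2 : ℝ) * y i ^ (1 / 2 : ℝ) ≤
      (∑' i, x i) ^ (1 / 2 : ℝ) * (∑' i, y i) ^ (1 / 2 : ℝ) := by
  let _ : MeasurableSpace ι := ⊤
  have h := ENNReal.lintegral_mul_le_Lp_mul_Lq (Measure.count (α := ι)) Real.HolderConjugate.two_two
    (f := fun i => x i ^ (1 / 2 : ℝ)) (g := fun i => y i ^ (1 / 2 : ℝ))
    measurable_from_top.aemeasurable measurable_from_top.aemeasurable
  simp only [lintegral_count, ← ENNReal.rpow_mul, Pi.mul_apply] at h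
  norm_num at h ⊢
  exact h

theorem tsum_kernel_mul_sqrt_le (a : ℝ) (A B : ℤ → ℝ≥0∞) :
    ∑' p, ∑' j, kernel a (p - j) * (A j ^ (1 / 2 : ℝ) * B p ^ (1 / 2 : ℝ)) ≤
      (∑' m, kernel a m) * ((∑' j, A j) ^ (1 / 2 : ℝ) * (∑' p, B p) ^ (1 / 2 : ℝ)) := by
  have hx : ∀ y : ℝ≥0∞, y ^ (1 / 2 : ℝ) * y ^ (1 / 2 : ℝ) = y := fun y => by
    rw [← ENNReal.rpow_add_of_nonneg _ _ (by norm_num) (by norm_num)]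
    norm_num
  have e1 : ∑' x : ℤ × ℤ, kernel a (x.1 - x.2) * A x.2 = (∑' m, kernel a m) * ∑' j, A j := by
    rw [ENNReal.tsum_prod (f := fun p j => kernel a (p - j) * A j), ENNReal.tsum_comm,
      ← ENNReal.tsum_mul_left]
    refine tsum_congr fun j => ?_
    rw [ENNReal.tsum_mul_right]
    congr 1
    exact (Equiv.subRight j).tsum_eq (kernel a)
  have e2 : ∑' x : ℤ × ℤ, kernel a (x.1 - x.2) * B x.1 = (∑' m, kernel a m) * ∑' j, B j := by
    rw [ENNReal.tsum_prod (f := fun p j => kernel a (p - j) * B p), ← ENNReal.tsum_mul_left]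
    refine tsum_congr fun p => ?_
    rw [ENNReal.tsum_mul_right]
    congr 1
    exact (Equiv.subLeft p).tsum_eq (kernel a)
  have h := tsum_sqrt_mul_sqrt_le (fun x : ℤ × ℤ => kernel a (x.1 - x.2) * A x.2)
    (fun x : ℤ × ℤ => kernel a (x.1 - x.2) * B x.1)
  rw [e1, e2] at h
  have hhalf : (0 : ℝ) ≤ 1 / 2 := by norm_num
  simp only [ENNReal.mul_rpow_of_nonneg _ _ hhalf] at h
  rw [ENNReal.tsum_prod (f := fun p j => kernel a (p - j) ^ (1 / 2 : ℝ) * A j ^ (1 / 2 : ℝ) *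
        (kernel a (p - j) ^ (1 / 2 : ℝ) * B p ^ (1 / 2 : ℝ)))] at h
  calc ∑' p, ∑' j, kernel a (p - j) * (A j ^ (1 / 2 : ℝ) * B p ^ (1 / 2 : ℝ))
      = ∑' p, ∑' j, kernel a (p - j) ^ (1 / 2 : ℝ) * A j ^ (1 / 2 : ℝ) *
        (kernel a (p - j) ^ (1 / 2 : ℝ) * B p ^ (1 / 2 : ℝ)) := by
        refine tsum_congr fun p => tsum_congr fun j => ?_
        conv_lhs => rw [← hx (kernel a (p - j))]
        ring
    _ ≤ _ := h
    _ = _ := by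
        conv_rhs => rw [← hx (∑' m, kernel a m)]
        ring

/-! ### Hölder's inequality in time -/

theorem lintegral_mul_mul_le_timeNorm {T : ℝ} {a b c : ℝ → ℝ≥0∞}
    (hb : AEMeasurable b (volume.restrict (Set.Ioc 0 T)))
    (hc : AEMeasurable c (volume.restrict (Set.Ioc 0 T))) :
    ∫⁻ t in Set.Ioc 0 T, a t * (b t * c t) ≤ timeNorm ⊤ T a * (timeNorm 2 T b * timeNorm 2 T c) := by
  have h1 : ∀ᵐ t ∂(volume.restrict (Set.Ioc 0 T)), a t ≤ timeNorm ⊤ T a := by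
    have := enorm_ae_le_eLpNormEssSup a (volume.restrict (Set.Ioc 0 T))
    simpa [timeNorm] using this
  calc ∫⁻ t in Set.Ioc 0 T, a t * (b t * c t)
      ≤ ∫⁻ t in Set.Ioc 0 T, timeNorm ⊤ T a * (b t * c t) := by
        refine lintegral_mono_ae ?_
        filter_upwards [h1] with t ht
        exact mul_le_mul_left ht _
    _ = timeNorm ⊤ T a * ∫⁻ t in Set.Ioc 0 T, b t * c t := lintegral_const_mul'' _ (hb.mul hc)
    _ ≤ _ := by
        refine mul_le_mul_right ((ENNReal.pow_le_pow_left_iff two_ne_zero).1 ?_) _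
        rw [mul_pow, timeNorm, timeNorm, eLpNorm_two_sq, eLpNorm_two_sq]
        exact lintegral_mul_sq_le hb hc

theorem ae_lt_top_of_timeNorm_top {T : ℝ} {a : ℝ → ℝ≥0∞} (h : timeNorm ⊤ T a < ⊤) :
    ∀ᵐ t ∂(volume.restrict (Set.Ioc 0 T)), a t < ⊤ := by
  have := enorm_ae_le_eLpNormEssSup a (volume.restrict (Set.Ioc 0 T))
  filter_upwards [this] with t ht
  rw [enorm_eq_self] at ht
  refine ht.trans_lt ?_
  simpa [timeNorm] using h

theorem ae_lt_top_of_timeNorm_two {T : ℝ} {a : ℝ → ℝ≥0∞}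
    (ha : AEMeasurable a (volume.restrict (Set.Ioc 0 T))) (h : timeNorm 2 T a < ⊤) :
    ∀ᵐ t ∂(volume.restrict (Set.Ioc 0 T)), a t < ⊤ := by
  have h1 : ∫⁻ t in Set.Ioc 0 T, a t ^ 2 ≠ ⊤ := by
    have := eLpNorm_two_sq (volume.restrict (Set.Ioc 0 T)) a
    simp only [enorm_eq_self] at this
    rw [← this]
    exact ENNReal.pow_ne_top h.ne
  filter_upwards [ae_lt_top' (ha.pow_const 2) h1] with t ht
  exact (ENNReal.pow_lt_top_iff.1 ht).resolve_right (by norm_num)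

section Besov

variable {χ φ : ℝ → ℝ}

theorem tsum_enorm_block_ne_top (h : IsDyadicPair χ φ) {u : L2xv}
    (hu : besovNorm χ φ (1 / 2) u ≠ ⊤) : ∑' j : ℤ, ‖block χ φ j u‖ₑ ≠ ⊤ := by
  refine ne_top_of_le_ne_top (ENNReal.mul_ne_top
    (tsum_kernel_ne_top (a := 1 / 2) (by norm_num)) hu) ?_
  rw [← (Equiv.neg ℤ).tsum_eq (kernel (1 / 2)), ← ENNReal.tsum_mul_right]
  refine ENNReal.tsum_le_tsum fun j => ?_
  by_cases hj : j < -1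
  · have : block χ φ j u = 0 := by
      refine hermiteCoeff_ext fun n => ?_
      rw [hermiteCoeff_block h, show blockSymbol χ φ j = fun _ => 0 from
        funext (blockSymbol_of_lt χ φ hj), fourierMul_const]
      rw [Complex.ofReal_zero, zero_smul]
      exact (map_zero (hermiteCoeffCLM n)).symm
    rw [this, enorm_zero]
    exact zero_le
  · rw [Equiv.neg_apply, kernel, if_pos (by omega)]
    calc ‖block χ φ j u‖ₑ = dyad (-j) (1 / 2) * (dyad j (1 / 2) * ‖block χ φ j u‖ₑ) := by
          rw [← mul_assoc, ← dyad_add, neg_add_cancel]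
          simp [dyad]
      _ ≤ _ := mul_le_mul_right (dyad_mul_enorm_block_le χ φ (1 / 2) j u) _

theorem trilinearRhs_ne_top (h : IsDyadicPair χ φ) {s : ℝ} (p : ℤ) {f g : L2xv} (w : L2xv)
    (hg : InOscDomain (s / 2) g) (hbf : besovNorm χ φ (1 / 2) f ≠ ⊤)
    (hbg : besovNorm χ φ (1 / 2) (oscPow (s / 2) g) ≠ ⊤) : trilinearRhs χ φ s p f g w ≠ ⊤ := by
  unfold trilinearRhs
  refine ENNReal.add_ne_top.2 ⟨ENNReal.sum_ne_top.2 fun j _ =>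
    ENNReal.mul_ne_top (ENNReal.mul_ne_top enorm_ne_top hbg) enorm_ne_top, ?_⟩
  rw [ENNReal.tsum_mul_right, ENNReal.tsum_mul_left]
  refine ENNReal.mul_ne_top (ENNReal.mul_ne_top hbf ?_) enorm_ne_top
  simp only [oscPow_block h hg]
  exact ne_top_of_le_ne_top (tsum_enorm_block_ne_top h hbg)
    (ENNReal.tsum_comp_le_tsum_of_injective Subtype.val_injective _)

theorem weakFormDefined_of_besovNorm (h : IsDyadicPair χ φ) {s κ t : ℝ} (hs : 0 < s) (hs' : s < 1)
    (hκ : 0 < κ) (hκ1 : κ ≤ 1) (ht : 0 ≤ t) (p : ℤ) {f g w : L2xv}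
    (hg : InOscDomain (s / 2) g) (hw : InOscDomain (s / 2) w) (hbf : besovNorm χ φ (1 / 2) f ≠ ⊤)
    (hbg : besovNorm χ φ (1 / 2) (oscPow (s / 2) g) ≠ ⊤) :
    WeakFormDefined χ φ s κ t p f g w := by
  obtain ⟨C, hC⟩ := exists_tsum_weakTerm_le h hs hs'
  refine ⟨memLp_conjGammaCoeff hs hs' hκ hκ1 ht (integrable_uhat h hbf) g, ?_⟩
  refine Summable.of_enorm ?_
  exact ne_top_of_le_ne_top (ENNReal.mul_ne_top ENNReal.coe_ne_top
    (trilinearRhs_ne_top h p w hg hbf hbg)) (hC κ t hκ hκ1 ht p f g w hg hw hbf hbg)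

end Besov

/-! ### The estimate in time -/

section Besov

variable {χ φ : ℝ → ℝ}

theorem trilinearRhs_le (h : IsDyadicPair χ φ) {s : ℝ} (p : ℤ) (f : L2xv) {g w : L2xv}
    (hg : InOscDomain (s / 2) g) (hw : InOscDomain (s / 2) w) :
    trilinearRhs χ φ s p f g w ≤ ∑' j : ℤ, if p - j ≤ 4 then
      ‖block χ φ j f‖ₑ * (besovNorm χ φ (1 / 2) (oscPow (s / 2) g) *
        ‖block χ φ p (oscPow (s / 2) w)‖ₑ) +
      besovNorm χ φ (1 / 2) f * (‖block χ φ j (oscPow (s / 2) g)‖ₑ *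
        ‖block χ φ p (oscPow (s / 2) w)‖ₑ) else 0 := by
  set G := oscPow (s / 2) g
  set D := ‖block χ φ p (oscPow (s / 2) w)‖ₑ
  have e : (∑' j : ℤ, if p - j ≤ 4 then ‖block χ φ j f‖ₑ * (besovNorm χ φ (1 / 2) G * D) +
      besovNorm χ φ (1 / 2) f * (‖block χ φ j G‖ₑ * D) else 0) =
      (∑' j : ℤ, if p - j ≤ 4 then ‖block χ φ j f‖ₑ * (besovNorm χ φ (1 / 2) G * D) else 0) +
      ∑' j : ℤ, if p - j ≤ 4 then besovNorm χ φ (1 / 2) f * (‖block χ φ j G‖ₑ * D) else 0 := by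
    rw [← ENNReal.tsum_add]
    refine tsum_congr fun j => ?_
    split_ifs <;> simp
  rw [e, trilinearRhs]
  simp only [oscPow_block h hg, oscPow_block h hw, mul_assoc]
  refine add_le_add ?_ (le_of_eq ?_)
  · refine le_trans (le_of_eq (Finset.sum_congr rfl fun j hj => ?_))
      (ENNReal.sum_le_tsum (Finset.Icc (p - 4) (p + 4)))
    rw [Finset.mem_Icc] at hj
    rw [if_pos (by omega)]
  · have e2 := tsum_subtype {j : ℤ | p - 4 ≤ j}
      fun j => besovNorm χ φ (1 / 2) f * (‖block χ φ j G‖ₑ * D)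
    refine e2.trans (tsum_congr fun j => ?_)
    by_cases hj : p - j ≤ 4
    · rw [if_pos hj, Set.indicator_of_mem (s := {j : ℤ | p - 4 ≤ j})]
      rw [Set.mem_ofPred_eq]; omega
    · rw [if_neg hj, Set.indicator_of_notMem (s := {j : ℤ | p - 4 ≤ j})]
      rw [Set.mem_ofPred_eq]; omega

theorem dyad_mul_sqrt_le {σ : ℝ} (p : ℤ) {I c : ℝ≥0∞} {x y z : ℤ → ℝ≥0∞} {X Y : ℝ≥0∞}
    (hI : I ≤ c * ∑' j : ℤ, if p - j ≤ 4 then x j * (X * z p) + Y * (y j * z p) else 0) :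
    dyad p σ * I ^ (1 / 2 : ℝ) ≤ c ^ (1 / 2 : ℝ) *
      ((X ^ (1 / 2 : ℝ) * ∑' j, kernel (σ / 2) (p - j) *
        ((dyad j σ * x j) ^ (1 / 2 : ℝ) * (dyad p σ * z p) ^ (1 / 2 : ℝ))) +
      Y ^ (1 / 2 : ℝ) * ∑' j, kernel (σ / 2) (p - j) *
        ((dyad j σ * y j) ^ (1 / 2 : ℝ) * (dyad p σ * z p) ^ (1 / 2 : ℝ))) := by
  have hhalf : (0 : ℝ) ≤ 1 / 2 := by norm_num
  have hk : ∀ j, p - j ≤ 4 → kernel (σ / 2) (p - j) * dyad j (σ / 2) = dyad p (σ / 2) := by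
    intro j hj
    rw [kernel, if_pos hj, ← dyad_add, sub_add_cancel]
  calc dyad p σ * I ^ (1 / 2 : ℝ)
      ≤ dyad p σ * (c ^ (1 / 2 : ℝ) * ∑' j : ℤ, (if p - j ≤ 4 then
          x j * (X * z p) + Y * (y j * z p) else 0) ^ (1 / 2 : ℝ)) := by
        refine mul_le_mul_right ((ENNReal.rpow_le_rpow hI hhalf).trans ?_) _
        rw [ENNReal.mul_rpow_of_nonneg _ _ hhalf]
        exact mul_le_mul_right (sqrt_tsum_le _) _
    _ = c ^ (1 / 2 : ℝ) * ∑' j : ℤ, dyad p σ * (if p - j ≤ 4 then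
          x j * (X * z p) + Y * (y j * z p) else 0) ^ (1 / 2 : ℝ) := by
        rw [ENNReal.tsum_mul_left]
        ring
    _ ≤ _ := by
        refine mul_le_mul_right ?_ _
        rw [← ENNReal.tsum_mul_left, ← ENNReal.tsum_mul_left, ← ENNReal.tsum_add]
        refine ENNReal.tsum_le_tsum fun j => ?_
        by_cases hj : p - j ≤ 4
        · rw [if_pos hj]
          refine (mul_le_mul_right (sqrt_add_le _ _) _).trans (le_of_eq ?_)
          simp only [ENNReal.mul_rpow_of_nonneg _ _ hhalf, dyad_sqrt]
          rw [dyad_two_mul p σ]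
          conv_lhs => rw [← hk j hj]
          rw [← hk j hj]
          ring
        · rw [if_neg hj, ENNReal.zero_rpow_of_pos (by norm_num), mul_zero]
          exact zero_le

theorem exists_weakForm_time_estimate (h : IsDyadicPair χ φ) {s : ℝ} (hs : 0 < s) (hs' : s < 1)
    {σ : ℝ} (hσ : 0 < σ) :
    ∃ C : ℝ≥0, ∀ (T κ : ℝ) (f g w : ℝ → L2xv), 0 < T → 0 < κ → κ ≤ 1 →
      AEStronglyMeasurable f (volume.restrict (Set.Ioc 0 T)) →
      AEStronglyMeasurable g (volume.restrict (Set.Ioc 0 T)) →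
      AEStronglyMeasurable w (volume.restrict (Set.Ioc 0 T)) →
      (∀ᵐ t ∂(volume.restrict (Set.Ioc 0 T)),
        InOscDomain (s / 2) (g t) ∧ InOscDomain (s / 2) (w t)) →
      mixedNorm χ φ ⊤ T (1 / 2) f < ⊤ →
      mixedNorm χ φ 2 T (1 / 2) (fun t => oscPow (s / 2) (g t)) < ⊤ →
      (∀ᵐ t ∂(volume.restrict (Set.Ioc 0 T)), ∀ p : ℤ, -1 ≤ p →
        WeakFormDefined χ φ s κ t p (f t) (g t) (w t)) ∧
      (∀ p : ℤ, -1 ≤ p →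
        AEStronglyMeasurable (fun t => weakForm χ φ s κ t p (f t) (g t) (w t))
          (volume.restrict (Set.Ioc 0 T))) ∧
      ∑' p : {p : ℤ // -1 ≤ p}, dyad p σ *
          (∫⁻ t in Set.Ioc 0 T, ‖weakForm χ φ s κ t p (f t) (g t) (w t)‖ₑ) ^ (1 / 2 : ℝ) ≤
        C * cheminLernerNorm χ φ ⊤ T σ f ^ (1 / 2 : ℝ)
            * mixedNorm χ φ 2 T (1 / 2) (fun t => oscPow (s / 2) (g t)) ^ (1 / 2 : ℝ)
            * cheminLernerNorm χ φ 2 T σ (fun t => oscPow (s / 2) (w t)) ^ (1 / 2 : ℝ)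
          + C * mixedNorm χ φ ⊤ T (1 / 2) f ^ (1 / 2 : ℝ)
            * cheminLernerNorm χ φ 2 T σ (fun t => oscPow (s / 2) (g t)) ^ (1 / 2 : ℝ)
            * cheminLernerNorm χ φ 2 T σ (fun t => oscPow (s / 2) (w t)) ^ (1 / 2 : ℝ) := by
  obtain ⟨C0, hC0⟩ := exists_tsum_weakTerm_le h hs hs'
  have hKtop := tsum_kernel_ne_top (a := σ / 2) (by linarith)
  refine ⟨C0 ^ (1 / 2 : ℝ) * (∑' m, kernel (σ / 2) m).toNNReal,
    fun T κ f g w _ hκ hκ1 hf hg hw hdom hmf hmg => ?_⟩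
  set μ : Measure ℝ := volume.restrict (Set.Ioc 0 T) with hμ
  have ht0 : ∀ᵐ t ∂μ, 0 ≤ t := by
    filter_upwards [ae_restrict_mem measurableSet_Ioc] with t ht
    exact ht.1.le
  have hG : AEStronglyMeasurable (fun t => oscPow (s / 2) (g t)) μ :=
    aestronglyMeasurable_oscPow hg (hdom.mono fun t ht => ht.1)
  have hH : AEStronglyMeasurable (fun t => oscPow (s / 2) (w t)) μ :=
    aestronglyMeasurable_oscPow hw (hdom.mono fun t ht => ht.2)
  have hGm := aemeasurable_besovNorm h (1 / 2) hG
  have hbf : ∀ᵐ t ∂μ, besovNorm χ φ (1 / 2) (f t) < ⊤ := ae_lt_top_of_timeNorm_top hmf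
  have hbg : ∀ᵐ t ∂μ, besovNorm χ φ (1 / 2) (oscPow (s / 2) (g t)) < ⊤ :=
    ae_lt_top_of_timeNorm_two hGm hmg
  have hdef : ∀ᵐ t ∂μ, ∀ p : ℤ, WeakFormDefined χ φ s κ t p (f t) (g t) (w t) := by
    filter_upwards [ht0, hdom, hbf, hbg] with t h1 h2 h3 h4 p
    exact weakFormDefined_of_besovNorm h hs hs' hκ hκ1 h1 p h2.1 h2.2 h3.ne h4.ne
  refine ⟨hdef.mono fun t ht p _ => ht p, fun p _ => ?_, ?_⟩
  · refine aestronglyMeasurable_of_hasSum (a := fun n t => weakTerm χ φ s κ t p (f t) (g t) (w t) n)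
      (fun n => aestronglyMeasurable_weakTerm h hs hs' hκ hκ1 ht0 hf hg hw ?_ p n) ?_
    · filter_upwards [hbf] with t ht
      exact integrable_uhat h ht.ne
    · filter_upwards [hdef] with t ht
      exact (ht p).2.hasSum
  set x : ℤ → ℝ≥0∞ := fun j => timeNorm ⊤ T fun t => ‖block χ φ j (f t)‖ₑ with hx
  set y : ℤ → ℝ≥0∞ := fun j => timeNorm 2 T fun t => ‖block χ φ j (oscPow (s / 2) (g t))‖ₑ with hy
  set z : ℤ → ℝ≥0∞ := fun j => timeNorm 2 T fun t => ‖block χ φ j (oscPow (s / 2) (w t))‖ₑ with hz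
  set X := mixedNorm χ φ 2 T (1 / 2) (fun t => oscPow (s / 2) (g t)) with hX
  set Y := mixedNorm χ φ ⊤ T (1 / 2) f with hY
  have hblock : ∀ {u : ℝ → L2xv}, AEStronglyMeasurable u μ → ∀ j,
      AEMeasurable (fun t => ‖block χ φ j (u t)‖ₑ) μ := fun hu j =>
    ((continuous_block h j).comp_aestronglyMeasurable hu).enorm
  have hFm := aemeasurable_besovNorm h (1 / 2) hf
  have hint : ∀ p : ℤ, ∫⁻ t in Set.Ioc 0 T, ‖weakForm χ φ s κ t p (f t) (g t) (w t)‖ₑ ≤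
      C0 * ∑' j : ℤ, if p - j ≤ 4 then x j * (X * z p) + Y * (y j * z p) else 0 := by
    intro p
    have h1 : ∀ j, AEMeasurable (fun t => ‖block χ φ j (f t)‖ₑ *
        (besovNorm χ φ (1 / 2) (oscPow (s / 2) (g t)) * ‖block χ φ p (oscPow (s / 2) (w t))‖ₑ)) μ :=
      fun j => (hblock hf j).mul (hGm.mul (hblock hH p))
    have h2 : ∀ j, AEMeasurable (fun t => besovNorm χ φ (1 / 2) (f t) *
        (‖block χ φ j (oscPow (s / 2) (g t))‖ₑ * ‖block χ φ p (oscPow (s / 2) (w t))‖ₑ)) μ :=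
      fun j => hFm.mul ((hblock hG j).mul (hblock hH p))
    calc ∫⁻ t, ‖weakForm χ φ s κ t p (f t) (g t) (w t)‖ₑ ∂μ
        ≤ ∫⁻ t, C0 * ∑' j : ℤ, (if p - j ≤ 4 then ‖block χ φ j (f t)‖ₑ *
          (besovNorm χ φ (1 / 2) (oscPow (s / 2) (g t)) * ‖block χ φ p (oscPow (s / 2) (w t))‖ₑ) +
          besovNorm χ φ (1 / 2) (f t) * (‖block χ φ j (oscPow (s / 2) (g t))‖ₑ *
          ‖block χ φ p (oscPow (s / 2) (w t))‖ₑ) else 0) ∂μ := by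
          refine lintegral_mono_ae ?_
          filter_upwards [ht0, hdom, hbf, hbg] with t h3 h4 h5 h6
          exact (enorm_tsum_le_tsum_enorm).trans
            ((hC0 κ t hκ hκ1 h3 p _ _ _ h4.1 h4.2 h5.ne h6.ne).trans
              (mul_le_mul_right (trilinearRhs_le h p _ h4.1 h4.2) _))
      _ = C0 * ∑' j : ℤ, ∫⁻ t, (if p - j ≤ 4 then ‖block χ φ j (f t)‖ₑ *
          (besovNorm χ φ (1 / 2) (oscPow (s / 2) (g t)) * ‖block χ φ p (oscPow (s / 2) (w t))‖ₑ) +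
          besovNorm χ φ (1 / 2) (f t) * (‖block χ φ j (oscPow (s / 2) (g t))‖ₑ *
          ‖block χ φ p (oscPow (s / 2) (w t))‖ₑ) else 0) ∂μ := by
          rw [lintegral_const_mul' _ _ ENNReal.coe_ne_top, lintegral_tsum fun j => ?_]
          split_ifs
          · exact (h1 j).add (h2 j)
          · exact aemeasurable_const
      _ ≤ _ := by
          refine mul_le_mul_right (ENNReal.tsum_le_tsum fun j => ?_) _
          split_ifs
          · rw [lintegral_add_left' (h1 j)]
            exact add_le_add (lintegral_mul_mul_le_timeNorm hGm (hblock hH p))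
              (lintegral_mul_mul_le_timeNorm (hblock hG j) (hblock hH p))
          · simp
  have hp : ∀ p : ℤ, dyad p σ *
      (∫⁻ t in Set.Ioc 0 T, ‖weakForm χ φ s κ t p (f t) (g t) (w t)‖ₑ) ^ (1 / 2 : ℝ) ≤ _ :=
    fun p => dyad_mul_sqrt_le p (hint p)
  calc ∑' p : {p : ℤ // -1 ≤ p}, dyad p σ *
        (∫⁻ t in Set.Ioc 0 T, ‖weakForm χ φ s κ t p (f t) (g t) (w t)‖ₑ) ^ (1 / 2 : ℝ)
      ≤ ∑' p : ℤ, dyad p σ *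
        (∫⁻ t in Set.Ioc 0 T, ‖weakForm χ φ s κ t p (f t) (g t) (w t)‖ₑ) ^ (1 / 2 : ℝ) :=
        ENNReal.tsum_comp_le_tsum_of_injective Subtype.val_injective _
    _ ≤ _ := ENNReal.tsum_le_tsum hp
    _ ≤ (C0 : ℝ≥0∞) ^ (1 / 2 : ℝ) * (X ^ (1 / 2 : ℝ) * ((∑' m, kernel (σ / 2) m) *
          ((∑' j, dyad j σ * x j) ^ (1 / 2 : ℝ) * (∑' p, dyad p σ * z p) ^ (1 / 2 : ℝ))) +
        Y ^ (1 / 2 : ℝ) * ((∑' m, kernel (σ / 2) m) *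
          ((∑' j, dyad j σ * y j) ^ (1 / 2 : ℝ) * (∑' p, dyad p σ * z p) ^ (1 / 2 : ℝ)))) := by
        rw [ENNReal.tsum_mul_left, ENNReal.tsum_add, ENNReal.tsum_mul_left, ENNReal.tsum_mul_left]
        exact mul_le_mul_right (add_le_add
          (mul_le_mul_right (tsum_kernel_mul_sqrt_le _ _ _) _)
          (mul_le_mul_right (tsum_kernel_mul_sqrt_le _ _ _) _)) _
    _ = _ := by
        unfold cheminLernerNorm
        rw [ENNReal.coe_mul, ENNReal.coe_toNNReal hKtop,
          ENNReal.coe_rpow_of_nonneg _ (by norm_num : (0 : ℝ) ≤ 1 / 2)]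
        ring

end Besov

/-! ### Schwartz functions in frequency -/

section Schwartz

open LineDeriv

/-- The unnormalized Hermite functions. -/
def hermiteGauss (k : ℕ) (v : ℝ) : ℝ := hermiteVal k v * Real.exp (-(1 / 4) * v ^ 2)

theorem continuous_hermiteGauss (k : ℕ) : Continuous (hermiteGauss k) := by
  have := continuous_hermiteVal k
  unfold hermiteGauss
  fun_prop

theorem hasDerivAt_hermiteGauss (k : ℕ) (v : ℝ) :
    HasDerivAt (hermiteGauss k) (k * hermiteGauss (k - 1) v - v / 2 * hermiteGauss k v) v := by
  have h1 : HasDerivAt (hermiteVal k) (k * hermiteVal (k - 1) v) v := by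
    rcases k with _ | k
    · have : hermiteVal 0 = fun _ => 1 := funext hermiteVal_zero
      rw [this]
      simpa using hasDerivAt_const v (1 : ℝ)
    · simpa using hasDerivAt_hermiteVal_succ k v
  have h2 : HasDerivAt (fun v : ℝ => Real.exp (-(1 / 4) * v ^ 2))
      (Real.exp (-(1 / 4) * v ^ 2) * (-(1 / 4) * (2 * v))) v := by
    have := ((hasDerivAt_pow 2 v).const_mul (-(1 / 4) : ℝ)).exp
    simpa using this
  refine (h1.mul h2).congr_deriv ?_
  unfold hermiteGauss
  ring

theorem hermiteGauss_succ (k : ℕ) (v : ℝ) :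
    hermiteGauss (k + 1) v = v * hermiteGauss k v - k * hermiteGauss (k - 1) v := by
  unfold hermiteGauss
  linear_combination -Real.exp (-(1 / 4) * v ^ 2) * mul_hermiteVal k v

theorem exists_abs_aeval_mul_gaussian_le (p : Polynomial ℤ) :
    ∃ C : ℝ, ∀ v : ℝ, |Polynomial.aeval v p * Real.exp (-(1 / 4) * v ^ 2)| ≤ C := by
  induction p using Polynomial.induction_on' with
  | add p q hp hq =>
    obtain ⟨C, hC⟩ := hp
    obtain ⟨D, hD⟩ := hq
    refine ⟨C + D, fun v => ?_⟩
    rw [map_add, add_mul]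
    exact (abs_add_le _ _).trans (add_le_add (hC v) (hD v))
  | monomial n a =>
    refine ⟨|(a : ℝ)| * (n.factorial * Real.exp 1), fun v => ?_⟩
    rw [Polynomial.aeval_monomial, abs_mul, abs_mul, abs_pow, Real.abs_exp, mul_assoc]
    refine mul_le_mul (by simp) ?_ (by positivity) (abs_nonneg _)
    refine (mul_le_mul_of_nonneg_right (abs_pow_le_exp n v) (Real.exp_pos _).le).trans ?_
    rw [mul_assoc, ← Real.exp_add]
    refine mul_le_mul_of_nonneg_left (Real.exp_le_exp.2 ?_) (by positivity)
    nlinarith [sq_nonneg (|v| - 2), sq_abs v]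

/-- The plane waves in `x` times the unnormalized Hermite functions in `v`. -/
def planeWave (k : ℕ) (ξ : ℝ) (z : ℝ × ℝ) : ℂ :=
  (hermiteGauss k z.2 : ℂ) * Complex.exp ((-2 * Real.pi * ξ * z.1 : ℝ) * Complex.I)

theorem continuous_planeWave (k : ℕ) (ξ : ℝ) : Continuous (planeWave k ξ) := by
  have := continuous_hermiteGauss k
  unfold planeWave
  fun_prop

theorem integrable_mul_planeWave (f : 𝓢(ℝ × ℝ, ℂ)) (k : ℕ) (ξ : ℝ) :
    Integrable fun z => f z * planeWave k ξ z := by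
  obtain ⟨C, hC⟩ := exists_abs_aeval_mul_gaussian_le (Polynomial.hermite k)
  refine (f.integrable (μ := volume)).mul_bdd (c := C)
    (continuous_planeWave k ξ).aestronglyMeasurable (Filter.Eventually.of_forall fun z => ?_)
  rw [planeWave, norm_mul, Complex.norm_exp_ofReal_mul_I, mul_one, Complex.norm_real]
  exact hC z.2

/-- Multiplication by half of the velocity. -/
def velHalf (f : 𝓢(ℝ × ℝ, ℂ)) : 𝓢(ℝ × ℝ, ℂ) :=
  SchwartzMap.smulLeftCLM ℂ (fun z : ℝ × ℝ => z.2 / 2) f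

theorem velHalf_apply (f : 𝓢(ℝ × ℝ, ℂ)) (z : ℝ × ℝ) : velHalf f z = (z.2 / 2 : ℝ) * f z := by
  have h : (fun z : ℝ × ℝ => z.2 / 2).HasTemperateGrowth := by
    have := (((1 / 2 : ℝ) • ContinuousLinearMap.snd ℝ ℝ ℝ)).hasTemperateGrowth
    convert this using 2 with z
    simp; ring
  rw [velHalf, SchwartzMap.smulLeftCLM_apply_apply h, Complex.real_smul]

theorem integral_lineDeriv_mul (f : 𝓢(ℝ × ℝ, ℂ)) (m : ℝ × ℝ) {ψ ψ' : ℝ × ℝ → ℂ}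
    (hψ : ∀ z, HasLineDerivAt ℝ ψ (ψ' z) z m) (h1 : Integrable fun z => ∂_{m} f z * ψ z)
    (h2 : Integrable fun z => f z * ψ' z) (h3 : Integrable fun z => f z * ψ z) :
    ∫ z, ∂_{m} f z * ψ z = -∫ z, f z * ψ' z := by
  have hf : ∀ z, HasLineDerivAt ℝ f (∂_{m} f z) z m := fun z =>
    (f.hasFDerivAt z).hasLineDerivAt m
  have h := integral_bilinear_hasLineDerivAt_right_eq_neg_left_of_integrable
    (B := ContinuousLinearMap.mul ℝ ℂ) (μ := (volume : Measure (ℝ × ℝ))) (v := m) (f := fun z => f z)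
    (f' := fun z => ∂_{m} f z) (g := ψ) (g' := ψ') h1 h2 h3 (fun z _ => hf z) (fun z _ => hψ z)
  simp only [ContinuousLinearMap.mul_apply'] at h
  rw [h, neg_neg]

theorem hasLineDerivAt_planeWave_snd (k : ℕ) (ξ : ℝ) (z : ℝ × ℝ) :
    HasLineDerivAt ℝ (planeWave k ξ)
      ((k : ℂ) * planeWave (k - 1) ξ z - (z.2 / 2 : ℝ) * planeWave k ξ z) z (0, 1) := by
  have h := ((hasDerivAt_hermiteGauss k (z.2 + 0)).comp (0 : ℝ)
    ((hasDerivAt_id (0 : ℝ)).const_add z.2)).ofReal_comp.mul_const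
      (Complex.exp ((-2 * Real.pi * ξ * z.1 : ℝ) * Complex.I))
  unfold HasLineDerivAt
  refine (h.congr_deriv ?_).congr_of_eventuallyEq (Filter.Eventually.of_forall fun t => ?_)
  · unfold planeWave
    push_cast
    simp only [add_zero]
    ring
  · simp [planeWave]

theorem hasLineDerivAt_planeWave_fst (k : ℕ) (ξ : ℝ) (z : ℝ × ℝ) :
    HasLineDerivAt ℝ (planeWave k ξ) (-(2 * Real.pi * ξ * Complex.I) * planeWave k ξ z) z
      (1, 0) := by
  have h0 : HasDerivAt (fun t : ℝ => ((-2 * Real.pi * ξ * (z.1 + t) : ℝ) : ℂ) * Complex.I)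
      (((-2 * Real.pi * ξ * 1 : ℝ) : ℂ) * Complex.I) 0 :=
    (((hasDerivAt_id (0 : ℝ)).const_add z.1).const_mul _).ofReal_comp.mul_const _
  have h := h0.cexp.const_mul (hermiteGauss k z.2 : ℂ)
  unfold HasLineDerivAt
  refine (h.congr_deriv ?_).congr_of_eventuallyEq (Filter.Eventually.of_forall fun t => ?_)
  · unfold planeWave
    push_cast
    simp only [add_zero]
    ring
  · simp [planeWave]

/-- The lowering operator `v/2 + ∂_v`. -/
def lowering (f : 𝓢(ℝ × ℝ, ℂ)) : 𝓢(ℝ × ℝ, ℂ) := velHalf f + ∂_{((0 : ℝ), (1 : ℝ))} f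

/-- The raising operator `v/2 - ∂_v`. -/
def raising (f : 𝓢(ℝ × ℝ, ℂ)) : 𝓢(ℝ × ℝ, ℂ) := velHalf f - ∂_{((0 : ℝ), (1 : ℝ))} f

theorem integral_lineDeriv_snd_mul (f : 𝓢(ℝ × ℝ, ℂ)) (k : ℕ) (ξ : ℝ) :
    ∫ z, ∂_{((0 : ℝ), (1 : ℝ))} f z * planeWave k ξ z =
      (∫ z, velHalf f z * planeWave k ξ z) - k * ∫ z, f z * planeWave (k - 1) ξ z := by
  have i1 := (integrable_mul_planeWave f (k - 1) ξ).const_mul (k : ℂ)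
  have i2 := integrable_mul_planeWave (velHalf f) k ξ
  have e : ∀ z, f z * ((k : ℂ) * planeWave (k - 1) ξ z - (z.2 / 2 : ℝ) * planeWave k ξ z) =
      (k : ℂ) * (f z * planeWave (k - 1) ξ z) - velHalf f z * planeWave k ξ z := fun z => by
    rw [velHalf_apply]; ring
  rw [integral_lineDeriv_mul f _ (hasLineDerivAt_planeWave_snd k ξ)
    (integrable_mul_planeWave _ k ξ) (by simp only [e]; exact i1.sub i2)
    (integrable_mul_planeWave f k ξ)]
  simp only [e]
  rw [integral_sub i1 i2, integral_const_mul]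
  ring

theorem integral_raising_mul (f : 𝓢(ℝ × ℝ, ℂ)) (k : ℕ) (ξ : ℝ) :
    ∫ z, raising f z * planeWave k ξ z = k * ∫ z, f z * planeWave (k - 1) ξ z := by
  simp only [raising, sub_apply, sub_mul]
  rw [integral_sub (integrable_mul_planeWave _ _ _) (integrable_mul_planeWave _ _ _),
    integral_lineDeriv_snd_mul]
  ring

theorem integral_lowering_mul (f : 𝓢(ℝ × ℝ, ℂ)) (k : ℕ) (ξ : ℝ) :
    ∫ z, lowering f z * planeWave k ξ z = ∫ z, f z * planeWave (k + 1) ξ z := by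
  have i1 := (integrable_mul_planeWave f (k - 1) ξ).const_mul (k : ℂ)
  have i2 := (integrable_mul_planeWave (velHalf f) k ξ).const_mul (2 : ℂ)
  have e : ∀ z, f z * planeWave (k + 1) ξ z =
      2 * (velHalf f z * planeWave k ξ z) - (k : ℂ) * (f z * planeWave (k - 1) ξ z) := fun z => by
    rw [velHalf_apply]
    simp only [planeWave, hermiteGauss_succ]
    push_cast
    ring
  simp only [e, lowering, add_apply, add_mul]
  rw [integral_add (integrable_mul_planeWave _ _ _) (integrable_mul_planeWave _ _ _),
    integral_sub i2 i1, integral_lineDeriv_snd_mul, integral_const_mul, integral_const_mul]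
  ring

theorem integral_raising_lowering_mul (f : 𝓢(ℝ × ℝ, ℂ)) (k : ℕ) (ξ : ℝ) :
    ∫ z, raising (lowering f) z * planeWave k ξ z = k * ∫ z, f z * planeWave k ξ z := by
  rw [integral_raising_mul, integral_lowering_mul]
  rcases k with _ | k
  · simp
  · rfl

theorem integral_lineDeriv_fst_mul (f : 𝓢(ℝ × ℝ, ℂ)) (k : ℕ) (ξ : ℝ) :
    ∫ z, ∂_{((1 : ℝ), (0 : ℝ))} f z * planeWave k ξ z =
      2 * Real.pi * ξ * Complex.I * ∫ z, f z * planeWave k ξ z := by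
  have e : ∀ z, f z * (-(2 * Real.pi * ξ * Complex.I) * planeWave k ξ z) =
      -(2 * Real.pi * ξ * Complex.I) * (f z * planeWave k ξ z) := fun z => by ring
  have i := (integrable_mul_planeWave f k ξ).const_mul (-(2 * Real.pi * ξ * Complex.I))
  rw [integral_lineDeriv_mul f _ (hasLineDerivAt_planeWave_fst k ξ)
    (integrable_mul_planeWave _ k ξ) (by simpa only [e] using i) (integrable_mul_planeWave f k ξ)]
  simp only [e]
  rw [integral_const_mul]
  ring

/-- The operator `(𝓗 + 1/2)`. -/
def oscShift (f : 𝓢(ℝ × ℝ, ℂ)) : 𝓢(ℝ × ℝ, ℂ) := raising (lowering f) + f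

/-- The operator `1 - ∂_x²`. -/
def bessel (f : 𝓢(ℝ × ℝ, ℂ)) : 𝓢(ℝ × ℝ, ℂ) :=
  f - ∂_{((1 : ℝ), (0 : ℝ))} (∂_{((1 : ℝ), (0 : ℝ))} f)

theorem integral_oscShift_mul (f : 𝓢(ℝ × ℝ, ℂ)) (k : ℕ) (ξ : ℝ) :
    ∫ z, oscShift f z * planeWave k ξ z = (k + 1) * ∫ z, f z * planeWave k ξ z := by
  simp only [oscShift, add_apply, add_mul]
  rw [integral_add (integrable_mul_planeWave _ _ _) (integrable_mul_planeWave _ _ _),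
    integral_raising_lowering_mul, one_mul]

theorem integral_bessel_mul (f : 𝓢(ℝ × ℝ, ℂ)) (k : ℕ) (ξ : ℝ) :
    ∫ z, bessel f z * planeWave k ξ z =
      (1 + (2 * Real.pi * ξ) ^ 2) * ∫ z, f z * planeWave k ξ z := by
  simp only [bessel, sub_apply, sub_mul]
  rw [integral_sub (integrable_mul_planeWave _ _ _) (integrable_mul_planeWave _ _ _),
    integral_lineDeriv_fst_mul, integral_lineDeriv_fst_mul]
  linear_combination (-(2 * Real.pi * ξ) ^ 2 * ∫ z, f z * planeWave k ξ z) * Complex.I_sq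

theorem coeFn_ofSchwartz (f : 𝓢(ℝ × ℝ, ℂ)) : ofSchwartz f =ᵐ[volume] f :=
  coeFn_toL2 (f.memLp 2 volume)

/-- The Hermite coefficients of a Schwartz function in frequency. -/
theorem uhat_ofSchwartz (f : 𝓢(ℝ × ℝ, ℂ)) (k : ℕ) :
    uhat k (ofSchwartz f) =ᵐ[volume] fun ξ =>
      (((Real.sqrt (k.factorial * Real.sqrt (2 * Real.pi)))⁻¹ : ℝ) : ℂ) *
        ∫ z, f z * planeWave k ξ z := by
  set c : ℝ := (Real.sqrt (k.factorial * Real.sqrt (2 * Real.pi)))⁻¹ with hc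
  have hcf : ∀ v, hermiteFun k v = c * hermiteGauss k v := fun v => by
    rw [hermiteFun_eq, hc, hermiteGauss]; ring
  set a : ℝ → ℂ := fun x => ∫ v : ℝ, f (x, v) * (hermiteFun k v : ℂ) with ha
  have ha1 : Integrable a := by
    have h := (integrable_mul_planeWave f k 0).const_mul (c : ℂ)
    rw [Measure.volume_eq_prod] at h
    refine h.integral_prod_left.congr (Filter.Eventually.of_forall fun x => ?_)
    rw [ha]
    simp only [planeWave, hcf]
    congr 1; ext v
    simp
    ring
  have ha2 : hermiteCoeff k (ofSchwartz f) = toL2 a := by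
    refine toL2_congr ?_
    filter_upwards [ae_slice_eq (coeFn_ofSchwartz f)] with x hx
    refine integral_congr_ae ?_
    filter_upwards [hx] with v hv
    rw [hv]
  have ha3 : MemLp a 2 := by
    refine (memLp_congr_ae ?_).1 (Lp.memLp (hermiteCoeff k (ofSchwartz f)))
    filter_upwards [coeFn_hermiteCoeff k (ofSchwartz f), ae_slice_eq (coeFn_ofSchwartz f)]
      with x h1 hx
    rw [h1]
    refine integral_congr_ae ?_
    filter_upwards [hx] with v hv
    rw [hv]
  unfold uhat
  rw [ha2]
  filter_upwards [fourier_toL2 ha1 ha3] with ξ hξ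
  rw [hξ, Real.fourier_eq', integral_plane (integrable_mul_planeWave f k ξ),
    ← integral_const_mul]
  congr 1; ext x
  rw [ha]
  simp only [smul_eq_mul, planeWave, hcf]
  rw [← integral_const_mul, ← integral_const_mul]
  congr 1; ext v
  have e : (-2 * Real.pi * inner ℝ x ξ : ℝ) = -2 * Real.pi * ξ * x := by simp; ring
  rw [e]
  push_cast
  ring

/-- The Hermite coefficients of a Schwartz function decay in the index and in frequency. -/
theorem exists_rapid (f : 𝓢(ℝ × ℝ, ℂ)) : ∃ w : L2xv, ∀ k : ℕ, ∀ᵐ ξ : ℝ,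
    uhat k w ξ = (((k : ℝ) + 1) ^ 2 * (1 + (2 * Real.pi * ξ) ^ 2) : ℝ) *
      uhat k (ofSchwartz f) ξ := by
  refine ⟨ofSchwartz (oscShift (oscShift (bessel f))), fun k => ?_⟩
  filter_upwards [uhat_ofSchwartz (oscShift (oscShift (bessel f))) k, uhat_ofSchwartz f k]
    with ξ h1 h2
  rw [h1, h2, integral_oscShift_mul, integral_oscShift_mul, integral_bessel_mul]
  push_cast
  ring

end Schwartz

/-! ### Regularity of functions with rapidly decaying coefficients -/

/-- `w = (𝓗 + 1/2)² (1 - ∂_x²) u`, in frequency. -/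
def IsRapid (u w : L2xv) : Prop := ∀ k : ℕ, ∀ᵐ ξ : ℝ,
  uhat k w ξ = (((k : ℝ) + 1) ^ 2 * (1 + (2 * Real.pi * ξ) ^ 2) : ℝ) * uhat k u ξ

theorem tsum_mul_sq_le {ι : Type} (x y : ι → ℝ≥0∞) :
    (∑' i, x i * y i) ^ 2 ≤ (∑' i, x i ^ 2) * ∑' i, y i ^ 2 := by
  have e : ∀ z : ℝ≥0∞, (z ^ 2) ^ (1 / 2 : ℝ) = z := fun z => by
    rw [← ENNReal.rpow_natCast, ← ENNReal.rpow_mul]; norm_num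
  have e' : ∀ z : ℝ≥0∞, (z ^ (1 / 2 : ℝ)) ^ 2 = z := fun z => by
    rw [← ENNReal.rpow_natCast, ← ENNReal.rpow_mul]; norm_num
  have h := tsum_sqrt_mul_sqrt_le (fun i => x i ^ 2) fun i => y i ^ 2
  simp only [e] at h
  refine (pow_le_pow_left₀ (by positivity) h 2).trans (le_of_eq ?_)
  rw [mul_pow, e', e']

theorem tsum_inv_sq_ne_top : ∑' k : ℕ, (ENNReal.ofReal ((k : ℝ) + 1)⁻¹) ^ 2 ≠ ⊤ := by
  have h : Summable fun k : ℕ => (((k : ℝ) + 1)⁻¹) ^ 2 := by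
    have := (summable_nat_add_iff 1).2 (Real.summable_nat_pow_inv (p := 2).2 one_lt_two)
    refine this.congr fun k => ?_
    push_cast
    rw [inv_pow]
  have e : ∀ k : ℕ, (ENNReal.ofReal ((k : ℝ) + 1)⁻¹) ^ 2 = ENNReal.ofReal ((((k : ℝ) + 1)⁻¹) ^ 2) :=
    fun k => (ENNReal.ofReal_pow (by positivity) 2).symm
  simp only [e]
  exact h.tsum_ofReal_ne_top

theorem add_half_rpow_le (n : ℕ) {r : ℝ} (hr0 : 0 ≤ r) (hr : r ≤ 2) :
    ((n : ℝ) + 1 / 2) ^ r ≤ ((n : ℝ) + 1) ^ 2 := by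
  have hn : (0 : ℝ) ≤ n := n.cast_nonneg
  calc ((n : ℝ) + 1 / 2) ^ r ≤ ((n : ℝ) + 1) ^ r :=
        Real.rpow_le_rpow (by positivity) (by linarith) hr0
    _ ≤ ((n : ℝ) + 1) ^ (2 : ℝ) := Real.rpow_le_rpow_of_exponent_le (by linarith) hr
    _ = ((n : ℝ) + 1) ^ 2 := by norm_cast

namespace IsRapid

variable {u w : L2xv}

theorem ae_mul_enorm_le (h : IsRapid u w) (k : ℕ) : ∀ᵐ ξ : ℝ, ENNReal.ofReal (((k : ℝ) + 1) ^ 2) *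
    (ENNReal.ofReal (1 + (2 * Real.pi * ξ) ^ 2) * ‖uhat k u ξ‖ₑ) = ‖uhat k w ξ‖ₑ := by
  filter_upwards [h k] with ξ hξ
  rw [hξ, enorm_mul, ← mul_assoc, ← ENNReal.ofReal_mul (by positivity)]
  congr 1
  rw [← ofReal_norm, Complex.norm_real, Real.norm_of_nonneg (by positivity)]

theorem mul_enorm_hermiteCoeff_le (h : IsRapid u w) (k : ℕ) :
    ENNReal.ofReal (((k : ℝ) + 1) ^ 2) * ‖hermiteCoeff k u‖ₑ ≤ ‖hermiteCoeff k w‖ₑ := by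
  refine (ENNReal.pow_le_pow_left_iff two_ne_zero).1 ?_
  rw [mul_pow, ← lintegral_uhat_sq, ← lintegral_uhat_sq,
    ← lintegral_const_mul' _ _ (ENNReal.pow_ne_top ENNReal.ofReal_ne_top)]
  refine lintegral_mono_ae ?_
  filter_upwards [h.ae_mul_enorm_le k] with ξ hξ
  rw [← mul_pow, ← hξ]
  refine pow_le_pow_left₀ (by positivity) (mul_le_mul_right ?_ _) 2
  refine le_mul_of_one_le_left (by positivity) ?_
  rw [ENNReal.one_le_ofReal]
  nlinarith [sq_nonneg (2 * Real.pi * ξ)]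

theorem inOscDomain (h : IsRapid u w) {r : ℝ} (hr0 : 0 ≤ r) (hr : r ≤ 2) : InOscDomain r u := by
  rw [inOscDomain_iff]
  refine Summable.of_nonneg_of_le (fun n => by positivity) (fun n => ?_)
    (summable_norm_sq_hermiteCoeff w)
  refine pow_le_pow_left₀ (by positivity) ?_ 2
  have h1 := h.mul_enorm_hermiteCoeff_le n
  rw [← ofReal_norm, ← ofReal_norm, ← ENNReal.ofReal_mul (by positivity),
    ENNReal.ofReal_le_ofReal_iff (norm_nonneg _)] at h1
  exact le_trans (mul_le_mul_of_nonneg_right (add_half_rpow_le n hr0 hr) (norm_nonneg _)) h1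

end IsRapid

section Besov

variable {χ φ : ℝ → ℝ}

theorem dyad_mul_enorm_block_le_of_decay (h : IsDyadicPair χ φ) {u w : L2xv}
    (hu : ∀ k : ℕ, ∀ᵐ ξ : ℝ,
      ENNReal.ofReal (1 + (2 * Real.pi * ξ) ^ 2) * ‖uhat k u ξ‖ₑ ≤ ‖uhat k w ξ‖ₑ) (q : ℤ) :
    dyad q 2 * ‖block χ φ q u‖ₑ ≤ 2 * ‖w‖ₑ := by
  have key : ∀ ξ, dyad q 2 * ENNReal.ofReal (blockSymbol χ φ q ξ) ≤
      2 * ENNReal.ofReal (1 + ξ ^ 2) := by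
    intro ξ
    by_cases h0 : blockSymbol χ φ q ξ = 0
    · simp [h0]
    have h1 := neg_one_le_of_blockSymbol_ne_zero h0
    have h2 : ((2 : ℝ) ^ q) ^ 2 ≤ 2 * (1 + ξ ^ 2) := by
      rcases h1.eq_or_lt with rfl | h3
      · norm_num
        nlinarith [sq_nonneg ξ]
      · have h4 := le_abs_of_blockSymbol_ne_zero h (by omega) h0
        have h5 : (0 : ℝ) < 2 ^ q := by positivity
        nlinarith [sq_abs ξ]
    have h3 : dyad q 2 = ENNReal.ofReal (((2 : ℝ) ^ q) ^ 2) := by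
      rw [dyad]
      congr 1
      rw [Real.rpow_mul two_pos.le, Real.rpow_intCast]
      norm_num
    have e2 : (2 : ℝ≥0∞) = ENNReal.ofReal 2 := by simp
    rw [h3, e2, ← ENNReal.ofReal_mul two_pos.le, ← ENNReal.ofReal_mul (by positivity)]
    refine ENNReal.ofReal_le_ofReal (le_trans ?_ h2)
    exact mul_le_of_le_one_right (by positivity) (blockSymbol_le_one h q ξ)
  refine (ENNReal.pow_le_pow_left_iff two_ne_zero).1 ?_
  rw [mul_pow, mul_pow, ← tsum_lintegral_uhat_sq, ← tsum_lintegral_uhat_sq, ← ENNReal.tsum_mul_left,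
    ← ENNReal.tsum_mul_left]
  refine ENNReal.tsum_le_tsum fun k => ?_
  rw [← lintegral_const_mul' _ _ (ENNReal.pow_ne_top (dyad_ne_top q 2)),
    ← lintegral_const_mul' _ _ (by norm_num)]
  refine lintegral_mono_ae ?_
  filter_upwards [hu k, uhat_block h q u k] with ξ h1 h2
  rw [← mul_pow, ← mul_pow, h2, enorm_mul]
  refine pow_le_pow_left₀ (by positivity) ?_ 2
  have e : ‖(blockSymbol χ φ q (2 * Real.pi * ξ) : ℂ)‖ₑ =
      ENNReal.ofReal (blockSymbol χ φ q (2 * Real.pi * ξ)) := by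
    rw [← ofReal_norm, Complex.norm_real, Real.norm_of_nonneg (blockSymbol_nonneg h q _)]
  rw [e, ← mul_assoc]
  refine (mul_le_mul_left (key _) _).trans ?_
  rw [mul_assoc]
  exact mul_le_mul_right h1 _

theorem enorm_block_of_lt (h : IsDyadicPair χ φ) {q : ℤ} (hq : q < -1) (u : L2xv) :
    ‖block χ φ q u‖ₑ = 0 := by
  refine (pow_eq_zero_iff two_ne_zero).1 ?_
  rw [← tsum_lintegral_uhat_sq, ENNReal.tsum_eq_zero]
  intro k
  rw [lintegral_congr_ae (g := fun _ => 0), lintegral_zero]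
  filter_upwards [uhat_block h q u k] with ξ h1
  rw [h1, blockSymbol_of_lt χ φ hq]
  simp

theorem besovNorm_ne_top_of_decay (h : IsDyadicPair χ φ) {u w : L2xv}
    (hu : ∀ k : ℕ, ∀ᵐ ξ : ℝ,
      ENNReal.ofReal (1 + (2 * Real.pi * ξ) ^ 2) * ‖uhat k u ξ‖ₑ ≤ ‖uhat k w ξ‖ₑ) :
    besovNorm χ φ (1 / 2) u ≠ ⊤ := by
  have hk : ∀ a : ℝ, ∀ q : ℤ, -4 ≤ q → kernel a (-q) * dyad q a = 1 := fun a q hq => by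
    rw [kernel, if_pos (by omega), ← dyad_add, neg_add_cancel]
    simp [dyad]
  have hb : ∀ q : ℤ, dyad q 1 ^ 2 * ‖block χ φ q u‖ₑ ^ 2 ≤ kernel 2 (-q) * (2 * ‖w‖ₑ) ^ 2 := by
    intro q
    by_cases hq : -4 ≤ q
    · have e : dyad q 1 ^ 2 = dyad q 2 := by rw [dyad_two_mul q 2, sq]; norm_num
      rw [e]
      calc dyad q 2 * ‖block χ φ q u‖ₑ ^ 2
          = kernel 2 (-q) * dyad q 2 * (dyad q 2 * ‖block χ φ q u‖ₑ ^ 2) := by rw [hk 2 q hq, one_mul]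
        _ = kernel 2 (-q) * (dyad q 2 * ‖block χ φ q u‖ₑ) ^ 2 := by ring
        _ ≤ _ := mul_le_mul_right (pow_le_pow_left₀ (by positivity)
            (dyad_mul_enorm_block_le_of_decay h hu q) 2) _
    · rw [enorm_block_of_lt h (by omega)]
      simp
  have hsum : ∀ a : ℝ, 0 < a → ∑' q : ℤ, kernel a (-q) ≠ ⊤ := fun a ha => by
    have e : ∑' q : ℤ, kernel a (-q) = ∑' q : ℤ, kernel a q := (Equiv.neg ℤ).tsum_eq (kernel a)
    rw [e]
    exact tsum_kernel_ne_top ha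
  have hz : ∀ᵐ v : ℝ, ∀ q : ℤ, dyad q (1 / 2) * sliceNorm (block χ φ q u) v ≤
      kernel (1 / 2) (-q) * (dyad q 1 * sliceNorm (block χ φ q u) v) := by
    rw [ae_all_iff]
    intro q
    by_cases hq : -4 ≤ q
    · refine Filter.Eventually.of_forall fun v => le_of_eq ?_
      have e : dyad q 1 = dyad q (1 / 2) * dyad q (1 / 2) := dyad_two_mul q 1
      rw [e, ← mul_assoc, ← mul_assoc, hk _ q hq, one_mul]
    · have h1 := lintegral_sliceNorm_sq (block χ φ q u)
      rw [enorm_block_of_lt h (by omega)] at h1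
      have h2 := (lintegral_eq_zero_iff ((measurable_sliceNorm (block χ φ q u)).pow_const 2)).1
        (h1.trans (by simp))
      filter_upwards [h2] with v hv
      rw [(pow_eq_zero_iff two_ne_zero).1 hv]
      simp
  refine fun htop => ?_
  have h1 := besovNorm_sq χ φ (1 / 2) u
  have h2 : ∫⁻ v, (∑' q : ℤ, dyad q (1 / 2) * sliceNorm (block χ φ q u) v) ^ 2 ≤
      (∑' q : ℤ, kernel (1 / 2) (-q) ^ 2) * ((∑' q : ℤ, kernel 2 (-q)) * (2 * ‖w‖ₑ) ^ 2) := by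
    calc _ ≤ ∫⁻ v, (∑' q : ℤ, kernel (1 / 2) (-q) ^ 2) *
          ∑' q : ℤ, dyad q 1 ^ 2 * sliceNorm (block χ φ q u) v ^ 2 := by
          refine lintegral_mono_ae ?_
          filter_upwards [hz] with v hv
          refine (pow_le_pow_left₀ (by positivity) (ENNReal.tsum_le_tsum hv) 2).trans ?_
          simp only [← mul_pow]
          exact tsum_mul_sq_le _ _
      _ = (∑' q : ℤ, kernel (1 / 2) (-q) ^ 2) *
          ∑' q : ℤ, dyad q 1 ^ 2 * ‖block χ φ q u‖ₑ ^ 2 := by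
          have hm : ∀ q : ℤ, Measurable fun v => dyad q 1 ^ 2 * sliceNorm (block χ φ q u) v ^ 2 :=
            fun q => ((measurable_sliceNorm _).pow_const 2).const_mul _
          rw [lintegral_const_mul _ (Measurable.tsum hm),
            lintegral_tsum fun q => (hm q).aemeasurable]
          congr 1
          refine tsum_congr fun q => ?_
          rw [lintegral_const_mul _ ((measurable_sliceNorm _).pow_const 2), lintegral_sliceNorm_sq]
      _ ≤ _ := by
          refine mul_le_mul_right ?_ _
          rw [← ENNReal.tsum_mul_right]
          exact ENNReal.tsum_le_tsum hb
  have h3 : ∀ q : ℤ, kernel (1 / 2) (-q) ^ 2 = kernel 1 (-q) := fun q => by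
    unfold kernel
    split_ifs
    · rw [sq]; exact (dyad_two_mul (-q) 1).symm
    · simp
  simp only [h3] at h2
  rw [← h1, htop] at h2
  refine absurd h2 (not_le.2 ?_)
  refine lt_of_lt_of_eq (ENNReal.mul_lt_top (hsum 1 one_pos).lt_top
    (ENNReal.mul_lt_top (hsum 2 two_pos).lt_top (ENNReal.pow_lt_top ?_))) (by simp)
  exact ENNReal.mul_lt_top (by norm_num) enorm_lt_top

theorem IsRapid.besovNorm_ne_top (h : IsDyadicPair χ φ) {u w : L2xv} (hu : IsRapid u w) :
    besovNorm χ φ (1 / 2) u ≠ ⊤ := by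
  refine besovNorm_ne_top_of_decay h (w := w) fun k => ?_
  filter_upwards [hu.ae_mul_enorm_le k] with ξ hξ
  rw [← hξ]
  refine le_mul_of_one_le_left (by positivity) ?_
  rw [ENNReal.one_le_ofReal]
  exact one_le_pow₀ (by linarith [(Nat.cast_nonneg k : (0 : ℝ) ≤ k)])

theorem IsRapid.besovNorm_oscPow_ne_top (h : IsDyadicPair χ φ) {u w : L2xv} (hu : IsRapid u w)
    {r : ℝ} (hr0 : 0 ≤ r) (hr : r ≤ 2) : besovNorm χ φ (1 / 2) (oscPow r u) ≠ ⊤ := by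
  refine besovNorm_ne_top_of_decay h (w := w) fun k => ?_
  filter_upwards [hu.ae_mul_enorm_le k, uhat_oscPow (hu.inOscDomain hr0 hr) k] with ξ hξ h2
  rw [← hξ, h2, enorm_mul, mul_left_comm]
  refine mul_le_mul_left ?_ _
  rw [← ofReal_norm, Complex.norm_real, Real.norm_of_nonneg (by positivity)]
  exact ENNReal.ofReal_le_ofReal (add_half_rpow_le k hr0 hr)

end Besov

/-! ### Weighted sums of coefficients -/

/-- The sum `∑ (k + 1) |c_k|`. -/
def weightedSum (c : ℕ → ℂ) : ℝ≥0∞ := ∑' k : ℕ, ENNReal.ofReal ((k : ℝ) + 1) * ‖c k‖ₑ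

theorem ofReal_inv_mul (k : ℕ) (x : ℝ≥0∞) :
    ENNReal.ofReal ((k : ℝ) + 1) * x =
      ENNReal.ofReal ((k : ℝ) + 1)⁻¹ * (ENNReal.ofReal (((k : ℝ) + 1) ^ 2) * x) := by
  rw [← mul_assoc, ← ENNReal.ofReal_mul (by positivity)]
  congr 2
  field_simp

theorem IsRapid.weightedSum_sq_le {u w : L2xv} (hu : IsRapid u w) {s κ t : ℝ} (hs : 0 < s)
    (hκ : 0 < κ) (hκ1 : κ ≤ 1) (ht : 0 ≤ t) :
    ∫⁻ x, weightedSum (fun k => invCoeff s κ t k u x) ^ 2 < ⊤ := by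
  have hm : ∀ k : ℕ, AEMeasurable (fun x => (ENNReal.ofReal (((k : ℝ) + 1) ^ 2) *
      ‖invCoeff s κ t k u x‖ₑ) ^ 2) := fun k =>
    ((Lp.aestronglyMeasurable (invCoeff s κ t k u)).enorm.const_mul _).pow_const 2
  calc ∫⁻ x, weightedSum (fun k => invCoeff s κ t k u x) ^ 2
      ≤ ∫⁻ x, (∑' k : ℕ, (ENNReal.ofReal ((k : ℝ) + 1)⁻¹) ^ 2) *
        ∑' k : ℕ, (ENNReal.ofReal (((k : ℝ) + 1) ^ 2) * ‖invCoeff s κ t k u x‖ₑ) ^ 2 := by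
        refine lintegral_mono fun x => ?_
        unfold weightedSum
        simp only [ofReal_inv_mul]
        exact tsum_mul_sq_le _ _
    _ = (∑' k : ℕ, (ENNReal.ofReal ((k : ℝ) + 1)⁻¹) ^ 2) *
        ∑' k : ℕ, (ENNReal.ofReal (((k : ℝ) + 1) ^ 2) * ‖invCoeff s κ t k u‖ₑ) ^ 2 := by
        rw [lintegral_const_mul' _ _ tsum_inv_sq_ne_top, lintegral_tsum hm]
        congr 1
        refine tsum_congr fun k => ?_
        simp only [mul_pow]
        rw [lintegral_const_mul' _ _ (ENNReal.pow_ne_top ENNReal.ofReal_ne_top),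
          ← enorm_sq_eq_lintegral]
    _ ≤ (∑' k : ℕ, (ENNReal.ofReal ((k : ℝ) + 1)⁻¹) ^ 2) * (2 ^ 2 * ‖w‖ₑ ^ 2) := by
        refine mul_le_mul_right ?_ _
        rw [enorm_sq_eq_tsum w, ← ENNReal.tsum_mul_left]
        refine ENNReal.tsum_le_tsum fun k => ?_
        rw [← mul_pow]
        refine pow_le_pow_left₀ (by positivity) ?_ 2
        have h1 : ‖invCoeff s κ t k u‖ₑ ≤ 2 * ‖hermiteCoeff k u‖ₑ := by
          have := norm_fourierMul_le (measurable_inv_weightSymbol hs hκ t k)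
            (abs_inv_weightSymbol_le hκ hκ1 ht s k) (hermiteCoeff k u)
          rw [← ofReal_norm, ← ofReal_norm]
          refine (ENNReal.ofReal_le_ofReal this).trans (le_of_eq ?_)
          rw [ENNReal.ofReal_mul two_pos.le, ENNReal.ofReal_ofNat]
        refine (mul_le_mul_right h1 _).trans ?_
        rw [mul_left_comm]
        exact mul_le_mul_right (hu.mul_enorm_hermiteCoeff_le k) _
    _ < ⊤ := ENNReal.mul_lt_top tsum_inv_sq_ne_top.lt_top
        (ENNReal.mul_lt_top (by norm_num) (ENNReal.pow_lt_top enorm_lt_top))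

theorem lintegral_inv_one_add_sq_ne_top :
    ∫⁻ ξ : ℝ, (ENNReal.ofReal (1 + (2 * Real.pi * ξ) ^ 2)⁻¹) ^ 2 ≠ ⊤ := by
  have hi : Integrable fun ξ : ℝ => (1 + ξ ^ 2)⁻¹ := integrable_inv_one_add_sq
  refine ne_top_of_le_ne_top hi.lintegral_lt_top.ne (lintegral_mono fun ξ => ?_)
  rw [← ENNReal.ofReal_pow (by positivity)]
  refine ENNReal.ofReal_le_ofReal ?_
  have h1 : ((1 + (2 * Real.pi * ξ) ^ 2)⁻¹ : ℝ) ≤ (1 + ξ ^ 2)⁻¹ := by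
    refine inv_anti₀ (by positivity) ?_
    have h2 : ξ ^ 2 ≤ (2 * Real.pi) ^ 2 * ξ ^ 2 :=
      le_mul_of_one_le_left (sq_nonneg ξ) (one_le_pow₀ (by linarith [Real.pi_gt_three]))
    rw [mul_pow]
    linarith
  have h3 : ((1 + (2 * Real.pi * ξ) ^ 2)⁻¹ : ℝ) ≤ 1 :=
    inv_le_one_of_one_le₀ (by nlinarith [sq_nonneg (2 * Real.pi * ξ)])
  rw [sq]
  exact (mul_le_of_le_one_left (by positivity) h3).trans h1

theorem IsRapid.exists_weightedSum_le {u w : L2xv} (hu : IsRapid u w)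
    (hui : ∀ k, Integrable (uhat k u)) {s κ t : ℝ} (hs : 0 < s)
    (hκ : 0 < κ) (hκ1 : κ ≤ 1) (ht : 0 ≤ t) :
    ∃ B : ℝ≥0∞, B ≠ ⊤ ∧ ∀ᵐ x : ℝ, weightedSum (fun k => invCoeff s κ t k u x) ≤ B := by
  set A : ℝ≥0∞ := (∫⁻ ξ : ℝ, (ENNReal.ofReal (1 + (2 * Real.pi * ξ) ^ 2)⁻¹) ^ 2) ^ (1 / 2 : ℝ)
    with hA
  have hA2 : A ^ 2 = ∫⁻ ξ : ℝ, (ENNReal.ofReal (1 + (2 * Real.pi * ξ) ^ 2)⁻¹) ^ 2 := by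
    rw [hA, ← ENNReal.rpow_natCast, ← ENNReal.rpow_mul]; norm_num
  have h1 : ∀ k : ℕ, ENNReal.ofReal (((k : ℝ) + 1) ^ 2) * ∫⁻ ξ, ‖uhat k u ξ‖ₑ ≤
      A * ‖hermiteCoeff k w‖ₑ := by
    intro k
    refine (ENNReal.pow_le_pow_left_iff two_ne_zero).1 ?_
    rw [mul_pow A, hA2, ← lintegral_uhat_sq, ← lintegral_const_mul' _ _ ENNReal.ofReal_ne_top]
    refine le_trans (pow_le_pow_left₀ (by positivity) (le_of_eq ?_) 2)
      (lintegral_mul_sq_le (by fun_prop) (memLp_uhat k w).aestronglyMeasurable.enorm)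
    refine lintegral_congr_ae ?_
    filter_upwards [hu.ae_mul_enorm_le k] with ξ hξ
    rw [← hξ, mul_left_comm _ (ENNReal.ofReal (((k : ℝ) + 1) ^ 2)), ← mul_assoc (ENNReal.ofReal _)
      (ENNReal.ofReal _) ‖uhat k u ξ‖ₑ, ← ENNReal.ofReal_mul (by positivity),
      inv_mul_cancel₀ (by positivity), ENNReal.ofReal_one, one_mul]
  have h2 : ∀ k : ℕ, ∀ᵐ x : ℝ, ‖invCoeff s κ t k u x‖ₑ ≤ 2 * ∫⁻ ξ, ‖uhat k u ξ‖ₑ := by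
    intro k
    filter_upwards [invCoeff_ae_eq hs hκ hκ1 ht k (hui k)] with x hx
    rw [hx, ← lintegral_const_mul' _ _ (by norm_num), Real.fourierInv_eq']
    refine (enorm_integral_le_lintegral_enorm _).trans (lintegral_mono fun ξ => ?_)
    rw [enorm_smul, enorm_mul]
    have e1 : ‖Complex.exp ((2 * Real.pi * inner ℝ ξ x : ℝ) * Complex.I)‖ₑ = 1 := by
      rw [← ofReal_norm, Complex.norm_exp_ofReal_mul_I, ENNReal.ofReal_one]
    rw [e1, one_mul]
    refine mul_le_mul_left ?_ _
    rw [← ofReal_norm, Complex.norm_real, ← ENNReal.ofReal_ofNat]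
    exact ENNReal.ofReal_le_ofReal (abs_inv_weightSymbol_le hκ hκ1 ht s k _)
  refine ⟨2 * A * ∑' k : ℕ, ENNReal.ofReal ((k : ℝ) + 1)⁻¹ * ‖hermiteCoeff k w‖ₑ, ?_, ?_⟩
  · refine ENNReal.mul_ne_top (ENNReal.mul_ne_top (by norm_num) ?_) ?_
    · exact ENNReal.rpow_ne_top_of_nonneg (by norm_num) lintegral_inv_one_add_sq_ne_top
    · refine fun h => ?_
      have h3 := tsum_mul_sq_le (fun k : ℕ => ENNReal.ofReal ((k : ℝ) + 1)⁻¹)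
        fun k => ‖hermiteCoeff k w‖ₑ
      rw [h, ← enorm_sq_eq_tsum] at h3
      exact absurd h3 (not_le.2 (lt_of_lt_of_eq (ENNReal.mul_lt_top tsum_inv_sq_ne_top.lt_top
        (ENNReal.pow_lt_top enorm_lt_top)) (by simp)))
  · filter_upwards [ae_all_iff.2 h2] with x hx
    rw [← ENNReal.tsum_mul_left]
    refine ENNReal.tsum_le_tsum fun k => ?_
    rw [ofReal_inv_mul]
    calc ENNReal.ofReal ((k : ℝ) + 1)⁻¹ *
          (ENNReal.ofReal (((k : ℝ) + 1) ^ 2) * ‖invCoeff s κ t k u x‖ₑ)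
        ≤ ENNReal.ofReal ((k : ℝ) + 1)⁻¹ *
          (2 * (ENNReal.ofReal (((k : ℝ) + 1) ^ 2) * ∫⁻ ξ, ‖uhat k u ξ‖ₑ)) := by
          rw [mul_left_comm (2 : ℝ≥0∞)]
          exact mul_le_mul_right (mul_le_mul_right (hx k) _) _
      _ ≤ ENNReal.ofReal ((k : ℝ) + 1)⁻¹ * (2 * (A * ‖hermiteCoeff k w‖ₑ)) :=
          mul_le_mul_right (mul_le_mul_right (h1 k) _) _
      _ = _ := by ring

/-! ### The nonlinear term of regular functions -/

theorem choose_succ_succ_le (k l : ℕ) :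
    (k + 2 + l).choose (k + 2) ≤ (k + 2 + l) ^ 2 * (k + l).choose k := by
  have h1 := Nat.add_one_mul_choose_eq (k + l) k
  have h2 := Nat.add_one_mul_choose_eq (k + 1 + l) (k + 1)
  have e1 : k + l + 1 = k + 1 + l := by omega
  have e2 : k + 1 + l + 1 = k + 2 + l := by omega
  rw [e1] at h1
  rw [e2] at h2
  have h3 : (k + 2 + l).choose (k + 2) ≤ (k + 2 + l) * (k + 1 + l).choose (k + 1) := by
    rw [h2]
    exact Nat.le_mul_of_pos_right _ (by omega)
  have h4 : (k + 1 + l).choose (k + 1) ≤ (k + 1 + l) * (k + l).choose k := by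
    rw [h1]
    exact Nat.le_mul_of_pos_right _ (by omega)
  calc (k + 2 + l).choose (k + 2) ≤ (k + 2 + l) * ((k + 1 + l) * (k + l).choose k) :=
        h3.trans (Nat.mul_le_mul_left _ h4)
    _ ≤ (k + 2 + l) * ((k + 2 + l) * (k + l).choose k) :=
        Nat.mul_le_mul_left _ (Nat.mul_le_mul_right _ (by omega))
    _ = _ := by ring

theorem choose_mul_sin_mul_cos_le_one (k l : ℕ) (θ : ℝ) :
    ((k + l).choose k : ℝ) * (Real.sin θ ^ 2) ^ k * (Real.cos θ ^ 2) ^ l ≤ 1 := by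
  have h := add_pow (Real.sin θ ^ 2) (Real.cos θ ^ 2) (k + l)
  rw [Real.sin_sq_add_cos_sq, one_pow] at h
  rw [h]
  refine le_trans (le_of_eq ?_) (Finset.single_le_sum (f := fun m => (Real.sin θ ^ 2) ^ m *
    (Real.cos θ ^ 2) ^ (k + l - m) * ((k + l).choose m : ℝ)) (fun m _ => by positivity)
    (Finset.mem_range.2 (by omega : k < k + l + 1)))
  simp only [Nat.add_sub_cancel_left]
  ring

theorem abs_angleFactor_le (k l : ℕ) {θ : ℝ} (hθ : θ ∈ angles) :
    |angleFactor k l θ| ≤ (k + 1) * (l + 1) * θ ^ 2 := by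
  have hk : (0 : ℝ) ≤ k := k.cast_nonneg
  have hl : (0 : ℝ) ≤ l := l.cast_nonneg
  unfold angleFactor
  split_ifs with h1 h2
  · refine (abs_cos_pow_sub_one_le l hθ).trans ((min_le_right _ _).trans ?_)
    refine mul_le_mul_of_nonneg_right ?_ (sq_nonneg θ)
    nlinarith
  · rw [abs_zero]; positivity
  · obtain ⟨m, rfl⟩ : ∃ m, k = m + 2 := ⟨k - 2, by have := two_le_of_not_odd h1 h2; omega⟩
    have hn : (0 : ℝ) ≤ ((m + 2 + l : ℕ) : ℝ) := Nat.cast_nonneg _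
    have h3 : |Real.sqrt ((m + 2 + l).choose (m + 2)) *
        (Real.sin θ ^ (m + 2) * Real.cos θ ^ l)| ≤ ((m + 2 + l : ℕ) : ℝ) * Real.sin θ ^ 2 := by
      refine abs_le_of_sq_le_sq ?_ (by positivity)
      rw [mul_pow, Real.sq_sqrt (Nat.cast_nonneg _)]
      have h4 : ((m + 2 + l).choose (m + 2) : ℝ) ≤
          ((m + 2 + l : ℕ) : ℝ) ^ 2 * ((m + l).choose m : ℝ) := by
        exact_mod_cast choose_succ_succ_le m l
      calc ((m + 2 + l).choose (m + 2) : ℝ) * (Real.sin θ ^ (m + 2) * Real.cos θ ^ l) ^ 2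
          ≤ (((m + 2 + l : ℕ) : ℝ) ^ 2 * ((m + l).choose m : ℝ)) *
            (Real.sin θ ^ (m + 2) * Real.cos θ ^ l) ^ 2 :=
            mul_le_mul_of_nonneg_right h4 (sq_nonneg _)
        _ = (((m + 2 + l : ℕ) : ℝ) * Real.sin θ ^ 2) ^ 2 *
            (((m + l).choose m : ℝ) * (Real.sin θ ^ 2) ^ m * (Real.cos θ ^ 2) ^ l) := by ring
        _ ≤ _ := mul_le_of_le_one_right (sq_nonneg _) (choose_mul_sin_mul_cos_le_one m l θ)
    refine h3.trans (mul_le_mul ?_ (sin_sq_le θ) (sq_nonneg _) (by positivity))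
    push_cast
    push_cast at hk
    nlinarith

/-- The integrand of the nonlinear term. -/
def angularWeighted (f g : ℝ × ℝ → ℂ) (x θ v : ℝ) : ℂ :=
  ((Real.sqrt (maxwellian v))⁻¹ : ℂ) * angular (weighted f x) (weighted g x) θ v

theorem measurable_maxwellian : Measurable maxwellian := by
  unfold maxwellian; fun_prop

theorem measurable_angularWeighted {f g : ℝ × ℝ → ℂ} (hf : Measurable f) (hg : Measurable g) :
    Measurable fun q : ℝ × ℝ × ℝ => angularWeighted f g q.1 q.2.1 q.2.2 := by
  have hw : ∀ u : ℝ × ℝ → ℂ, Measurable u → Measurable fun z : ℝ × ℝ => weighted u z.1 z.2 := by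
    intro u hu
    have := measurable_maxwellian
    unfold weighted
    fun_prop
  have he : ∀ u : ℝ × ℝ → ℂ, Measurable u →
      Measurable fun z : ℝ × ℝ => evenPart (weighted u z.1) z.2 := by
    intro u hu
    have m : Measurable fun z : ℝ × ℝ => (z.1, -z.2) := by fun_prop
    have h1 := (hw u hu).comp m
    have h2 := ((hw u hu).add h1).div_const 2
    exact h2
  have hi : Measurable fun r : (ℝ × ℝ × ℝ) × ℝ =>
      evenPart (weighted f r.1.1) (r.1.2.2 * Real.sin r.1.2.1 + r.2 * Real.cos r.1.2.1) *
        weighted g r.1.1 (r.1.2.2 * Real.cos r.1.2.1 - r.2 * Real.sin r.1.2.1) -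
      evenPart (weighted f r.1.1) r.2 * weighted g r.1.1 r.1.2.2 := by
    have m1 : Measurable fun r : (ℝ × ℝ × ℝ) × ℝ =>
        (r.1.1, r.1.2.2 * Real.sin r.1.2.1 + r.2 * Real.cos r.1.2.1) := by fun_prop
    have m2 : Measurable fun r : (ℝ × ℝ × ℝ) × ℝ =>
        (r.1.1, r.1.2.2 * Real.cos r.1.2.1 - r.2 * Real.sin r.1.2.1) := by fun_prop
    have m3 : Measurable fun r : (ℝ × ℝ × ℝ) × ℝ => (r.1.1, r.2) := by fun_prop
    have m4 : Measurable fun r : (ℝ × ℝ × ℝ) × ℝ => (r.1.1, r.1.2.2) := by fun_prop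
    have h := (((he f hf).comp m1).mul ((hw g hg).comp m2)).sub
      (((he f hf).comp m3).mul ((hw g hg).comp m4))
    exact h
  have h2 : StronglyMeasurable fun q : ℝ × ℝ × ℝ =>
      angular (weighted f q.1) (weighted g q.1) q.2.1 q.2.2 :=
    hi.stronglyMeasurable.integral_prod_right'
  have h3 : Measurable fun q : ℝ × ℝ × ℝ => ((Real.sqrt (maxwellian q.2.2))⁻¹ : ℂ) := by
    have := measurable_maxwellian
    fun_prop
  have h := h3.mul h2.measurable
  exact h

theorem measurable_angularWeighted_slice {f g : ℝ × ℝ → ℂ} (hf : Measurable f) (hg : Measurable g)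
    (x : ℝ) : Measurable fun q : ℝ × ℝ => angularWeighted f g x q.2 q.1 := by
  have m : Measurable fun q : ℝ × ℝ => (x, q.2, q.1) := by fun_prop
  have h := (measurable_angularWeighted hf hg).comp m
  exact h

/-- The Hermite coefficients in `v` at a fixed `x`. -/
def sliceCoeff (f : ℝ × ℝ → ℂ) (x : ℝ) (k : ℕ) : ℂ := ∫ v, f (x, v) * (hermiteFun k v : ℂ)

theorem tsum_mul_tsum_antidiagonal (a b : ℕ → ℝ≥0∞) : (∑' k, a k) * ∑' l, b l =
    ∑' n, ∑ p ∈ Finset.HasAntidiagonal.antidiagonal n, a p.1 * b p.2 := by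
  have h1 : (∑' k, a k) * ∑' l, b l = ∑' p : ℕ × ℕ, a p.1 * b p.2 := by
    rw [ENNReal.tsum_prod (f := fun k l => a k * b l), ← ENNReal.tsum_mul_right]
    exact tsum_congr fun k => ENNReal.tsum_mul_left.symm
  rw [h1, ← Finset.HasAntidiagonal.sigmaAntidiagonalEquivProd.tsum_eq, ENNReal.tsum_sigma']
  refine tsum_congr fun n => ?_
  rw [tsum_fintype]
  exact Finset.sum_coe_sort (Finset.HasAntidiagonal.antidiagonal n) fun p => a p.1 * b p.2

theorem lintegral_angularWeighted_sq_le {f g : ℝ × ℝ → ℂ} {x : ℝ}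
    (hf : MemLp (fun v => f (x, v)) 2) (hg : MemLp (fun v => g (x, v)) 2) {θ : ℝ}
    (hθ : θ ∈ angles) :
    ∫⁻ v, ‖angularWeighted f g x θ v‖ₑ ^ 2 ≤
      (ENNReal.ofReal (θ ^ 2) * (weightedSum (sliceCoeff f x) * weightedSum (sliceCoeff g x))) ^ 2 := by
  have h1 : ∫⁻ v, ‖angularWeighted f g x θ v‖ₑ ^ 2 =
      ∫⁻ v, ‖angularTerm (fun v => f (x, v)) (fun v => g (x, v)) θ v‖ₑ ^ 2 := by
    refine lintegral_congr_ae ?_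
    filter_upwards [ae_memLp_slice_of_memLp (memLp_gain hf hg θ)] with v hv
    rw [← inv_mul_angular_eq hf hv]
    rfl
  have h2 : ∀ n : ℕ, ‖∫ v, angularTerm (fun v => f (x, v)) (fun v => g (x, v)) θ v *
      (hermiteFun n v : ℂ)‖ₑ ≤ ENNReal.ofReal (θ ^ 2) *
        ∑ p ∈ Finset.HasAntidiagonal.antidiagonal n,
          ENNReal.ofReal ((p.1 : ℝ) + 1) * ‖sliceCoeff f x p.1‖ₑ *
            (ENNReal.ofReal ((p.2 : ℝ) + 1) * ‖sliceCoeff g x p.2‖ₑ) := by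
    intro n
    rw [integral_angularTerm_mul hf hg, Finset.mul_sum]
    refine (enorm_sum_le _ _).trans (Finset.sum_le_sum fun p _ => ?_)
    rw [enorm_mul, enorm_mul]
    have h3 : ‖(angleFactor p.1 p.2 θ : ℂ)‖ₑ ≤ ENNReal.ofReal ((p.1 : ℝ) + 1) *
        ENNReal.ofReal ((p.2 : ℝ) + 1) * ENNReal.ofReal (θ ^ 2) := by
      rw [← ENNReal.ofReal_mul (by positivity), ← ENNReal.ofReal_mul (by positivity), ← ofReal_norm,
        Complex.norm_real, Real.norm_eq_abs]
      exact ENNReal.ofReal_le_ofReal (abs_angleFactor_le _ _ hθ)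
    refine (mul_le_mul_left h3 _).trans (le_of_eq ?_)
    unfold sliceCoeff
    ring
  rw [h1, lintegral_eq_tsum_hermite (memLp_angularTerm hf hg θ)]
  have h4 : ∀ c : ℕ → ℝ≥0∞, ∑' n, c n ^ 2 ≤ (∑' n, c n) ^ 2 := fun c => by
    rw [sq (∑' n, c n), ← ENNReal.tsum_mul_left]
    refine ENNReal.tsum_le_tsum fun n => ?_
    rw [sq]
    exact mul_le_mul_left (ENNReal.le_tsum n) _
  refine (h4 _).trans (pow_le_pow_left₀ (by positivity) ?_ 2)
  refine (ENNReal.tsum_le_tsum h2).trans (le_of_eq ?_)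
  rw [ENNReal.tsum_mul_left, weightedSum, weightedSum]
  congr 1
  exact (tsum_mul_tsum_antidiagonal (fun k => ENNReal.ofReal ((k : ℝ) + 1) * ‖sliceCoeff f x k‖ₑ)
    fun k => ENNReal.ofReal ((k : ℝ) + 1) * ‖sliceCoeff g x k‖ₑ).symm

/-- The integral of the absolute value over the angles in the nonlinear term. -/
def angularNorm (s : ℝ) (f g : ℝ × ℝ → ℂ) (x v : ℝ) : ℝ≥0∞ :=
  ∫⁻ θ in angles, ENNReal.ofReal (crossSection s θ) * ‖angularWeighted f g x θ v‖ₑ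

theorem lintegral_angularNorm_sq_le (s : ℝ) {f g : ℝ × ℝ → ℂ} (hfm : Measurable f)
    (hgm : Measurable g) {x : ℝ}
    (hf : MemLp (fun v => f (x, v)) 2) (hg : MemLp (fun v => g (x, v)) 2) :
    ∫⁻ v, angularNorm s f g x v ^ 2 ≤
      ((∫⁻ θ in angles, ENNReal.ofReal (crossSection s θ * θ ^ 2)) *
        (weightedSum (sliceCoeff f x) * weightedSum (sliceCoeff g x))) ^ 2 := by
  set A := ∫⁻ θ in angles, ENNReal.ofReal (crossSection s θ * θ ^ 2) with hA
  set Y := weightedSum (sliceCoeff f x) * weightedSum (sliceCoeff g x) with hY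
  have hc := measurable_crossSection s
  have hm := measurable_angularWeighted_slice hfm hgm x
  have hm2 : ∀ v, Measurable fun θ => angularWeighted f g x θ v := fun v => by
    have m : Measurable fun θ : ℝ => (v, θ) := by fun_prop
    have h := hm.comp m
    exact h
  have h1 : ∀ v, angularNorm s f g x v ^ 2 ≤ A * ∫⁻ θ in angles,
      ENNReal.ofReal (crossSection s θ / θ ^ 2) * ‖angularWeighted f g x θ v‖ₑ ^ 2 := by
    intro v
    have h2 := lintegral_mul_sq_le (μ := volume.restrict angles)
      (f := fun θ => ENNReal.ofReal (Real.sqrt (crossSection s θ) * |θ|))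
      (g := fun θ => ENNReal.ofReal (Real.sqrt (crossSection s θ) / |θ|) *
        ‖angularWeighted f g x θ v‖ₑ)
      (by fun_prop) (by have := hm2 v; fun_prop)
    refine le_trans (pow_le_pow_left₀ (by positivity) (le_of_eq ?_) 2) (h2.trans (le_of_eq ?_))
    · refine lintegral_congr_ae ?_
      filter_upwards [ae_angles_ne_zero] with θ hθ
      have h0 : |θ| ≠ 0 := abs_ne_zero.2 hθ.2
      rw [← mul_assoc, ← ENNReal.ofReal_mul (by positivity)]
      congr 2
      have h3 := Real.mul_self_sqrt (crossSection_nonneg s θ)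
      field_simp
      linarith
    · congr 1
      · refine lintegral_congr fun θ => ?_
        rw [← ENNReal.ofReal_pow (by positivity), mul_pow, Real.sq_sqrt (crossSection_nonneg s θ),
          sq_abs]
      · refine lintegral_congr fun θ => ?_
        rw [mul_pow, ← ENNReal.ofReal_pow (by positivity), div_pow,
          Real.sq_sqrt (crossSection_nonneg s θ), sq_abs]
  have hm3 : Measurable fun q : ℝ × ℝ => ENNReal.ofReal (crossSection s q.2 / q.2 ^ 2) *
      ‖angularWeighted f g x q.2 q.1‖ₑ ^ 2 := by fun_prop
  calc ∫⁻ v, angularNorm s f g x v ^ 2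
      ≤ ∫⁻ v, A * ∫⁻ θ in angles,
        ENNReal.ofReal (crossSection s θ / θ ^ 2) * ‖angularWeighted f g x θ v‖ₑ ^ 2 :=
        lintegral_mono h1
    _ = A * ∫⁻ θ in angles, ∫⁻ v,
        ENNReal.ofReal (crossSection s θ / θ ^ 2) * ‖angularWeighted f g x θ v‖ₑ ^ 2 := by
        rw [lintegral_const_mul _ (Measurable.lintegral_prod_right' hm3)]
        congr 1
        exact lintegral_lintegral_swap hm3.aemeasurable
    _ ≤ A * ∫⁻ θ in angles, ENNReal.ofReal (crossSection s θ * θ ^ 2) * Y ^ 2 := by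
        refine mul_le_mul_right (lintegral_mono_ae ?_) _
        filter_upwards [ae_angles_ne_zero] with θ hθ
        rw [lintegral_const_mul' _ _ ENNReal.ofReal_ne_top]
        refine (mul_le_mul_right (lintegral_angularWeighted_sq_le hf hg hθ.1) _).trans
          (le_of_eq ?_)
        rw [mul_pow, ← mul_assoc, ← ENNReal.ofReal_pow (sq_nonneg θ), ← ENNReal.ofReal_mul
          (div_nonneg (crossSection_nonneg s θ) (sq_nonneg θ))]
        congr 2
        have := hθ.2
        field_simp
    _ = (A * Y) ^ 2 := by
        rw [lintegral_mul_const _ (by fun_prop)]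
        ring

theorem gammaTerm_eq (s : ℝ) (f g : ℝ × ℝ → ℂ) (x v : ℝ) : gammaTerm s f g (x, v) =
    ∫ θ in angles, (crossSection s θ : ℂ) * angularWeighted f g x θ v := by
  unfold gammaTerm collision angularWeighted
  rw [← integral_const_mul]
  congr 1; ext θ
  ring

theorem enorm_ofReal_crossSection (s θ : ℝ) :
    ‖(crossSection s θ : ℂ)‖ₑ = ENNReal.ofReal (crossSection s θ) := by
  rw [← ofReal_norm, Complex.norm_real, Real.norm_of_nonneg (crossSection_nonneg s θ)]

theorem enorm_gammaTerm_le (s : ℝ) (f g : ℝ × ℝ → ℂ) (x v : ℝ) :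
    ‖gammaTerm s f g (x, v)‖ₑ ≤ angularNorm s f g x v := by
  rw [gammaTerm_eq]
  refine (enorm_integral_le_lintegral_enorm _).trans (le_of_eq ?_)
  simp only [enorm_mul, enorm_ofReal_crossSection]
  rfl

theorem measurable_gammaTerm (s : ℝ) {f g : ℝ × ℝ → ℂ} (hf : Measurable f) (hg : Measurable g) :
    Measurable (gammaTerm s f g) := by
  have m : Measurable fun r : (ℝ × ℝ) × ℝ => (r.1.1, r.2, r.1.2) := by fun_prop
  have h0 := (measurable_angularWeighted hf hg).comp m
  have hc := measurable_crossSection s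
  have hc2 : Measurable fun r : (ℝ × ℝ) × ℝ => (crossSection s r.2 : ℂ) := by fun_prop
  have h1 : Measurable fun r : (ℝ × ℝ) × ℝ =>
      (crossSection s r.2 : ℂ) * angularWeighted f g r.1.1 r.2 r.1.2 := hc2.mul h0
  have h2 := (h1.stronglyMeasurable.integral_prod_right' (ν := volume.restrict angles)).measurable
  have e : gammaTerm s f g = fun z : ℝ × ℝ =>
      ∫ θ in angles, (crossSection s θ : ℂ) * angularWeighted f g z.1 θ z.2 :=
    funext fun z => gammaTerm_eq s f g z.1 z.2
  rw [e]
  exact h2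

/-- Fubini's theorem for the Hermite coefficients of the nonlinear term. -/
theorem integral_gammaTerm_mul (s : ℝ) {f g : ℝ × ℝ → ℂ} (hfm : Measurable f)
    (hgm : Measurable g) {x : ℝ} (h : ∫⁻ v, angularNorm s f g x v ^ 2 < ⊤) (n : ℕ) :
    ∫ v, gammaTerm s f g (x, v) * (hermiteFun n v : ℂ) = gammaCoeff s n f g x := by
  have hm := measurable_angularWeighted_slice hfm hgm x
  have hm2 : Measurable fun q : ℝ × ℝ =>
      (crossSection s q.2 : ℂ) * angularWeighted f g x q.2 q.1 * (hermiteFun n q.1 : ℂ) := by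
    have h1 := measurable_crossSection s
    have h2 := continuous_hermiteFun n
    have h3 : Measurable fun q : ℝ × ℝ => (crossSection s q.2 : ℂ) := by fun_prop
    have h4 : Measurable fun q : ℝ × ℝ => (hermiteFun n q.1 : ℂ) := by fun_prop
    exact (h3.mul hm).mul h4
  have hN : Measurable fun v => angularNorm s f g x v := by
    have : Measurable fun q : ℝ × ℝ => ENNReal.ofReal (crossSection s q.2) *
        ‖angularWeighted f g x q.2 q.1‖ₑ := by
      have := measurable_crossSection s
      fun_prop
    exact Measurable.lintegral_prod_right' this
  have hi : Integrable (fun q : ℝ × ℝ =>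
      (crossSection s q.2 : ℂ) * angularWeighted f g x q.2 q.1 * (hermiteFun n q.1 : ℂ))
      (volume.prod (volume.restrict angles)) := by
    refine ⟨hm2.aestronglyMeasurable, ?_⟩
    rw [hasFiniteIntegral_iff_enorm, lintegral_prod _ hm2.enorm.aemeasurable]
    have e : ∀ v, ∫⁻ θ in angles, ‖(crossSection s θ : ℂ) * angularWeighted f g x θ v *
        (hermiteFun n v : ℂ)‖ₑ = angularNorm s f g x v * ‖(hermiteFun n v : ℂ)‖ₑ := fun v => by
      simp only [enorm_mul, enorm_ofReal_crossSection]
      rw [lintegral_mul_const' _ _ enorm_ne_top]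
      rfl
    simp only [e]
    have h1 := lintegral_mul_sq_le (μ := volume) hN.aemeasurable
      (memLp_hermiteFun_ofReal n).aestronglyMeasurable.enorm
    rw [← eLpNorm_two_sq volume (fun v => (hermiteFun n v : ℂ))] at h1
    have h2 := h1.trans_lt (ENNReal.mul_lt_top h
      (ENNReal.pow_lt_top (memLp_hermiteFun_ofReal n).eLpNorm_lt_top))
    exact (ENNReal.pow_lt_top_iff.1 h2).resolve_right two_ne_zero
  unfold gammaCoeff
  simp only [gammaTerm_eq, ← integral_mul_const]
  rw [integral_integral_swap hi]
  refine integral_congr_ae (Filter.Eventually.of_forall fun θ => ?_)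
  simp only
  rw [← integral_const_mul]
  congr 1; ext v
  unfold angularWeighted
  ring

/-! ### The trilinear form of regular functions -/

section Rapid

variable {s κ t : ℝ} {f g f' g' : L2xv}

theorem ae_sliceCoeff_weightInv (hs : 0 < s) (hκ : 0 < κ) (hκ1 : κ ≤ 1) (ht : 0 ≤ t) (u : L2xv) :
    ∀ᵐ x : ℝ, sliceCoeff (weightInv s κ t u) x = fun k => invCoeff s κ t k u x := by
  have h : ∀ k, ∀ᵐ x : ℝ, sliceCoeff (weightInv s κ t u) x k = invCoeff s κ t k u x := fun k => by
    rw [← hermiteCoeff_weightInv hs hκ hκ1 ht]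
    filter_upwards [coeFn_hermiteCoeff k (weightInv s κ t u)] with x hx
    rw [hx, sliceCoeff]
  filter_upwards [ae_all_iff.2 h] with x hx
  exact funext hx

theorem exists_lintegral_angularNorm_sq_le (hs : 0 < s) (hs' : s < 1) (hκ : 0 < κ) (hκ1 : κ ≤ 1)
    (ht : 0 ≤ t) (hf : IsRapid f f') (hfi : ∀ k, Integrable (uhat k f)) (g : L2xv) :
    ∃ B : ℝ≥0∞, B ≠ ⊤ ∧ ∀ᵐ x : ℝ,
      ∫⁻ v, angularNorm s (weightInv s κ t f) (weightInv s κ t g) x v ^ 2 ≤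
        B * weightedSum (fun k => invCoeff s κ t k g x) ^ 2 := by
  obtain ⟨B, hB, hBle⟩ := hf.exists_weightedSum_le hfi hs hκ hκ1 ht
  have hA : ∫⁻ θ in angles, ENNReal.ofReal (crossSection s θ * θ ^ 2) ≠ ⊤ :=
    (integrableOn_crossSection_mul_sq hs hs').lintegral_lt_top.ne
  refine ⟨((∫⁻ θ in angles, ENNReal.ofReal (crossSection s θ * θ ^ 2)) * B) ^ 2,
    ENNReal.pow_ne_top (ENNReal.mul_ne_top hA hB), ?_⟩
  filter_upwards [hBle, ae_sliceCoeff_weightInv hs hκ hκ1 ht f,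
    ae_sliceCoeff_weightInv hs hκ hκ1 ht g, ae_memLp_slice (weightInv s κ t f),
    ae_memLp_slice (weightInv s κ t g)] with x h1 h2 h3 h4 h5
  refine (lintegral_angularNorm_sq_le s (measurable_L2xv _) (measurable_L2xv _) h4 h5).trans ?_
  rw [← mul_pow, h2, h3, mul_assoc]
  exact pow_le_pow_left₀ (by positivity) (mul_le_mul_right (mul_le_mul_left h1 _) _) 2

theorem memLp_conjGamma (hs : 0 < s) (hs' : s < 1) (hκ : 0 < κ) (hκ1 : κ ≤ 1)
    (ht : 0 ≤ t) (hf : IsRapid f f') (hfi : ∀ k, Integrable (uhat k f)) (hg : IsRapid g g') :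
    MemLp (conjGamma s κ t f g) 2 volume := by
  have hm : Measurable (conjGamma s κ t f g) := measurable_gammaTerm s
    (measurable_L2xv (weightInv s κ t f)) (measurable_L2xv (weightInv s κ t g))
  obtain ⟨B, hB, hle⟩ := exists_lintegral_angularNorm_sq_le hs hs' hκ hκ1 ht hf hfi g
  refine memLp_two_of_lintegral hm.aestronglyMeasurable ?_
  rw [lintegral_plane (hm.enorm.pow_const 2).aemeasurable]
  calc ∫⁻ x, ∫⁻ v, ‖conjGamma s κ t f g (x, v)‖ₑ ^ 2
      ≤ ∫⁻ x, B * weightedSum (fun k => invCoeff s κ t k g x) ^ 2 := by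
        refine lintegral_mono_ae ?_
        filter_upwards [hle] with x hx
        exact (lintegral_mono fun v => pow_le_pow_left₀ (by positivity)
          (enorm_gammaTerm_le s _ _ x v) 2).trans hx
    _ < ⊤ := by
        rw [lintegral_const_mul' _ _ hB]
        exact ENNReal.mul_lt_top hB.lt_top (hg.weightedSum_sq_le hs hκ hκ1 ht)

theorem hermiteCoeff_conjGamma (hs : 0 < s) (hs' : s < 1) (hκ : 0 < κ) (hκ1 : κ ≤ 1)
    (ht : 0 ≤ t) (hf : IsRapid f f') (hfi : ∀ k, Integrable (uhat k f)) (hg : IsRapid g g')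
    (hgi : ∀ k, Integrable (uhat k g)) (n : ℕ) :
    hermiteCoeff n (toL2 (conjGamma s κ t f g)) = toL2 (conjGammaCoeff s κ t n f g) := by
  obtain ⟨B, hB, hle⟩ := exists_lintegral_angularNorm_sq_le hs hs' hκ hκ1 ht hf hfi g
  obtain ⟨D, hD, hDle⟩ := hg.exists_weightedSum_le hgi hs hκ hκ1 ht
  refine toL2_congr ?_
  filter_upwards [hle, hDle, ae_slice_eq (coeFn_toL2 (memLp_conjGamma hs hs' hκ hκ1 ht hf hfi hg))]
    with x h1 h2 h3
  rw [conjGammaCoeff, ← integral_gammaTerm_mul s (measurable_L2xv _) (measurable_L2xv _)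
    (h1.trans_lt (ENNReal.mul_lt_top hB.lt_top (ENNReal.pow_lt_top (h2.trans_lt hD.lt_top))))]
  refine integral_congr_ae ?_
  filter_upwards [h3] with v hv
  rw [hv, conjGamma]

variable {χ φ : ℝ → ℝ}

/-- The weak form of regular functions is the form. -/
theorem weakForm_eq_form (h : IsDyadicPair χ φ) (hs : 0 < s) (hs' : s < 1) (hκ : 0 < κ)
    (hκ1 : κ ≤ 1) (ht : 0 ≤ t) (hf : IsRapid f f') (hg : IsRapid g g') (p : ℤ) (w : L2xv) :
    weakForm χ φ s κ t p f g w = form χ φ s κ t p f g w := by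
  have hfi := integrable_uhat h (hf.besovNorm_ne_top h)
  have hgi := integrable_uhat h (hg.besovNorm_ne_top h)
  have h1 := hasSum_inner_hermiteCoeff (block χ φ p w)
    (weight s κ t (block χ φ p (toL2 (conjGamma s κ t f g))))
  unfold weakForm form
  rw [← h1.tsum_eq]
  refine tsum_congr fun n => ?_
  rw [weight, hermiteCoeff_spectralMul (fun n => (continuous_weightSymbol hs hκ t n).measurable)
    (fun n ξ => abs_weightSymbol_le hκ s t n ξ), hermiteCoeff_block h, hermiteCoeff_block h,
    hermiteCoeff_conjGamma hs hs' hκ hκ1 ht hf hfi hg hgi]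
  rfl

end Rapid

end Kac

end

theorem lemma2p5 (s : ℝ) (hs : 0 < s) (hs' : s < 1) (χ φ : ℝ → ℝ) (hχφ : Kac.IsDyadicPair χ φ) :
    (∃ C : ℝ≥0, ∀ (f g h : 𝓢(ℝ × ℝ, ℂ)) (t κ : ℝ) (p : ℤ), 0 ≤ t → 0 < κ → κ ≤ 1 → -1 ≤ p →
      MemLp (Kac.conjGamma s κ t (Kac.ofSchwartz f) (Kac.ofSchwartz g)) 2 volume ∧
      ‖Kac.form χ φ s κ t p (Kac.ofSchwartz f) (Kac.ofSchwartz g) (Kac.ofSchwartz h)‖ₑ ≤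
        C * ((∑ j ∈ Finset.Icc (p - 4) (p + 4),
            ‖Kac.block χ φ j (Kac.ofSchwartz f)‖ₑ
              * Kac.besovNorm χ φ (1 / 2) (Kac.oscPow (s / 2) (Kac.ofSchwartz g))
              * ‖Kac.oscPow (s / 2) (Kac.block χ φ p (Kac.ofSchwartz h))‖ₑ)
          + ∑' j : {j : ℤ // p - 4 ≤ j},
            Kac.besovNorm χ φ (1 / 2) (Kac.ofSchwartz f)
              * ‖Kac.oscPow (s / 2) (Kac.block χ φ j (Kac.ofSchwartz g))‖ₑ
              * ‖Kac.oscPow (s / 2) (Kac.block χ φ p (Kac.ofSchwartz h))‖ₑ)) ∧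
    (∀ (f g h : 𝓢(ℝ × ℝ, ℂ)) (t κ : ℝ) (p : ℤ), 0 ≤ t → 0 < κ → κ ≤ 1 → -1 ≤ p →
      Kac.weakForm χ φ s κ t p (Kac.ofSchwartz f) (Kac.ofSchwartz g) (Kac.ofSchwartz h) =
        Kac.form χ φ s κ t p (Kac.ofSchwartz f) (Kac.ofSchwartz g) (Kac.ofSchwartz h)) ∧
    (∀ σ : ℝ, 0 < σ → ∃ C : ℝ≥0, ∀ (T κ : ℝ) (f g h : ℝ → Kac.L2xv), 0 < T → 0 < κ → κ ≤ 1 →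
      AEStronglyMeasurable f (volume.restrict (Set.Ioc 0 T)) →
      AEStronglyMeasurable g (volume.restrict (Set.Ioc 0 T)) →
      AEStronglyMeasurable h (volume.restrict (Set.Ioc 0 T)) →
      (∀ᵐ t ∂(volume.restrict (Set.Ioc 0 T)),
        Kac.InOscDomain (s / 2) (g t) ∧ Kac.InOscDomain (s / 2) (h t)) →
      Kac.cheminLernerNorm χ φ ⊤ T σ f < ⊤ →
      Kac.mixedNorm χ φ ⊤ T (1 / 2) f < ⊤ →
      Kac.mixedNorm χ φ 2 T (1 / 2) (fun t => Kac.oscPow (s / 2) (g t)) < ⊤ →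
      Kac.cheminLernerNorm χ φ 2 T σ (fun t => Kac.oscPow (s / 2) (g t)) < ⊤ →
      Kac.cheminLernerNorm χ φ 2 T σ (fun t => Kac.oscPow (s / 2) (h t)) < ⊤ →
      (∀ᵐ t ∂(volume.restrict (Set.Ioc 0 T)), ∀ p : ℤ, -1 ≤ p →
        Kac.WeakFormDefined χ φ s κ t p (f t) (g t) (h t)) ∧
      (∀ p : ℤ, -1 ≤ p →
        AEStronglyMeasurable (fun t => Kac.weakForm χ φ s κ t p (f t) (g t) (h t))
          (volume.restrict (Set.Ioc 0 T))) ∧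
      ∑' p : {p : ℤ // -1 ≤ p}, Kac.dyad p σ *
          (∫⁻ t in Set.Ioc 0 T, ‖Kac.weakForm χ φ s κ t p (f t) (g t) (h t)‖ₑ) ^ (1 / 2 : ℝ) ≤
        C * Kac.cheminLernerNorm χ φ ⊤ T σ f ^ (1 / 2 : ℝ)
            * Kac.mixedNorm χ φ 2 T (1 / 2) (fun t => Kac.oscPow (s / 2) (g t)) ^ (1 / 2 : ℝ)
            * Kac.cheminLernerNorm χ φ 2 T σ (fun t => Kac.oscPow (s / 2) (h t)) ^ (1 / 2 : ℝ)
          + C * Kac.mixedNorm χ φ ⊤ T (1 / 2) f ^ (1 / 2 : ℝ)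
            * Kac.cheminLernerNorm χ φ 2 T σ (fun t => Kac.oscPow (s / 2) (g t)) ^ (1 / 2 : ℝ)
            * Kac.cheminLernerNorm χ φ 2 T σ (fun t => Kac.oscPow (s / 2) (h t)) ^ (1 / 2 : ℝ)) := by
  have hr0 : 0 ≤ s / 2 := by linarith
  have hr : s / 2 ≤ 2 := by linarith
  refine ⟨?_, ?_, fun σ hσ => ?_⟩
  · obtain ⟨C, hC⟩ := Kac.exists_tsum_weakTerm_le hχφ hs hs'
    refine ⟨C, fun f g h t κ p ht hκ hκ1 _ => ?_⟩
    obtain ⟨f', hf⟩ := Kac.exists_rapid f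
    obtain ⟨g', hg⟩ := Kac.exists_rapid g
    obtain ⟨h', hh⟩ := Kac.exists_rapid h
    have hbf := Kac.IsRapid.besovNorm_ne_top hχφ hf
    refine ⟨Kac.memLp_conjGamma hs hs' hκ hκ1 ht hf (Kac.integrable_uhat hχφ hbf) hg, ?_⟩
    rw [← Kac.weakForm_eq_form hχφ hs hs' hκ hκ1 ht hf hg p]
    exact enorm_tsum_le_tsum_enorm.trans (hC κ t hκ hκ1 ht p _ _ _
      (Kac.IsRapid.inOscDomain hg hr0 hr) (Kac.IsRapid.inOscDomain hh hr0 hr) hbf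
      (Kac.IsRapid.besovNorm_oscPow_ne_top hχφ hg hr0 hr))
  · intro f g h t κ p ht hκ hκ1 _
    obtain ⟨f', hf⟩ := Kac.exists_rapid f
    obtain ⟨g', hg⟩ := Kac.exists_rapid g
    exact Kac.weakForm_eq_form hχφ hs hs' hκ hκ1 ht hf hg p _
  · obtain ⟨C, hC⟩ := Kac.exists_weakForm_time_estimate hχφ hs hs' hσ
    exact ⟨C, fun T κ f g h hT hκ hκ1 hf hg hh hd _ h2 h3 _ _ =>
      hC T κ f g h hT hκ hκ1 hf hg hh hd h2 h3⟩
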